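/- **Setting.** Let $n\ge 2$ and let $M$ be a smooth $n$-manifold with a fixed global chart; $\partial_a$ and components refer to it. Let $\mathcal L=C^\infty(M,\mathbb C)[Z]\langle Y\rangle\{\{X\}\}$ be the algebra of formal series $f=\sum_{m,s,l}(f)_{m,s,l}X^mY^sZ^l$ with $(f)_{m,s,l}\in C^\infty(M,\mathbb C)$, $m,s\in\mathbb R$, $l\in\mathbb N$, whose support in $m$ is discrete (without limit points in $\mathbb R$) and bounded below and which have, for each $m$, only finitely many non-zero coefficients; write $f(m)=\sum_{s,l}(f)_{m,s,l}Y^sZ^l$. For $u\in\mathbb R$ let $\mathcal S_u\subset\mathcal L$ be the set of all $f$ with $f(m)=0$ for $m<0$ and $(f)_{m,s,l}=0$ whenever $m<u$ and ($s\ne0$ or $l\neq 0$). **Parameters.** Let $\xi,\mu\in\mathbb R$, $\Lambda>0$, and let $V$ be a smooth real function on a non-degenerate interval containing $0$, with $V(0)=\Lambda$, $V'(0)=\mu^2/2$. Put $H=\sqrt{2\Lambda/(n(n-1))}$, $K=[n^2/4-\xi n(n+1)]H^2$; for $\mu^2>K$ put $k_1=k_2=n/2$, $\omega=\sqrt{\mu^2-K}/H$;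 for $\mu^2\le K$ put $k_{1}=n/2-\sqrt{K-\mu^2}/H$, $k_2=n/2+\sqrt{K-\mu^2}/H$, $\omega=0$. Assume $\mu^2>-\xi n(n+1)H^2$. **Operations.** On $\mathcal L$ put $(\partial_af)_{m,s,l}=\partial_a(f)_{m,s,l}$, $(\partial_tf)_{m,s,l}=-(m+is)H(f)_{m,s,l}+(l+1)(f)_{m,s,l+1}$ and $(f^*)_{m,s,l}=\overline{(f)_{m,-s,l}}$; $f$ is real if $f^*=f$. Consider pairs $(g_{ab},\phi)$, where $g_{ab}$ is a real symmetric family in $\mathcal S_uX^{-v}$ for some $u>0$, $v\in\mathbb R$, with $(g_{ab})_{-v,0,0}$ the components of a Riemannian metric, and $\phi\in\mathcal L$ has $\phi(m)=0$ for $m\le0$. Let $g^{ab}$ be the inverse of $g_{ab}$, let $k_{ab}=-\frac12\partial_tg_{ab}$, and form from $g_{ab}$, $g^{ab}$ and $\partial_a$ by the usual formulas the connection coefficients $\Gamma^c_{ab}$, the covariant derivative $\nabla$, $\Delta=\nabla^i\nabla_i$, the Ricci tensor $R_{ab}=\partial_i\Gamma^i_{ab}-\partial_a\Gamma^i_{ib}+\Gamma^j_{ab}\Gamma^i_{ij}-\Gamma^i_{aj}\Gamma^j_{ib}$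 and its trace $R$. A hat denotes the traceless part, and $\sigma^a{}_b=\hat k^a{}_b$. Let $W=\sum_j\frac1{j!}V^{(j)}(0)(\phi^*\phi)^j$, $W'=\sum_j\frac1{j!}V^{(j+1)}(0)(\phi^*\phi)^j$, let c.c. denote the conjugate of all preceding terms in the bracket, and put $$\begin{aligned} S^a{}_b&=\tfrac12(1-\xi\phi^*\phi)^{-1}\Big[(1-2\xi)\nabla^a\phi^*\nabla_b\phi-2\xi\phi^*(\nabla^a\nabla_b\phi+k^a{}_b\partial_t\phi)+\big\{(2\xi-\tfrac12)(\nabla_i\phi^*\nabla^i\phi-\partial_t\phi^*\partial_t\phi)\\&\qquad+2\xi\phi^*(\Delta\phi+(\mathrm{tr}\,k)\partial_t\phi-\partial_t^2\phi)-W\big\}\delta^a{}_b+\text{c.c.}\Big],\\ j^a&=\tfrac12(1-\xi\phi^*\phi)^{-1}\big[-(1-2\xi)\nabla^a\phi^*\partial_t\phi+2\xi\phi^*(\partial_t\nabla^a\phi-k^a{}_i\nabla^i\phi)+\text{c.c.}\big],\\ \rho&=\tfrac12(1-\xi\phi^*\phi)^{-1}\big[\tfrac12\partial_t\phi^*\partial_t\phi-(2\xi-\tfrac12)\nabla_i\phi^*\nabla^i\phi-2\xi\phi^*(\Delta\phi+(\mathrm{tr}\,k)\partial_t\phi)+W+\text{c.c.}\big],\\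 \hat E^a{}_b&=\partial_t\sigma^a{}_b-\big[\hat R^a{}_b+(\mathrm{tr}\,k)\sigma^a{}_b-\hat S^a{}_b\big],\\ E&=\partial_t\,\mathrm{tr}\,k-\big[R+(\mathrm{tr}\,k)^2+\tfrac1{n-1}\mathrm{tr}\,S-\tfrac n{n-1}\rho\big],\\ C&=R-k_{ij}k^{ij}+(\mathrm{tr}\,k)^2-2\rho,\qquad C_a=\nabla_ik^i{}_a-\nabla_a\mathrm{tr}\,k-j_a,\\ F&=\Delta\phi+(\mathrm{tr}\,k)\partial_t\phi-\partial_t^2\phi-\xi\big(R-2\partial_t\mathrm{tr}\,k+k_{ij}k^{ij}+(\mathrm{tr}\,k)^2\big)\phi-2\phi W'. \end{aligned}$$ The pair $(g_{ab},\phi)$ is a *solution of the Einstein scalar field equations at relative order* $m\in\mathbb R$ if $\hat E^a{}_b(m)=0$, $E(m)=0$, $C(m)=0$, $C_a(m)=0$ and $F(m+k_1)=0$. **Lemma.** Let $A_{ab}\in C^\infty(M)$ be the components of a Riemannian metric and $\phi_0,\phi_1\in C^\infty(M,\mathbb C)$. Then there exists a pair $(g_{ab},\phi)$ which is a solution at every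 relative order $m<n$, with $g_{ab}\in\mathcal S_nX^{-2}$, $\phi\in\mathcal S_{k_2-k_1}X^{k_1}$, such that - (G1) $g_{ab}(-2)=A_{ab}$; - (P1) $\phi(k_1)=\phi_0$ if $\mu^2<K$; $\phi(k_1)=\phi_0+\phi_1Z$ if $\mu^2=K$; $\phi(k_1)=\phi_0Y^{-\omega}+\phi_1Y^{\omega}$ if $\mu^2>K$; - (P2) if $\mu^2<K$, then $\phi(k_2)\in\phi_1+C^\infty(M,\mathbb C)\,Z$. It is unique up to, but not including, relative order $n$: if $(g_{ab},\phi)$ and $(g'_{ab},\phi')$ are two such pairs, then $g_{ab}(m-2)=g'_{ab}(m-2)$ and $\phi(m+k_1)=\phi'(m+k_1)$ for every real $m<n$. -/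

import Mathlib

open scoped Manifold ContDiff

noncomputable section

namespace AlgESF

/-! ### Smooth functions on a manifold with a global chart -/

/-- The coordinate space of an `n`-dimensional manifold. -/
abbrev Coord (n : ℕ) : Type := EuclideanSpace ℝ (Fin n)

/-- The algebra `C^∞(M, ℝ)`. -/
abbrev SmoothR (n : ℕ) (M : Type*) [TopologicalSpace M] [ChartedSpace (Coord n) M] :=
  C^∞⟮𝓡 n, M; 𝓘(ℝ, ℝ), ℝ⟯

/-- Multiplication of complex numbers is smooth over the reals. -/
instance instContMDiffRingComplex : ContMDiffRing 𝓘(ℝ, ℂ) ∞ ℂ :=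
  { instNormedSpaceLieAddGroup with
    contMDiff_mul := by
      rw [contMDiff_iff]
      refine ⟨continuous_mul, fun x y => ?_⟩
      simp only [mfld_simps, chartAt_self_eq]
      rw [contDiffOn_univ]
      exact contDiff_mul }

/-- The algebra `C^∞(M, ℂ)`. -/
def SmoothC (n : ℕ) (M : Type*) [TopologicalSpace M] [ChartedSpace (Coord n) M] :=
  C^∞⟮𝓡 n, M; 𝓘(ℝ, ℂ), ℂ⟯

section

variable {n : ℕ} {M : Type*} [TopologicalSpace M] [ChartedSpace (Coord n) M]

instance : FunLike (SmoothC n M) M ℂ :=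
  inferInstanceAs (FunLike C^∞⟮𝓡 n, M; 𝓘(ℝ, ℂ), ℂ⟯ M ℂ)

/-- Pointwise addition and multiplication. -/
instance : CommRing (SmoothC n M) :=
  inferInstanceAs (CommRing C^∞⟮𝓡 n, M; 𝓘(ℝ, ℂ), ℂ⟯)

/-- Pointwise multiplication by real scalars. -/
instance : Algebra ℝ (SmoothC n M) :=
  inferInstanceAs (Algebra ℝ C^∞⟮𝓡 n, M; 𝓘(ℝ, ℂ), ℂ⟯)

theorem SmoothC.contMDiff (f : SmoothC n M) : ContMDiff (𝓡 n) 𝓘(ℝ, ℂ) ∞ f :=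
  ContMDiffMap.contMDiff (I := 𝓡 n) (I' := 𝓘(ℝ, ℂ)) (n := ∞) f

@[ext]
theorem SmoothC.ext {f g : SmoothC n M} (h : ∀ p, f p = g p) : f = g :=
  DFunLike.ext f g h

end

/-- A chart of the smooth structure of `M` whose domain is all of `M`. -/
structure GlobalChart (n : ℕ) (M : Type*) [TopologicalSpace M] [ChartedSpace (Coord n) M] where
  /-- the coordinate map -/
  chart : OpenPartialHomeomorph M (Coord n)
  chart_mem : chart ∈ IsManifold.maximalAtlas (𝓡 n) ∞ M
  source_eq : chart.source = Set.univ

section Smooth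

variable {n : ℕ} {M : Type*} [TopologicalSpace M] [ChartedSpace (Coord n) M]

/-- Constant functions. -/
def cstC : ℂ →+* SmoothC n M where
  toFun c := ⟨fun _ => c, contMDiff_const⟩
  map_one' := rfl
  map_mul' _ _ := rfl
  map_zero' := rfl
  map_add' _ _ := rfl

/-- The inclusion of `C^∞(M, ℝ)` in `C^∞(M, ℂ)`. -/
def ofRealC (f : SmoothR n M) : SmoothC n M :=
  ⟨fun p => ((f p : ℝ) : ℂ), Complex.ofRealCLM.contDiff.contMDiff.comp f.contMDiff⟩

/-- Pointwise complex conjugation of a smooth function. -/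
def conjC : SmoothC n M →+ SmoothC n M where
  toFun f := ⟨fun p => starRingEnd ℂ (f p),
    (Complex.conjCLE.contDiff (n := ∞)).contMDiff.comp f.contMDiff⟩
  map_zero' := by
    ext p
    exact map_zero (starRingEnd ℂ)
  map_add' f g := by
    ext p
    exact map_add (starRingEnd ℂ) (f p) (g p)

/-- The coordinate expression of a smooth function is smooth on the image of the chart. -/
theorem contDiffOn_coord (x : GlobalChart n M) (f : SmoothC n M) :
    ContDiffOn ℝ ∞ (fun y => f (x.chart.symm y)) x.chart.target := by
  have h := contMDiffOn_symm_of_mem_maximalAtlas x.chart_mem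
  exact (f.contMDiff.comp_contMDiffOn h).contDiffOn

variable [IsManifold (𝓡 n) ∞ M]

/-- The partial derivative `∂_a f` in the given chart. -/
def pderivC (x : GlobalChart n M) (a : Fin n) : SmoothC n M →+ SmoothC n M where
  toFun f := ⟨fun p => fderiv ℝ (fun y => f (x.chart.symm y)) (x.chart p)
      (EuclideanSpace.single a (1 : ℝ)), by
    have h1 : ContDiffOn ℝ ∞ (fun y => fderiv ℝ (fun y => f (x.chart.symm y)) y
        (EuclideanSpace.single a (1 : ℝ))) x.chart.target :=
      ((contDiffOn_coord x f).fderiv_of_isOpen x.chart.open_target (m := ∞)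
        (by simp)).clm_apply contDiffOn_const
    have h2 := contMDiffOn_of_mem_maximalAtlas x.chart_mem
    rw [← contMDiffOn_univ, ← x.source_eq]
    exact h1.contMDiffOn.comp h2 x.chart.mapsTo⟩
  map_zero' := by
    ext p
    change fderiv ℝ (fun _ : Coord n => (0 : ℂ)) (x.chart p) _ = 0
    simp
  map_add' f g := by
    ext p
    have hp : x.chart p ∈ x.chart.target := x.chart.mapsTo (x.source_eq ▸ Set.mem_univ p)
    have hd : ∀ f : SmoothC n M,
        DifferentiableAt ℝ (fun y => f (x.chart.symm y)) (x.chart p) := fun f =>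
      ((contDiffOn_coord x f).differentiableOn (by simp)).differentiableAt
        (x.chart.open_target.mem_nhds hp)
    change fderiv ℝ ((fun y => f (x.chart.symm y)) + fun y => g (x.chart.symm y))
      (x.chart p) _ = _
    rw [fderiv_add (hd f) (hd g)]
    rfl

/-- The functions `A_ab` are the components of a Riemannian metric: the matrix `(A_ab)` is
symmetric and positive definite at every point. -/
def IsRiemannian (A : Matrix (Fin n) (Fin n) (SmoothR n M)) : Prop :=
  ∀ p, (Matrix.of fun a b => A a b p).PosDef

end Smooth

/-! ### Formal series -/

section Series

variable (n : ℕ) (M : Type*) [TopologicalSpace M] [ChartedSpace (Coord n) M]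

/-- `C^∞(M, ℂ)[Z]⟨Y⟩`: generalized polynomials in `Y` (finitely many real exponents) over the
polynomials in `Z`. -/
abbrev Coef := AddMonoidAlgebra (Polynomial (SmoothC n M)) ℝ

/-- Hahn series in `X` with real exponents over `C^∞(M, ℂ)[Z]⟨Y⟩`. This is an auxiliary ambient
ring: its support condition (well-ordered) is weaker than that of the series in `formalSeries`,
which form a subring. -/
abbrev Ser := HahnSeries ℝ (Coef n M)

/-- A set of reals is discrete (without limit points in `ℝ`) and bounded below exactly if it has
only finitely many elements below every real number. -/
theorem discrete_bddBelow_iff (s : Set ℝ) :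
    ((∀ y, ¬ AccPt y (Filter.principal s)) ∧ BddBelow s) ↔ ∀ c, (s ∩ Set.Iic c).Finite := by
  constructor
  · rintro ⟨h, b, hb⟩ c
    by_contra hinf
    have hinf' : (s ∩ Set.Iic c).Infinite := hinf
    obtain ⟨y, -, hy⟩ := hinf'.exists_accPt_of_subset_isCompact (isCompact_Icc (a := b) (b := c))
      (fun z hz => ⟨hb hz.1, hz.2⟩)
    exact h y (hy.mono (Filter.principal_mono.2 Set.inter_subset_left))
  · intro h
    refine ⟨fun y hy => ?_, ?_⟩
    · rw [accPt_iff_frequently] at hy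
      have hfin : ((s ∩ Set.Iic (y + 1)) \ {y}).Finite := (h (y + 1)).subset Set.sdiff_subset
      have h1 : ∀ᶠ z in nhds y, z ∉ (s ∩ Set.Iic (y + 1)) \ {y} :=
        hfin.isClosed.isOpen_compl.mem_nhds (by simp)
      have h2 : ∀ᶠ z in nhds y, z < y + 1 := eventually_lt_nhds (by linarith)
      obtain ⟨z, ⟨hz1, hz2⟩, hz3, hz4⟩ := (hy.and_eventually (h1.and h2)).exists
      exact hz3 ⟨⟨hz2, hz4.le⟩, hz1⟩
    · obtain ⟨b, hb⟩ := (h 0).bddBelow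
      refine ⟨min b 0, fun z hz => ?_⟩
      rcases le_total z 0 with h0 | h0
      · exact (min_le_left _ _).trans (hb ⟨hz, h0⟩)
      · exact (min_le_right _ _).trans h0

/-- The algebra `𝓛 = C^∞(M, ℂ)[Z]⟨Y⟩{{X}}` of generalized finite formal Laurent series: the
support (a set of real exponents of `X`) is discrete and bounded below
(see `discrete_bddBelow_iff`). -/
def formalSeries : Subring (Ser n M) where
  carrier := {f | ∀ c, (f.support ∩ Set.Iic c).Finite}
  zero_mem' c := by simp
  one_mem' c := by
    refine (Set.finite_singleton (0 : ℝ)).subset fun z hz => ?_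
    by_contra h0
    exact hz.1 (by simp [HahnSeries.coeff_one, show z ≠ 0 from h0])
  add_mem' {f g} hf hg c := by
    refine ((hf c).union (hg c)).subset fun z hz => ?_
    rcases HahnSeries.support_add_subset (x := f) (y := g) hz.1 with h | h
    · exact Or.inl ⟨h, hz.2⟩
    · exact Or.inr ⟨h, hz.2⟩
  neg_mem' {f} hf c := by
    rw [HahnSeries.support_neg]
    exact hf c
  mul_mem' {f g} hf hg c := by
    obtain ⟨-, bf, hbf⟩ := (discrete_bddBelow_iff _).2 hf
    obtain ⟨-, bg, hbg⟩ := (discrete_bddBelow_iff _).2 hg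
    refine ((hf (c - bg)).add (hg (c - bf))).subset fun z hz => ?_
    obtain ⟨u, hu, v, hv, rfl⟩ := HahnSeries.support_mul_subset hz.1
    have h1 := hbf hu
    have h2 := hbg hv
    have h3 : u + v ≤ c := hz.2
    exact ⟨u, ⟨hu, by simp only [Set.mem_Iic]; linarith⟩, v,
      ⟨hv, by simp only [Set.mem_Iic]; linarith⟩, rfl⟩

variable {n M}

/-- The coefficient `(f)_{m,s,l}` of `X^m Y^s Z^l`. -/
def coef (f : Ser n M) (m s : ℝ) (l : ℕ) : SmoothC n M := ((f.coeff m).coeff s).coeff l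

/-- A smooth function as an element of `C^∞(M, ℂ)[Z]⟨Y⟩`. -/
def fn (f : SmoothC n M) : Coef n M := AddMonoidAlgebra.single 0 (Polynomial.C f)

/-- The variable `Z` as an element of `C^∞(M, ℂ)[Z]⟨Y⟩`. -/
def varZ : Coef n M := AddMonoidAlgebra.single 0 Polynomial.X

/-- The power `Y^s` as an element of `C^∞(M, ℂ)[Z]⟨Y⟩`. -/
def powY (s : ℝ) : Coef n M := AddMonoidAlgebra.single s 1

/-- The power `X^α`. -/
def powX (α : ℝ) : Ser n M := HahnSeries.single α 1

/-- The set `𝓢_u`: series in `𝓛` of order not less than zero which have neither oscillatory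
(`s ≠ 0`) nor logarithmic (`l ≠ 0`) terms before `u`. -/
def calS (u : ℝ) : Set (Ser n M) :=
  {f | f ∈ formalSeries n M ∧ (∀ m < 0, f.coeff m = 0) ∧
    ∀ m < u, ∀ (s : ℝ) (l : ℕ), s ≠ 0 ∨ l ≠ 0 → coef f m s l = 0}

/-- The set `𝓢_u X^α`. -/
def calSX (u α : ℝ) : Set (Ser n M) := {f | ∃ h ∈ calS u, f = h * powX α}

/-- The time derivative on the coefficient of `X^m`:
`(q)_{s,l} ↦ -(m + i s) H (q)_{s,l} + (l + 1) (q)_{s,l+1}`. -/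
def dtCoef (H m : ℝ) (q : Coef n M) : Coef n M :=
  AddMonoidAlgebra.ofCoeff (Finsupp.onFinset q.coeff.support
    (fun s => Polynomial.C (cstC (-((m : ℂ) + Complex.I * (s : ℂ)) * (H : ℂ))) * q.coeff s
      + Polynomial.derivative (q.coeff s))
    (fun s hs => by
      rw [Finsupp.mem_support_iff]
      intro h
      simp [h] at hs))

/-- The formal time derivative `∂_t f`. -/
def dt (H : ℝ) (f : Ser n M) : Ser n M where
  coeff m := dtCoef H m (f.coeff m)
  isPWO_support' := f.isPWO_support.mono fun m hm h0 => hm (by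
    change dtCoef H m (f.coeff m) = 0
    rw [h0]
    apply AddMonoidAlgebra.coeff_injective
    ext s
    simp [dtCoef])

/-- The action of an additive map of `C^∞(M, ℂ)` on all coefficients of a polynomial in `Z`. -/
def mapZ (T : SmoothC n M →+ SmoothC n M) :
    Polynomial (SmoothC n M) →+ Polynomial (SmoothC n M) where
  toFun q := Polynomial.ofFinsupp (AddMonoidAlgebra.map T q.toFinsupp)
  map_zero' := by
    ext l
    simp [Polynomial.coeff]
  map_add' q r := by
    ext l
    simp [Polynomial.coeff]

/-- Complex conjugation on the coefficients: `(q^*)_{s,l} = ((q)_{-s,l})^*`. -/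
def conjCoef (q : Coef n M) : Coef n M :=
  AddMonoidAlgebra.mapDomain (fun s : ℝ => -s) (AddMonoidAlgebra.map (mapZ conjC) q)

/-- Complex conjugation `f^*` of formal series: `(f^*)_{m,s,l} = ((f)_{m,-s,l})^*`. -/
def conj (f : Ser n M) : Ser n M where
  coeff m := conjCoef (f.coeff m)
  isPWO_support' := f.isPWO_support.mono fun m hm h0 => hm (by simp [h0, conjCoef])

/-- A formal series is real if it equals its complex conjugate. -/
def IsReal (f : Ser n M) : Prop := conj f = f

/-- A term plus its complex conjugate. -/
def addCC (f : Ser n M) : Ser n M := f + conj f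

variable [IsManifold (𝓡 n) ∞ M]

/-- The formal spatial derivative, `(∂_a f)_{m,s,l} = ∂_a (f)_{m,s,l}`. -/
def pd (x : GlobalChart n M) (a : Fin n) (f : Ser n M) : Ser n M where
  coeff m := AddMonoidAlgebra.map (mapZ (pderivC x a)) (f.coeff m)
  isPWO_support' := f.isPWO_support.mono fun m hm h0 => hm (by simp [h0])

end Series

/-! ### Parameters of the model -/

/-- The parameters of a curvature coupled scalar field model: the coupling constant `ξ`, the
cosmological constant `Λ`, the field mass `μ` and the potential `V`, whose values are relevant on
the set `I` only. -/
structure Model where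
  ξ : ℝ
  Λ : ℝ
  μ : ℝ
  V : ℝ → ℝ
  I : Set ℝ

namespace Model

variable (P : Model) (n : ℕ)

/-- The asymptotic Hubble constant. -/
def H : ℝ := √(2 * P.Λ / ((n : ℝ) * ((n : ℝ) - 1)))

/-- The critical value `K` of the squared field mass. -/
def K : ℝ := ((n : ℝ) ^ 2 / 4 - P.ξ * (n : ℝ) * ((n : ℝ) + 1)) * P.H n ^ 2

/-- The exponent `k₁`. -/
def k₁ : ℝ :=
  open Classical in
  if P.K n < P.μ ^ 2 then (n : ℝ) / 2 else (n : ℝ) / 2 - √(P.K n - P.μ ^ 2) / P.H n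

/-- The exponent `k₂`. -/
def k₂ : ℝ :=
  open Classical in
  if P.K n < P.μ ^ 2 then (n : ℝ) / 2 else (n : ℝ) / 2 + √(P.K n - P.μ ^ 2) / P.H n

/-- The frequency parameter `ω`. -/
def freq : ℝ :=
  open Classical in
  if P.K n < P.μ ^ 2 then √(P.μ ^ 2 - P.K n) / P.H n else 0

/-- The standing assumptions: `Λ > 0`; `V` is smooth on a nondegenerate interval containing zero,
with `V(0) = Λ` and `V'(0) = μ²/2`; and `μ² > -ξ n (n + 1) H²`. -/
structure Valid : Prop where
  Λ_pos : 0 < P.Λ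
  interval : P.I.OrdConnected
  nontrivial : P.I.Nontrivial
  zero_mem : (0 : ℝ) ∈ P.I
  smooth : ContDiffOn ℝ ∞ P.V P.I
  V_zero : P.V 0 = P.Λ
  V_deriv : derivWithin P.V P.I 0 = P.μ ^ 2 / 2
  mass : -P.ξ * (n : ℝ) * ((n : ℝ) + 1) * P.H n ^ 2 < P.μ ^ 2

/-- The Maclaurin series of `V`. -/
def taylorV : PowerSeries ℝ :=
  PowerSeries.mk fun k => iteratedDerivWithin k P.V P.I 0 / (k.factorial : ℝ)

/-- The Maclaurin series of `V'`. -/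
def taylorV' : PowerSeries ℝ :=
  PowerSeries.mk fun k => iteratedDerivWithin (k + 1) P.V P.I 0 / (k.factorial : ℝ)

end Model

/-! ### Geometric quantities of a formal metric

Throughout, `H` is the Hubble constant entering the formal time derivative, `g` the family
`g_ab` and `x` the chart. The first index of a mixed tensor is the upper one. -/

section Geometry

variable {n : ℕ} {M : Type*} [TopologicalSpace M] [ChartedSpace (Coord n) M]

/-- Raising the first index: `g^{ai} T_{ib}`, where `g^{ab}` is the inverse of `g_ab`. -/
def raise (g T : Matrix (Fin n) (Fin n) (Ser n M)) : Matrix (Fin n) (Fin n) (Ser n M) :=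
  g⁻¹ * T

/-- The traceless part `T^a_b - (1/n) T^i_i δ^a_b` of a mixed tensor. -/
def traceless (T : Matrix (Fin n) (Fin n) (Ser n M)) : Matrix (Fin n) (Fin n) (Ser n M) :=
  T - ((n : ℝ)⁻¹ • T.trace) • (1 : Matrix (Fin n) (Fin n) (Ser n M))

/-- The second fundamental form `k_ab`, defined by `∂_t g_ab = -2 k_ab`. -/
def kLow (H : ℝ) (g : Matrix (Fin n) (Fin n) (Ser n M)) : Matrix (Fin n) (Fin n) (Ser n M) :=
  Matrix.of fun a b => (-(1 / 2) : ℝ) • dt H (g a b)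

/-- `k^a_b`. -/
def kMix (H : ℝ) (g : Matrix (Fin n) (Fin n) (Ser n M)) : Matrix (Fin n) (Fin n) (Ser n M) :=
  raise g (kLow H g)

/-- `tr k`. -/
def trK (H : ℝ) (g : Matrix (Fin n) (Fin n) (Ser n M)) : Ser n M := (kMix H g).trace

/-- `k_ij k^ij`. -/
def kSq (H : ℝ) (g : Matrix (Fin n) (Fin n) (Ser n M)) : Ser n M :=
  ∑ i, ∑ j, kLow H g i j * ∑ p, ∑ q, g⁻¹ i p * g⁻¹ j q * kLow H g p q

/-- `σ^a_b`, the traceless part of `k^a_b`. -/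
def sigma (H : ℝ) (g : Matrix (Fin n) (Fin n) (Ser n M)) : Matrix (Fin n) (Fin n) (Ser n M) :=
  traceless (kMix H g)

variable [IsManifold (𝓡 n) ∞ M]

/-- The connection coefficients `Γ^c_ab`. -/
def Gam (x : GlobalChart n M) (g : Matrix (Fin n) (Fin n) (Ser n M)) (c a b : Fin n) : Ser n M :=
  (1 / 2 : ℝ) • ∑ i, g⁻¹ i c * (pd x a (g i b) + pd x b (g a i) - pd x i (g a b))

/-- The Ricci tensor `R_ab`. -/
def ricci (x : GlobalChart n M) (g : Matrix (Fin n) (Fin n) (Ser n M)) :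
    Matrix (Fin n) (Fin n) (Ser n M) :=
  Matrix.of fun a b =>
    (∑ i, pd x i (Gam x g i a b)) - (∑ i, pd x a (Gam x g i i b))
      + (∑ i, ∑ j, Gam x g j a b * Gam x g i i j) - ∑ i, ∑ j, Gam x g i a j * Gam x g j i b

/-- `R^a_b`. -/
def ricciMix (x : GlobalChart n M) (g : Matrix (Fin n) (Fin n) (Ser n M)) :
    Matrix (Fin n) (Fin n) (Ser n M) :=
  raise g (ricci x g)

/-- The scalar curvature `R`. -/
def scal (x : GlobalChart n M) (g : Matrix (Fin n) (Fin n) (Ser n M)) : Ser n M :=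
  (ricciMix x g).trace

/-- The ambient scalar curvature `R - 2 ∂_t tr k + k_ij k^ij + (tr k)²`. -/
def ambientScal (x : GlobalChart n M) (H : ℝ) (g : Matrix (Fin n) (Fin n) (Ser n M)) : Ser n M :=
  scal x g - (2 : ℝ) • dt H (trK H g) + kSq H g + trK H g ^ 2

/-- The covariant derivative `∇_c T^a_b` of a mixed tensor. -/
def covMix (x : GlobalChart n M) (g T : Matrix (Fin n) (Fin n) (Ser n M)) (c a b : Fin n) :
    Ser n M :=
  pd x c (T a b) + (∑ j, Gam x g a c j * T j b) - ∑ j, Gam x g j c b * T a j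

/-- `∇^a f`. -/
def gradUp (x : GlobalChart n M) (g : Matrix (Fin n) (Fin n) (Ser n M)) (f : Ser n M)
    (a : Fin n) : Ser n M :=
  ∑ i, g⁻¹ a i * pd x i f

/-- `∇_a ∇_b f`. -/
def hess (x : GlobalChart n M) (g : Matrix (Fin n) (Fin n) (Ser n M)) (f : Ser n M) :
    Matrix (Fin n) (Fin n) (Ser n M) :=
  Matrix.of fun a b => pd x a (pd x b f) - ∑ c, Gam x g c a b * pd x c f

/-- `Δ f = ∇^i ∇_i f`. -/
def lap (x : GlobalChart n M) (g : Matrix (Fin n) (Fin n) (Ser n M)) (f : Ser n M) : Ser n M :=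
  (raise g (hess x g f)).trace

/-- `∇_i φ^* ∇^i φ`. -/
def gradSq (x : GlobalChart n M) (g : Matrix (Fin n) (Fin n) (Ser n M)) (φ : Ser n M) : Ser n M :=
  ∑ i, pd x i (conj φ) * gradUp x g φ i

end Geometry

/-! ### Matter quantities and the field equations -/

section Equations

variable {n : ℕ} {M : Type*} [TopologicalSpace M] [ChartedSpace (Coord n) M]

/-- `W`, the substitution of `φ^* φ` in the Maclaurin series of `V` (the power series evaluation
`PowerSeries.heval` is the pointwise finite sum of the terms when `φ^* φ` has positive order). -/
def potW (P : Model) (φ : Ser n M) : Ser n M :=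
  PowerSeries.heval (conj φ * φ) (PowerSeries.map (algebraMap ℝ (Coef n M)) P.taylorV)

/-- `W'`, the substitution of `φ^* φ` in the Maclaurin series of `V'`. -/
def potW' (P : Model) (φ : Ser n M) : Ser n M :=
  PowerSeries.heval (conj φ * φ) (PowerSeries.map (algebraMap ℝ (Coef n M)) P.taylorV')

/-- `(1 - ξ φ^* φ)⁻¹`. -/
def confInv (P : Model) (φ : Ser n M) : Ser n M := Ring.inverse (1 - P.ξ • (conj φ * φ))

variable [IsManifold (𝓡 n) ∞ M]

/-- The stress components `S^a_b` of the effective energy momentum tensor. -/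
def effS (x : GlobalChart n M) (P : Model) (g : Matrix (Fin n) (Fin n) (Ser n M)) (φ : Ser n M) :
    Matrix (Fin n) (Fin n) (Ser n M) :=
  Matrix.of fun a b => (1 / 2 : ℝ) • (confInv P φ * addCC (
    (1 - 2 * P.ξ) • (gradUp x g (conj φ) a * pd x b φ)
    - (2 * P.ξ) • (conj φ * (raise g (hess x g φ) a b + kMix (P.H n) g a b * dt (P.H n) φ))
    + ((2 * P.ξ - 1 / 2) • (gradSq x g φ - dt (P.H n) (conj φ) * dt (P.H n) φ)
        + (2 * P.ξ) • (conj φ * (lap x g φ + trK (P.H n) g * dt (P.H n) φ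
            - dt (P.H n) (dt (P.H n) φ)))
        - potW P φ) * (1 : Matrix (Fin n) (Fin n) (Ser n M)) a b))

/-- The current `j^a` of the effective energy momentum tensor. -/
def effJUp (x : GlobalChart n M) (P : Model) (g : Matrix (Fin n) (Fin n) (Ser n M)) (φ : Ser n M)
    (a : Fin n) : Ser n M :=
  (1 / 2 : ℝ) • (confInv P φ * addCC (
    -((1 - 2 * P.ξ) • (gradUp x g (conj φ) a * dt (P.H n) φ))
    + (2 * P.ξ) • (conj φ * (dt (P.H n) (gradUp x g φ a)
        - ∑ i, kMix (P.H n) g a i * gradUp x g φ i))))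

/-- `j_a`. -/
def effJ (x : GlobalChart n M) (P : Model) (g : Matrix (Fin n) (Fin n) (Ser n M)) (φ : Ser n M)
    (a : Fin n) : Ser n M :=
  ∑ i, g a i * effJUp x P g φ i

/-- The energy density `ρ` of the effective energy momentum tensor. -/
def effRho (x : GlobalChart n M) (P : Model) (g : Matrix (Fin n) (Fin n) (Ser n M))
    (φ : Ser n M) : Ser n M :=
  (1 / 2 : ℝ) • (confInv P φ * addCC (
    (1 / 2 : ℝ) • (dt (P.H n) (conj φ) * dt (P.H n) φ)
    - (2 * P.ξ - 1 / 2) • gradSq x g φ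
    - (2 * P.ξ) • (conj φ * (lap x g φ + trK (P.H n) g * dt (P.H n) φ))
    + potW P φ))

/-- The traceless evolution quantity `Ê^a_b`. -/
def evolTl (x : GlobalChart n M) (P : Model) (g : Matrix (Fin n) (Fin n) (Ser n M))
    (φ : Ser n M) (a b : Fin n) : Ser n M :=
  dt (P.H n) (sigma (P.H n) g a b)
    - (traceless (ricciMix x g) a b + trK (P.H n) g * sigma (P.H n) g a b
        - traceless (effS x P g φ) a b)

/-- The evolution quantity `E` of the trace. -/
def evolTr (x : GlobalChart n M) (P : Model) (g : Matrix (Fin n) (Fin n) (Ser n M))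
    (φ : Ser n M) : Ser n M :=
  dt (P.H n) (trK (P.H n) g)
    - (scal x g + trK (P.H n) g ^ 2 + (1 / ((n : ℝ) - 1)) • (effS x P g φ).trace
        - ((n : ℝ) / ((n : ℝ) - 1)) • effRho x P g φ)

/-- The energy constraint quantity `C`. -/
def constrHam (x : GlobalChart n M) (P : Model) (g : Matrix (Fin n) (Fin n) (Ser n M))
    (φ : Ser n M) : Ser n M :=
  scal x g - kSq (P.H n) g + trK (P.H n) g ^ 2 - (2 : ℝ) • effRho x P g φ

/-- The momentum constraint quantity `C_a`. -/
def constrMom (x : GlobalChart n M) (P : Model) (g : Matrix (Fin n) (Fin n) (Ser n M))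
    (φ : Ser n M) (a : Fin n) : Ser n M :=
  (∑ i, covMix x g (kMix (P.H n) g) i i a) - pd x a (trK (P.H n) g) - effJ x P g φ a

/-- The left hand side of the scalar field equation. -/
def fieldEq (x : GlobalChart n M) (P : Model) (g : Matrix (Fin n) (Fin n) (Ser n M))
    (φ : Ser n M) : Ser n M :=
  lap x g φ + trK (P.H n) g * dt (P.H n) φ - dt (P.H n) (dt (P.H n) φ)
    - P.ξ • (ambientScal x (P.H n) g * φ) - (2 : ℝ) • (φ * potW' P φ)

/-- The pairs for which the field equations are posed: `g_ab` is a real symmetric family in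
`𝓢_u X^{-v}` for some `u > 0` and real `v`, with `(g_ab)_{-v,0,0}` a Riemannian metric, and
`φ ∈ 𝓛` is of order greater than zero. -/
structure IsAdmissible (g : Matrix (Fin n) (Fin n) (Ser n M)) (φ : Ser n M) : Prop where
  real : ∀ a b, IsReal (g a b)
  symm : ∀ a b, g a b = g b a
  metric : ∃ u > (0 : ℝ), ∃ v : ℝ, (∀ a b, g a b ∈ calSX u (-v)) ∧
    ∃ B : Matrix (Fin n) (Fin n) (SmoothR n M), IsRiemannian B ∧
      ∀ a b, coef (g a b) (-v) 0 0 = ofRealC (B a b)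
  field_mem : φ ∈ formalSeries n M
  field_order : ∀ m ≤ 0, φ.coeff m = 0

/-- The Einstein equations hold at relative order `m`. -/
structure EinsteinAt (x : GlobalChart n M) (P : Model) (g : Matrix (Fin n) (Fin n) (Ser n M))
    (φ : Ser n M) (m : ℝ) : Prop where
  evolTl_eq : ∀ a b, (evolTl x P g φ a b).coeff m = 0
  evolTr_eq : (evolTr x P g φ).coeff m = 0
  constrHam_eq : (constrHam x P g φ).coeff m = 0
  constrMom_eq : ∀ a, (constrMom x P g φ a).coeff m = 0

/-- The scalar field equation holds at relative order `m`. -/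
def FieldAt (x : GlobalChart n M) (P : Model) (g : Matrix (Fin n) (Fin n) (Ser n M))
    (φ : Ser n M) (m : ℝ) : Prop :=
  (fieldEq x P g φ).coeff (m + P.k₁ n) = 0

/-- `(g_ab, φ)` is a solution of the Einstein scalar field equations up to relative order `n`,
exclusive, with `g_ab ∈ 𝓢_n X^{-2}`, `φ ∈ 𝓢_{k₂-k₁} X^{k₁}` and the leading data given by `A_ab`,
`φ₀` and `φ₁`. -/
structure IsInitialSolution (x : GlobalChart n M) (P : Model)
    (A : Matrix (Fin n) (Fin n) (SmoothR n M)) (φ₀ φ₁ : SmoothC n M)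
    (g : Matrix (Fin n) (Fin n) (Ser n M)) (φ : Ser n M) : Prop where
  admissible : IsAdmissible g φ
  einstein : ∀ m < (n : ℝ), EinsteinAt x P g φ m
  field : ∀ m < (n : ℝ), FieldAt x P g φ m
  metric_mem : ∀ a b, g a b ∈ calSX (n : ℝ) (-2)
  field_mem : φ ∈ calSX (P.k₂ n - P.k₁ n) (P.k₁ n)
  G1 : ∀ a b, (g a b).coeff (-2) = fn (ofRealC (A a b))
  P1_sub : P.μ ^ 2 < P.K n → φ.coeff (P.k₁ n) = fn φ₀
  P1_crit : P.μ ^ 2 = P.K n → φ.coeff (P.k₁ n) = fn φ₀ + fn φ₁ * varZ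
  P1_super : P.K n < P.μ ^ 2 →
    φ.coeff (P.k₁ n) = fn φ₀ * powY (-P.freq n) + fn φ₁ * powY (P.freq n)
  P2 : P.μ ^ 2 < P.K n → ∃ χ : SmoothC n M, φ.coeff (P.k₂ n) = fn φ₁ + fn χ * varZ

end Equations

end AlgESF

end

open scoped Manifold ContDiff

set_option linter.unusedSectionVars false

noncomputable section

/-! Measured against the background `X⁻² A`, a metric is described by the matrix `η = X² A⁻¹ g - 1`
(`pert`), which has positive order. Since `∂_t X^m = -m H X^m`, one finds `k = -H δ - ½ ∂_t η` up to
terms quadratic in `η`, while spatial curvature carries an extra `X²`. So, with `M² = ξ n (n+1) H² +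
μ²`, the equations read `Ê = -½ ∂_t(∂_t + nH) η̂ + …`, `E = -½ ∂_t(∂_t + 2nH) tr η + …`, `F = -(∂_t²
+ nH ∂_t + M²) φ + …`. The omitted terms are at least quadratic, or gain powers of `X`: if two pairs
agree up to relative order `m`, their omitted terms agree up to order `m + ε`, with a fixed `ε > 0`.

On the coefficient of `X^p` the metric operators are invertible for `0 < p < n`. The wave operator
factors with the roots `k₁ + iω` and `k₂ - iω` and is invertible unless `p` is `k₁` or `k₂`. Its
kernel at `k₁` contains the data in (P1). At `k₂ > k₁` it annihilates functions, which leaves `φ₁`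
free, and it is injective on multiples of `Z`, so a single logarithm absorbs the error there
(`exists_waveCoef_eq`). Iterating in steps of size `ε` gives existence
(`ApproxSolution.exists_next`); comparing two solutions in the same way gives uniqueness
(`IsInitialSolution.unique`).

Logarithms and oscillations stay out of the metric below relative order `n` because the matter
sources are quadratic in the field: they start at `2k₁`, and the field is free of such terms below
`k₂`, so the sources are free of them below `2k₁ + (k₂ - k₁) = n` (`plain_evolTl`, `plain_evolTr`).

The construction solves the evolution and field equations only. The constraints follow from the
contracted Bianchi identity for `-dt² + g` (`MetricConnection.divMix_violation`): the violation of
the Einstein equations, multiplied by `1 - ξ φ^*φ`, has a divergence built from `F`. Its time and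
space components are equations `(∂_t + 2nH) u = …` and `(∂_t + nH) h_b = …` for the rescaled
constraints, and these operators are injective on orders below `n` (`constraints_mem`). The symmetry
of the same violation tensor makes the metric corrections symmetric.

All estimates are proved once, for an abstract relation between pairs of series with a weight
(`WeightRel`). Its two instances are congruence up to a relative order, and absence of oscillatory
and logarithmic terms below a relative order. -/

namespace AlgESF

/-! ### Smooth functions, their conjugates and their coordinate derivatives -/

section SmoothCalculus

variable {n : ℕ} {M : Type*} [TopologicalSpace M] [ChartedSpace (Coord n) M]

@[simp] theorem SmoothC.add_apply (f g : SmoothC n M) (p : M) : (f + g) p = f p + g p := rfl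
@[simp] theorem SmoothC.mul_apply (f g : SmoothC n M) (p : M) : (f * g) p = f p * g p := rfl
@[simp] theorem SmoothC.one_apply (p : M) : (1 : SmoothC n M) p = 1 := rfl
@[simp] theorem SmoothC.smul_apply (r : ℝ) (f : SmoothC n M) (p : M) : (r • f) p = r • f p := rfl
@[simp] theorem cstC_apply (c : ℂ) (p : M) : (cstC c : SmoothC n M) p = c := rfl
@[simp] theorem ofRealC_apply (f : SmoothR n M) (p : M) : ofRealC f p = ((f p : ℝ) : ℂ) := rfl
@[simp] theorem conjC_apply (f : SmoothC n M) (p : M) : conjC f p = starRingEnd ℂ (f p) := rfl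

theorem smul_eq_cstC_mul (r : ℝ) (f : SmoothC n M) : r • f = cstC (r : ℂ) * f := by
  ext p
  simp

theorem conjC_mul (f g : SmoothC n M) : conjC (f * g) = conjC f * conjC g := by
  ext p
  simp

theorem conjC_one : conjC (1 : SmoothC n M) = 1 := by
  ext p
  simp

theorem conjC_conjC (f : SmoothC n M) : conjC (conjC f) = f := by
  ext p
  simp

theorem conjC_cstC (c : ℂ) : conjC (cstC c : SmoothC n M) = cstC (starRingEnd ℂ c) := by
  ext p
  simp

/-- Complex conjugation as a ring homomorphism. -/
def conjCHom : SmoothC n M →+* SmoothC n M where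
  toFun := conjC
  map_one' := conjC_one
  map_mul' := conjC_mul
  map_zero' := map_zero _
  map_add' := map_add _

/-- The inclusion of real functions as a ring homomorphism. -/
def ofRealCHom : SmoothR n M →+* SmoothC n M where
  toFun := ofRealC
  map_one' := by ext p; change ((1 : ℝ) : ℂ) = 1; simp
  map_mul' f g := by ext p; change ((f p * g p : ℝ) : ℂ) = _; simp
  map_zero' := by ext p; change ((0 : ℝ) : ℂ) = 0; simp
  map_add' f g := by ext p; change ((f p + g p : ℝ) : ℂ) = _; simp

theorem exists_inverse_of_pos (f : SmoothR n M) (hf : ∀ p, 0 < f p) :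
    ∃ g : SmoothR n M, f * g = 1 := by
  have h1 : ContMDiff (𝓡 n) 𝓘(ℝ, ℝ) ∞ fun p => (f p)⁻¹ := by
    intro p
    have h2 : ContMDiffAt 𝓘(ℝ, ℝ) 𝓘(ℝ, ℝ) ∞ (fun y : ℝ => y⁻¹) (f p) :=
      (contDiffAt_inv ℝ (hf p).ne').contMDiffAt
    exact h2.comp p f.contMDiff.contMDiffAt
  refine ⟨⟨_, h1⟩, ?_⟩
  ext p
  exact mul_inv_cancel₀ (hf p).ne'

theorem GlobalChart.mem_target (x : GlobalChart n M) (p : M) : x.chart p ∈ x.chart.target :=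
  x.chart.mapsTo (x.source_eq ▸ Set.mem_univ p)

theorem GlobalChart.left_inv (x : GlobalChart n M) (p : M) : x.chart.symm (x.chart p) = p :=
  x.chart.left_inv (x.source_eq ▸ Set.mem_univ p)

theorem contDiffAt_coord (x : GlobalChart n M) (f : SmoothC n M) {y : Coord n}
    (hy : y ∈ x.chart.target) : ContDiffAt ℝ ∞ (fun y => f (x.chart.symm y)) y :=
  (contDiffOn_coord x f).contDiffAt (x.chart.open_target.mem_nhds hy)

theorem differentiableAt_coord (x : GlobalChart n M) (f : SmoothC n M) (p : M) :
    DifferentiableAt ℝ (fun y => f (x.chart.symm y)) (x.chart p) :=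
  (contDiffAt_coord x f (x.mem_target p)).differentiableAt (by simp)

variable [IsManifold (𝓡 n) ∞ M]

theorem pderivC_apply (x : GlobalChart n M) (a : Fin n) (f : SmoothC n M) (p : M) :
    pderivC x a f p = fderiv ℝ (fun y => f (x.chart.symm y)) (x.chart p)
      (EuclideanSpace.single a (1 : ℝ)) := rfl

theorem pderivC_mul (x : GlobalChart n M) (a : Fin n) (f g : SmoothC n M) :
    pderivC x a (f * g) = pderivC x a f * g + f * pderivC x a g := by
  ext p
  rw [pderivC_apply]
  change fderiv ℝ ((fun y => f (x.chart.symm y)) * fun y => g (x.chart.symm y)) _ _ = _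
  rw [fderiv_mul (differentiableAt_coord x f p) (differentiableAt_coord x g p)]
  simp only [SmoothC.add_apply, SmoothC.mul_apply, pderivC_apply, add_apply,
    smul_apply, smul_eq_mul, x.left_inv]
  ring

theorem pderivC_cstC (x : GlobalChart n M) (a : Fin n) (c : ℂ) :
    pderivC x a (cstC c) = 0 := by
  ext p
  rw [pderivC_apply]
  change fderiv ℝ (fun _ : Coord n => c) (x.chart p) _ = 0
  simp

theorem pderivC_smul (x : GlobalChart n M) (a : Fin n) (r : ℝ) (f : SmoothC n M) :
    pderivC x a (r • f) = r • pderivC x a f := by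
  rw [smul_eq_cstC_mul, pderivC_mul, pderivC_cstC, smul_eq_cstC_mul, zero_mul, zero_add]

theorem pderivC_conjC (x : GlobalChart n M) (a : Fin n) (f : SmoothC n M) :
    pderivC x a (conjC f) = conjC (pderivC x a f) := by
  ext p
  rw [conjC_apply, pderivC_apply, pderivC_apply]
  change fderiv ℝ (Complex.conjCLE ∘ fun y => f (x.chart.symm y)) _ _ = _
  rw [ContinuousLinearEquiv.comp_fderiv]
  rfl

theorem pderivC_comm (x : GlobalChart n M) (a b : Fin n) (f : SmoothC n M) :
    pderivC x a (pderivC x b f) = pderivC x b (pderivC x a f) := by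
  ext p
  have key : ∀ c d : Fin n, pderivC x c (pderivC x d f) p =
      fderiv ℝ (fderiv ℝ (fun y => f (x.chart.symm y))) (x.chart p)
        (EuclideanSpace.single c (1 : ℝ)) (EuclideanSpace.single d (1 : ℝ)) := by
    intro c d
    rw [pderivC_apply]
    -- The coordinate expression of the first derivative is known only on the target of the chart;
    -- this is open, which suffices for differentiating once more.
    have h1 : (fun y => pderivC x d f (x.chart.symm y)) =ᶠ[nhds (x.chart p)] fun y =>
        fderiv ℝ (fun y => f (x.chart.symm y)) y (EuclideanSpace.single d (1 : ℝ)) := by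
      filter_upwards [x.chart.open_target.mem_nhds (x.mem_target p)] with y hy
      rw [pderivC_apply, x.chart.right_inv hy]
    rw [h1.fderiv_eq]
    have h2 : DifferentiableAt ℝ (fderiv ℝ (fun y => f (x.chart.symm y))) (x.chart p) :=
      ((contDiffAt_coord x f (x.mem_target p)).fderiv_right (m := 1) (by norm_cast)).differentiableAt
        (by simp)
    rw [fderiv_clm_apply h2 (differentiableAt_const _)]
    simp
  rw [key, key]
  have hs : IsSymmSndFDerivAt ℝ (fun y => f (x.chart.symm y)) (x.chart p) :=
    (contDiffAt_coord x f (x.mem_target p)).isSymmSndFDerivAt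
      (by
        rw [minSmoothness_of_isRCLikeNormedField]
        exact WithTop.coe_le_coe.2 (le_top : (2 : ℕ∞) ≤ ⊤))
  exact hs _ _

end SmoothCalculus

/-! ### Time derivative, spatial derivatives and conjugation on the coefficients of powers of `X` -/

section Coefficients

variable {n : ℕ} {M : Type*} [TopologicalSpace M] [ChartedSpace (Coord n) M]

theorem coeff_mapZ (T : SmoothC n M →+ SmoothC n M) (q : Polynomial (SmoothC n M)) (l : ℕ) :
    (mapZ T q).coeff l = T (q.coeff l) := by
  simp [mapZ, Polynomial.coeff]

theorem mapZ_conjC (q : Polynomial (SmoothC n M)) : mapZ conjC q = q.map conjCHom := by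
  ext1 l
  rw [coeff_mapZ, Polynomial.coeff_map]
  rfl

theorem mapZ_mul (T : SmoothC n M →+ SmoothC n M) (hT : ∀ f g, T (f * g) = T f * g + f * T g)
    (q r : Polynomial (SmoothC n M)) : mapZ T (q * r) = mapZ T q * r + q * mapZ T r := by
  ext1 l
  simp only [coeff_mapZ, Polynomial.coeff_mul, Polynomial.coeff_add, map_sum, hT,
    Finset.sum_add_distrib]

theorem dtCoef_single (H m s : ℝ) (q : Polynomial (SmoothC n M)) :
    dtCoef H m (AddMonoidAlgebra.single s q) = AddMonoidAlgebra.single s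
      (Polynomial.C (cstC (-((m : ℂ) + Complex.I * (s : ℂ)) * (H : ℂ))) * q
        + Polynomial.derivative q) := by
  apply AddMonoidAlgebra.coeff_injective
  ext1 t
  by_cases h : s = t
  · subst h
    simp [dtCoef]
  · simp [dtCoef, h]

theorem coeff_dtCoef (H m s : ℝ) (q : Coef n M) :
    (dtCoef H m q).coeff s = Polynomial.C (cstC (-((m : ℂ) + Complex.I * (s : ℂ)) * (H : ℂ)))
      * q.coeff s + Polynomial.derivative (q.coeff s) := rfl

/-- The time derivative on coefficients as an additive map. -/
def dtCoefHom (H m : ℝ) : Coef n M →+ Coef n M where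
  toFun := dtCoef H m
  map_zero' := by
    apply AddMonoidAlgebra.coeff_injective
    ext1 s
    simp [coeff_dtCoef]
  map_add' q r := by
    apply AddMonoidAlgebra.coeff_injective
    ext1 s
    simp only [coeff_dtCoef, AddMonoidAlgebra.coeff_add, Finsupp.add_apply, mul_add,
      Polynomial.derivative_add]
    ring

/-- The factor `-(m + is)H` is additive in the exponents of `X` and `Y`, and the derivative in `Z`
obeys the product rule. The exponents of `X` are parameters because a coefficient alone does not
know its power of `X`. -/
theorem dtCoef_mul (H m m' : ℝ) (q r : Coef n M) :
    dtCoef H (m + m') (q * r) = dtCoef H m q * r + q * dtCoef H m' r := by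
  change dtCoefHom H (m + m') (q * r) = dtCoefHom H m q * r + q * dtCoefHom H m' r
  induction q using AddMonoidAlgebra.induction_linear with
  | zero => simp
  | add q q' h h' => simp only [add_mul, map_add, h, h']; abel
  | single s p =>
    induction r using AddMonoidAlgebra.induction_linear with
    | zero => simp
    | add q q' h h' => simp only [mul_add, map_add, h, h']; abel
    | single s' p' =>
      change dtCoef H (m + m') _ = dtCoef H m _ * _ + _ * dtCoef H m' _
      simp only [dtCoef_single, AddMonoidAlgebra.single_mul_single, ← AddMonoidAlgebra.single_add]
      congr 1
      rw [show -(((m + m' : ℝ) : ℂ) + Complex.I * ((s + s' : ℝ) : ℂ)) * (H : ℂ) =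
        -((m : ℂ) + Complex.I * (s : ℂ)) * (H : ℂ) + -((m' : ℂ) + Complex.I * (s' : ℂ)) * (H : ℂ)
        by push_cast; ring]
      simp only [map_add, Polynomial.derivative_mul]
      ring

theorem dtCoef_smul (H m r : ℝ) (q : Coef n M) : dtCoef H m (r • q) = r • dtCoef H m q := by
  apply AddMonoidAlgebra.coeff_injective
  ext1 s
  simp only [coeff_dtCoef, AddMonoidAlgebra.coeff_smul, Finsupp.smul_apply, smul_add,
    Polynomial.derivative_smul, mul_smul_comm]

theorem conjCoef_single (s : ℝ) (q : Polynomial (SmoothC n M)) :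
    conjCoef (AddMonoidAlgebra.single s q) = AddMonoidAlgebra.single (-s) (q.map conjCHom) := by
  simp [conjCoef, mapZ_conjC]

/-- Complex conjugation on coefficients as a ring homomorphism. -/
def conjCoefHom : Coef n M →+* Coef n M where
  toFun := conjCoef
  map_one' := by
    rw [AddMonoidAlgebra.one_def, conjCoef_single]
    simp
  map_zero' := by simp [conjCoef]
  map_add' q r := by simp [conjCoef, AddMonoidAlgebra.map_add, AddMonoidAlgebra.mapDomain_add]
  map_mul' q r := by
    have h0 : conjCoef (0 : Coef n M) = 0 := by simp [conjCoef]
    have hadd : ∀ q r : Coef n M, conjCoef (q + r) = conjCoef q + conjCoef r := fun q r => by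
      simp [conjCoef, AddMonoidAlgebra.map_add, AddMonoidAlgebra.mapDomain_add]
    induction q using AddMonoidAlgebra.induction_linear with
    | zero => simp [h0]
    | add q q' h h' => simp only [add_mul, hadd, h, h']
    | single s p =>
      induction r using AddMonoidAlgebra.induction_linear with
      | zero => simp [h0]
      | add q q' h h' => simp only [mul_add, hadd, h, h']
      | single s' p' =>
        simp only [conjCoef_single, AddMonoidAlgebra.single_mul_single, Polynomial.map_mul]
        congr 1
        ring

theorem conjCoefHom_single (s : ℝ) (q : Polynomial (SmoothC n M)) :
    conjCoefHom (AddMonoidAlgebra.single s q) =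
      AddMonoidAlgebra.single (-s) (q.map conjCHom) := conjCoef_single s q

/-- The reflection `s ↦ -s` undoes the conjugation of `i` in the factor `-(m + is)H`. -/
theorem conjCoef_dtCoef (H m : ℝ) (q : Coef n M) :
    conjCoef (dtCoef H m q) = dtCoef H m (conjCoef q) := by
  change conjCoefHom (dtCoefHom H m q) = dtCoefHom H m (conjCoefHom q)
  induction q using AddMonoidAlgebra.induction_linear with
  | zero => simp
  | add q q' h h' => simp only [map_add, h, h']
  | single s p =>
    change conjCoefHom (dtCoef H m _) = dtCoef H m (conjCoefHom _)
    simp only [conjCoefHom_single, dtCoef_single, Polynomial.map_add, Polynomial.map_mul,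
      Polynomial.map_C, Polynomial.derivative_map]
    congr 4
    change conjC _ = _
    rw [conjC_cstC]
    congr 1
    simp

theorem conjCoef_conjCoef (q : Coef n M) : conjCoef (conjCoef q) = q := by
  change conjCoefHom (conjCoefHom q) = q
  induction q using AddMonoidAlgebra.induction_linear with
  | zero => simp
  | add q q' h h' => simp only [map_add, h, h']
  | single s p =>
    simp only [conjCoefHom_single, neg_neg, Polynomial.map_map]
    congr 1
    ext1 l
    rw [Polynomial.coeff_map]
    exact conjC_conjC _

theorem conjCoef_smul (r : ℝ) (q : Coef n M) : conjCoef (r • q) = r • conjCoef q := by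
  change conjCoefHom (r • q) = r • conjCoefHom q
  induction q using AddMonoidAlgebra.induction_linear with
  | zero => simp
  | add q q' h h' => simp only [map_add, smul_add, h, h']
  | single s p =>
    rw [AddMonoidAlgebra.smul_single, conjCoefHom_single, conjCoefHom_single,
      AddMonoidAlgebra.smul_single]
    congr 1
    ext1 l
    simp only [Polynomial.coeff_map, Polynomial.coeff_smul, smul_eq_cstC_mul, map_mul]
    congr 1
    change conjC _ = _
    rw [conjC_cstC]
    simp

/-- The constant coefficients form the image of a ring homomorphism. -/
def fnHom : SmoothC n M →+* Coef n M :=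
  AddMonoidAlgebra.singleZeroRingHom.comp Polynomial.C

theorem conjCoef_fn (f : SmoothC n M) : conjCoef (fn f) = fn (conjC f) := by
  rw [fn, conjCoef_single, Polynomial.map_C, neg_zero]
  rfl

theorem dtCoef_fn (H m : ℝ) (f : SmoothC n M) : dtCoef H m (fn f) = (-m * H) • fn f := by
  rw [fn, dtCoef_single, AddMonoidAlgebra.smul_single, Polynomial.derivative_C, add_zero]
  congr 1
  rw [← Polynomial.C_mul, Polynomial.smul_C, smul_eq_cstC_mul]
  congr 3
  push_cast
  ring

variable [IsManifold (𝓡 n) ∞ M]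

theorem map_mapZ_mul (T : SmoothC n M →+ SmoothC n M)
    (hT : ∀ f g, T (f * g) = T f * g + f * T g) (q r : Coef n M) :
    AddMonoidAlgebra.map (mapZ T) (q * r) =
      AddMonoidAlgebra.map (mapZ T) q * r + q * AddMonoidAlgebra.map (mapZ T) r := by
  induction q using AddMonoidAlgebra.induction_linear with
  | zero => simp
  | add q q' h h' => simp only [add_mul, AddMonoidAlgebra.map_add, h, h']; abel
  | single s p =>
    induction r using AddMonoidAlgebra.induction_linear with
    | zero => simp
    | add q q' h h' => simp only [mul_add, AddMonoidAlgebra.map_add, h, h']; abel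
    | single s' p' =>
      simp only [AddMonoidAlgebra.map_single, AddMonoidAlgebra.single_mul_single,
        ← AddMonoidAlgebra.single_add, mapZ_mul T hT]

theorem map_pderivC_fn (x : GlobalChart n M) (a : Fin n) (f : SmoothC n M) :
    AddMonoidAlgebra.map (mapZ (pderivC x a)) (fn f) = fn (pderivC x a f) := by
  rw [fn, AddMonoidAlgebra.map_single, fn]
  congr 1
  ext1 l
  rw [coeff_mapZ, Polynomial.coeff_C, Polynomial.coeff_C]
  split_ifs <;> simp

end Coefficients

/-! ### Derivations and conjugation on formal series -/

section SeriesCalculus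

variable {n : ℕ} {M : Type*} [TopologicalSpace M] [ChartedSpace (Coord n) M]

instance (priority := high) serCommRing : CommRing (Ser n M) := HahnSeries.instCommRing

instance (priority := high) serAlgebra : Algebra ℝ (Ser n M) := HahnSeries.instAlgebra

theorem coeff_smul (r : ℝ) (f : Ser n M) (m : ℝ) : (r • f).coeff m = r • f.coeff m := rfl

/-- The coefficients of a product are finite sums over pairs of exponents, so a product rule for
each pair suffices. As `D` may shrink supports, the sums for `D f` and `D g` are first extended to
the supports of `f` and `g`. -/
theorem leibniz_of_coeff (T : ℝ → Coef n M →+ Coef n M)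
    (hT : ∀ m m' q r, T (m + m') (q * r) = T m q * r + q * T m' r) (D : Ser n M → Ser n M)
    (hD : ∀ f m, (D f).coeff m = T m (f.coeff m)) (f g : Ser n M) :
    D (f * g) = f * D g + g * D f := by
  have hs : ∀ f, (D f).support ⊆ f.support := fun f m hm h0 => hm (by
    rw [hD, h0, map_zero])
  rw [mul_comm g]
  ext m : 2
  rw [hD, HahnSeries.coeff_add, HahnSeries.coeff_mul,
    HahnSeries.coeff_mul_left' f.isPWO_support (hs f),
    HahnSeries.coeff_mul_right' g.isPWO_support (hs g), map_sum, ← Finset.sum_add_distrib]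
  refine Finset.sum_congr rfl fun ij hij => ?_
  rw [Finset.mem_antidiagonal] at hij
  rw [← hij.2.2, hT, hD, hD, add_comm]

theorem coeff_dt (H m : ℝ) (f : Ser n M) : (dt H f).coeff m = dtCoef H m (f.coeff m) := rfl

theorem coeff_conj (m : ℝ) (f : Ser n M) : (conj f).coeff m = conjCoef (f.coeff m) := rfl

/-- The time derivative as a derivation. -/
def dtD (H : ℝ) : Derivation ℝ (Ser n M) (Ser n M) where
  toFun := dt H
  map_add' f g := by
    ext m : 2
    exact (dtCoefHom H m).map_add _ _
  map_smul' r f := by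
    ext m : 2
    simp only [coeff_smul, coeff_dt, dtCoef_smul, RingHom.id_apply]
  map_one_eq_zero' := by
    change dt H 1 = 0
    have h := leibniz_of_coeff (dtCoefHom H) (dtCoef_mul H) (dt (n := n) (M := M) H)
      (fun _ _ => rfl) 1 1
    rw [mul_one, one_mul] at h
    have h2 := sub_eq_zero.2 h
    rw [sub_add_cancel_left, neg_eq_zero] at h2
    exact h2
  leibniz' f g := leibniz_of_coeff (dtCoefHom H) (dtCoef_mul H) (dt H) (fun _ _ => rfl) f g

theorem dtD_apply (H : ℝ) (f : Ser n M) : dtD H f = dt H f := rfl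

/-- Complex conjugation of formal series as a ring homomorphism. -/
def conjHom : Ser n M →+* Ser n M where
  toFun := conj
  map_one' := by
    ext m : 2
    rw [coeff_conj, HahnSeries.coeff_one]
    split_ifs
    · exact conjCoefHom.map_one
    · exact conjCoefHom.map_zero
  map_zero' := by
    ext m : 2
    exact conjCoefHom.map_zero
  map_add' f g := by
    ext m : 2
    exact conjCoefHom.map_add _ _
  map_mul' f g := by
    have hs : ∀ f : Ser n M, (conj f).support ⊆ f.support := fun f m hm h0 => hm (by
      rw [coeff_conj, h0]
      exact conjCoefHom.map_zero)
    ext m : 2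
    rw [coeff_conj, HahnSeries.coeff_mul]
    rw [HahnSeries.coeff_mul_left' f.isPWO_support (hs f)]
    change conjCoefHom _ = _
    rw [map_sum]
    have hsub : Finset.antidiagonal f.isPWO_support (conj g).isPWO_support m ⊆
        Finset.antidiagonal f.isPWO_support g.isPWO_support m := by
      intro ij hij
      rw [Finset.mem_antidiagonal] at hij ⊢
      exact ⟨hij.1, hs g hij.2.1, hij.2.2⟩
    symm
    refine Finset.sum_subset_zero_on_sdiff hsub (fun ij hij => ?_) fun ij _ => ?_
    · rw [Finset.mem_sdiff, Finset.mem_antidiagonal, Finset.mem_antidiagonal] at hij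
      by_cases h : (conj g).coeff ij.2 = 0
      · change conjCoef (g.coeff ij.2) = 0 at h
        rw [map_mul]
        change _ * conjCoef (g.coeff ij.2) = 0
        rw [h, mul_zero]
      · exact absurd ⟨hij.1.1, h, hij.1.2.2⟩ hij.2
    · rw [map_mul]
      rfl

theorem conj_add (f g : Ser n M) : conj (f + g) = conj f + conj g := map_add conjHom f g
theorem conj_sub (f g : Ser n M) : conj (f - g) = conj f - conj g := map_sub conjHom f g
theorem conj_neg (f : Ser n M) : conj (-f) = -conj f := map_neg conjHom f
theorem conj_mul (f g : Ser n M) : conj (f * g) = conj f * conj g := map_mul conjHom f g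
theorem conj_one : conj (1 : Ser n M) = 1 := map_one conjHom
theorem conj_zero : conj (0 : Ser n M) = 0 := map_zero conjHom
theorem conj_sum {ι : Type*} (s : Finset ι) (f : ι → Ser n M) :
    conj (∑ i ∈ s, f i) = ∑ i ∈ s, conj (f i) := map_sum conjHom f s

theorem conj_conj (f : Ser n M) : conj (conj f) = f := by
  ext m : 2
  exact conjCoef_conjCoef _

theorem conj_smul (r : ℝ) (f : Ser n M) : conj (r • f) = r • conj f := by
  ext m : 2
  exact conjCoef_smul r _

theorem conj_dt (H : ℝ) (f : Ser n M) : conj (dt H f) = dt H (conj f) := by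
  ext m : 2
  exact conjCoef_dtCoef H m _

theorem conj_addCC (f : Ser n M) : conj (addCC f) = addCC f := by
  rw [addCC, conj_add, conj_conj, add_comm]

variable [IsManifold (𝓡 n) ∞ M]

theorem coeff_pd (x : GlobalChart n M) (a : Fin n) (f : Ser n M) (m : ℝ) :
    (pd x a f).coeff m = AddMonoidAlgebra.map (mapZ (pderivC x a)) (f.coeff m) := rfl

/-- The spatial derivative as a derivation. -/
def pdD (x : GlobalChart n M) (a : Fin n) : Derivation ℝ (Ser n M) (Ser n M) where
  toFun := pd x a
  map_add' f g := by
    ext m : 2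
    rw [HahnSeries.coeff_add, coeff_pd, coeff_pd, coeff_pd, HahnSeries.coeff_add,
      AddMonoidAlgebra.map_add]
  map_smul' r f := by
    ext m : 2
    rw [RingHom.id_apply, coeff_smul, coeff_pd, coeff_pd, coeff_smul]
    apply AddMonoidAlgebra.coeff_injective
    ext s l : 2
    simp [coeff_mapZ, pderivC_smul]
  map_one_eq_zero' := by
    change pd x a 1 = 0
    have h := leibniz_of_coeff
      (fun _ => ⟨⟨AddMonoidAlgebra.map (mapZ (pderivC x a)), AddMonoidAlgebra.map_zero _⟩,
        AddMonoidAlgebra.map_add _⟩)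
      (fun _ _ => map_mapZ_mul (pderivC x a) (pderivC_mul x a)) (pd x a) (fun _ _ => rfl) 1 1
    rw [mul_one, one_mul] at h
    have h2 := sub_eq_zero.2 h
    rw [sub_add_cancel_left, neg_eq_zero] at h2
    exact h2
  leibniz' f g := leibniz_of_coeff
      (fun _ => ⟨⟨AddMonoidAlgebra.map (mapZ (pderivC x a)), AddMonoidAlgebra.map_zero _⟩,
        AddMonoidAlgebra.map_add _⟩)
      (fun _ _ => map_mapZ_mul (pderivC x a) (pderivC_mul x a)) (pd x a) (fun _ _ => rfl) f g

theorem pdD_apply (x : GlobalChart n M) (a : Fin n) (f : Ser n M) : pdD x a f = pd x a f := rfl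

theorem pd_comm (x : GlobalChart n M) (a b : Fin n) (f : Ser n M) :
    pd x a (pd x b f) = pd x b (pd x a f) := by
  ext m : 2
  apply AddMonoidAlgebra.coeff_injective
  ext s l : 2
  simp [coeff_pd, coeff_mapZ, pderivC_comm x a b]

theorem dt_pd_comm (x : GlobalChart n M) (H : ℝ) (a : Fin n) (f : Ser n M) :
    dt H (pd x a f) = pd x a (dt H f) := by
  ext m : 2
  apply AddMonoidAlgebra.coeff_injective
  ext s l : 2
  have h : ((l : SmoothC n M) + 1) = cstC ((l : ℂ) + 1) := by
    rw [map_add, map_natCast, map_one]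
  simp only [coeff_pd, coeff_dt, coeff_dtCoef, AddMonoidAlgebra.coeff_map,
    Finsupp.mapRange_apply, Polynomial.coeff_add, Polynomial.coeff_C_mul, coeff_mapZ,
    Polynomial.coeff_derivative, h, map_add (pderivC x a), pderivC_mul, pderivC_cstC,
    zero_mul, mul_zero, zero_add, add_zero]

theorem conj_pd (x : GlobalChart n M) (a : Fin n) (f : Ser n M) :
    conj (pd x a f) = pd x a (conj f) := by
  ext m : 2
  rw [coeff_conj, coeff_pd, coeff_pd, coeff_conj]
  induction f.coeff m using AddMonoidAlgebra.induction_linear with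
  | zero => simp [conjCoef]
  | add q q' h h' =>
    have hadd : ∀ q r : Coef n M, conjCoef (q + r) = conjCoef q + conjCoef r :=
      conjCoefHom.map_add
    simp only [hadd, AddMonoidAlgebra.map_add, h, h']
  | single s p =>
    simp only [AddMonoidAlgebra.map_single, conjCoef_single]
    congr 1
    ext1 l
    simp only [Polynomial.coeff_map, coeff_mapZ]
    exact (pderivC_conjC x a _).symm

end SeriesCalculus

/-! ### Metric geometry over a commutative ring with commuting derivations -/

section AbstractGeometry

variable {S : Type*} [CommRing S] [Algebra ℝ S] {ι : Type*} [Fintype ι] [DecidableEq ι]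

/-- Connection coefficients of a metric `G` with inverse `Gi`. -/
def chris (D : ι → Derivation ℝ S S) (G Gi : Matrix ι ι S) (c a b : ι) : S :=
  (1 / 2 : ℝ) • ∑ i, Gi i c * (D a (G i b) + D b (G a i) - D i (G a b))

/-- The Ricci tensor of connection coefficients. -/
def ric (D : ι → Derivation ℝ S S) (Γ : ι → ι → ι → S) : Matrix ι ι S :=
  Matrix.of fun a b =>
    (∑ i, D i (Γ i a b)) - (∑ i, D a (Γ i i b))
      + (∑ i, ∑ j, Γ j a b * Γ i i j) - ∑ i, ∑ j, Γ i a j * Γ j i b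

/-- The divergence of a mixed tensor. -/
def divMix (D : ι → Derivation ℝ S S) (Γ : ι → ι → ι → S) (T : Matrix ι ι S) (b : ι) : S :=
  (∑ a, D a (T a b)) + (∑ a, ∑ c, Γ a a c * T c b) - ∑ a, ∑ c, Γ c a b * T a c

/-- The Hessian of a function. -/
def hessian (D : ι → Derivation ℝ S S) (Γ : ι → ι → ι → S) (φ : S) : Matrix ι ι S :=
  Matrix.of fun a b => D a (D b φ) - ∑ c, Γ c a b * D c φ

/-- Commuting derivations with a metric, its inverse, and its Levi-Civita connection. -/
structure MetricConnection (D : ι → Derivation ℝ S S) (G Gi : Matrix ι ι S)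
    (Γ : ι → ι → ι → S) : Prop where
  comm : ∀ a b f, D a (D b f) = D b (D a f)
  metric_symm : ∀ a b, G a b = G b a
  inv_symm : ∀ a b, Gi a b = Gi b a
  mul_inv : G * Gi = 1
  torsion_free : ∀ c a b, Γ c a b = Γ c b a
  compat : ∀ c a b, D c (G a b) = (∑ i, Γ i c a * G i b) + ∑ i, G a i * Γ i c b

theorem inv_symm_of_symm {G Gi : Matrix ι ι S} (h : ∀ a b, G a b = G b a) (h1 : G * Gi = 1)
    (a b : ι) : Gi a b = Gi b a := by
  have hG : G.transpose = G := by
    ext a b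
    exact h b a
  have h2 : Gi.transpose * G = 1 := by
    have := congrArg Matrix.transpose h1
    have h5 := mul_eq_one_comm.1 h1
    rwa [Matrix.transpose_mul, hG, Matrix.transpose_one] at this
  have h3 : Gi.transpose = Gi := by
    calc Gi.transpose = Gi.transpose * (G * Gi) := by rw [h1, mul_one]
      _ = Gi := by rw [← mul_assoc, h2, one_mul]
  exact congrFun (congrFun h3 b) a

theorem metricConnection_chris {D : ι → Derivation ℝ S S} {G Gi : Matrix ι ι S}
    (hD : ∀ a b f, D a (D b f) = D b (D a f)) (hs : ∀ a b, G a b = G b a) (hi : G * Gi = 1) :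
    MetricConnection D G Gi (chris D G Gi) where
  comm := hD
  metric_symm := hs
  inv_symm := inv_symm_of_symm hs hi
  mul_inv := hi
  torsion_free c a b := by
    unfold chris
    congr 1
    refine Finset.sum_congr rfl fun i _ => ?_
    rw [hs a i, hs i b, hs a b, add_comm (D a (G b i))]
  compat c a b := by
    -- Lowering the upper index gives the symbols of the first kind; the two that occur add up to a
    -- single derivative of the metric.
    have key : ∀ c a b, ∑ i, chris D G Gi i c a * G i b
        = (1 / 2 : ℝ) • (D c (G b a) + D a (G c b) - D b (G c a)) := by
      intro c a b
      have h1 : ∀ j, ∑ i, Gi j i * G i b = if j = b then 1 else 0 := fun j => by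
        have h := mul_eq_one_comm.1 hi
        have := congrFun (congrFun h j) b
        rwa [Matrix.mul_apply, Matrix.one_apply] at this
      simp only [chris, smul_mul_assoc, ← Finset.smul_sum, Finset.sum_mul]
      rw [Finset.sum_comm]
      congr 1
      calc _ = ∑ j, (D c (G j a) + D a (G c j) - D j (G c a)) * ∑ i, Gi j i * G i b := by
            refine Finset.sum_congr rfl fun j _ => ?_
            rw [Finset.mul_sum]
            refine Finset.sum_congr rfl fun i _ => ?_
            ring
        _ = _ := by simp [h1]
    have h2 : ∑ i, G a i * chris D G Gi i c b = ∑ i, chris D G Gi i c b * G i a :=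
      Finset.sum_congr rfl fun i _ => by rw [hs a i, mul_comm]
    rw [h2, key, key, ← smul_add, hs b a, hs c b, hs c a]
    rw [show D c (G a b) + D a (G b c) - D b (G a c) + (D c (G a b) + D b (G a c) - D a (G b c))
      = (2 : ℝ) • D c (G a b) by rw [two_smul]; ring, smul_smul]
    norm_num

theorem map_mul_derivation (d : Derivation ℝ S S) (A B : Matrix ι ι S) :
    (A * B).map d = A.map d * B + A * B.map d := by
  ext a b
  simp only [Matrix.map_apply, Matrix.mul_apply, Matrix.add_apply, map_sum, Derivation.leibniz,
    smul_eq_mul, ← Finset.sum_add_distrib]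
  refine Finset.sum_congr rfl fun i _ => ?_
  ring

/-- The matrix of the connection in a direction. -/
def connMat (Γ : ι → ι → ι → S) (c : ι) : Matrix ι ι S := Matrix.of fun a b => Γ a c b

/-- The curvature matrix. -/
def curvMat (D : ι → Derivation ℝ S S) (Γ : ι → ι → ι → S) (μ ν : ι) : Matrix ι ι S :=
  (connMat Γ ν).map (D μ) - (connMat Γ μ).map (D ν) + connMat Γ μ * connMat Γ ν
    - connMat Γ ν * connMat Γ μ

theorem map_add_derivation (d : Derivation ℝ S S) (A B : Matrix ι ι S) :
    (A + B).map d = A.map d + B.map d := by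
  ext a b
  simp

theorem map_sub_derivation (d : Derivation ℝ S S) (A B : Matrix ι ι S) :
    (A - B).map d = A.map d - B.map d := by
  ext a b
  simp

theorem ric_eq_curvMat (D : ι → Derivation ℝ S S) (Γ : ι → ι → ι → S) (a b : ι)
    : ric D Γ a b = ∑ i, curvMat D Γ i a i b := by
  have h : ∑ i, ∑ j, Γ i a j * Γ j i b = ∑ i, ∑ j, Γ i a j * Γ j i b := rfl
  simp only [ric, curvMat, connMat, Matrix.of_apply, Matrix.sub_apply, Matrix.add_apply,
    Matrix.map_apply, Matrix.mul_apply, Finset.sum_add_distrib, Finset.sum_sub_distrib]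
  congr 2
  refine Finset.sum_congr rfl fun i _ => Finset.sum_congr rfl fun j _ => mul_comm _ _

namespace MetricConnection

variable {D : ι → Derivation ℝ S S} {G Gi : Matrix ι ι S} {Γ : ι → ι → ι → S}

theorem inv_mul (hm : MetricConnection D G Gi Γ) : Gi * G = 1 := mul_eq_one_comm.1 hm.mul_inv

theorem map_metric (hm : MetricConnection D G Gi Γ) (c : ι) :
    G.map (D c) = (connMat Γ c).transpose * G + G * connMat Γ c := by
  ext a b
  simp only [Matrix.map_apply, hm.compat, Matrix.add_apply, Matrix.mul_apply,
    Matrix.transpose_apply, connMat, Matrix.of_apply]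

theorem map_inv (hm : MetricConnection D G Gi Γ) (c : ι) :
    Gi.map (D c) = -(connMat Γ c * Gi) - Gi * (connMat Γ c).transpose := by
  have h0 : (1 : Matrix ι ι S).map (D c) = 0 := by
    ext a b
    simp [Matrix.one_apply, apply_ite (D c)]
  have h1 := map_mul_derivation (D c) Gi G
  rw [hm.inv_mul, h0, hm.map_metric] at h1
  calc Gi.map (D c) = Gi.map (D c) * (G * Gi) := by rw [hm.mul_inv, mul_one]
    _ = (Gi.map (D c) * G) * Gi := by rw [mul_assoc]
    _ = -(Gi * ((connMat Γ c).transpose * G + G * connMat Γ c)) * Gi := by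
        rw [eq_neg_of_add_eq_zero_left h1.symm]
    _ = -(Gi * G * connMat Γ c * Gi) - Gi * (connMat Γ c).transpose * (G * Gi) := by
        noncomm_ring
    _ = _ := by rw [hm.inv_mul, hm.mul_inv, one_mul, mul_one]

theorem map_map_comm (hm : MetricConnection D G Gi Γ) (A : Matrix ι ι S) (a b : ι) :
    (A.map (D a)).map (D b) = (A.map (D b)).map (D a) := by
  ext i j
  exact hm.comm _ _ _

/-- Second derivatives of the metric commute. Expressed through the connection by metric
compatibility, their commutator is precisely this combination of curvature and metric. -/
theorem curvMat_transpose (hm : MetricConnection D G Gi Γ) (μ ν : ι) :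
    (curvMat D Γ μ ν).transpose * G + G * curvMat D Γ μ ν = 0 := by
  have key : ∀ μ ν, (G.map (D ν)).map (D μ) =
      ((connMat Γ ν).map (D μ)).transpose * G
        + (connMat Γ ν).transpose * ((connMat Γ μ).transpose * G + G * connMat Γ μ)
        + (((connMat Γ μ).transpose * G + G * connMat Γ μ) * connMat Γ ν
        + G * (connMat Γ ν).map (D μ)) := by
    intro μ ν
    rw [hm.map_metric ν, map_add_derivation, map_mul_derivation, map_mul_derivation,
      hm.map_metric μ, Matrix.transpose_map]
  have h3 := hm.map_map_comm G ν μ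
  rw [key, key] at h3
  rw [← sub_eq_zero] at h3
  rw [← h3]
  simp only [curvMat, Matrix.transpose_sub, Matrix.transpose_add, Matrix.transpose_mul]
  noncomm_ring

/-- The curvature with both matrix indices raised. -/
def curvUp (D : ι → Derivation ℝ S S) (Gi : Matrix ι ι S) (Γ : ι → ι → ι → S) (μ ν : ι) :
    Matrix ι ι S := curvMat D Γ μ ν * Gi

theorem curvUp_antisymm (hm : MetricConnection D G Gi Γ) (μ ν a b : ι) :
    curvUp D Gi Γ μ ν a b = -curvUp D Gi Γ μ ν b a := by
  have hGi : Gi.transpose = Gi := by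
    ext a b
    exact hm.inv_symm b a
  have h : (curvUp D Gi Γ μ ν).transpose + curvUp D Gi Γ μ ν = 0 := by
    rw [curvUp, Matrix.transpose_mul, hGi]
    calc _ = Gi * (curvMat D Γ μ ν).transpose * (G * Gi) + Gi * G * curvMat D Γ μ ν * Gi := by
          rw [hm.mul_inv, hm.inv_mul, one_mul, mul_one]
      _ = Gi * ((curvMat D Γ μ ν).transpose * G + G * curvMat D Γ μ ν) * Gi := by noncomm_ring
      _ = 0 := by rw [hm.curvMat_transpose, mul_zero, zero_mul]
  have h2 := congrFun (congrFun h b) a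
  exact eq_neg_of_add_eq_zero_left h2

theorem curvMat_swap (μ ν : ι) : curvMat D Γ μ ν = -curvMat D Γ ν μ := by
  simp only [curvMat]
  noncomm_ring

theorem curvUp_swap (μ ν a b : ι) : curvUp D Gi Γ μ ν a b = -curvUp D Gi Γ ν μ a b := by
  rw [curvUp, curvMat_swap, neg_mul]
  rfl

/-- Only the matrix indices are differentiated covariantly. In this form the second Bianchi identity
is pure algebra: the second derivatives of the connection matrices cancel in pairs and the remaining
products cancel as in the Jacobi identity, without use of torsion or metric. -/
theorem bianchi_matrix (hm : MetricConnection D G Gi Γ) (μ ν ρ : ι) :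
    ((curvMat D Γ μ ν).map (D ρ) + connMat Γ ρ * curvMat D Γ μ ν
        - curvMat D Γ μ ν * connMat Γ ρ)
      + ((curvMat D Γ ν ρ).map (D μ) + connMat Γ μ * curvMat D Γ ν ρ
        - curvMat D Γ ν ρ * connMat Γ μ)
      + ((curvMat D Γ ρ μ).map (D ν) + connMat Γ ν * curvMat D Γ ρ μ
        - curvMat D Γ ρ μ * connMat Γ ν) = 0 := by
  simp only [curvMat, map_add_derivation, map_sub_derivation, map_mul_derivation]
  rw [hm.map_map_comm (connMat Γ ν) μ ρ, hm.map_map_comm (connMat Γ μ) ν ρ,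
    hm.map_map_comm (connMat Γ ρ) ν μ]
  noncomm_ring

theorem bianchi_up (hm : MetricConnection D G Gi Γ) (μ ν ρ : ι) :
    ((curvUp D Gi Γ μ ν).map (D ρ) + connMat Γ ρ * curvUp D Gi Γ μ ν
        + curvUp D Gi Γ μ ν * (connMat Γ ρ).transpose)
      + ((curvUp D Gi Γ ν ρ).map (D μ) + connMat Γ μ * curvUp D Gi Γ ν ρ
        + curvUp D Gi Γ ν ρ * (connMat Γ μ).transpose)
      + ((curvUp D Gi Γ ρ μ).map (D ν) + connMat Γ ν * curvUp D Gi Γ ρ μ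
        + curvUp D Gi Γ ρ μ * (connMat Γ ν).transpose) = 0 := by
  have h := congrArg (fun A => A * Gi) (hm.bianchi_matrix μ ν ρ)
  simp only [zero_mul] at h
  rw [← h]
  simp only [curvUp, map_mul_derivation, hm.map_inv]
  noncomm_ring

theorem bianchi_entry (hm : MetricConnection D G Gi Γ) (μ ν ρ a b : ι) :
    (D ρ (curvUp D Gi Γ μ ν a b) + ∑ c, Γ a ρ c * curvUp D Gi Γ μ ν c b
        + ∑ c, Γ b ρ c * curvUp D Gi Γ μ ν a c)
      + (D μ (curvUp D Gi Γ ν ρ a b) + ∑ c, Γ a μ c * curvUp D Gi Γ ν ρ c b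
        + ∑ c, Γ b μ c * curvUp D Gi Γ ν ρ a c)
      + (D ν (curvUp D Gi Γ ρ μ a b) + ∑ c, Γ a ν c * curvUp D Gi Γ ρ μ c b
        + ∑ c, Γ b ν c * curvUp D Gi Γ ρ μ a c) = 0 := by
  have h := congrFun (congrFun (hm.bianchi_up μ ν ρ) a) b
  simpa only [Matrix.add_apply, Matrix.map_apply, Matrix.mul_apply, Matrix.transpose_apply,
    connMat, Matrix.of_apply, Matrix.zero_apply, mul_comm (curvUp D Gi Γ _ _ _ _)] using h

/-- The mixed Ricci tensor as a contraction of the curvature. -/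
def ricMix (D : ι → Derivation ℝ S S) (Gi : Matrix ι ι S) (Γ : ι → ι → ι → S) : Matrix ι ι S :=
  Matrix.of fun a b => ∑ c, curvUp D Gi Γ c b c a

theorem sum_symm_antisymm {X Y : ι → ι → S} (hX : ∀ a b, X a b = X b a)
    (hY : ∀ a b, Y a b = -Y b a) : ∑ a, ∑ b, X a b * Y a b = 0 := by
  have h : ∑ a, ∑ b, X a b * Y a b = -∑ a, ∑ b, X a b * Y a b := by
    conv_lhs => rw [Finset.sum_comm]
    rw [← Finset.sum_neg_distrib]
    refine Finset.sum_congr rfl fun a _ => ?_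
    rw [← Finset.sum_neg_distrib]
    refine Finset.sum_congr rfl fun b _ => ?_
    rw [hX, hY]
    ring
  have h2 : (2 : ℝ) • ∑ a, ∑ b, X a b * Y a b = 0 := by
    rw [two_smul]
    exact eq_neg_iff_add_eq_zero.1 h
  have h3 := congrArg (fun z => (1 / 2 : ℝ) • z) h2
  simpa [smul_smul] using h3

/-- The contracted second Bianchi identity. -/
theorem contracted_bianchi (hm : MetricConnection D G Gi Γ) (ρ : ι) :
    (2 : ℝ) • divMix D Γ (ricMix D Gi Γ) ρ = D ρ (ricMix D Gi Γ).trace := by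
  -- The double trace of the Bianchi identity has nine terms. Two vanish, being contractions of the
  -- symmetric connection with the antisymmetric curvature; one is the derivative of the scalar
  -- curvature, and the other six form twice the negative divergence.
  have h : ∑ a, ∑ b, ((D ρ (curvUp D Gi Γ a b a b) + ∑ c, Γ a ρ c * curvUp D Gi Γ a b c b
        + ∑ c, Γ b ρ c * curvUp D Gi Γ a b a c)
      + (D a (curvUp D Gi Γ b ρ a b) + ∑ c, Γ a a c * curvUp D Gi Γ b ρ c b
        + ∑ c, Γ b a c * curvUp D Gi Γ b ρ a c)
      + (D b (curvUp D Gi Γ ρ a a b) + ∑ c, Γ a b c * curvUp D Gi Γ ρ a c b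
        + ∑ c, Γ b b c * curvUp D Gi Γ ρ a a c)) = 0 :=
    Finset.sum_eq_zero fun a _ => Finset.sum_eq_zero fun b _ => hm.bianchi_entry a b ρ a b
  simp only [Finset.sum_add_distrib] at h
  have e1 : ∑ a, ∑ b, D ρ (curvUp D Gi Γ a b a b) = D ρ (ricMix D Gi Γ).trace := by
    simp only [ricMix, Matrix.trace, Matrix.diag_apply, Matrix.of_apply, map_sum]
    exact Finset.sum_comm
  have e2 : ∑ a, ∑ b, ∑ c, Γ a ρ c * curvUp D Gi Γ a b c b
      = ∑ a, ∑ c, Γ c a ρ * ricMix D Gi Γ a c := by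
    have : ∀ a : ι, ∑ b, ∑ c, Γ a ρ c * curvUp D Gi Γ a b c b
        = ∑ c, Γ a c ρ * ricMix D Gi Γ c a := fun a => by
      rw [Finset.sum_comm]
      refine Finset.sum_congr rfl fun c _ => ?_
      rw [ricMix, Matrix.of_apply, Finset.mul_sum]
      refine Finset.sum_congr rfl fun b _ => ?_
      rw [hm.torsion_free, curvUp_swap, hm.curvUp_antisymm, neg_neg]
    simp only [this]
    exact Finset.sum_comm
  have e3 : ∑ a, ∑ b, ∑ c, Γ b ρ c * curvUp D Gi Γ a b a c
      = ∑ a, ∑ c, Γ c a ρ * ricMix D Gi Γ a c := by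
    rw [Finset.sum_comm]
    have : ∀ b : ι, ∑ a, ∑ c, Γ b ρ c * curvUp D Gi Γ a b a c
        = ∑ c, Γ b c ρ * ricMix D Gi Γ c b := fun b => by
      rw [Finset.sum_comm]
      refine Finset.sum_congr rfl fun c _ => ?_
      rw [ricMix, Matrix.of_apply, Finset.mul_sum, hm.torsion_free]
    simp only [this]
    exact Finset.sum_comm
  have e4 : ∑ a, ∑ b, D a (curvUp D Gi Γ b ρ a b) = -∑ a, D a (ricMix D Gi Γ a ρ) := by
    rw [← Finset.sum_neg_distrib]
    refine Finset.sum_congr rfl fun a _ => ?_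
    simp only [ricMix, Matrix.of_apply, ← map_neg, ← map_sum, ← Finset.sum_neg_distrib]
    congr 1
    exact Finset.sum_congr rfl fun b _ => hm.curvUp_antisymm _ _ _ _
  have e5 : ∑ a, ∑ b, ∑ c, Γ a a c * curvUp D Gi Γ b ρ c b
      = -∑ a, ∑ c, Γ a a c * ricMix D Gi Γ c ρ := by
    rw [← Finset.sum_neg_distrib]
    refine Finset.sum_congr rfl fun a _ => ?_
    rw [Finset.sum_comm, ← Finset.sum_neg_distrib]
    refine Finset.sum_congr rfl fun c _ => ?_
    rw [ricMix, Matrix.of_apply, Finset.mul_sum, ← Finset.sum_neg_distrib]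
    refine Finset.sum_congr rfl fun b _ => ?_
    rw [hm.curvUp_antisymm]
    ring
  have e6 : ∑ a, ∑ b, ∑ c, Γ b a c * curvUp D Gi Γ b ρ a c = 0 := by
    rw [Finset.sum_comm]
    exact Finset.sum_eq_zero fun b _ => sum_symm_antisymm (fun a c => hm.torsion_free b a c)
      fun a c => hm.curvUp_antisymm _ _ _ _
  have e7 : ∑ a, ∑ b, D b (curvUp D Gi Γ ρ a a b) = -∑ a, D a (ricMix D Gi Γ a ρ) := by
    rw [Finset.sum_comm, ← Finset.sum_neg_distrib]
    refine Finset.sum_congr rfl fun a _ => ?_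
    simp only [ricMix, Matrix.of_apply, ← map_neg, ← map_sum, ← Finset.sum_neg_distrib]
    congr 1
    exact Finset.sum_congr rfl fun b _ => curvUp_swap _ _ _ _
  have e8 : ∑ a, ∑ b, ∑ c, Γ a b c * curvUp D Gi Γ ρ a c b = 0 :=
    Finset.sum_eq_zero fun a _ => sum_symm_antisymm (fun b c => hm.torsion_free a b c)
      fun b c => hm.curvUp_antisymm _ _ _ _
  have e9 : ∑ a, ∑ b, ∑ c, Γ b b c * curvUp D Gi Γ ρ a a c
      = -∑ a, ∑ c, Γ a a c * ricMix D Gi Γ c ρ := by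
    rw [Finset.sum_comm, ← Finset.sum_neg_distrib]
    refine Finset.sum_congr rfl fun a _ => ?_
    rw [Finset.sum_comm, ← Finset.sum_neg_distrib]
    refine Finset.sum_congr rfl fun c _ => ?_
    rw [ricMix, Matrix.of_apply, Finset.mul_sum, ← Finset.sum_neg_distrib]
    refine Finset.sum_congr rfl fun b _ => ?_
    rw [curvUp_swap]
    ring
  rw [e1, e2, e3, e4, e5, e6, e7, e8, e9] at h
  rw [two_smul, divMix]
  linear_combination -h

/-- The antisymmetric part of the Ricci tensor is the trace of the curvature over its matrix
indices. This vanishes since the raised curvature is antisymmetric and the metric symmetric. -/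
theorem ric_symm (hm : MetricConnection D G Gi Γ) (a b : ι) : ric D Γ a b = ric D Γ b a := by
  have h1 : (curvMat D Γ a b).trace = 0 := by
    have h2 : curvMat D Γ a b = curvUp D Gi Γ a b * G := by
      rw [curvUp, mul_assoc, hm.inv_mul, mul_one]
    rw [h2]
    have h3 := sum_symm_antisymm hm.metric_symm (fun i j => hm.curvUp_antisymm a b i j)
    simp only [Matrix.trace, Matrix.diag_apply, Matrix.mul_apply]
    rw [← h3]
    refine Finset.sum_congr rfl fun i _ => Finset.sum_congr rfl fun j _ => ?_
    rw [hm.metric_symm, mul_comm]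
  have h4 : (curvMat D Γ a b).trace = (∑ i, D a (Γ i i b)) - ∑ i, D b (Γ i i a) := by
    rw [curvMat, Matrix.trace_sub, Matrix.trace_add, Matrix.trace_mul_comm, add_sub_cancel_right,
      Matrix.trace_sub]
    simp only [Matrix.trace, Matrix.diag_apply, Matrix.map_apply, connMat, Matrix.of_apply,
      hm.torsion_free _ b, hm.torsion_free _ a]
  rw [h4] at h1
  have h5 : ∑ i, ∑ j, Γ i a j * Γ j i b = ∑ i, ∑ j, Γ i b j * Γ j i a := by
    rw [Finset.sum_comm]
    refine Finset.sum_congr rfl fun i _ => Finset.sum_congr rfl fun j _ => ?_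
    rw [hm.torsion_free j a i, hm.torsion_free i j b, mul_comm]
  simp only [ric, Matrix.of_apply, h5, hm.torsion_free _ a b]
  linear_combination -h1

theorem ricMix_eq (hm : MetricConnection D G Gi Γ) : ricMix D Gi Γ = Gi * ric D Γ := by
  ext a b
  simp only [ricMix, Matrix.of_apply, curvUp, Matrix.mul_apply]
  rw [Finset.sum_comm]
  refine Finset.sum_congr rfl fun i _ => ?_
  rw [hm.ric_symm i b, ric_eq_curvMat, Finset.mul_sum]
  refine Finset.sum_congr rfl fun j _ => ?_
  rw [hm.inv_symm i a, mul_comm]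

theorem hessian_symm (hm : MetricConnection D G Gi Γ) (φ : S) (a b : ι) :
    hessian D Γ φ a b = hessian D Γ φ b a := by
  simp only [hessian, Matrix.of_apply, hm.comm a b, hm.torsion_free _ a b]

/-- The gradient vector. -/
def grad (D : ι → Derivation ℝ S S) (Gi : Matrix ι ι S) (φ : S) (a : ι) : S :=
  ∑ i, Gi a i * D i φ

theorem deriv_inv (hm : MetricConnection D G Gi Γ) (c a b : ι) :
    D c (Gi a b) = -(∑ i, Γ a c i * Gi i b) - ∑ i, Gi a i * Γ b c i := by
  have h := congrFun (congrFun (hm.map_inv c) a) b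
  simpa only [Matrix.map_apply, Matrix.sub_apply, Matrix.neg_apply, Matrix.mul_apply,
    Matrix.transpose_apply, connMat, Matrix.of_apply] using h

/-- The covariant derivative of the gradient is the Hessian with one index raised. -/
theorem deriv_grad (hm : MetricConnection D G Gi Γ) (φ : S) (a b : ι) :
    D b (grad D Gi φ a) + ∑ c, Γ a b c * grad D Gi φ c = (Gi * hessian D Γ φ) a b := by
  simp only [grad, map_sum, Derivation.leibniz, smul_eq_mul, Matrix.mul_apply,
    hm.deriv_inv, hm.hessian_symm φ _ b]
  simp only [hessian, Matrix.of_apply, mul_sub, mul_neg, Finset.sum_add_distrib,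
    Finset.sum_sub_distrib, Finset.sum_neg_distrib, Finset.mul_sum]
  have h1 : ∑ i, ∑ j, D i φ * (Γ a b j * Gi j i) = ∑ i, ∑ j, Γ a b i * (Gi i j * D j φ) := by
    rw [Finset.sum_comm]
    exact Finset.sum_congr rfl fun i _ => Finset.sum_congr rfl fun j _ => by ring
  have h2 : ∑ i, ∑ j, D i φ * (Gi a j * Γ i b j) = ∑ i, ∑ j, Gi a i * (Γ j b i * D j φ) := by
    rw [Finset.sum_comm]
    exact Finset.sum_congr rfl fun i _ => Finset.sum_congr rfl fun j _ => by ring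
  rw [h1, h2]
  ring

/-- The wave operator. -/
def box (D : ι → Derivation ℝ S S) (Gi : Matrix ι ι S) (Γ : ι → ι → ι → S) (φ : S) : S :=
  (Gi * hessian D Γ φ).trace

/-- The divergence of the Hessian. -/
theorem divMix_hessian (hm : MetricConnection D G Gi Γ) (φ : S) (b : ι) :
    divMix D Γ (Gi * hessian D Γ φ) b
      = D b (box D Gi Γ φ) + ∑ c, ric D Γ b c * grad D Gi φ c := by
  -- Expressing the mixed Hessian through the gradient vector reduces the claim to interchanging `D
  -- a` and `D b`; the leftover derivatives and products of connection coefficients are the terms of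
  -- the Ricci tensor.
  simp only [divMix, box, Matrix.trace, Matrix.diag_apply, ← hm.deriv_grad, ric,
    Matrix.of_apply]
  simp only [map_add, map_sum, Derivation.leibniz, smul_eq_mul, mul_add,
    Finset.sum_add_distrib, Finset.mul_sum, sub_mul, add_mul, Finset.sum_mul,
    Finset.sum_sub_distrib]
  have e1 : ∑ a, D a (D b (grad D Gi φ a)) = ∑ a, D b (D a (grad D Gi φ a)) :=
    Finset.sum_congr rfl fun a _ => hm.comm _ _ _
  have e2 : ∑ a, ∑ c, grad D Gi φ c * D a (Γ a b c)
      = ∑ c, ∑ a, D a (Γ a b c) * grad D Gi φ c := by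
    rw [Finset.sum_comm]
    exact Finset.sum_congr rfl fun i _ => Finset.sum_congr rfl fun j _ => by ring
  have e3 : ∑ a, ∑ c, Γ a b c * D a (grad D Gi φ c)
      = ∑ a, ∑ c, Γ c a b * D c (grad D Gi φ a) := by
    rw [Finset.sum_comm]
    refine Finset.sum_congr rfl fun i _ => Finset.sum_congr rfl fun j _ => ?_
    rw [hm.torsion_free j b i]
  have e4 : ∑ a, ∑ c, grad D Gi φ c * D b (Γ a a c)
      = ∑ c, ∑ a, D b (Γ a a c) * grad D Gi φ c := by
    rw [Finset.sum_comm]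
    exact Finset.sum_congr rfl fun i _ => Finset.sum_congr rfl fun j _ => by ring
  have e5 : ∑ a, ∑ c, ∑ d, Γ a a c * (Γ c b d * grad D Gi φ d)
      = ∑ c, ∑ i, ∑ j, Γ j b c * Γ i i j * grad D Gi φ c := by
    have h1 : ∀ a : ι, ∑ c, ∑ d, Γ a a c * (Γ c b d * grad D Gi φ d)
        = ∑ d, ∑ c, Γ c b d * Γ a a c * grad D Gi φ d := fun a => by
      rw [Finset.sum_comm]
      exact Finset.sum_congr rfl fun i _ => Finset.sum_congr rfl fun j _ => by ring
    simp only [h1]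
    exact Finset.sum_comm
  have e6 : ∑ a, ∑ c, ∑ d, Γ c a b * (Γ a c d * grad D Gi φ d)
      = ∑ c, ∑ i, ∑ j, Γ i b j * Γ j i c * grad D Gi φ c := by
    have h1 : ∀ a : ι, ∑ c, ∑ d, Γ c a b * (Γ a c d * grad D Gi φ d)
        = ∑ d, ∑ c, Γ c a b * Γ a c d * grad D Gi φ d := fun a => by
      rw [Finset.sum_comm]
      exact Finset.sum_congr rfl fun i _ => Finset.sum_congr rfl fun j _ => by ring
    simp only [h1]
    rw [Finset.sum_comm]
    refine Finset.sum_congr rfl fun d _ => ?_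
    rw [Finset.sum_comm]
    refine Finset.sum_congr rfl fun i _ => Finset.sum_congr rfl fun j _ => ?_
    rw [hm.torsion_free i j b]
  rw [e1, e2, e3, e4, e5, e6]
  ring

end MetricConnection

end AbstractGeometry

/-! ### The energy momentum tensor of the curvature coupled field and its divergence -/

section AbstractMatter

variable {S : Type*} [CommRing S] [Algebra ℝ S] {ι : Type*} [Fintype ι] [DecidableEq ι]
variable {D : ι → Derivation ℝ S S} {G Gi : Matrix ι ι S} {Γ : ι → ι → ι → S}

theorem divMix_add (T U : Matrix ι ι S) (b : ι) :
    divMix D Γ (T + U) b = divMix D Γ T b + divMix D Γ U b := by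
  simp only [divMix, Matrix.add_apply, map_add, mul_add, Finset.sum_add_distrib]
  ring

theorem divMix_smul (r : ℝ) (T : Matrix ι ι S) (b : ι) :
    divMix D Γ (r • T) b = r • divMix D Γ T b := by
  simp only [divMix, Matrix.smul_apply, Derivation.map_smul, mul_smul_comm, smul_add, smul_sub,
    Finset.smul_sum]

theorem divMix_sub (T U : Matrix ι ι S) (b : ι) :
    divMix D Γ (T - U) b = divMix D Γ T b - divMix D Γ U b := by
  simp only [divMix, Matrix.sub_apply, map_sub, mul_sub, Finset.sum_sub_distrib]
  ring

theorem divMix_mul (f : S) (T : Matrix ι ι S) (b : ι) :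
    divMix D Γ (Matrix.of fun a b => f * T a b) b
      = f * divMix D Γ T b + ∑ a, D a f * T a b := by
  simp only [divMix, Matrix.of_apply, Derivation.leibniz, smul_eq_mul, mul_add, mul_sub,
    Finset.sum_add_distrib, Finset.mul_sum, mul_left_comm f, mul_comm (T _ _) (D _ f)]
  ring

theorem divMix_scalar (f : S) (b : ι) :
    divMix D Γ (Matrix.of fun a b => f * (1 : Matrix ι ι S) a b) b = D b f := by
  simp only [divMix, Matrix.of_apply, Matrix.one_apply, mul_ite, mul_one, mul_zero,
    apply_ite (D _), map_zero, Finset.sum_ite_eq', Finset.sum_ite_eq, Finset.mem_univ, if_true]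
  ring

theorem divMix_vec (u : ι → S) (f : S) (b : ι) :
    divMix D Γ (Matrix.of fun a b => u a * D b f) b
      = ((∑ a, D a (u a)) + ∑ a, ∑ c, Γ a a c * u c) * D b f
        + ∑ a, u a * hessian D Γ f a b := by
  simp only [divMix, Matrix.of_apply, hessian, Derivation.leibniz, smul_eq_mul, mul_sub,
    Finset.sum_add_distrib, Finset.sum_sub_distrib, Finset.mul_sum, add_mul, Finset.sum_mul,
    mul_left_comm (u _), mul_assoc, mul_comm (D _ f) (D _ (u _))]
  ring

namespace MetricConnection

theorem box_eq (hm : MetricConnection D G Gi Γ) (φ : S) :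
    box D Gi Γ φ = (∑ a, D a (grad D Gi φ a)) + ∑ a, ∑ c, Γ a a c * grad D Gi φ c := by
  simp only [box, Matrix.trace, Matrix.diag_apply, ← hm.deriv_grad, Finset.sum_add_distrib]

/-- The inner product of two gradients. -/
def gradInner (D : ι → Derivation ℝ S S) (Gi : Matrix ι ι S) (ψ φ : S) : S :=
  ∑ i, D i ψ * grad D Gi φ i

theorem gradInner_comm (hm : MetricConnection D G Gi Γ) (ψ φ : S) :
    gradInner D Gi ψ φ = gradInner D Gi φ ψ := by
  simp only [gradInner, grad, Finset.mul_sum]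
  rw [Finset.sum_comm]
  refine Finset.sum_congr rfl fun i _ => Finset.sum_congr rfl fun j _ => ?_
  rw [hm.inv_symm j i]
  ring

theorem sum_grad_mul (hm : MetricConnection D G Gi Γ) (ψ : S) (X : ι → S) :
    ∑ a, grad D Gi ψ a * X a = ∑ a, D a ψ * ∑ c, Gi a c * X c := by
  simp only [grad, Finset.mul_sum, Finset.sum_mul]
  rw [Finset.sum_comm]
  refine Finset.sum_congr rfl fun i _ => Finset.sum_congr rfl fun j _ => ?_
  rw [hm.inv_symm j i]
  ring

theorem hessian_mul (ψ φ : S) (a b : ι) :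
    hessian D Γ (ψ * φ) a b = ψ * hessian D Γ φ a b + φ * hessian D Γ ψ a b
      + D a ψ * D b φ + D a φ * D b ψ := by
  simp only [hessian, Matrix.of_apply, Derivation.leibniz, smul_eq_mul, map_add, mul_add,
    Finset.sum_add_distrib, mul_left_comm (Γ _ _ _), ← Finset.mul_sum]
  ring

theorem hessianMix_mul (ψ φ : S) (a b : ι) :
    (Gi * hessian D Γ (ψ * φ)) a b = ψ * (Gi * hessian D Γ φ) a b
      + φ * (Gi * hessian D Γ ψ) a b + grad D Gi ψ a * D b φ + grad D Gi φ a * D b ψ := by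
  simp only [Matrix.mul_apply, hessian_mul, grad, Finset.mul_sum, Finset.sum_mul,
    ← Finset.sum_add_distrib]
  exact Finset.sum_congr rfl fun i _ => by ring

theorem box_mul (hm : MetricConnection D G Gi Γ) (ψ φ : S) :
    box D Gi Γ (ψ * φ) = ψ * box D Gi Γ φ + φ * box D Gi Γ ψ + 2 * gradInner D Gi ψ φ := by
  have h : gradInner D Gi ψ φ = ∑ a, grad D Gi φ a * D a ψ :=
    Finset.sum_congr rfl fun i _ => mul_comm _ _
  have h' : gradInner D Gi ψ φ = ∑ a, grad D Gi ψ a * D a φ := by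
    rw [hm.gradInner_comm]
    exact Finset.sum_congr rfl fun i _ => mul_comm _ _
  simp only [box, Matrix.trace, Matrix.diag_apply, hessianMix_mul, Finset.sum_add_distrib,
    ← Finset.mul_sum, ← h, ← h']
  ring

theorem deriv_gradInner (hm : MetricConnection D G Gi Γ) (ψ φ : S) (b : ι) :
    D b (gradInner D Gi ψ φ) = (∑ a, grad D Gi ψ a * hessian D Γ φ a b)
      + ∑ a, grad D Gi φ a * hessian D Γ ψ a b := by
  have h1 : ∀ a, D b (grad D Gi φ a) = (Gi * hessian D Γ φ) a b - ∑ c, Γ a b c * grad D Gi φ c :=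
    fun a => eq_sub_of_add_eq (hm.deriv_grad φ a b)
  have h2 : ∀ a, D b (D a ψ) = hessian D Γ ψ a b + ∑ c, Γ c a b * D c ψ := fun a => by
    simp only [hessian, Matrix.of_apply, hm.comm b a, sub_add_cancel]
  simp only [gradInner, map_sum, Derivation.leibniz, smul_eq_mul, h1, h2, mul_sub, mul_add,
    Finset.sum_add_distrib, Finset.sum_sub_distrib]
  rw [hm.sum_grad_mul ψ fun a => hessian D Γ φ a b]
  have h3 : ∑ a, D a ψ * ∑ c, Γ a b c * grad D Gi φ c
      = ∑ a, grad D Gi φ a * ∑ c, Γ c a b * D c ψ := by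
    simp only [Finset.mul_sum]
    rw [Finset.sum_comm]
    refine Finset.sum_congr rfl fun i _ => Finset.sum_congr rfl fun j _ => ?_
    rw [hm.torsion_free j b i]
    ring
  rw [h3]
  simp only [Matrix.mul_apply]
  ring

/-- One half of the curvature coupled energy momentum tensor, before symmetrization in the two
fields and without the conformal factor. -/
def stress (D : ι → Derivation ℝ S S) (Gi : Matrix ι ι S) (Γ : ι → ι → ι → S) (ξ : ℝ) (W : S)
    (ψ φ : S) : Matrix ι ι S :=
  Matrix.of fun a b => (1 - 2 * ξ) • (grad D Gi ψ a * D b φ)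
    - (2 * ξ) • (ψ * (Gi * hessian D Γ φ) a b)
    + ((2 * ξ - 1 / 2) • gradInner D Gi ψ φ + (2 * ξ) • (ψ * box D Gi Γ φ) - W)
      * (1 : Matrix ι ι S) a b

/-- By the product rules for Hessian and wave operator, symmetrization in the two fields collects
the second derivatives into those of `ψ * φ`, so that `divMix_hessian` applies. -/
theorem stress_add_stress (hm : MetricConnection D G Gi Γ) (ξ : ℝ) (W ψ φ : S) :
    (1 / 2 : ℝ) • (stress D Gi Γ ξ W ψ φ + stress D Gi Γ ξ W φ ψ)
      = (1 / 2 : ℝ) • ((Matrix.of fun a b => grad D Gi ψ a * D b φ)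
          + Matrix.of fun a b => grad D Gi φ a * D b ψ)
        + (Matrix.of fun a b => (ξ • box D Gi Γ (ψ * φ) - (1 / 2 : ℝ) • gradInner D Gi ψ φ - W)
          * (1 : Matrix ι ι S) a b)
        - ξ • (Gi * hessian D Γ (ψ * φ)) := by
  ext a b
  simp only [stress, Matrix.smul_apply, Matrix.add_apply, Matrix.sub_apply, Matrix.of_apply,
    hessianMix_mul, hm.box_mul, hm.gradInner_comm φ ψ]
  algebra

/-- The divergence of the energy momentum tensor. -/
theorem divMix_stress (hm : MetricConnection D G Gi Γ) (ξ : ℝ) {W W' ψ φ : S}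
    (hW : ∀ b, D b W = W' * D b (ψ * φ)) (b : ι) :
    divMix D Γ ((1 / 2 : ℝ) • (stress D Gi Γ ξ W ψ φ + stress D Gi Γ ξ W φ ψ)) b
      = (1 / 2 : ℝ) • (box D Gi Γ ψ * D b φ + box D Gi Γ φ * D b ψ) - W' * D b (ψ * φ)
        - ξ • ∑ c, ric D Γ b c * grad D Gi (ψ * φ) c := by
  rw [hm.stress_add_stress, divMix_sub, divMix_add, divMix_smul, divMix_smul, divMix_add,
    divMix_vec, divMix_vec, divMix_scalar, hm.divMix_hessian, ← hm.box_eq, ← hm.box_eq,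
    map_sub, map_sub, Derivation.map_smul, Derivation.map_smul, hm.deriv_gradInner, hW]
  algebra

/-- The Einstein tensor minus the energy momentum tensor, multiplied with the conformal
factor. -/
def violation (D : ι → Derivation ℝ S S) (Gi : Matrix ι ι S) (Γ : ι → ι → ι → S) (ξ : ℝ)
    (W : S) (ψ φ : S) : Matrix ι ι S :=
  (Matrix.of fun a b => (1 - ξ • (ψ * φ)) * ((ricMix D Gi Γ)
      - Matrix.of fun a b => ((1 / 2 : ℝ) • (ricMix D Gi Γ).trace) * (1 : Matrix ι ι S) a b) a b)
    - (1 / 2 : ℝ) • (stress D Gi Γ ξ W ψ φ + stress D Gi Γ ξ W φ ψ)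

/-- The left hand side of the scalar field equation. -/
def waveEq (D : ι → Derivation ℝ S S) (Gi : Matrix ι ι S) (Γ : ι → ι → ι → S) (ξ : ℝ)
    (W' φ : S) : S :=
  box D Gi Γ φ - ξ • ((ricMix D Gi Γ).trace * φ) - (2 : ℝ) • (φ * W')

/-- The divergence of the violation of the Einstein equations is a combination of the violations
of the scalar field equation. -/
theorem divMix_violation (hm : MetricConnection D G Gi Γ) (ξ : ℝ) {W W' ψ φ : S}
    (hW : ∀ b, D b W = W' * D b (ψ * φ)) (b : ι) :
    divMix D Γ (violation D Gi Γ ξ W ψ φ) b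
      = -((1 / 2 : ℝ) • (waveEq D Gi Γ ξ W' φ * D b ψ + waveEq D Gi Γ ξ W' ψ * D b φ)) := by
  -- The Einstein tensor is free of divergence by the contracted Bianchi identity.
  have h0 : divMix D Γ ((ricMix D Gi Γ)
      - Matrix.of fun a b => ((1 / 2 : ℝ) • (ricMix D Gi Γ).trace) * (1 : Matrix ι ι S) a b) b
      = 0 := by
    rw [divMix_sub, divMix_scalar, Derivation.map_smul, ← hm.contracted_bianchi, smul_smul]
    norm_num
  have h1 : ∑ a, D a (ψ * φ) * ricMix D Gi Γ a b = ∑ c, ric D Γ b c * grad D Gi (ψ * φ) c := by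
    simp only [hm.ricMix_eq, Matrix.mul_apply]
    rw [← hm.sum_grad_mul]
    exact Finset.sum_congr rfl fun i _ => by rw [hm.ric_symm, mul_comm]
  -- The derivative of the conformal factor contracted with the Einstein tensor: the Ricci part
  -- cancels the curvature term in the divergence of the stress, and the scalar part supplies the
  -- curvature coupling of the wave equation.
  have h2 : ∑ a, D a (1 - ξ • (ψ * φ)) * ((ricMix D Gi Γ)
      - Matrix.of fun a b => ((1 / 2 : ℝ) • (ricMix D Gi Γ).trace) * (1 : Matrix ι ι S) a b) a b
      = -(ξ • ∑ c, ric D Γ b c * grad D Gi (ψ * φ) c)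
        + ξ • ((1 / 2 : ℝ) • ((ricMix D Gi Γ).trace * D b (ψ * φ))) := by
    rw [← h1]
    simp only [map_sub, Derivation.map_one_eq_zero, Derivation.map_smul, zero_sub,
      Matrix.sub_apply, Matrix.of_apply, mul_sub, Finset.sum_sub_distrib, neg_mul,
      smul_mul_assoc, Finset.sum_neg_distrib, Matrix.one_apply, mul_ite, mul_one, mul_zero,
      mul_smul_comm, ← Finset.smul_sum]
    rw [Finset.sum_ite_eq', if_pos (Finset.mem_univ b)]
    algebra
  rw [violation, divMix_sub, divMix_mul, h0, h2, hm.divMix_stress ξ hW]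
  simp only [waveEq, Derivation.leibniz, smul_eq_mul]
  algebra

end MetricConnection

end AbstractMatter

/-! ### Metrics of the form `-dt² + g` -/

section Splitting

variable {S : Type*} [CommRing S] [Algebra ℝ S] {ι : Type*} [Fintype ι] [DecidableEq ι]

namespace MetricConnection

/-- Each constituent arises by raising an index of a symmetric tensor: Ricci tensor, metric,
Hessian, symmetrized product of gradients. The result serves to pass between the two mixed
time-space components and to show that the metric corrections are symmetric. -/
theorem violation_lower_symm {D : ι → Derivation ℝ S S} {G Gi : Matrix ι ι S}
    {Γ : ι → ι → ι → S} (hm : MetricConnection D G Gi Γ) (ξ : ℝ) (W ψ φ : S) (a b : ι) :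
    (G * violation D Gi Γ ξ W ψ φ) a b = (G * violation D Gi Γ ξ W ψ φ) b a := by
  have hr : ∀ a b, ∑ i, G a i * ricMix D Gi Γ i b = ric D Γ a b := fun a b => by
    rw [← Matrix.mul_apply, hm.ricMix_eq, ← mul_assoc, hm.mul_inv, one_mul]
  have hh : ∀ f a b, ∑ i, G a i * (Gi * hessian D Γ f) i b = hessian D Γ f a b := fun f a b => by
    rw [← Matrix.mul_apply, ← mul_assoc, hm.mul_inv, one_mul]
  have hg : ∀ f a, ∑ i, G a i * grad D Gi f i = D a f := fun f a => by
    have h : ∀ j, ∑ i, G a i * Gi i j = (1 : Matrix ι ι S) a j := fun j => by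
      rw [← Matrix.mul_apply, hm.mul_inv]
    simp only [grad, Finset.mul_sum]
    rw [Finset.sum_comm]
    simp only [← mul_assoc, ← Finset.sum_mul, h, Matrix.one_apply, ite_mul, one_mul, zero_mul,
      Finset.sum_ite_eq, Finset.mem_univ, if_true]
  have h1 : ∀ a b, ∑ i, G a i * (1 : Matrix ι ι S) i b = G a b := fun a b => by
    rw [← Matrix.mul_apply, mul_one]
  have key : ∀ a b, (G * violation D Gi Γ ξ W ψ φ) a b
      = (1 - ξ • (ψ * φ)) * (ric D Γ a b - (1 / 2 : ℝ) • (ricMix D Gi Γ).trace * G a b)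
        - ((1 / 2 : ℝ) • (D a ψ * D b φ + D a φ * D b ψ)
          + (ξ • box D Gi Γ (ψ * φ) - (1 / 2 : ℝ) • gradInner D Gi ψ φ - W) * G a b
          - ξ • hessian D Γ (ψ * φ) a b) := by
    intro a b
    rw [violation, hm.stress_add_stress, Matrix.mul_apply]
    rw [← hr a b, ← hg ψ a, ← hg φ a, ← h1 a b, ← hh (ψ * φ) a b]
    simp only [Matrix.sub_apply, Matrix.add_apply, Matrix.smul_apply, Matrix.of_apply,
      Finset.mul_sum, Finset.sum_mul, Finset.smul_sum, ← Finset.sum_add_distrib,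
      ← Finset.sum_sub_distrib]
    exact Finset.sum_congr rfl fun i _ => by algebra
  rw [key, key, hm.ric_symm a b, hm.metric_symm a b, hm.hessian_symm _ a b]
  algebra

end MetricConnection

/-- A time derivation and spatial derivations. -/
def splitD (d : Derivation ℝ S S) (D : ι → Derivation ℝ S S) :
    Option ι → Derivation ℝ S S
  | none => d
  | some a => D a

/-- The block matrix with entries `c` and `g`. -/
def splitG (c : S) (g : Matrix ι ι S) : Matrix (Option ι) (Option ι) S
  | none, none => c
  | none, some _ => 0
  | some _, none => 0
  | some a, some b => g a b

variable (d : Derivation ℝ S S) (D : ι → Derivation ℝ S S) (g gi : Matrix ι ι S)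

/-- The second fundamental form. -/
def secondForm : Matrix ι ι S := Matrix.of fun a b => (-(1 / 2) : ℝ) • d (g a b)

/-- The second fundamental form with the first index raised. -/
def secondMix : Matrix ι ι S := gi * secondForm d g

theorem splitG_mul (h : g * gi = 1) : splitG (-1) g * splitG (-1) gi = 1 := by
  ext a b
  rw [Matrix.mul_apply, Fintype.sum_option]
  rcases a with _ | a <;> rcases b with _ | b <;> simp [splitG, Matrix.one_apply]
  rw [← Matrix.mul_apply, h, Matrix.one_apply]

/-- The connection of the metric `-dt² + g`. -/
def splitΓ : Option ι → Option ι → Option ι → S :=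
  chris (splitD d D) (splitG (-1) g) (splitG (-1) gi)

variable {d D g gi}

theorem metricConnection_split (hd : ∀ a f, d (D a f) = D a (d f))
    (hD : ∀ a b f, D a (D b f) = D b (D a f)) (hs : ∀ a b, g a b = g b a) (hi : g * gi = 1) :
    MetricConnection (splitD d D) (splitG (-1) g) (splitG (-1) gi) (splitΓ d D g gi) := by
  refine metricConnection_chris (fun a b f => ?_) (fun a b => ?_) (splitG_mul g gi hi)
  · match a, b with
    | none, none => rfl
    | none, some b => exact hd b f
    | some a, none => exact (hd a f).symm
    | some a, some b => exact hD a b f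
  · match a, b with
    | none, none => rfl
    | none, some _ => rfl
    | some _, none => rfl
    | some a, some b => exact hs a b

theorem secondForm_symm (hs : ∀ a b, g a b = g b a) (a b : ι) :
    secondForm d g a b = secondForm d g b a := by
  simp [secondForm, hs a b]

theorem splitΓ_sss (c a b : ι) :
    splitΓ d D g gi (some c) (some a) (some b) = chris D g gi c a b := by
  simp [splitΓ, chris, splitD, splitG]

/-- The time component `-1` of the inverse metric combines with `∂_t g = -2 k`. -/
theorem splitΓ_nss (a b : ι) :
    splitΓ d D g gi none (some a) (some b) = -secondForm d g a b := by
  simp [splitΓ, chris, splitD, splitG, secondForm]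

theorem splitΓ_sns (hgi : ∀ a b, gi a b = gi b a) (c b : ι) :
    splitΓ d D g gi (some c) none (some b) = -secondMix d g gi c b := by
  simp [splitΓ, chris, splitD, splitG, secondMix, secondForm, Matrix.mul_apply, Finset.smul_sum,
    hgi c]

theorem splitΓ_ssn (hs : ∀ a b, g a b = g b a) (hgi : ∀ a b, gi a b = gi b a) (c b : ι) :
    splitΓ d D g gi (some c) (some b) none = -secondMix d g gi c b := by
  simp [splitΓ, chris, splitD, splitG, secondMix, secondForm, Matrix.mul_apply, Finset.smul_sum,
    hgi c, hs b]

theorem splitΓ_snn (c : ι) : splitΓ d D g gi (some c) none none = 0 := by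
  simp [splitΓ, chris, splitD, splitG]

theorem splitΓ_nsn (c : ι) : splitΓ d D g gi none (some c) none = 0 := by
  simp [splitΓ, chris, splitD, splitG]

theorem splitΓ_nns (c : ι) : splitΓ d D g gi none none (some c) = 0 := by
  simp [splitΓ, chris, splitD, splitG]

theorem splitΓ_nnn : splitΓ d D g gi none none none = 0 := by
  simp [splitΓ, chris, splitD, splitG]

/-- `k_ai k^i_b` is symmetric, in the form needed for contractions. -/
theorem sum_secondForm_mul (hs : ∀ a b, g a b = g b a) (hgi : ∀ a b, gi a b = gi b a) (a b : ι) :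
    ∑ i, secondMix d g gi i a * secondForm d g i b
      = ∑ j, secondForm d g a j * secondMix d g gi j b := by
  simp only [secondMix, Matrix.mul_apply, Finset.mul_sum, Finset.sum_mul]
  rw [Finset.sum_comm]
  refine Finset.sum_congr rfl fun i _ => Finset.sum_congr rfl fun j _ => ?_
  rw [hgi j i, secondForm_symm hs i a]
  ring

theorem ric_split_ss (hs : ∀ a b, g a b = g b a) (hgi : ∀ a b, gi a b = gi b a) (a b : ι) :
    ric (splitD d D) (splitΓ d D g gi) (some a) (some b)
      = ric D (chris D g gi) a b - d (secondForm d g a b)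
        + (secondMix d g gi).trace * secondForm d g a b
        - 2 * (secondForm d g * secondMix d g gi) a b := by
  have h := sum_secondForm_mul (d := d) hs hgi a b
  have e : ∑ i, secondForm d g a b * secondMix d g gi i i
      = (∑ i, secondMix d g gi i i) * secondForm d g a b := by
    rw [← Finset.mul_sum, mul_comm]
  simp only [ric, Matrix.of_apply, Fintype.sum_option, splitΓ_sss, splitΓ_nss, splitΓ_sns hgi,
    splitΓ_ssn hs hgi, splitΓ_nsn, splitΓ_nns, splitΓ_nnn, splitD, Matrix.trace, Matrix.diag_apply,
    Matrix.mul_apply, neg_mul_neg, map_neg, map_zero, mul_zero, zero_add,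
    Finset.sum_add_distrib, h, e, Finset.sum_const_zero]
  ring

theorem ric_split_nn (hs : ∀ a b, g a b = g b a) (hgi : ∀ a b, gi a b = gi b a) :
    ric (splitD d D) (splitΓ d D g gi) none none
      = d (secondMix d g gi).trace
        - ∑ i, ∑ j, secondMix d g gi i j * secondMix d g gi j i := by
  simp only [ric, Matrix.of_apply, Fintype.sum_option, splitΓ_sss, splitΓ_sns hgi,
    splitΓ_ssn hs hgi, splitΓ_nsn, splitΓ_nns, splitΓ_nnn, splitΓ_snn, splitD, Matrix.trace,
    Matrix.diag_apply, neg_mul_neg, map_neg, map_zero, mul_zero, zero_mul, zero_add,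
    add_zero, Finset.sum_add_distrib, map_sum, Finset.sum_neg_distrib, Finset.sum_const_zero]
  ring

/-- This is the Codazzi equation; it becomes the momentum constraint. -/
theorem ric_split_sn (hs : ∀ a b, g a b = g b a) (hgi : ∀ a b, gi a b = gi b a) (a : ι) :
    ric (splitD d D) (splitΓ d D g gi) (some a) none
      = D a (secondMix d g gi).trace - divMix D (chris D g gi) (secondMix d g gi) a := by
  have h : ∀ c a b, chris D g gi c a b = chris D g gi c b a := fun c a b => by
    unfold chris
    congr 1
    refine Finset.sum_congr rfl fun i _ => ?_
    rw [hs a i, hs i b, hs a b, add_comm (D a (g b i))]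
  have h2 : ∑ i, ∑ j, chris D g gi i a j * secondMix d g gi j i
      = ∑ i, ∑ j, chris D g gi j i a * secondMix d g gi i j := by
    rw [Finset.sum_comm]
    refine Finset.sum_congr rfl fun i _ => Finset.sum_congr rfl fun j _ => ?_
    rw [h j a i]
  simp only [ric, divMix, Matrix.of_apply, Fintype.sum_option, splitΓ_sss, splitΓ_nss,
    splitΓ_ssn hs hgi, splitΓ_nsn, splitΓ_nns, splitΓ_nnn, splitΓ_snn, splitD, Matrix.trace,
    Matrix.diag_apply, mul_neg, neg_mul, map_neg, map_zero, mul_zero, zero_mul, zero_add,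
    add_zero, Finset.sum_add_distrib, map_sum, Finset.sum_neg_distrib, Finset.sum_const_zero,
    h2, neg_zero, mul_comm (secondMix d g gi _ _)]
  ring

theorem deriv_inverse (hi : g * gi = 1) (a b : ι) :
    d (gi a b) = 2 * (secondMix d g gi * gi) a b := by
  have h0 : (1 : Matrix ι ι S).map d = 0 := by
    ext a b
    simp [Matrix.one_apply, apply_ite d]
  have hk : g.map d = -((2 : ℝ) • secondForm d g) := by
    ext a b
    simp only [Matrix.map_apply, secondForm, Matrix.neg_apply, Matrix.smul_apply, Matrix.of_apply,
      smul_smul]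
    norm_num
  have h1 := map_mul_derivation d gi g
  rw [mul_eq_one_comm.1 hi, h0, hk] at h1
  have h2 : gi.map d = (2 : ℝ) • (secondMix d g gi * gi) := by
    calc gi.map d = gi.map d * g * gi := by rw [mul_assoc, hi, mul_one]
      _ = -(gi * -((2 : ℝ) • secondForm d g)) * gi := by rw [eq_neg_of_add_eq_zero_left h1.symm]
      _ = _ := by
        rw [secondMix, mul_neg, neg_neg, Matrix.mul_smul, Matrix.smul_mul]
  have h3 := congrFun (congrFun h2 a) b
  rw [Matrix.map_apply, Matrix.smul_apply] at h3
  rw [h3]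
  algebra

theorem deriv_secondMix (hi : g * gi = 1) (a b : ι) :
    d (secondMix d g gi a b) = 2 * (secondMix d g gi * secondMix d g gi) a b
      + ∑ i, gi a i * d (secondForm d g i b) := by
  have h : (secondMix d g gi * secondMix d g gi) a b
      = ∑ i, (secondMix d g gi * gi) a i * secondForm d g i b := by
    rw [← Matrix.mul_apply, mul_assoc]
    rfl
  rw [h, Finset.mul_sum, ← Finset.sum_add_distrib]
  conv_lhs => rw [secondMix, Matrix.mul_apply, map_sum]
  refine Finset.sum_congr rfl fun i _ => ?_
  rw [Derivation.leibniz, deriv_inverse hi, smul_eq_mul, smul_eq_mul]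
  ring

theorem mul_split_s (X : Matrix (Option ι) (Option ι) S) (c : S) (a : ι) (b : Option ι) :
    (splitG c gi * X) (some a) b = ∑ i, gi a i * X (some i) b := by
  simp [Matrix.mul_apply, splitG]

theorem mul_split_n (X : Matrix (Option ι) (Option ι) S) (c : S) (b : Option ι) :
    (splitG c gi * X) none b = c * X none b := by
  simp [Matrix.mul_apply, splitG]

/-- Differentiating the inverse metric produces twice the square of the mixed second fundamental
form. It absorbs the quadratic term of `ric_split_ss`, so the mixed components satisfy a simpler
equation than those with lowered indices. -/
theorem ricMix_split_ss (hs : ∀ a b, g a b = g b a) (hi : g * gi = 1) (a b : ι) :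
    (splitG (-1) gi * ric (splitD d D) (splitΓ d D g gi)) (some a) (some b)
      = (gi * ric D (chris D g gi)) a b - d (secondMix d g gi a b)
        + (secondMix d g gi).trace * secondMix d g gi a b := by
  have hgi := inv_symm_of_symm hs hi
  have e1 : (secondMix d g gi * secondMix d g gi) a b
      = ∑ i, gi a i * (secondForm d g * secondMix d g gi) i b := by
    rw [← Matrix.mul_apply, ← mul_assoc]
    rfl
  have e2 : (secondMix d g gi).trace * secondMix d g gi a b
      = ∑ i, (secondMix d g gi).trace * (gi a i * secondForm d g i b) := by
    rw [← Finset.mul_sum, ← Matrix.mul_apply]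
    rfl
  rw [mul_split_s, deriv_secondMix hi, e1, e2, Matrix.mul_apply, Finset.mul_sum,
    ← Finset.sum_add_distrib, ← Finset.sum_sub_distrib, ← Finset.sum_add_distrib]
  refine Finset.sum_congr rfl fun i _ => ?_
  rw [ric_split_ss hs hgi]
  ring

theorem trace_option (X : Matrix (Option ι) (Option ι) S) :
    X.trace = X none none + ∑ a, X (some a) (some a) := by
  simp [Matrix.trace]

theorem ricMix_split_trace (hs : ∀ a b, g a b = g b a) (hi : g * gi = 1) :
    (splitG (-1) gi * ric (splitD d D) (splitΓ d D g gi)).trace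
      = (gi * ric D (chris D g gi)).trace - 2 * d (secondMix d g gi).trace
        + (∑ i, ∑ j, secondMix d g gi i j * secondMix d g gi j i)
        + (secondMix d g gi).trace ^ 2 := by
  rw [trace_option, mul_split_n, ric_split_nn hs (inv_symm_of_symm hs hi)]
  simp only [ricMix_split_ss hs hi, Finset.sum_add_distrib, Finset.sum_sub_distrib,
    ← Finset.mul_sum, ← map_sum]
  simp only [Matrix.trace, Matrix.diag_apply]
  ring

theorem grad_split_s (φ : S) (a : ι) :
    MetricConnection.grad (splitD d D) (splitG (-1) gi) φ (some a)
      = MetricConnection.grad D gi φ a := by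
  simp [MetricConnection.grad, splitD, splitG]

theorem grad_split_n (φ : S) :
    MetricConnection.grad (splitD d D) (splitG (-1) gi) φ none = -d φ := by
  simp [MetricConnection.grad, splitD, splitG]

theorem gradInner_split (ψ φ : S) :
    MetricConnection.gradInner (splitD d D) (splitG (-1) gi) ψ φ
      = MetricConnection.gradInner D gi ψ φ - d ψ * d φ := by
  simp only [MetricConnection.gradInner, Fintype.sum_option, grad_split_s, grad_split_n, splitD]
  ring

theorem hessian_split_ss (φ : S) (a b : ι) :
    hessian (splitD d D) (splitΓ d D g gi) φ (some a) (some b)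
      = hessian D (chris D g gi) φ a b + secondForm d g a b * d φ := by
  simp only [hessian, Matrix.of_apply, Fintype.sum_option, splitΓ_sss, splitΓ_nss, splitD]
  ring

theorem hessian_split_nn (φ : S) :
    hessian (splitD d D) (splitΓ d D g gi) φ none none = d (d φ) := by
  simp [hessian, splitΓ_snn, splitΓ_nnn, splitD]

theorem hessian_split_sn (hs : ∀ a b, g a b = g b a) (hgi : ∀ a b, gi a b = gi b a) (φ : S)
    (a : ι) : hessian (splitD d D) (splitΓ d D g gi) φ (some a) none
      = D a (d φ) + ∑ c, secondMix d g gi c a * D c φ := by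
  simp [hessian, splitΓ_ssn hs hgi, splitΓ_nsn, splitD]

theorem hessianMix_split_ss (φ : S) (a b : ι) :
    (splitG (-1) gi * hessian (splitD d D) (splitΓ d D g gi) φ) (some a) (some b)
      = (gi * hessian D (chris D g gi) φ) a b + secondMix d g gi a b * d φ := by
  rw [mul_split_s, Matrix.mul_apply, secondMix, Matrix.mul_apply]
  simp only [hessian_split_ss, mul_add, Finset.sum_add_distrib, Finset.sum_mul, mul_assoc]

theorem box_split (φ : S) :
    MetricConnection.box (splitD d D) (splitG (-1) gi) (splitΓ d D g gi) φ
      = MetricConnection.box D gi (chris D g gi) φ + (secondMix d g gi).trace * d φ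
        - d (d φ) := by
  rw [MetricConnection.box, trace_option, mul_split_n, hessian_split_nn]
  simp only [hessianMix_split_ss, Finset.sum_add_distrib, ← Finset.sum_mul,
    MetricConnection.box, Matrix.trace, Matrix.diag_apply]
  ring

/-- The last sum vanishes as soon as the time derivation commutes with the spatial ones, which is
not assumed here. -/
theorem hessianMix_split_sn (hs : ∀ a b, g a b = g b a) (hi : g * gi = 1) (φ : S) (a : ι) :
    (splitG (-1) gi * hessian (splitD d D) (splitΓ d D g gi) φ) (some a) none
      = d (MetricConnection.grad D gi φ a)
        - ∑ i, secondMix d g gi a i * MetricConnection.grad D gi φ i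
        + ∑ i, gi a i * (D i (d φ) - d (D i φ)) := by
  have hgi := inv_symm_of_symm hs hi
  have e1 : ∑ i, secondMix d g gi a i * MetricConnection.grad D gi φ i
      = ∑ i, (secondMix d g gi * gi) a i * D i φ := by
    simp only [MetricConnection.grad, Matrix.mul_apply, Finset.mul_sum, Finset.sum_mul]
    rw [Finset.sum_comm]
    exact Finset.sum_congr rfl fun i _ => Finset.sum_congr rfl fun j _ => by ring
  have e2 : ∑ i, gi a i * ∑ c, secondMix d g gi c i * D c φ
      = ∑ i, (secondMix d g gi * gi) a i * D i φ := by
    have h : ∀ c, (secondMix d g gi * gi) a c = ∑ i, gi a i * secondMix d g gi c i := fun c => by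
      rw [secondMix, mul_assoc, Matrix.mul_apply]
      refine Finset.sum_congr rfl fun i _ => ?_
      simp only [Matrix.mul_apply]
      congr 1
      refine Finset.sum_congr rfl fun j _ => ?_
      rw [secondForm_symm hs i j, hgi j c, mul_comm]
    simp only [h, Finset.mul_sum, Finset.sum_mul]
    rw [Finset.sum_comm]
    exact Finset.sum_congr rfl fun i _ => Finset.sum_congr rfl fun j _ => by ring
  have e3 : d (MetricConnection.grad D gi φ a)
      = 2 * (∑ i, (secondMix d g gi * gi) a i * D i φ) + ∑ i, gi a i * d (D i φ) := by
    simp only [MetricConnection.grad, map_sum, Derivation.leibniz, smul_eq_mul, deriv_inverse hi,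
      Finset.sum_add_distrib, Finset.mul_sum]
    rw [add_comm]
    congr 1
    exact Finset.sum_congr rfl fun i _ => by ring
  simp only [mul_split_s, hessian_split_sn hs hgi, mul_add, mul_sub, Finset.sum_add_distrib,
    Finset.sum_sub_distrib, e2]
  rw [e1, e3]
  ring

/-- The divergence of a mixed tensor in direction of time. -/
theorem divMix_split_n (hs : ∀ a b, g a b = g b a) (hgi : ∀ a b, gi a b = gi b a)
    (T : Matrix (Option ι) (Option ι) S) :
    divMix (splitD d D) (splitΓ d D g gi) T none
      = d (T none none) - (secondMix d g gi).trace * T none none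
        + (∑ a, D a (T (some a) none))
        + (∑ a, ∑ c, chris D g gi a a c * T (some c) none)
        + ∑ a, ∑ c, secondMix d g gi c a * T (some a) (some c) := by
  simp only [divMix, Fintype.sum_option, splitΓ_sss, splitΓ_nss, splitΓ_sns hgi,
    splitΓ_ssn hs hgi, splitΓ_nsn, splitΓ_nns, splitΓ_nnn, splitΓ_snn, splitD, Matrix.trace,
    Matrix.diag_apply, neg_mul, zero_mul, zero_add, add_zero,
    Finset.sum_add_distrib, Finset.sum_neg_distrib, Finset.sum_const_zero, Finset.sum_mul]
  ring

/-- The divergence of a mixed tensor in the spatial directions. -/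
theorem divMix_split_s (hs : ∀ a b, g a b = g b a) (hgi : ∀ a b, gi a b = gi b a)
    (T : Matrix (Option ι) (Option ι) S) (b : ι) :
    divMix (splitD d D) (splitΓ d D g gi) T (some b)
      = d (T none (some b)) - (secondMix d g gi).trace * T none (some b)
        + (∑ c, secondMix d g gi c b * T none (some c))
        + (∑ a, secondForm d g a b * T (some a) none)
        + divMix D (chris D g gi) (Matrix.of fun a b => T (some a) (some b)) b := by
  simp only [divMix, Fintype.sum_option, splitΓ_sss, splitΓ_nss, splitΓ_sns hgi,
    splitΓ_ssn hs hgi, splitΓ_nsn, splitΓ_nns, splitΓ_nnn, splitΓ_snn, splitD, Matrix.trace,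
    Matrix.diag_apply, neg_mul, zero_mul, zero_add, add_zero, Matrix.of_apply,
    Finset.sum_add_distrib, Finset.sum_neg_distrib, Finset.sum_const_zero, Finset.sum_mul]
  ring

end Splitting

/-! ### Orders of formal series -/

section Order

variable {n : ℕ} {M : Type*} [TopologicalSpace M] [ChartedSpace (Coord n) M]

/-- The series of order not less than `p`. -/
def ordGE (n : ℕ) (M : Type*) [TopologicalSpace M] [ChartedSpace (Coord n) M] (p : ℝ) :
    Submodule ℝ (Ser n M) where
  carrier := {f | ∀ m < p, f.coeff m = 0}
  zero_mem' _ _ := rfl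
  add_mem' {f g} hf hg m hm := by rw [HahnSeries.coeff_add, hf m hm, hg m hm, add_zero]
  smul_mem' r f hf m hm := by rw [coeff_smul, hf m hm, smul_zero]

theorem ordGE_mono {p q : ℝ} (h : q ≤ p) {f : Ser n M} (hf : f ∈ ordGE n M p) :
    f ∈ ordGE n M q := fun m hm => hf m (hm.trans_le h)

theorem ordGE_mul {p q : ℝ} {f g : Ser n M} (hf : f ∈ ordGE n M p) (hg : g ∈ ordGE n M q) :
    f * g ∈ ordGE n M (p + q) := by
  intro m hm
  rw [HahnSeries.coeff_mul]
  refine Finset.sum_eq_zero fun ij hij => ?_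
  rw [Finset.mem_antidiagonal] at hij
  rcases lt_or_ge ij.1 p with h1 | h1
  · rw [hf _ h1, zero_mul]
  · rw [hg ij.2 (by linarith [hij.2.2]), mul_zero]

theorem ordGE_mul' {p q r : ℝ} {f g : Ser n M} (hf : f ∈ ordGE n M p) (hg : g ∈ ordGE n M q)
    (h : r ≤ p + q) : f * g ∈ ordGE n M r := ordGE_mono h (ordGE_mul hf hg)

theorem single_mem_ordGE (p : ℝ) (q : Coef n M) : HahnSeries.single p q ∈ ordGE n M p :=
  fun _ hm => HahnSeries.coeff_single_of_ne hm.ne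

theorem one_mem_ordGE : (1 : Ser n M) ∈ ordGE n M 0 := single_mem_ordGE 0 1

theorem dt_mem_ordGE {p : ℝ} {f : Ser n M} (H : ℝ) (hf : f ∈ ordGE n M p) :
    dt H f ∈ ordGE n M p := fun m hm => by
  rw [coeff_dt, hf m hm]
  exact map_zero (dtCoefHom H m)

theorem conj_mem_ordGE {p : ℝ} {f : Ser n M} (hf : f ∈ ordGE n M p) :
    conj f ∈ ordGE n M p := fun m hm => by
  rw [coeff_conj, hf m hm]
  exact map_zero conjCoefHom

theorem eq_zero_of_forall_mem_ordGE {f : Ser n M} (h : ∀ c, f ∈ ordGE n M c) : f = 0 := by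
  ext m : 2
  exact h (m + 1) m (by linarith)

theorem orderTop_pos_of_mem_ordGE {ε : ℝ} (hε : 0 < ε) {f : Ser n M} (hf : f ∈ ordGE n M ε) :
    0 < f.orderTop := by
  rcases eq_or_ne f 0 with rfl | h0
  · rw [HahnSeries.orderTop_zero]
    exact WithTop.top_pos
  · have : ((ε : ℝ) : WithTop ℝ) ≤ f.orderTop := by
      rw [HahnSeries.le_orderTop_iff_forall]
      intro m hm
      exact hf m (WithTop.coe_lt_coe.1 hm)
    exact lt_of_lt_of_le (WithTop.coe_lt_coe.2 hε) this

variable [IsManifold (𝓡 n) ∞ M] in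
theorem pd_mem_ordGE {p : ℝ} {f : Ser n M} (x : GlobalChart n M) (a : Fin n)
    (hf : f ∈ ordGE n M p) : pd x a f ∈ ordGE n M p := fun m hm => by
  rw [coeff_pd, hf m hm, AddMonoidAlgebra.map_zero]

/-! ### Substitution in power series with real coefficients -/

/-- The substitution of a series of positive order in a power series with real coefficients. -/
def substReal (f : Ser n M) (P : PowerSeries ℝ) : Ser n M :=
  PowerSeries.heval f (PowerSeries.map (algebraMap ℝ (Coef n M)) P)

/-- The power series with coefficients shifted by one. -/
def shiftPS (P : PowerSeries ℝ) : PowerSeries ℝ :=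
  PowerSeries.mk fun k => PowerSeries.coeff (k + 1) P

theorem shiftPS_spec (P : PowerSeries ℝ) :
    P = PowerSeries.X * shiftPS P + PowerSeries.C (PowerSeries.coeff 0 P) := by
  conv_lhs => rw [PowerSeries.eq_X_mul_shift_add_const P]
  rw [PowerSeries.coeff_zero_eq_constantCoeff_apply]
  rfl

theorem substReal_add (f : Ser n M) (P Q : PowerSeries ℝ) :
    substReal f (P + Q) = substReal f P + substReal f Q := by
  simp only [substReal, map_add]

theorem substReal_mul (f : Ser n M) (P Q : PowerSeries ℝ) :
    substReal f (P * Q) = substReal f P * substReal f Q := by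
  simp only [substReal, map_mul]

theorem substReal_X {f : Ser n M} {ε : ℝ} (hε : 0 < ε) (hf : f ∈ ordGE n M ε) :
    substReal f PowerSeries.X = f := by
  rw [substReal, PowerSeries.map_X, PowerSeries.heval_X f (orderTop_pos_of_mem_ordGE hε hf)]

theorem substReal_C (f : Ser n M) (r : ℝ) : substReal f (PowerSeries.C r) = r • 1 := by
  rw [substReal, PowerSeries.map_C, PowerSeries.heval_C]
  ext m : 2
  rw [HahnSeries.coeff_smul, coeff_smul, Algebra.smul_def r, smul_eq_mul]

/-- Iterating this identity `N` times determines the substitution modulo order `N * ε`. Later facts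
on substitution are inductions on `N` over all power series simultaneously. -/
theorem substReal_eq {f : Ser n M} {ε : ℝ} (hε : 0 < ε) (hf : f ∈ ordGE n M ε)
    (P : PowerSeries ℝ) :
    substReal f P = PowerSeries.coeff 0 P • 1 + f * substReal f (shiftPS P) := by
  conv_lhs => rw [shiftPS_spec P]
  rw [substReal_add, substReal_mul, substReal_X hε hf, substReal_C, add_comm]

theorem pow_mem_ordGE {f : Ser n M} {ε : ℝ} (hf : f ∈ ordGE n M ε) (k : ℕ) :
    f ^ k ∈ ordGE n M (k * ε) := by
  induction k with
  | zero => simpa using one_mem_ordGE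
  | succ k ih =>
    rw [pow_succ]
    exact ordGE_mul' ih hf (by push_cast; linarith)

theorem substReal_mem_ordGE {f : Ser n M} {ε : ℝ} (hε : 0 < ε) (hf : f ∈ ordGE n M ε)
    (P : PowerSeries ℝ) : substReal f P ∈ ordGE n M 0 := by
  intro m hm
  rw [substReal, PowerSeries.coeff_heval]
  refine finsum_eq_zero_of_forall_eq_zero fun k => ?_
  have h0 := orderTop_pos_of_mem_ordGE hε hf
  have h1 : (f ^ k).coeff m = 0 :=
    pow_mem_ordGE hf k m (hm.trans_le (by positivity))
  have h2 := HahnSeries.SummableFamily.powerSeriesFamily_of_orderTop_pos h0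
    (PowerSeries.map (algebraMap ℝ (Coef n M)) P) k
  change (HahnSeries.SummableFamily.powerSeriesFamily f
    (PowerSeries.map (algebraMap ℝ (Coef n M)) P) k).coeff m = 0
  rw [h2, HahnSeries.coeff_smul, h1, smul_zero]

theorem mul_substReal_geom {f : Ser n M} {ε : ℝ} (hε : 0 < ε) (hf : f ∈ ordGE n M ε) :
    (1 - f) * substReal f (PowerSeries.mk fun _ => 1) = 1 := by
  have h := substReal_eq hε hf (PowerSeries.mk fun _ => 1)
  have h1 : shiftPS (PowerSeries.mk fun _ => 1) = PowerSeries.mk fun _ => 1 := by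
    ext k
    simp [shiftPS]
  rw [h1] at h
  have h2 : PowerSeries.coeff 0 (PowerSeries.mk fun _ => (1 : ℝ)) = 1 := by simp
  rw [h2, one_smul] at h
  linear_combination h

theorem inverse_one_sub {f : Ser n M} {ε : ℝ} (hε : 0 < ε) (hf : f ∈ ordGE n M ε) :
    Ring.inverse (1 - f) = substReal f (PowerSeries.mk fun _ => 1) :=
  Ring.inverse_unit (Units.mkOfMulEqOne _ _ (mul_substReal_geom hε hf))

/-- The chain rule for substitution in a power series. -/
theorem derivation_substReal (d : Derivation ℝ (Ser n M) (Ser n M))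
    (hd : ∀ p (f : Ser n M), f ∈ ordGE n M p → d f ∈ ordGE n M p) {f : Ser n M} {ε : ℝ}
    (hε : 0 < ε) (hf : f ∈ ordGE n M ε) (P P' : PowerSeries ℝ)
    (hP : ∀ k, PowerSeries.coeff k P' = PowerSeries.coeff (k + 1) P * ((k : ℝ) + 1)) :
    d (substReal f P) = substReal f P' * d f := by
  -- The error of the chain rule is multiplied by `f` when the power series is shifted once, so it
  -- has arbitrarily high order.
  have key : ∀ N : ℕ, ∀ P P' : PowerSeries ℝ,
      (∀ k, PowerSeries.coeff k P' = PowerSeries.coeff (k + 1) P * ((k : ℝ) + 1)) →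
      d (substReal f P) - substReal f P' * d f ∈ ordGE n M (N * ε) := by
    intro N
    induction N with
    | zero =>
      intro P P' _
      rw [Nat.cast_zero, zero_mul]
      exact Submodule.sub_mem _ (hd _ _ (substReal_mem_ordGE hε hf P))
        (ordGE_mul' (substReal_mem_ordGE hε hf P') (hd _ _ hf) (by linarith))
    | succ N ih =>
      intro P P' hP
      let Q : PowerSeries ℝ := PowerSeries.mk fun k =>
        PowerSeries.coeff (k + 1) (shiftPS P) * ((k : ℝ) + 1)
      have hQ := ih (shiftPS P) Q fun k => by simp [Q]
      -- The product rule for the shift decomposition of `P`, where `Q` is the formal derivative of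
      -- the shifted series.
      have hP' : P' = shiftPS P + PowerSeries.X * Q := by
        ext k
        rw [hP, map_add]
        rcases k with _ | k
        · simp [shiftPS]
        · rw [mul_comm PowerSeries.X, PowerSeries.coeff_succ_mul_X]
          simp only [shiftPS, PowerSeries.coeff_mk, Q]
          push_cast
          ring
      have h1 : d (substReal f P) - substReal f P' * d f
          = f * (d (substReal f (shiftPS P)) - substReal f Q * d f) := by
        rw [substReal_eq hε hf P, map_add, Derivation.map_smul, Derivation.map_one_eq_zero,
          Derivation.leibniz, hP', substReal_add, substReal_mul, substReal_X hε hf, smul_eq_mul,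
          smul_eq_mul, smul_zero]
        ring
      rw [h1]
      exact ordGE_mul' hf hQ (by push_cast; linarith)
  rw [← sub_eq_zero]
  refine eq_zero_of_forall_mem_ordGE fun c => ?_
  obtain ⟨N, hN⟩ := exists_nat_ge (c / ε)
  exact ordGE_mono ((div_le_iff₀ hε).1 hN) (key N P P' hP)

/-- A smooth function as a formal series. -/
def serFn : SmoothC n M →+* Ser n M := (HahnSeries.C).comp fnHom

theorem serFn_apply (f : SmoothC n M) : serFn f = HahnSeries.single 0 (fn f) := rfl

/-- Turns multiplication by real numbers into multiplication by constant functions, so that weighted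
relations need no separate rule for scalars. -/
theorem smul_eq_serFn (r : ℝ) (f : Ser n M) : r • f = serFn (cstC (r : ℂ)) * f := by
  have h : serFn (cstC (r : ℂ)) = algebraMap ℝ (Ser n M) r := by
    rw [Algebra.algebraMap_eq_smul_one, serFn_apply]
    ext m : 2
    rw [coeff_smul, HahnSeries.coeff_one, HahnSeries.coeff_single]
    split_ifs
    · rw [AddMonoidAlgebra.one_def, AddMonoidAlgebra.smul_single, fn]
      congr 1
      ext1 l
      rw [Polynomial.coeff_smul, smul_eq_cstC_mul, Polynomial.coeff_C, Polynomial.coeff_one]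
      split_ifs <;> simp
    · rw [smul_zero]
  rw [h, Algebra.smul_def]

theorem powX_mul (α β : ℝ) : (powX α : Ser n M) * powX β = powX (α + β) := by
  rw [powX, powX, HahnSeries.single_mul_single, one_mul, powX]

theorem powX_zero : (powX 0 : Ser n M) = 1 := rfl

theorem conj_serFn (f : SmoothC n M) : conj (serFn f) = serFn (conjC f) := by
  ext m : 2
  rw [coeff_conj, serFn_apply, serFn_apply, HahnSeries.coeff_single, HahnSeries.coeff_single]
  split_ifs
  · exact conjCoef_fn f
  · exact map_zero conjCoefHom

theorem conj_powX (α : ℝ) : conj (powX α : Ser n M) = powX α := by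
  ext m : 2
  rw [coeff_conj, powX, HahnSeries.coeff_single]
  split_ifs
  · exact map_one conjCoefHom
  · exact map_zero conjCoefHom

theorem dt_serFn (H : ℝ) (f : SmoothC n M) : dt H (serFn f) = 0 := by
  ext m : 2
  rw [coeff_dt, serFn_apply, HahnSeries.coeff_single]
  split_ifs with h
  · rw [dtCoef_fn, h]
    simp
  · exact map_zero (dtCoefHom H m)

theorem dt_powX (H α : ℝ) : dt H (powX α : Ser n M) = (-α * H) • powX α := by
  ext m : 2
  rw [coeff_dt, coeff_smul, powX, HahnSeries.coeff_single]
  split_ifs with h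
  · have h1 : (1 : Coef n M) = fn 1 := (map_one fnHom).symm
    rw [h1, dtCoef_fn, h]
  · rw [smul_zero]
    exact map_zero (dtCoefHom H m)

end Order

/-! ### Weighted relations -/

section Weights

variable {n : ℕ} {M : Type*} [TopologicalSpace M] [ChartedSpace (Coord n) M]
  [IsManifold (𝓡 n) ∞ M]

/-- A relation between formal series of order not less than a weight `p`, compatible with all
operations occurring in the field equations. -/
structure WeightRel (ρ : ℝ → Ser n M → Ser n M → Prop) : Prop where
  order : ∀ {p f f'}, ρ p f f' → f ∈ ordGE n M p ∧ f' ∈ ordGE n M p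
  mono : ∀ {p q f f'}, ρ p f f' → q ≤ p → ρ q f f'
  add : ∀ {p f f' g g'}, ρ p f f' → ρ p g g' → ρ p (f + g) (f' + g')
  mul' : ∀ {p q f f' g g'}, ρ p f f' → ρ q g g' → ρ (p + q) (f * g) (f' * g')
  dt : ∀ {p f f'} (H : ℝ), ρ p f f' → ρ p (dt H f) (dt H f')
  pd : ∀ {p f f'} (x : GlobalChart n M) (a : Fin n), ρ p f f' → ρ p (pd x a f) (pd x a f')
  conj : ∀ {p f f'}, ρ p f f' → ρ p (conj f) (conj f')
  serFn : ∀ c : SmoothC n M, ρ 0 (serFn c) (serFn c)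
  powX : ∀ α : ℝ, ρ α (powX α) (powX α)
  -- Closedness under approximation in the order; it admits infinite sums such as substitutions in
  -- power series.
  complete : ∀ {p f f'}, (∀ c : ℝ, ∃ u u', ρ p u u' ∧ f - u ∈ ordGE n M c ∧
    f' - u' ∈ ordGE n M c) → ρ p f f'

namespace WeightRel

variable {ρ : ℝ → Ser n M → Ser n M → Prop}
variable {p q r : ℝ} {f f' g g' : Ser n M}

theorem mul (h : WeightRel ρ) (hf : ρ p f f') (hg : ρ q g g') (hr : r ≤ p + q) :
    ρ r (f * g) (f' * g') := h.mono (h.mul' hf hg) hr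

theorem zero (h : WeightRel ρ) (p : ℝ) : ρ p 0 0 := by
  have h1 := h.mul' (h.serFn 0) (h.powX p)
  rwa [map_zero, zero_mul, zero_add] at h1

theorem smul (h : WeightRel ρ) (c : ℝ) (hf : ρ p f f') : ρ p (c • f) (c • f') := by
  rw [smul_eq_serFn, smul_eq_serFn]
  exact h.mul (h.serFn _) hf (by linarith)

theorem neg (h : WeightRel ρ) (hf : ρ p f f') : ρ p (-f) (-f') := by
  have h1 := h.smul (-1) hf
  rwa [neg_one_smul, neg_one_smul] at h1

theorem sub (h : WeightRel ρ) (hf : ρ p f f') (hg : ρ p g g') : ρ p (f - g) (f' - g') := by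
  rw [sub_eq_add_neg, sub_eq_add_neg]
  exact h.add hf (h.neg hg)

theorem one (h : WeightRel ρ) : ρ 0 1 1 := h.powX 0

theorem const (h : WeightRel ρ) (c : ℝ) : ρ 0 (c • 1) (c • 1) := h.smul c h.one

theorem sum (h : WeightRel ρ) {ι : Type*} (s : Finset ι) {F F' : ι → Ser n M}
    (hF : ∀ i ∈ s, ρ p (F i) (F' i)) : ρ p (∑ i ∈ s, F i) (∑ i ∈ s, F' i) := by
  classical
  induction s using Finset.induction_on with
  | empty => simpa using h.zero p
  | insert i s hi ih =>
    rw [Finset.sum_insert hi, Finset.sum_insert hi]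
    exact h.add (hF i (Finset.mem_insert_self i s))
      (ih fun j hj => hF j (Finset.mem_insert_of_mem hj))

theorem usum (h : WeightRel ρ) {ι : Type*} [Fintype ι] {F F' : ι → Ser n M}
    (hF : ∀ i, ρ p (F i) (F' i)) : ρ p (∑ i, F i) (∑ i, F' i) :=
  h.sum Finset.univ fun i _ => hF i

theorem prod (h : WeightRel ρ) {ι : Type*} (s : Finset ι) {F F' : ι → Ser n M}
    (hF : ∀ i ∈ s, ρ 0 (F i) (F' i)) : ρ 0 (∏ i ∈ s, F i) (∏ i ∈ s, F' i) := by
  classical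
  induction s using Finset.induction_on with
  | empty => simpa using h.one
  | insert i s hi ih =>
    rw [Finset.prod_insert hi, Finset.prod_insert hi]
    exact h.mul (hF i (Finset.mem_insert_self i s))
      (ih fun j hj => hF j (Finset.mem_insert_of_mem hj)) (by linarith)

/-- Truncations of the power series are built from sums and products and hence are related;
closedness gives the limit. -/
theorem substReal (h : WeightRel ρ) {ε : ℝ} (hε : 0 < ε) (hf : ρ ε f f') (P : PowerSeries ℝ) :
    ρ 0 (substReal f P) (substReal f' P) := by
  have key : ∀ N : ℕ, ∀ P : PowerSeries ℝ, ∃ u u', ρ 0 u u' ∧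
      AlgESF.substReal f P - u ∈ ordGE n M (N * ε) ∧
      AlgESF.substReal f' P - u' ∈ ordGE n M (N * ε) := by
    intro N
    induction N with
    | zero =>
      intro P
      refine ⟨0, 0, h.zero 0, ?_, ?_⟩
      · simpa using substReal_mem_ordGE hε (h.order hf).1 P
      · simpa using substReal_mem_ordGE hε (h.order hf).2 P
    | succ N ih =>
      intro P
      obtain ⟨u, u', h1, h2, h3⟩ := ih (shiftPS P)
      refine ⟨PowerSeries.coeff 0 P • 1 + f * u, PowerSeries.coeff 0 P • 1 + f' * u',
        h.add (h.const _) (h.mul hf h1 (by linarith)), ?_, ?_⟩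
      · rw [substReal_eq hε (h.order hf).1 P, add_sub_add_left_eq_sub, ← mul_sub]
        exact ordGE_mul' (h.order hf).1 h2 (by push_cast; linarith)
      · rw [substReal_eq hε (h.order hf).2 P, add_sub_add_left_eq_sub, ← mul_sub]
        exact ordGE_mul' (h.order hf).2 h3 (by push_cast; linarith)
  refine h.complete fun c => ?_
  obtain ⟨N, hN⟩ := exists_nat_ge (c / ε)
  obtain ⟨u, u', h1, h2, h3⟩ := key N P
  have h4 := (div_le_iff₀ hε).1 hN
  exact ⟨u, u', h1, ordGE_mono h4 h2, ordGE_mono h4 h3⟩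

/-- Without its constant term a substitution inherits the full weight of its argument. This is how
the potential and the conformal factor become quadratic in the field. -/
theorem substReal_sub_const (h : WeightRel ρ) {ε : ℝ} (hε : 0 < ε) (hf : ρ ε f f')
    (P : PowerSeries ℝ) :
    ρ ε (AlgESF.substReal f P - PowerSeries.coeff 0 P • 1)
      (AlgESF.substReal f' P - PowerSeries.coeff 0 P • 1) := by
  rw [substReal_eq hε (h.order hf).1 P, substReal_eq hε (h.order hf).2 P, add_sub_cancel_left,
    add_sub_cancel_left]
  exact h.mul hf (h.substReal hε hf _) (by linarith)

theorem det (h : WeightRel ρ) {ι : Type*} [Fintype ι] [DecidableEq ι]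
    {A A' : Matrix ι ι (Ser n M)}
    (hA : ∀ i j, ρ 0 (A i j) (A' i j)) : ρ 0 A.det A'.det := by
  rw [Matrix.det_apply', Matrix.det_apply']
  refine h.usum fun σ => h.mul ?_ (h.prod _ fun i _ => hA _ _) (by linarith : (0 : ℝ) ≤ 0 + 0)
  rcases Int.units_eq_one_or (Equiv.Perm.sign σ) with h1 | h1 <;> rw [h1]
  · simpa using h.one
  · simpa using h.neg h.one

theorem adjugate (h : WeightRel ρ) {ι : Type*} [Fintype ι] [DecidableEq ι]
    {A A' : Matrix ι ι (Ser n M)} (hA : ∀ i j, ρ 0 (A i j) (A' i j)) (i j : ι) :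
    ρ 0 (A.adjugate i j) (A'.adjugate i j) := by
  rw [Matrix.adjugate_apply, Matrix.adjugate_apply]
  refine h.det fun k l => ?_
  rw [Matrix.updateRow_apply, Matrix.updateRow_apply]
  split_ifs
  · rw [Pi.single_apply]
    split_ifs
    · exact h.one
    · exact h.zero 0
  · exact hA k l

end WeightRel

/-- Congruence of relative precision `r`. -/
def congRel (n : ℕ) (M : Type*) [TopologicalSpace M] [ChartedSpace (Coord n) M] (r : ℝ)
    (p : ℝ) (f f' : Ser n M) : Prop :=
  f ∈ ordGE n M p ∧ f' ∈ ordGE n M p ∧ f - f' ∈ ordGE n M (p + r)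

/-- Precision is measured relative to the weight, so that it survives products: in `(f - f') * g +
f' * (g - g')` the undisturbed factor contributes its whole weight. -/
theorem congRel_weightRel (r : ℝ) : WeightRel (congRel n M r) where
  order h := ⟨h.1, h.2.1⟩
  mono h hq := ⟨ordGE_mono hq h.1, ordGE_mono hq h.2.1, ordGE_mono (by linarith) h.2.2⟩
  add hf hg := ⟨Submodule.add_mem _ hf.1 hg.1, Submodule.add_mem _ hf.2.1 hg.2.1, by
    rw [add_sub_add_comm]
    exact Submodule.add_mem _ hf.2.2 hg.2.2⟩
  mul' {p q f f' g g'} hf hg := ⟨ordGE_mul hf.1 hg.1, ordGE_mul hf.2.1 hg.2.1, by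
    rw [show f * g - f' * g' = (f - f') * g + f' * (g - g') by ring]
    exact Submodule.add_mem _ (ordGE_mul' hf.2.2 hg.1 (by linarith))
      (ordGE_mul' hf.2.1 hg.2.2 (by linarith))⟩
  dt {p f f'} H h := ⟨dt_mem_ordGE H h.1, dt_mem_ordGE H h.2.1, by
    rw [← dtD_apply, ← dtD_apply, ← map_sub]
    exact dt_mem_ordGE H h.2.2⟩
  pd {p f f'} x a h := ⟨pd_mem_ordGE x a h.1, pd_mem_ordGE x a h.2.1, by
    rw [← pdD_apply, ← pdD_apply, ← map_sub]
    exact pd_mem_ordGE x a h.2.2⟩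
  conj h := ⟨conj_mem_ordGE h.1, conj_mem_ordGE h.2.1, by
    rw [← conj_sub]
    exact conj_mem_ordGE h.2.2⟩
  serFn c := ⟨single_mem_ordGE 0 _, single_mem_ordGE 0 _, by
    rw [sub_self]
    exact Submodule.zero_mem _⟩
  powX α := ⟨single_mem_ordGE α _, single_mem_ordGE α _, by
    rw [sub_self]
    exact Submodule.zero_mem _⟩
  complete {p f f'} h := by
    obtain ⟨u, u', hu, h1, h2⟩ := h (max p (p + r))
    have h3 := ordGE_mono (le_max_left _ _) h1
    have h4 := ordGE_mono (le_max_left _ _) h2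
    refine ⟨?_, ?_, ?_⟩
    · simpa using Submodule.add_mem _ h3 hu.1
    · simpa using Submodule.add_mem _ h4 hu.2.1
    · have h5 := ordGE_mono (le_max_right _ _) h1
      have h6 := ordGE_mono (le_max_right _ _) h2
      rw [show f - f' = (f - u) + (u - u') - (f' - u') by ring]
      exact Submodule.sub_mem _ (Submodule.add_mem _ h5 hu.2.2) h6

/-- The series in the algebra of formal series with only constant coefficients, that is without
oscillatory and logarithmic terms, below `q`. -/
def IsPlainBelow (q : ℝ) (f : Ser n M) : Prop :=
  f ∈ formalSeries n M ∧ ∀ m < q, ∃ c : SmoothC n M, f.coeff m = fn c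

theorem formal_of_support_subset {f g : Ser n M} (hf : f ∈ formalSeries n M)
    (h : ∀ m, f.coeff m = 0 → g.coeff m = 0) : g ∈ formalSeries n M := fun c =>
  (hf c).subset fun m hm => ⟨fun h0 => hm.1 (h m h0), hm.2⟩

theorem formal_serFn (c : SmoothC n M) : serFn c ∈ formalSeries n M := fun _ =>
  (Set.finite_singleton (0 : ℝ)).subset fun z hz => by
    by_contra h0
    exact hz.1 (HahnSeries.coeff_single_of_ne h0)

theorem formal_single (α : ℝ) (q : Coef n M) : HahnSeries.single α q ∈ formalSeries n M :=
  fun _ => (Set.finite_singleton α).subset fun z hz => by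
    by_contra h0
    exact hz.1 (HahnSeries.coeff_single_of_ne h0)

theorem fn_zero : (fn 0 : Coef n M) = 0 := map_zero fnHom

/-- Membership in `𝓢_r X^p`, as a relation. -/
def plainRel (n : ℕ) (M : Type*) [TopologicalSpace M] [ChartedSpace (Coord n) M] (r : ℝ)
    (p : ℝ) (f f' : Ser n M) : Prop :=
  f = f' ∧ f ∈ ordGE n M p ∧ IsPlainBelow (p + r) f

/-- Below `p + q + r`, a factor of order at least `q` meets only coefficients of the other factor
below `p + r`, and conversely. Hence products preserve absence of oscillations and logarithms when
it is measured relative to the weight. -/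
theorem plainRel_weightRel {r : ℝ} : WeightRel (plainRel n M r) where
  order h := ⟨h.2.1, h.1 ▸ h.2.1⟩
  mono h hq := ⟨h.1, ordGE_mono hq h.2.1, h.2.2.1, fun m hm => h.2.2.2 m (by linarith)⟩
  add {p f f' g g'} hf hg := ⟨by rw [hf.1, hg.1], Submodule.add_mem _ hf.2.1 hg.2.1,
    Subring.add_mem _ hf.2.2.1 hg.2.2.1, fun m hm => by
      obtain ⟨c, hc⟩ := hf.2.2.2 m hm
      obtain ⟨d, hd⟩ := hg.2.2.2 m hm
      refine ⟨c + d, ?_⟩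
      rw [HahnSeries.coeff_add, hc, hd]
      exact (map_add fnHom c d).symm⟩
  mul' {p q f f' g g'} hf hg := ⟨by rw [hf.1, hg.1], ordGE_mul hf.2.1 hg.2.1,
    Subring.mul_mem _ hf.2.2.1 hg.2.2.1, fun m hm => by
      have : ∀ m, ∃ c : SmoothC n M, f.coeff m = fn c ∨ p + r ≤ m := fun m => by
        rcases lt_or_ge m (p + r) with h1 | h1
        · obtain ⟨c, hc⟩ := hf.2.2.2 m h1
          exact ⟨c, Or.inl hc⟩
        · exact ⟨0, Or.inr h1⟩
      -- The functions form a subring of the coefficient ring, so it suffices to look at the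
      -- individual products in the finite sum.
      have hmem : (f * g).coeff m ∈ (fnHom (n := n) (M := M)).range := by
        rw [HahnSeries.coeff_mul]
        refine Subring.sum_mem _ fun ij hij => ?_
        rw [Finset.mem_antidiagonal] at hij
        have hi : p ≤ ij.1 := by
          by_contra h0
          exact hij.1 (hf.2.1 _ (not_le.1 h0))
        have hj : q ≤ ij.2 := by
          by_contra h0
          exact hij.2.1 (hg.2.1 _ (not_le.1 h0))
        obtain ⟨c, hc⟩ := hf.2.2.2 ij.1 (by linarith [hij.2.2])
        obtain ⟨d, hd⟩ := hg.2.2.2 ij.2 (by linarith [hij.2.2])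
        exact Subring.mul_mem _ ⟨c, hc.symm⟩ ⟨d, hd.symm⟩
      obtain ⟨c, hc⟩ := hmem
      exact ⟨c, hc.symm⟩⟩
  dt {p f f'} H h := ⟨by rw [h.1], dt_mem_ordGE H h.2.1,
    formal_of_support_subset h.2.2.1 fun m h0 => by
      rw [coeff_dt, h0]
      exact map_zero (dtCoefHom H m), fun m hm => by
      obtain ⟨c, hc⟩ := h.2.2.2 m hm
      refine ⟨(-m * H) • c, ?_⟩
      rw [coeff_dt, hc, dtCoef_fn, fn, fn, AddMonoidAlgebra.smul_single, Polynomial.smul_C]⟩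
  pd {p f f'} x a h := ⟨by rw [h.1], pd_mem_ordGE x a h.2.1,
    formal_of_support_subset h.2.2.1 fun m h0 => by
      rw [coeff_pd, h0, AddMonoidAlgebra.map_zero], fun m hm => by
      obtain ⟨c, hc⟩ := h.2.2.2 m hm
      exact ⟨pderivC x a c, by rw [coeff_pd, hc, map_pderivC_fn]⟩⟩
  conj {p f f'} h := ⟨by rw [h.1], conj_mem_ordGE h.2.1,
    formal_of_support_subset h.2.2.1 fun m h0 => by
      rw [coeff_conj, h0]
      exact map_zero conjCoefHom, fun m hm => by
      obtain ⟨c, hc⟩ := h.2.2.2 m hm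
      exact ⟨conjC c, by rw [coeff_conj, hc, conjCoef_fn]⟩⟩
  serFn c := ⟨rfl, single_mem_ordGE 0 _, formal_serFn c, fun m _ => by
    rw [serFn_apply, HahnSeries.coeff_single]
    split_ifs
    · exact ⟨c, rfl⟩
    · exact ⟨0, fn_zero.symm⟩⟩
  powX α := ⟨rfl, single_mem_ordGE α _, formal_single α _, fun m _ => by
    rw [powX, HahnSeries.coeff_single]
    split_ifs
    · exact ⟨1, (map_one fnHom).symm⟩
    · exact ⟨0, fn_zero.symm⟩⟩
  complete {p f f'} h := by
    have hf : f = f' := by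
      rw [← sub_eq_zero]
      refine eq_zero_of_forall_mem_ordGE fun c => ?_
      obtain ⟨u, u', hu, h1, h2⟩ := h c
      rw [show f - f' = (f - u) - (f' - u') by rw [hu.1]; ring]
      exact Submodule.sub_mem _ h1 h2
    have key : ∀ c, ∃ u, plainRel n M r p u u ∧ ∀ m < c, f.coeff m = u.coeff m := fun c => by
      obtain ⟨u, u', hu, h1, -⟩ := h c
      refine ⟨u, ⟨rfl, hu.2⟩, fun m hm => ?_⟩
      have := h1 m hm
      rwa [HahnSeries.coeff_sub, sub_eq_zero] at this
    refine ⟨hf, fun m hm => ?_, fun c => ?_, fun m hm => ?_⟩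
    · obtain ⟨u, hu, h1⟩ := key p
      rw [h1 m hm, hu.2.1 m hm]
    · obtain ⟨u, hu, h1⟩ := key (c + 1)
      refine (hu.2.2.1 c).subset fun m hm => ⟨fun h0 => hm.1 ?_, hm.2⟩
      rw [h1 m (lt_of_le_of_lt hm.2 (by linarith)), h0]
    · obtain ⟨u, hu, h1⟩ := key (p + r)
      rw [h1 m hm]
      exact hu.2.2.2 m hm

end Weights

/-! ### Formal metrics close to a background metric -/

section Background

variable {n : ℕ} {M : Type*} [TopologicalSpace M] [ChartedSpace (Coord n) M]

/-- A matrix of real functions as a matrix of formal series. -/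
def bg (A : Matrix (Fin n) (Fin n) (SmoothR n M)) : Matrix (Fin n) (Fin n) (Ser n M) :=
  (serFn.comp ofRealCHom).mapMatrix A

theorem bg_apply (A : Matrix (Fin n) (Fin n) (SmoothR n M)) (a b : Fin n) :
    bg A a b = serFn (ofRealC (A a b)) := rfl

theorem bg_mul (A B : Matrix (Fin n) (Fin n) (SmoothR n M)) : bg (A * B) = bg A * bg B :=
  map_mul _ A B

theorem bg_one : bg (1 : Matrix (Fin n) (Fin n) (SmoothR n M)) = 1 := map_one _

theorem IsRiemannian.exists_inverse {A : Matrix (Fin n) (Fin n) (SmoothR n M)}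
    (hA : IsRiemannian A) : ∃ B : Matrix (Fin n) (Fin n) (SmoothR n M), A * B = 1 := by
  have hdet : ∀ p, 0 < A.det p := fun p => by
    have h1 : A.det p = (Matrix.of fun a b => A a b p).det := by
      have h2 := RingHom.map_det (ContMDiffMap.evalRingHom (I := 𝓡 n) (I' := 𝓘(ℝ, ℝ)) (n := ∞) p) A
      exact h2
    rw [h1]
    exact (hA p).det_pos
  obtain ⟨c, hc⟩ := exists_inverse_of_pos A.det hdet
  refine ⟨c • A.adjugate, ?_⟩
  rw [Matrix.mul_smul, Matrix.mul_adjugate, smul_smul, mul_comm, hc, one_smul]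

theorem IsRiemannian.symm {A : Matrix (Fin n) (Fin n) (SmoothR n M)}
    (hA : IsRiemannian A) (a b : Fin n) : A a b = A b a := by
  ext p
  have := (hA p).isHermitian.apply b a
  simpa using this

/-- The relative deviation `X² A⁻¹ g - 1` of a metric from the background, where `B = A⁻¹`. -/
def pert (B : Matrix (Fin n) (Fin n) (SmoothR n M)) (g : Matrix (Fin n) (Fin n) (Ser n M)) :
    Matrix (Fin n) (Fin n) (Ser n M) := (powX 2 : Ser n M) • (bg B * g) - 1

variable {A B : Matrix (Fin n) (Fin n) (SmoothR n M)}

theorem metric_eq_pert (hAB : A * B = 1) (g : Matrix (Fin n) (Fin n) (Ser n M)) :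
    g = (powX (-2) : Ser n M) • (bg A * (1 + pert B g)) := by
  rw [pert, add_sub_cancel, Matrix.mul_smul, smul_smul, powX_mul, ← mul_assoc, ← bg_mul, hAB,
    bg_one, one_mul]
  norm_num [powX_zero]

variable [IsManifold (𝓡 n) ∞ M]

/-- Two formal metrics whose relative deviations from the background are related with
weight `ε`. -/
structure NearRel (ρ : ℝ → Ser n M → Ser n M → Prop) (A B : Matrix (Fin n) (Fin n) (SmoothR n M))
    (ε : ℝ) (g g' : Matrix (Fin n) (Fin n) (Ser n M)) : Prop where
  rel : WeightRel ρ
  inv : A * B = 1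
  pos : 0 < ε
  -- Terms carrying `X²`, as the spatial curvature does, may then be counted with weight `2 * ε`.
  le_one : ε ≤ 1
  pert : ∀ a b, ρ ε (pert B g a b) (pert B g' a b)
  symm : ∀ a b, g a b = g b a
  symm' : ∀ a b, g' a b = g' b a

namespace WeightRel

variable {ρ : ℝ → Ser n M → Ser n M → Prop} {ε : ℝ} {h h' : Matrix (Fin n) (Fin n) (Ser n M)}

theorem one_entry (hρ : WeightRel ρ) (a b : Fin n) :
    ρ 0 ((1 : Matrix (Fin n) (Fin n) (Ser n M)) a b)
      ((1 : Matrix (Fin n) (Fin n) (Ser n M)) a b) := by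
  rw [Matrix.one_apply]
  split_ifs
  · exact hρ.one
  · exact hρ.zero 0

theorem matMul (hρ : WeightRel ρ) {p q r : ℝ} {S S' T T' : Matrix (Fin n) (Fin n) (Ser n M)}
    (hS : ∀ a b, ρ p (S a b) (S' a b)) (hT : ∀ a b, ρ q (T a b) (T' a b)) (hr : r ≤ p + q)
    (a b : Fin n) : ρ r ((S * T) a b) ((S' * T') a b) := by
  rw [Matrix.mul_apply, Matrix.mul_apply]
  exact hρ.usum fun c => hρ.mul (hS a c) (hT c b) hr

theorem trace (hρ : WeightRel ρ) {p : ℝ} {S S' : Matrix (Fin n) (Fin n) (Ser n M)}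
    (hS : ∀ a b, ρ p (S a b) (S' a b)) : ρ p S.trace S'.trace :=
  hρ.usum fun a => hS a a

theorem traceless (hρ : WeightRel ρ) {p : ℝ} {S S' : Matrix (Fin n) (Fin n) (Ser n M)}
    (hS : ∀ a b, ρ p (S a b) (S' a b)) (a b : Fin n) :
    ρ p (traceless S a b) (AlgESF.traceless S' a b) :=
  hρ.sub (hS a b) (hρ.mul (hρ.smul _ (hρ.trace hS)) (hρ.one_entry a b) (by linarith))

end WeightRel

/-- Congruence with precision `ε` at weight zero, applied to the matrices `1 + η` and `1`, replaces
an expansion of the determinant. -/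
theorem det_one_add_sub_one_mem {ε : ℝ} (hε : 0 ≤ ε) {η : Matrix (Fin n) (Fin n) (Ser n M)}
    (hη : ∀ a b, η a b ∈ ordGE n M ε) : 1 - (1 + η).det ∈ ordGE n M ε := by
  have hw := congRel_weightRel (n := n) (M := M) ε
  have h1 : congRel n M ε 0 (1 + η).det (1 : Matrix (Fin n) (Fin n) (Ser n M)).det := by
    refine hw.det fun a b => ?_
    have h2 := (hw.one_entry a b).1
    refine ⟨?_, h2, ?_⟩
    · exact Submodule.add_mem _ h2 (ordGE_mono hε (hη a b))
    · rw [Matrix.add_apply, add_sub_cancel_left, zero_add]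
      exact hη a b
  have h3 := Submodule.neg_mem _ h1.2.2
  rwa [Matrix.det_one, neg_sub, zero_add] at h3

theorem one_add_isUnit {ε : ℝ} (hε : 0 < ε) {η : Matrix (Fin n) (Fin n) (Ser n M)}
    (hη : ∀ a b, η a b ∈ ordGE n M ε) : IsUnit (1 + η).det := by
  have h := mul_substReal_geom hε (det_one_add_sub_one_mem hε.le hη)
  rw [sub_sub_cancel] at h
  exact IsUnit.of_mul_eq_one _ h

/-- Cramer's rule, with the inverse determinant as a geometric series in `1 - det (1 + η)`. For this
argument the relation is established at weight zero only, so `WeightRel.substReal` does not apply;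
its positive order is obtained separately and ensures convergence. -/
theorem WeightRel.inverse_one_add {ρ : ℝ → Ser n M → Ser n M → Prop} (hρ : WeightRel ρ)
    {ε : ℝ} (hε : 0 < ε) {η η' : Matrix (Fin n) (Fin n) (Ser n M)}
    (hη : ∀ a b, ρ ε (η a b) (η' a b)) (a b : Fin n) :
    ρ 0 ((1 + η)⁻¹ a b) ((1 + η')⁻¹ a b) := by
  have h0 : ∀ a b, ρ 0 ((1 + η) a b) ((1 + η') a b) := fun a b =>
    hρ.add (hρ.one_entry a b) (hρ.mono (hη a b) hε.le)
  have key : ∀ η : Matrix (Fin n) (Fin n) (Ser n M), (∀ a b, η a b ∈ ordGE n M ε) →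
      (1 + η)⁻¹ a b = AlgESF.substReal (1 - (1 + η).det) (PowerSeries.mk fun _ => 1)
        * (1 + η).adjugate a b := by
    intro η hη
    rw [Matrix.inv_def, ← inverse_one_sub hε (det_one_add_sub_one_mem hε.le hη), sub_sub_cancel]
    rfl
  rw [key η fun a b => (hρ.order (hη a b)).1, key η' fun a b => (hρ.order (hη a b)).2]
  have h1 : ρ 0 (1 - (1 + η).det) (1 - (1 + η').det) := hρ.sub hρ.one (hρ.det h0)
  refine hρ.mul ?_ (hρ.adjugate h0 a b) (by linarith : (0 : ℝ) ≤ 0 + 0)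
  have m1 := det_one_add_sub_one_mem hε.le fun a b => (hρ.order (hη a b)).1
  have m2 := det_one_add_sub_one_mem hε.le fun a b => (hρ.order (hη a b)).2
  refine hρ.complete fun c => ?_
  obtain ⟨N, hN⟩ := exists_nat_ge (c / ε)
  have aux : ∀ N : ℕ, ∃ u u', ρ 0 u u' ∧
      AlgESF.substReal (1 - (1 + η).det) (PowerSeries.mk fun _ => 1) - u ∈ ordGE n M (N * ε) ∧
      AlgESF.substReal (1 - (1 + η').det) (PowerSeries.mk fun _ => 1) - u'
        ∈ ordGE n M (N * ε) := by
    intro N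
    have hs : shiftPS (PowerSeries.mk fun _ => 1) = PowerSeries.mk fun _ => 1 := by
      ext k
      simp [shiftPS]
    induction N with
    | zero =>
      refine ⟨0, 0, hρ.zero 0, ?_, ?_⟩
      · simpa using substReal_mem_ordGE hε m1 _
      · simpa using substReal_mem_ordGE hε m2 _
    | succ N ih =>
      obtain ⟨u, u', h2, h3, h4⟩ := ih
      refine ⟨PowerSeries.coeff 0 (PowerSeries.mk fun _ => (1 : ℝ)) • 1 + (1 - (1 + η).det) * u,
        PowerSeries.coeff 0 (PowerSeries.mk fun _ => (1 : ℝ)) • 1 + (1 - (1 + η').det) * u',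
        hρ.add (hρ.const _) (hρ.mul h1 h2 (by linarith)), ?_, ?_⟩
      · rw [substReal_eq hε m1, hs, add_sub_add_left_eq_sub, ← mul_sub]
        exact ordGE_mul' m1 h3 (by push_cast; linarith)
      · rw [substReal_eq hε m2, hs, add_sub_add_left_eq_sub, ← mul_sub]
        exact ordGE_mul' m2 h4 (by push_cast; linarith)
  obtain ⟨u, u', h2, h3, h4⟩ := aux N
  have h5 := (div_le_iff₀ hε).1 hN
  exact ⟨u, u', h2, ordGE_mono h5 h3, ordGE_mono h5 h4⟩

/-! ### Formulas for the inverse metric and the second fundamental form -/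

/-- A formal metric whose relative deviation from the background has positive order. -/
structure IsNear (A B : Matrix (Fin n) (Fin n) (SmoothR n M)) (ε : ℝ)
    (g : Matrix (Fin n) (Fin n) (Ser n M)) : Prop where
  inv : A * B = 1
  pos : 0 < ε
  pert : ∀ a b, pert B g a b ∈ ordGE n M ε
  symm : ∀ a b, g a b = g b a

variable {ε : ℝ} {g g' : Matrix (Fin n) (Fin n) (Ser n M)}

theorem IsNear.inv_mul_one_add (hg : IsNear A B ε g) : (1 + AlgESF.pert B g)⁻¹ * (1 + AlgESF.pert B g) = 1 :=
  Matrix.nonsing_inv_mul _ (one_add_isUnit hg.pos hg.pert)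

theorem IsNear.mul_inverse (hg : IsNear A B ε g) :
    g * ((powX 2 : Ser n M) • ((1 + AlgESF.pert B g)⁻¹ * bg B)) = 1 := by
  have h1 := Matrix.mul_nonsing_inv _ (one_add_isUnit hg.pos hg.pert)
  have h2 := metric_eq_pert hg.inv g
  generalize AlgESF.pert B g = η at h1 h2 ⊢
  rw [h2, Matrix.smul_mul, Matrix.mul_smul, smul_smul, powX_mul, mul_assoc, ← mul_assoc (1 + _), h1,
    one_mul, ← bg_mul, hg.inv, bg_one]
  norm_num [powX_zero]

theorem IsNear.inv_eq (hg : IsNear A B ε g) :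
    g⁻¹ = (powX 2 : Ser n M) • ((1 + AlgESF.pert B g)⁻¹ * bg B) :=
  Matrix.inv_eq_right_inv hg.mul_inverse

theorem IsNear.mul_inv (hg : IsNear A B ε g) : g * g⁻¹ = 1 := by
  rw [hg.inv_eq, hg.mul_inverse]

theorem dt_bg_mul (H : ℝ) (T : Matrix (Fin n) (Fin n) (Ser n M)) :
    (bg A * T).map (dt H) = bg A * T.map (dt H) := by
  have h := map_mul_derivation (dtD H) (bg A) T
  have h2 : (bg A).map (dtD (n := n) (M := M) H) = 0 := by
    refine Matrix.ext fun a b => ?_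
    exact dt_serFn H (ofRealC (A a b))
  rw [h2, zero_mul, zero_add] at h
  exact h

theorem dt_one_add (H : ℝ) (T : Matrix (Fin n) (Fin n) (Ser n M)) :
    (1 + T).map (dt H) = T.map (dt H) := by
  refine Matrix.ext fun a b => ?_
  have h : dt H ((1 : Matrix (Fin n) (Fin n) (Ser n M)) a b) = 0 := by
    rw [Matrix.one_apply]
    split_ifs
    · exact (dtD H).map_one_eq_zero
    · exact map_zero (dtD H)
  rw [Matrix.map_apply, Matrix.add_apply, ← dtD_apply, map_add, dtD_apply, h, zero_add]
  rfl

theorem dt_powX_smul (H α : ℝ) (T : Matrix (Fin n) (Fin n) (Ser n M)) :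
    ((powX α : Ser n M) • T).map (dt H)
      = (-α * H) • ((powX α : Ser n M) • T) + (powX α : Ser n M) • T.map (dt H) := by
  refine Matrix.ext fun a b => ?_
  simp only [Matrix.map_apply, Matrix.smul_apply, Matrix.add_apply, smul_eq_mul]
  rw [← dtD_apply, Derivation.leibniz, dtD_apply, dtD_apply, dt_powX, smul_eq_mul, smul_eq_mul,
    add_comm, mul_smul_comm, mul_comm (T a b)]

theorem dt_metric (hAB : A * B = 1) (H : ℝ) (g : Matrix (Fin n) (Fin n) (Ser n M)) :
    g.map (dt H) = (2 * H) • g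
      + (powX (-2) : Ser n M) • (bg A * (AlgESF.pert B g).map (dt H)) := by
  have h2 := metric_eq_pert hAB g
  generalize AlgESF.pert B g = η at h2 ⊢
  rw [← dt_one_add H η, ← dt_bg_mul, h2, dt_powX_smul, neg_neg]

/-- The factor `X⁻²` contributes `∂_t g = 2H g`, hence the background value `-H δ`; everything else
differentiates the relative deviation. -/
theorem IsNear.kMix_eq (hg : IsNear A B ε g) (H : ℝ) :
    kMix H g = -(H • (1 : Matrix (Fin n) (Fin n) (Ser n M)))
      - (1 / 2 : ℝ) • ((1 + AlgESF.pert B g)⁻¹ * (AlgESF.pert B g).map (dt H)) := by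
  have h1 : kLow H g = (-(1 / 2) : ℝ) • g.map (dt H) := rfl
  have h2 : g⁻¹ * g = 1 := mul_eq_one_comm.1 hg.mul_inv
  have h3 : g⁻¹ * ((powX (-2) : Ser n M) • (bg A * (AlgESF.pert B g).map (dt H)))
      = (1 + AlgESF.pert B g)⁻¹ * (AlgESF.pert B g).map (dt H) := by
    rw [hg.inv_eq, Matrix.smul_mul, Matrix.mul_smul, smul_smul, powX_mul, mul_assoc,
      ← mul_assoc (bg B), ← bg_mul, mul_eq_one_comm.1 hg.inv, bg_one, one_mul]
    norm_num [powX_zero]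
  rw [kMix, raise, h1, dt_metric hg.inv, Matrix.mul_smul, Matrix.mul_add, Matrix.mul_smul, h2, h3,
    smul_add, smul_smul, neg_smul (1 / 2 : ℝ) (_ * _), ← sub_eq_add_neg, ← neg_smul]
  congr 2
  ring

/-- Isolates the linear part `-½ ∂_t η`: the remainder contains the deviation twice, which is what
gives it weight `2 * ε`. -/
theorem IsNear.kMix_add (hg : IsNear A B ε g) (H : ℝ) :
    kMix H g + H • (1 : Matrix (Fin n) (Fin n) (Ser n M))
        + (1 / 2 : ℝ) • (AlgESF.pert B g).map (dt H)
      = (1 / 2 : ℝ) • ((1 + AlgESF.pert B g)⁻¹ * AlgESF.pert B g * (AlgESF.pert B g).map (dt H)) := by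
  have h1 : (1 + AlgESF.pert B g)⁻¹ * AlgESF.pert B g = 1 - (1 + AlgESF.pert B g)⁻¹ := by
    have h2 := hg.inv_mul_one_add
    rw [mul_add, mul_one] at h2
    exact eq_sub_of_add_eq' h2
  rw [h1, hg.kMix_eq, sub_mul, one_mul, smul_sub]
  abel

theorem IsNear.inv_symm (hg : IsNear A B ε g) (a b : Fin n) : g⁻¹ a b = g⁻¹ b a :=
  inv_symm_of_symm hg.symm hg.mul_inv a b

theorem sum_comm_outer {ι S : Type*} [Fintype ι] [AddCommMonoid S] (F : ι → ι → ι → S) :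
    ∑ i, ∑ j, ∑ p, F i j p = ∑ p, ∑ j, ∑ i, F i j p := by
  rw [Finset.sum_comm]
  rw [Finset.sum_congr rfl fun j _ => Finset.sum_comm]
  exact Finset.sum_comm

theorem IsNear.kSq_eq (hg : IsNear A B ε g) (H : ℝ) :
    kSq H g = ∑ i, ∑ j, kMix H g i j * kMix H g j i := by
  have hk : ∀ a b, kLow H g a b = kLow H g b a := fun a b => by simp [kLow, hg.symm a b]
  have h1 : ∀ i j, kMix H g i j = ∑ p, g⁻¹ i p * kLow H g p j := fun i j => rfl
  have h2 : ∀ p j, kMix H g p j = ∑ i, g⁻¹ i p * kLow H g i j := fun p j => by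
    rw [h1]
    exact Finset.sum_congr rfl fun i _ => by rw [hg.inv_symm]
  have h3 : ∀ p j, kMix H g j p = ∑ q, g⁻¹ j q * kLow H g p q := fun p j => by
    rw [h1]
    exact Finset.sum_congr rfl fun i _ => by rw [hk]
  have h4 : kSq H g = ∑ i, ∑ j, ∑ p, ∑ q, kLow H g i j * (g⁻¹ i p * g⁻¹ j q * kLow H g p q) := by
    simp only [kSq, Finset.mul_sum]
  have h5 : ∑ i, ∑ j, ∑ p, ∑ q, kLow H g i j * (g⁻¹ i p * g⁻¹ j q * kLow H g p q)
      = ∑ i, ∑ j, ∑ p, g⁻¹ i p * kLow H g i j * kMix H g j p := by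
    refine Finset.sum_congr rfl fun i _ => Finset.sum_congr rfl fun j _ =>
      Finset.sum_congr rfl fun p _ => ?_
    rw [h3, Finset.mul_sum]
    exact Finset.sum_congr rfl fun q _ => by ring
  rw [h4, h5, sum_comm_outer fun i j p => g⁻¹ i p * kLow H g i j * kMix H g j p]
  refine Finset.sum_congr rfl fun p _ => Finset.sum_congr rfl fun j _ => ?_
  rw [h2 p j, Finset.sum_mul]

end Background

/-! ### Expansions about the background -/

section Expansion

variable {n : ℕ} {M : Type*} [TopologicalSpace M] [ChartedSpace (Coord n) M]
  [IsManifold (𝓡 n) ∞ M]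

theorem traceless_add (S T : Matrix (Fin n) (Fin n) (Ser n M)) :
    traceless (S + T) = traceless S + traceless T := by
  simp only [traceless, Matrix.trace_add, smul_add, add_smul]
  abel

theorem traceless_smul (c : ℝ) (S : Matrix (Fin n) (Fin n) (Ser n M)) :
    traceless (c • S) = c • traceless S := by
  rw [traceless, traceless, Matrix.trace_smul, smul_comm, smul_sub, smul_assoc c]

theorem traceless_one : traceless (1 : Matrix (Fin n) (Fin n) (Ser n M)) = 0 := by
  rcases Nat.eq_zero_or_pos n with rfl | hn
  · exact Matrix.ext fun a => a.elim0
  · have h1 : ((n : ℕ) : Ser n M) = (n : ℝ) • 1 := by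
      rw [Nat.cast_smul_eq_nsmul, nsmul_one]
    have h : ((n : ℝ)⁻¹ • ((n : ℕ) : Ser n M)) = 1 := by
      rw [h1, smul_smul, inv_mul_cancel₀ (by positivity), one_smul]
    rw [traceless, Matrix.trace_one, Fintype.card_fin, h, one_smul, sub_self]

theorem dt_add (H : ℝ) (f f' : Ser n M) : dt H (f + f') = dt H f + dt H f' := map_add (dtD H) f f'

theorem dt_sub (H : ℝ) (f f' : Ser n M) : dt H (f - f') = dt H f - dt H f' := map_sub (dtD H) f f'

theorem dt_smul (H c : ℝ) (f : Ser n M) : dt H (c • f) = c • dt H f := (dtD H).map_smul c f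

theorem dt_one (H : ℝ) : dt H (1 : Ser n M) = 0 := (dtD H).map_one_eq_zero

theorem dt_zero (H : ℝ) : dt H (0 : Ser n M) = 0 := map_zero (dtD H)

theorem dt_mul (H : ℝ) (f f' : Ser n M) : dt H (f * f') = f * dt H f' + f' * dt H f :=
  (dtD H).leibniz f f'

theorem dt_one_entry (H : ℝ) (a b : Fin n) :
    dt H ((1 : Matrix (Fin n) (Fin n) (Ser n M)) a b) = 0 := by
  rw [Matrix.one_apply]
  split_ifs
  · exact dt_one H
  · exact dt_zero H

theorem traceless_map_dt (H : ℝ) (S : Matrix (Fin n) (Fin n) (Ser n M)) :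
    traceless (S.map (dt H)) = (traceless S).map (dt H) := by
  refine Matrix.ext fun a b => ?_
  have h1 : (S.map (dt H)).trace = dt H S.trace := by
    rw [Matrix.trace, Matrix.trace, ← dtD_apply, map_sum]
    rfl
  simp only [traceless, Matrix.sub_apply, Matrix.map_apply, Matrix.smul_apply, smul_eq_mul, h1]
  rw [dt_sub, dt_mul, dt_smul, dt_one_entry, mul_zero, zero_add, mul_comm]

theorem trace_map_dt (H : ℝ) (S : Matrix (Fin n) (Fin n) (Ser n M)) :
    (S.map (dt H)).trace = dt H S.trace := by
  rw [Matrix.trace, Matrix.trace, ← dtD_apply, map_sum]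
  rfl

theorem trace_smul_one (c : ℝ) :
    (c • (1 : Matrix (Fin n) (Fin n) (Ser n M))).trace = (n * c) • 1 := by
  rw [Matrix.trace_smul, Matrix.trace_one, Fintype.card_fin, ← nsmul_one n,
    ← Nat.cast_smul_eq_nsmul ℝ n (1 : Ser n M), smul_smul, mul_comm]

variable {ρ : ℝ → Ser n M → Ser n M → Prop} {A B : Matrix (Fin n) (Fin n) (SmoothR n M)} {ε : ℝ}
  {g g' : Matrix (Fin n) (Fin n) (Ser n M)}

namespace NearRel

theorem near (h : NearRel ρ A B ε g g') : IsNear A B ε g :=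
  ⟨h.inv, h.pos, fun a b => (h.rel.order (h.pert a b)).1, h.symm⟩

theorem near' (h : NearRel ρ A B ε g g') : IsNear A B ε g' :=
  ⟨h.inv, h.pos, fun a b => (h.rel.order (h.pert a b)).2, h.symm'⟩

theorem one_add (h : NearRel ρ A B ε g g') (a b : Fin n) :
    ρ 0 ((1 + AlgESF.pert B g) a b) ((1 + AlgESF.pert B g') a b) :=
  h.rel.add (h.rel.one_entry a b) (h.rel.mono (h.pert a b) h.pos.le)

theorem metric (h : NearRel ρ A B ε g g') (a b : Fin n) : ρ (-2) (g a b) (g' a b) := by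
  have h1 := h.rel.mul (h.rel.powX (-2))
    (h.rel.matMul (fun a b => h.rel.serFn (ofRealC (A a b))) h.one_add (le_refl (0 + 0)) a b)
    (show (-2 : ℝ) ≤ -2 + (0 + 0) by norm_num)
  have e := congrFun (congrFun (metric_eq_pert h.inv g) a) b
  have e' := congrFun (congrFun (metric_eq_pert h.inv g') a) b
  rw [Matrix.smul_apply, smul_eq_mul] at e e'
  rw [e, e']
  exact h1

theorem inverse (h : NearRel ρ A B ε g g') (a b : Fin n) : ρ 2 (g⁻¹ a b) (g'⁻¹ a b) := by
  have h1 := h.rel.mul (h.rel.powX 2)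
    (h.rel.matMul (h.rel.inverse_one_add h.pos h.pert)
      (fun a b => h.rel.serFn (ofRealC (B a b))) (le_refl (0 + 0)) a b)
    (show (2 : ℝ) ≤ 2 + (0 + 0) by norm_num)
  rw [h.near.inv_eq, h.near'.inv_eq]
  exact h1

theorem dt_pert (h : NearRel ρ A B ε g g') (H : ℝ) (a b : Fin n) :
    ρ ε ((AlgESF.pert B g).map (dt H) a b) ((AlgESF.pert B g').map (dt H) a b) :=
  h.rel.dt H (h.pert a b)

theorem kMix_add (h : NearRel ρ A B ε g g') (H : ℝ) (a b : Fin n) :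
    ρ ε ((kMix H g + H • (1 : Matrix (Fin n) (Fin n) (Ser n M))) a b)
      ((kMix H g' + H • (1 : Matrix (Fin n) (Fin n) (Ser n M))) a b) := by
  have key : ∀ {g}, IsNear A B ε g → kMix H g + H • (1 : Matrix (Fin n) (Fin n) (Ser n M))
      = (-(1 / 2) : ℝ) • ((1 + AlgESF.pert B g)⁻¹ * (AlgESF.pert B g).map (dt H)) := by
    intro g hg
    rw [hg.kMix_eq, neg_smul]
    abel
  rw [key h.near, key h.near']
  exact h.rel.smul _ (h.rel.matMul (h.rel.inverse_one_add h.pos h.pert) (h.dt_pert H)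
    (zero_add ε).ge a b)

theorem kMix_add_add (h : NearRel ρ A B ε g g') (H : ℝ) (a b : Fin n) :
    ρ (2 * ε) ((kMix H g + H • (1 : Matrix (Fin n) (Fin n) (Ser n M))
        + (1 / 2 : ℝ) • (AlgESF.pert B g).map (dt H)) a b)
      ((kMix H g' + H • (1 : Matrix (Fin n) (Fin n) (Ser n M))
        + (1 / 2 : ℝ) • (AlgESF.pert B g').map (dt H)) a b) := by
  rw [h.near.kMix_add, h.near'.kMix_add]
  exact h.rel.smul _ (h.rel.matMul (h.rel.matMul (h.rel.inverse_one_add h.pos h.pert) h.pert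
    (zero_add ε).ge) (h.dt_pert H) (by linarith) a b)

theorem kMix (h : NearRel ρ A B ε g g') (H : ℝ) (a b : Fin n) :
    ρ 0 (kMix H g a b) (AlgESF.kMix H g' a b) := by
  have h1 := h.rel.sub (h.rel.mono (h.kMix_add H a b) h.pos.le)
    (h.rel.smul H (h.rel.one_entry a b))
  simpa only [Matrix.add_apply, Matrix.smul_apply, add_sub_cancel_right] using h1

theorem trK_add (h : NearRel ρ A B ε g g') (H : ℝ) :
    ρ ε (trK H g + (n * H) • 1) (trK H g' + (n * H) • 1) := by
  have h1 := h.rel.trace (h.kMix_add H)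
  rwa [Matrix.trace_add, Matrix.trace_add, trace_smul_one] at h1

theorem trK_add_add (h : NearRel ρ A B ε g g') (H : ℝ) :
    ρ (2 * ε) (trK H g + (n * H) • 1 + (1 / 2 : ℝ) • dt H (AlgESF.pert B g).trace)
      (trK H g' + (n * H) • 1 + (1 / 2 : ℝ) • dt H (AlgESF.pert B g').trace) := by
  have h1 := h.rel.trace (h.kMix_add_add H)
  rwa [Matrix.trace_add, Matrix.trace_add, Matrix.trace_add, Matrix.trace_add, trace_smul_one,
    Matrix.trace_smul, Matrix.trace_smul, trace_map_dt, trace_map_dt] at h1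

theorem trK (h : NearRel ρ A B ε g g') (H : ℝ) : ρ 0 (trK H g) (AlgESF.trK H g') :=
  h.rel.trace (h.kMix H)

theorem sigma (h : NearRel ρ A B ε g g') (H : ℝ) (a b : Fin n) :
    ρ ε (sigma H g a b) (AlgESF.sigma H g' a b) := by
  have h1 := h.rel.traceless (h.kMix_add H) a b
  rwa [traceless_add, traceless_add, traceless_smul, traceless_one, smul_zero, add_zero,
    add_zero] at h1

theorem sigma_add (h : NearRel ρ A B ε g g') (H : ℝ) (a b : Fin n) :
    ρ (2 * ε) (AlgESF.sigma H g a b + (1 / 2 : ℝ) • dt H (traceless (AlgESF.pert B g) a b))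
      (AlgESF.sigma H g' a b + (1 / 2 : ℝ) • dt H (traceless (AlgESF.pert B g') a b)) := by
  have h1 := h.rel.traceless (h.kMix_add_add H) a b
  rw [traceless_add, traceless_add, traceless_add, traceless_add, traceless_smul, traceless_one,
    smul_zero, add_zero, add_zero, traceless_smul, traceless_smul, traceless_map_dt,
    traceless_map_dt] at h1
  exact h1

theorem gam (h : NearRel ρ A B ε g g') (x : GlobalChart n M) (a b c : Fin n) :
    ρ 0 (Gam x g a b c) (Gam x g' a b c) :=
  h.rel.smul _ (h.rel.usum fun _ => h.rel.mul (h.inverse _ _)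
    (h.rel.sub (h.rel.add (h.rel.pd x _ (h.metric _ _)) (h.rel.pd x _ (h.metric _ _)))
      (h.rel.pd x _ (h.metric _ _))) (by norm_num))

theorem ricci (h : NearRel ρ A B ε g g') (x : GlobalChart n M) (a b : Fin n) :
    ρ 0 (ricci x g a b) (AlgESF.ricci x g' a b) :=
  h.rel.sub (h.rel.add (h.rel.sub (h.rel.usum fun _ => h.rel.pd x _ (h.gam x _ _ _))
    (h.rel.usum fun _ => h.rel.pd x _ (h.gam x _ _ _)))
    (h.rel.usum fun _ => h.rel.usum fun _ => h.rel.mul (h.gam x _ _ _) (h.gam x _ _ _)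
      (zero_add 0).ge))
    (h.rel.usum fun _ => h.rel.usum fun _ => h.rel.mul (h.gam x _ _ _) (h.gam x _ _ _)
      (zero_add 0).ge)

theorem ricciMix (h : NearRel ρ A B ε g g') (x : GlobalChart n M) (a b : Fin n) :
    ρ 2 (ricciMix x g a b) (AlgESF.ricciMix x g' a b) :=
  h.rel.matMul h.inverse (h.ricci x) (by norm_num) a b

theorem scal (h : NearRel ρ A B ε g g') (x : GlobalChart n M) :
    ρ 2 (scal x g) (AlgESF.scal x g') := h.rel.trace (h.ricciMix x)

/-- With `tr k` replaced by `-nH` the equation for the traceless part is linear; the error is a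
product of two small factors. Removing the matter source leaves an expression in the metric alone,
which is why no relation between the two fields is needed. -/
theorem evolTl (h : NearRel ρ A B ε g g') (x : GlobalChart n M) (P : Model) (φ φ' : Ser n M)
    (a b : Fin n) :
    ρ (2 * ε)
      (evolTl x P g φ a b - traceless (effS x P g φ) a b
        + (1 / 2 : ℝ) • (dt (P.H n) (dt (P.H n) (traceless (AlgESF.pert B g) a b))
          + (n * P.H n) • dt (P.H n) (traceless (AlgESF.pert B g) a b)))
      (AlgESF.evolTl x P g' φ' a b - traceless (effS x P g' φ') a b
        + (1 / 2 : ℝ) • (dt (P.H n) (dt (P.H n) (traceless (AlgESF.pert B g') a b))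
          + (n * P.H n) • dt (P.H n) (traceless (AlgESF.pert B g') a b))) := by
  have hρ := h.rel
  have key : ∀ (g : Matrix (Fin n) (Fin n) (Ser n M)) (φ : Ser n M),
      AlgESF.evolTl x P g φ a b - traceless (effS x P g φ) a b
        + (1 / 2 : ℝ) • (dt (P.H n) (dt (P.H n) (traceless (AlgESF.pert B g) a b))
          + (n * P.H n) • dt (P.H n) (traceless (AlgESF.pert B g) a b))
      = dt (P.H n) (AlgESF.sigma (P.H n) g a b
            + (1 / 2 : ℝ) • dt (P.H n) (traceless (AlgESF.pert B g) a b))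
        + (n * P.H n) • (AlgESF.sigma (P.H n) g a b
            + (1 / 2 : ℝ) • dt (P.H n) (traceless (AlgESF.pert B g) a b))
        - (AlgESF.trK (P.H n) g + (n * P.H n) • 1) * AlgESF.sigma (P.H n) g a b
        - traceless (AlgESF.ricciMix x g) a b := by
    intro g φ
    rw [AlgESF.evolTl, dt_add, dt_smul, add_mul, smul_mul_assoc, one_mul]
    module
  rw [key g φ, key g' φ']
  exact hρ.sub (hρ.sub (hρ.add (hρ.dt _ (h.sigma_add _ a b)) (hρ.smul _ (h.sigma_add _ a b)))
    (hρ.mul (h.trK_add _) (h.sigma _ a b) (by linarith)))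
    (hρ.traceless (fun a b => hρ.mono (h.ricciMix x a b) (by linarith [h.le_one])) a b)

/-- Writing `(tr k)²` in terms of `(tr k + nH)²` shifts its linear part into the operator, whose
damping is therefore `2nH` and not `nH`. The leftover constant `(nH)²` is grouped with the sources,
where it balances the cosmological constant. -/
theorem evolTr (h : NearRel ρ A B ε g g') (x : GlobalChart n M) (P : Model) (φ φ' : Ser n M) :
    ρ (2 * ε)
      (evolTr x P g φ + ((1 / ((n : ℝ) - 1)) • (effS x P g φ).trace
          - ((n : ℝ) / ((n : ℝ) - 1)) • effRho x P g φ + (n * P.H n) ^ 2 • 1)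
        + (1 / 2 : ℝ) • (dt (P.H n) (dt (P.H n) (AlgESF.pert B g).trace)
          + (2 * n * P.H n) • dt (P.H n) (AlgESF.pert B g).trace))
      (AlgESF.evolTr x P g' φ' + ((1 / ((n : ℝ) - 1)) • (effS x P g' φ').trace
          - ((n : ℝ) / ((n : ℝ) - 1)) • effRho x P g' φ' + (n * P.H n) ^ 2 • 1)
        + (1 / 2 : ℝ) • (dt (P.H n) (dt (P.H n) (AlgESF.pert B g').trace)
          + (2 * n * P.H n) • dt (P.H n) (AlgESF.pert B g').trace)) := by
  have hρ := h.rel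
  have key : ∀ (g : Matrix (Fin n) (Fin n) (Ser n M)) (φ : Ser n M),
      AlgESF.evolTr x P g φ + ((1 / ((n : ℝ) - 1)) • (effS x P g φ).trace
          - ((n : ℝ) / ((n : ℝ) - 1)) • effRho x P g φ + (n * P.H n) ^ 2 • 1)
        + (1 / 2 : ℝ) • (dt (P.H n) (dt (P.H n) (AlgESF.pert B g).trace)
          + (2 * n * P.H n) • dt (P.H n) (AlgESF.pert B g).trace)
      = dt (P.H n) (AlgESF.trK (P.H n) g + (n * P.H n) • 1
            + (1 / 2 : ℝ) • dt (P.H n) (AlgESF.pert B g).trace)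
        + (2 * n * P.H n) • (AlgESF.trK (P.H n) g + (n * P.H n) • 1
            + (1 / 2 : ℝ) • dt (P.H n) (AlgESF.pert B g).trace)
        - (AlgESF.trK (P.H n) g + (n * P.H n) • 1) * (AlgESF.trK (P.H n) g + (n * P.H n) • 1)
        - AlgESF.scal x g := by
    intro g φ
    have h1 : dt (P.H n) (AlgESF.trK (P.H n) g + (n * P.H n) • 1
            + (1 / 2 : ℝ) • dt (P.H n) (AlgESF.pert B g).trace)
        = dt (P.H n) (AlgESF.trK (P.H n) g)
          + (1 / 2 : ℝ) • dt (P.H n) (dt (P.H n) (AlgESF.pert B g).trace) := by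
      rw [dt_add, dt_add, dt_smul, dt_smul, dt_one, smul_zero, add_zero]
    rw [h1, AlgESF.evolTr]
    generalize AlgESF.trK (P.H n) g = u
    generalize (AlgESF.effS x P g φ).trace = v1
    generalize AlgESF.effRho x P g φ = v2
    generalize AlgESF.scal x g = v3
    generalize (AlgESF.pert B g).trace = v4
    generalize dt (P.H n) (dt (P.H n) v4) = v5
    generalize dt (P.H n) v4 = v6
    generalize dt (P.H n) u = v7
    generalize P.H n = c
    generalize 1 / ((n : ℝ) - 1) = c1
    generalize (n : ℝ) / ((n : ℝ) - 1) = c2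
    algebra
  rw [key g φ, key g' φ']
  exact hρ.sub (hρ.sub (hρ.add (hρ.dt _ (h.trK_add_add _)) (hρ.smul _ (h.trK_add_add _)))
    (hρ.mul (h.trK_add _) (h.trK_add _) (by linarith)))
    (hρ.mono (h.scal x) (by linarith [h.le_one]))

theorem trK_sq (h : NearRel ρ A B ε g g') (H : ℝ) :
    ρ ε (AlgESF.trK H g ^ 2 - (n * H) ^ 2 • 1) (AlgESF.trK H g' ^ 2 - (n * H) ^ 2 • 1) := by
  have key : ∀ u : Ser n M, u ^ 2 - (n * H) ^ 2 • 1 = (u + (n * H) • 1) * (u - (n * H) • 1) :=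
    fun u => by algebra
  rw [key, key]
  exact h.rel.mul (h.trK_add H) (h.rel.sub (h.trK H) (h.rel.const _)) (by linarith)

theorem kSq_sub (h : NearRel ρ A B ε g g') (H : ℝ) :
    ρ ε (kSq H g - (n * H ^ 2) • 1) (kSq H g' - (n * H ^ 2) • 1) := by
  have key : ∀ {g}, IsNear A B ε g → kSq H g - (n * H ^ 2) • 1
      = ((AlgESF.kMix H g + H • (1 : Matrix (Fin n) (Fin n) (Ser n M)))
        * (AlgESF.kMix H g - H • (1 : Matrix (Fin n) (Fin n) (Ser n M)))).trace := by
    intro g hg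
    have h1 : kSq H g = (AlgESF.kMix H g * AlgESF.kMix H g).trace := hg.kSq_eq H
    have h2 : (AlgESF.kMix H g + H • (1 : Matrix (Fin n) (Fin n) (Ser n M)))
        * (AlgESF.kMix H g - H • (1 : Matrix (Fin n) (Fin n) (Ser n M)))
        = AlgESF.kMix H g * AlgESF.kMix H g
          - (H ^ 2) • (1 : Matrix (Fin n) (Fin n) (Ser n M)) := by
      rw [add_mul, mul_sub, mul_sub, Matrix.mul_smul, Matrix.smul_mul, Matrix.smul_mul, mul_one,
        one_mul, Matrix.mul_smul, one_mul, smul_smul, ← sq H]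
      abel
    rw [h1, h2, Matrix.trace_sub, trace_smul_one]
  rw [key h.near, key h.near']
  exact h.rel.trace (h.rel.matMul (h.kMix_add H)
    (fun a b => h.rel.sub (h.kMix H a b) (h.rel.smul H (h.rel.one_entry a b))) (by linarith))

/-- On the background `k = -H δ` with flat spatial part, `k_ij k^ij` contributes `n H²` and `(tr
k)²` contributes `n² H²`. -/
theorem ambientScal_sub (h : NearRel ρ A B ε g g') (x : GlobalChart n M) (H : ℝ) :
    ρ ε (ambientScal x H g - (n * (n + 1) * H ^ 2) • 1)
      (ambientScal x H g' - (n * (n + 1) * H ^ 2) • 1) := by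
  have key : ∀ g : Matrix (Fin n) (Fin n) (Ser n M),
      ambientScal x H g - (n * (n + 1) * H ^ 2) • 1
      = AlgESF.scal x g - (2 : ℝ) • dt H (AlgESF.trK H g + (n * H) • 1)
        + (kSq H g - (n * H ^ 2) • 1) + (AlgESF.trK H g ^ 2 - (n * H) ^ 2 • 1) := by
    intro g
    rw [ambientScal, dt_add, dt_smul, dt_one, smul_zero, add_zero]
    module
  rw [key, key]
  exact h.rel.add (h.rel.add (h.rel.sub (h.rel.mono (h.scal x) (by linarith [h.le_one]))
    (h.rel.smul _ (h.rel.dt H (h.trK_add H)))) (h.kSq_sub H)) (h.trK_sq H)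

section Field

variable {k : ℝ} {φ φ' : Ser n M}

theorem gradUp (h : NearRel ρ A B ε g g') (x : GlobalChart n M) (hφ : ρ k φ φ') (a : Fin n) :
    ρ (k + 2) (gradUp x g φ a) (AlgESF.gradUp x g' φ' a) :=
  h.rel.usum fun _ => h.rel.mul (h.inverse _ _) (h.rel.pd x _ hφ) (by linarith)

theorem hess (h : NearRel ρ A B ε g g') (x : GlobalChart n M) (hφ : ρ k φ φ') (a b : Fin n) :
    ρ k (hess x g φ a b) (AlgESF.hess x g' φ' a b) :=
  h.rel.sub (h.rel.pd x _ (h.rel.pd x _ hφ))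
    (h.rel.usum fun _ => h.rel.mul (h.gam x _ _ _) (h.rel.pd x _ hφ) (by linarith))

theorem hessMix (h : NearRel ρ A B ε g g') (x : GlobalChart n M) (hφ : ρ k φ φ') (a b : Fin n) :
    ρ (k + 2) (raise g (AlgESF.hess x g φ) a b) (raise g' (AlgESF.hess x g' φ') a b) :=
  h.rel.matMul h.inverse (h.hess x hφ) (by linarith) a b

theorem lap (h : NearRel ρ A B ε g g') (x : GlobalChart n M) (hφ : ρ k φ φ') :
    ρ (k + 2) (lap x g φ) (AlgESF.lap x g' φ') := h.rel.trace (h.hessMix x hφ)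

theorem gradSq (h : NearRel ρ A B ε g g') (x : GlobalChart n M) (hφ : ρ k φ φ') :
    ρ (2 * k) (gradSq x g φ) (AlgESF.gradSq x g' φ') :=
  h.rel.usum fun _ => h.rel.mul (h.rel.pd x _ (h.rel.conj hφ)) (h.gradUp x hφ _) (by linarith)

end Field

end NearRel

namespace WeightRel

variable {k : ℝ} {φ φ' : Ser n M}

theorem conj_mul_self (hρ : WeightRel ρ) (hφ : ρ k φ φ') :
    ρ (2 * k) (AlgESF.conj φ * φ) (AlgESF.conj φ' * φ') :=
  hρ.mul (hρ.conj hφ) hφ (by linarith)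

theorem addCC (hρ : WeightRel ρ) (hφ : ρ k φ φ') : ρ k (addCC φ) (AlgESF.addCC φ') :=
  hρ.add hφ (hρ.conj hφ)

end WeightRel

theorem coeff_taylorV {P : Model} (hP : P.Valid n) :
    PowerSeries.coeff 0 P.taylorV = P.Λ := by
  simp [Model.taylorV, hP.V_zero]

theorem coeff_taylorV' {P : Model} (hP : P.Valid n) :
    PowerSeries.coeff 0 P.taylorV' = P.μ ^ 2 / 2 := by
  simp [Model.taylorV', hP.V_deriv]

theorem conj_mul_self_mem {k : ℝ} {φ : Ser n M} (hφ : φ ∈ ordGE n M k) (c : ℝ) :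
    c • (conj φ * φ) ∈ ordGE n M (2 * k) :=
  Submodule.smul_mem _ _ (ordGE_mul' (conj_mem_ordGE hφ) hφ (by linarith))

theorem confInv_eq (P : Model) {k : ℝ} (hk : 0 < k) {φ : Ser n M} (hφ : φ ∈ ordGE n M k) :
    confInv P φ = substReal (P.ξ • (conj φ * φ)) (PowerSeries.mk fun _ => 1) :=
  inverse_one_sub (by linarith : 0 < 2 * k) (conj_mul_self_mem hφ _)

theorem mul_confInv (P : Model) {k : ℝ} (hk : 0 < k) {φ : Ser n M} (hφ : φ ∈ ordGE n M k) :
    (1 - P.ξ • (conj φ * φ)) * confInv P φ = 1 := by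
  rw [confInv_eq P hk hφ]
  exact mul_substReal_geom (by linarith : 0 < 2 * k) (conj_mul_self_mem hφ _)

theorem Model.H_sq {P : Model} (hn : 2 ≤ n) (hP : P.Valid n) :
    P.H n ^ 2 = 2 * P.Λ / ((n : ℝ) * ((n : ℝ) - 1)) := by
  have h1 : (2 : ℝ) ≤ n := by exact_mod_cast hn
  rw [Model.H, Real.sq_sqrt]
  have := hP.Λ_pos
  have h2 : (0 : ℝ) < (n : ℝ) * ((n : ℝ) - 1) := mul_pos (by linarith) (by linarith)
  positivity

theorem Model.H_pos {P : Model} (hn : 2 ≤ n) (hP : P.Valid n) : 0 < P.H n := by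
  have h1 : (2 : ℝ) ≤ n := by exact_mod_cast hn
  rw [Model.H]
  have := hP.Λ_pos
  have h2 : (0 : ℝ) < (n : ℝ) * ((n : ℝ) - 1) := mul_pos (by linarith) (by linarith)
  positivity

/-! ### Expansions of the matter quantities and the field equation -/

section Matter

variable {P : Model} {k : ℝ} {φ φ' : Ser n M}

theorem WeightRel.potW (hρ : WeightRel ρ) (hP : P.Valid n) (hk : 0 < k) (hφ : ρ k φ φ') :
    ρ (2 * k) (potW P φ - P.Λ • 1) (AlgESF.potW P φ' - P.Λ • 1) := by
  have h1 := hρ.substReal_sub_const (by linarith : 0 < 2 * k) (hρ.conj_mul_self hφ) P.taylorV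
  rwa [coeff_taylorV hP] at h1

theorem WeightRel.potW' (hρ : WeightRel ρ) (hP : P.Valid n) (hk : 0 < k) (hφ : ρ k φ φ') :
    ρ (2 * k) (potW' P φ - (P.μ ^ 2 / 2) • 1) (AlgESF.potW' P φ' - (P.μ ^ 2 / 2) • 1) := by
  have h1 := hρ.substReal_sub_const (by linarith : 0 < 2 * k) (hρ.conj_mul_self hφ) P.taylorV'
  rwa [coeff_taylorV' hP] at h1

theorem WeightRel.confInv_sub (hρ : WeightRel ρ) (hk : 0 < k) (hφ : ρ k φ φ') :
    ρ (2 * k) (confInv P φ - 1) (confInv P φ' - 1) := by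
  have h1 := hρ.substReal_sub_const (by linarith : 0 < 2 * k)
    (hρ.smul P.ξ (hρ.conj_mul_self hφ)) (PowerSeries.mk fun _ => 1)
  rw [PowerSeries.coeff_mk, one_smul] at h1
  rwa [confInv_eq P hk (hρ.order hφ).1, confInv_eq P hk (hρ.order hφ).2]

theorem WeightRel.confInv (hρ : WeightRel ρ) (hk : 0 < k) (hφ : ρ k φ φ') :
    ρ 0 (confInv P φ) (AlgESF.confInv P φ') := by
  have h1 := hρ.add (hρ.mono (hρ.confInv_sub (P := P) hk hφ) (by linarith)) hρ.one
  simpa only [sub_add_cancel] using h1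

/-- After removal of the principal part every term is the Laplacian, which gains `X²`, or the field
(or its time derivative) times a small factor. The condition `ε ≤ 2 * k` places the potential term,
of weight `3 * k`, in weight `k + ε`. -/
theorem NearRel.fieldEq (h : NearRel ρ A B ε g g') (x : GlobalChart n M) (hP : P.Valid n)
    (hk : ε ≤ 2 * k) (hφ : ρ k φ φ') :
    ρ (k + ε)
      (fieldEq x P g φ + (dt (P.H n) (dt (P.H n) φ) + (n * P.H n) • dt (P.H n) φ
        + (P.ξ * (n * (n + 1) * P.H n ^ 2) + P.μ ^ 2) • φ))
      (AlgESF.fieldEq x P g' φ' + (dt (P.H n) (dt (P.H n) φ') + (n * P.H n) • dt (P.H n) φ'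
        + (P.ξ * (n * (n + 1) * P.H n ^ 2) + P.μ ^ 2) • φ')) := by
  have hρ := h.rel
  have hk0 : 0 < k := by linarith [h.pos]
  have key : ∀ (g : Matrix (Fin n) (Fin n) (Ser n M)) (φ : Ser n M),
      AlgESF.fieldEq x P g φ + (dt (P.H n) (dt (P.H n) φ) + (n * P.H n) • dt (P.H n) φ
        + (P.ξ * (n * (n + 1) * P.H n ^ 2) + P.μ ^ 2) • φ)
      = AlgESF.lap x g φ + (AlgESF.trK (P.H n) g + (n * P.H n) • 1) * dt (P.H n) φ
        - P.ξ • ((ambientScal x (P.H n) g - (n * (n + 1) * P.H n ^ 2) • 1) * φ)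
        - (2 : ℝ) • (φ * (AlgESF.potW' P φ - (P.μ ^ 2 / 2) • 1)) := by
    intro g φ
    rw [AlgESF.fieldEq]
    generalize AlgESF.trK (P.H n) g = u1
    generalize AlgESF.lap x g φ = u2
    generalize ambientScal x (P.H n) g = u3
    generalize AlgESF.potW' P φ = u4
    generalize dt (P.H n) (dt (P.H n) φ) = u5
    generalize dt (P.H n) φ = u6
    generalize P.H n = c1
    generalize P.ξ = c2
    generalize P.μ = c3
    algebra
  rw [key, key]
  exact hρ.sub (hρ.sub (hρ.add (hρ.mono (h.lap x hφ) (by linarith [h.le_one]))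
    (hρ.mul (h.trK_add _) (hρ.dt _ hφ) (by linarith)))
    (hρ.smul _ (hρ.mul (h.ambientScal_sub x _) hφ (by linarith))))
    (hρ.smul _ (hρ.mul hφ (hρ.potW' hP hk0 hφ) (by linarith)))

theorem addCC_smul_one (c : ℝ) (f : Ser n M) (hf : conj f = f) : addCC (c • f) = (2 * c) • f := by
  rw [addCC, conj_smul, hf]
  module

theorem conj_one_entry (a b : Fin n) : conj ((1 : Matrix (Fin n) (Fin n) (Ser n M)) a b)
    = (1 : Matrix (Fin n) (Fin n) (Ser n M)) a b := by
  rw [Matrix.one_apply]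
  split_ifs
  · exact conj_one
  · exact conj_zero

theorem addCC_add (f f' : Ser n M) : addCC (f + f') = addCC f + addCC f' := by
  rw [addCC, addCC, addCC, conj_add]
  abel

/-- Without field the stress is `-Λ δ`. Since the constant part of the potential is multiplied by
the conformal factor, subtracting it leaves a multiple of `confInv - 1`, which is again quadratic in
the field. -/
theorem NearRel.effS (h : NearRel ρ A B ε g g') (x : GlobalChart n M) (hP : P.Valid n)
    (hk : 0 < k) (hφ : ρ k φ φ') (a b : Fin n) :
    ρ (2 * k) ((effS x P g φ + P.Λ • (1 : Matrix (Fin n) (Fin n) (Ser n M))) a b)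
      ((AlgESF.effS x P g' φ' + P.Λ • (1 : Matrix (Fin n) (Fin n) (Ser n M))) a b) := by
  have hρ := h.rel
  have key : ∀ c u d : Ser n M, conj d = d → (1 / 2 : ℝ) • (c * addCC u) + P.Λ • d
      = (1 / 2 : ℝ) • (c * addCC (u + P.Λ • d)) - P.Λ • ((c - 1) * d) := by
    intro c u d hd
    rw [addCC_add, addCC_smul_one _ _ hd]
    algebra
  rw [Matrix.add_apply, Matrix.add_apply, Matrix.smul_apply, AlgESF.effS, AlgESF.effS,
    Matrix.of_apply, Matrix.of_apply, key _ _ _ (conj_one_entry a b),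
    key _ _ _ (conj_one_entry a b)]
  have hc := hρ.conj hφ
  have h1 := h.rel.one_entry (n := n) (M := M) a b
  refine hρ.sub (hρ.smul _ (hρ.mul (hρ.confInv hk hφ) (hρ.addCC ?_) (zero_add _).ge))
    (hρ.smul _ (hρ.mul (hρ.confInv_sub hk hφ) h1 (add_zero _).ge))
  have key2 : ∀ u v w d : Ser n M, u + (v - w) * d + P.Λ • d
      = u + v * d - (w - P.Λ • 1) * d := fun u v w d => by algebra
  rw [key2, key2]
  refine hρ.sub (hρ.add (hρ.sub (hρ.smul _ ?_) (hρ.smul _ ?_))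
    (hρ.mul (hρ.add (hρ.smul _ (hρ.sub ?_ ?_)) (hρ.smul _ ?_)) h1 (add_zero _).ge))
    (hρ.mul (hρ.potW hP hk hφ) h1 (add_zero _).ge)
  · exact hρ.mul (h.gradUp x hc a) (hρ.pd x b hφ) (by linarith)
  · exact hρ.mul hc (hρ.add (hρ.mono (h.hessMix x hφ a b) (by linarith))
      (hρ.mul (h.kMix _ a b) (hρ.dt _ hφ) (zero_add k).ge)) (by linarith)
  · exact h.gradSq x hφ
  · exact hρ.mul (hρ.dt _ hc) (hρ.dt _ hφ) (by linarith)
  · exact hρ.mul hc (hρ.sub (hρ.add (hρ.mono (h.lap x hφ) (by linarith))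
      (hρ.mul (h.trK _) (hρ.dt _ hφ) (zero_add k).ge)) (hρ.dt _ (hρ.dt _ hφ))) (by linarith)

theorem NearRel.effRho (h : NearRel ρ A B ε g g') (x : GlobalChart n M) (hP : P.Valid n)
    (hk : 0 < k) (hφ : ρ k φ φ') :
    ρ (2 * k) (effRho x P g φ - P.Λ • 1) (AlgESF.effRho x P g' φ' - P.Λ • 1) := by
  have hρ := h.rel
  have key : ∀ c u w : Ser n M, (1 / 2 : ℝ) • (c * addCC (u + w)) - P.Λ • 1
      = (1 / 2 : ℝ) • (c * addCC (u + (w - P.Λ • 1))) + P.Λ • (c - 1) := by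
    intro c u w
    have h1 : addCC (u + w) = addCC (u + (w - P.Λ • 1)) + addCC (P.Λ • 1) := by
      rw [← addCC_add]
      congr 1
      abel
    rw [h1, addCC_smul_one _ _ conj_one]
    algebra
  rw [AlgESF.effRho, AlgESF.effRho, key, key]
  have hc := hρ.conj hφ
  refine hρ.add (hρ.smul _ (hρ.mul (hρ.confInv hk hφ) (hρ.addCC ?_) (zero_add _).ge))
    (hρ.smul _ (hρ.confInv_sub hk hφ))
  refine hρ.add (hρ.sub (hρ.sub (hρ.smul _ ?_) (hρ.smul _ (h.gradSq x hφ))) (hρ.smul _ ?_))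
    (hρ.potW hP hk hφ)
  · exact hρ.mul (hρ.dt _ hc) (hρ.dt _ hφ) (by linarith)
  · exact hρ.mul hc (hρ.add (hρ.mono (h.lap x hφ) (by linarith))
      (hρ.mul (h.trK _) (hρ.dt _ hφ) (zero_add k).ge)) (by linarith)

theorem NearRel.effJ (h : NearRel ρ A B ε g g') (x : GlobalChart n M)
    (hk : 0 < k) (hφ : ρ k φ φ') (a : Fin n) :
    ρ (2 * k) (effJ x P g φ a) (AlgESF.effJ x P g' φ' a) := by
  have hρ := h.rel
  have hc := hρ.conj hφ
  -- Lowering the index costs weight two, which the raised gradient has gained.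
  refine hρ.usum fun i => hρ.mul (h.metric a i) (?_ : ρ (2 * k + 2) _ _) (by linarith)
  refine hρ.smul _ (hρ.mul (hρ.confInv hk hφ) (hρ.addCC ?_) (zero_add _).ge)
  refine hρ.add (hρ.neg (hρ.smul _ (hρ.mul (h.gradUp x hc i) (hρ.dt _ hφ) (by linarith))))
    (hρ.smul _ (hρ.mul hc (hρ.sub (hρ.dt _ (h.gradUp x hφ i)) (hρ.usum fun j =>
      hρ.mul (h.kMix _ i j) (h.gradUp x hφ j) (zero_add _).ge)) (by linarith)))

theorem NearRel.tracelessEffS (h : NearRel ρ A B ε g g') (x : GlobalChart n M) (hP : P.Valid n)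
    (hk : 0 < k) (hφ : ρ k φ φ') (a b : Fin n) :
    ρ (2 * k) (traceless (AlgESF.effS x P g φ) a b) (traceless (AlgESF.effS x P g' φ') a b) := by
  have h1 := h.rel.traceless (h.effS x hP hk hφ) a b
  rwa [traceless_add, traceless_add, traceless_smul, traceless_one, smul_zero, add_zero,
    add_zero] at h1

theorem NearRel.traceSource (h : NearRel ρ A B ε g g') (x : GlobalChart n M) (hn : 2 ≤ n)
    (hP : P.Valid n) (hk : 0 < k) (hφ : ρ k φ φ') :
    ρ (2 * k) ((1 / ((n : ℝ) - 1)) • (AlgESF.effS x P g φ).trace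
          - ((n : ℝ) / ((n : ℝ) - 1)) • AlgESF.effRho x P g φ + (n * P.H n) ^ 2 • 1)
      ((1 / ((n : ℝ) - 1)) • (AlgESF.effS x P g' φ').trace
          - ((n : ℝ) / ((n : ℝ) - 1)) • AlgESF.effRho x P g' φ' + (n * P.H n) ^ 2 • 1) := by
  have hn1 : (2 : ℝ) ≤ n := by exact_mod_cast hn
  -- The choice of `H`: the cosmological parts of `tr S` and `ρ` together balance `(tr k)²` on the
  -- background.
  have hc : (n * P.H n) ^ 2 = 1 / ((n : ℝ) - 1) * (n * P.Λ) + n / ((n : ℝ) - 1) * P.Λ := by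
    rw [mul_pow, Model.H_sq hn hP]
    have h2 : (n : ℝ) ≠ 0 := by linarith
    have h3 : (n : ℝ) - 1 ≠ 0 := by linarith
    field_simp
    ring
  have key : ∀ (g : Matrix (Fin n) (Fin n) (Ser n M)) (φ : Ser n M),
      (1 / ((n : ℝ) - 1)) • (AlgESF.effS x P g φ).trace
          - ((n : ℝ) / ((n : ℝ) - 1)) • AlgESF.effRho x P g φ + (n * P.H n) ^ 2 • 1
      = (1 / ((n : ℝ) - 1)) • (AlgESF.effS x P g φ
            + P.Λ • (1 : Matrix (Fin n) (Fin n) (Ser n M))).trace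
        - ((n : ℝ) / ((n : ℝ) - 1)) • (AlgESF.effRho x P g φ - P.Λ • 1) := by
    intro g φ
    rw [Matrix.trace_add, trace_smul_one, hc]
    module
  rw [key, key]
  exact h.rel.sub (h.rel.smul _ (h.rel.trace (h.effS x hP hk hφ)))
    (h.rel.smul _ (h.effRho x hP hk hφ))

end Matter

end Expansion

/-! ### The violation of the Einstein equations in the 3+1 splitting -/

section SplitViolation

open MetricConnection

variable {S : Type*} [CommRing S] [Algebra ℝ S] {ι : Type*} [Fintype ι] [DecidableEq ι]
variable {d : Derivation ℝ S S} {D : ι → Derivation ℝ S S} {g gi : Matrix ι ι S}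

theorem stress_split_ss (ξ : ℝ) (W ψ φ : S) (a b : ι) :
    stress (splitD d D) (splitG (-1) gi) (splitΓ d D g gi) ξ W ψ φ (some a) (some b)
      = (1 - 2 * ξ) • (grad D gi ψ a * D b φ)
        - (2 * ξ) • (ψ * ((gi * hessian D (chris D g gi) φ) a b + secondMix d g gi a b * d φ))
        + ((2 * ξ - 1 / 2) • (gradInner D gi ψ φ - d ψ * d φ)
            + (2 * ξ) • (ψ * (box D gi (chris D g gi) φ + (secondMix d g gi).trace * d φ
              - d (d φ))) - W) * (1 : Matrix ι ι S) a b := by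
  rw [stress, Matrix.of_apply, grad_split_s, hessianMix_split_ss, gradInner_split, box_split]
  simp only [splitD, Matrix.one_apply, Option.some.injEq]

theorem stress_split_nn (ξ : ℝ) (W ψ φ : S) :
    stress (splitD d D) (splitG (-1) gi) (splitΓ d D g gi) ξ W ψ φ none none
      = -((1 / 2 : ℝ) • (d ψ * d φ) - (2 * ξ - 1 / 2) • gradInner D gi ψ φ
        - (2 * ξ) • (ψ * (box D gi (chris D g gi) φ + (secondMix d g gi).trace * d φ)) + W) := by
  rw [stress, Matrix.of_apply, grad_split_n, mul_split_n, hessian_split_nn, gradInner_split,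
    box_split]
  simp only [splitD, Matrix.one_apply_eq]
  algebra

theorem stress_split_sn (hd : ∀ a f, d (D a f) = D a (d f)) (hs : ∀ a b, g a b = g b a)
    (hi : g * gi = 1) (ξ : ℝ) (W ψ φ : S) (a : ι) :
    stress (splitD d D) (splitG (-1) gi) (splitΓ d D g gi) ξ W ψ φ (some a) none
      = -(-((1 - 2 * ξ) • (grad D gi ψ a * d φ))
        + (2 * ξ) • (ψ * (d (grad D gi φ a)
          - ∑ i, secondMix d g gi a i * grad D gi φ i))) := by
  rw [stress, Matrix.of_apply, grad_split_s, hessianMix_split_sn hs hi]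
  simp only [splitD, Matrix.one_apply, reduceCtorEq, if_false, hd, sub_self, mul_zero,
    Finset.sum_const_zero, add_zero]
  algebra

theorem violation_apply {κ : Type*} [Fintype κ] [DecidableEq κ] {E : κ → Derivation ℝ S S}
    {G Gi : Matrix κ κ S} {Γ : κ → κ → κ → S} (hm : MetricConnection E G Gi Γ) (ξ : ℝ)
    (W ψ φ : S) (a b : κ) :
    violation E Gi Γ ξ W ψ φ a b
      = (1 - ξ • (ψ * φ)) * ((Gi * ric E Γ) a b
          - ((1 / 2 : ℝ) • (Gi * ric E Γ).trace) * (1 : Matrix κ κ S) a b)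
        - (1 / 2 : ℝ) • (stress E Gi Γ ξ W ψ φ a b + stress E Gi Γ ξ W φ ψ a b) := by
  rw [violation, hm.ricMix_eq]
  simp only [Matrix.sub_apply, Matrix.smul_apply, Matrix.add_apply, Matrix.of_apply]

end SplitViolation

/-! ### Reality -/

section Reality

variable {n : ℕ} {M : Type*} [TopologicalSpace M] [ChartedSpace (Coord n) M]

theorem conj_substReal {ε : ℝ} (hε : 0 < ε) {f : Ser n M} (hf : f ∈ ordGE n M ε)
    (P : PowerSeries ℝ) : conj (substReal f P) = substReal (conj f) P := by
  have key : ∀ N : ℕ, ∀ P : PowerSeries ℝ,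
      conj (substReal f P) - substReal (conj f) P ∈ ordGE n M (N * ε) := by
    intro N
    induction N with
    | zero =>
      intro P
      rw [Nat.cast_zero, zero_mul]
      exact Submodule.sub_mem _ (conj_mem_ordGE (substReal_mem_ordGE hε hf P))
        (substReal_mem_ordGE hε (conj_mem_ordGE hf) P)
    | succ N ih =>
      intro P
      rw [substReal_eq hε hf P, substReal_eq hε (conj_mem_ordGE hf) P, conj_add, conj_smul,
        conj_one, conj_mul, add_sub_add_left_eq_sub, ← mul_sub]
      exact ordGE_mul' (conj_mem_ordGE hf) (ih _) (by push_cast; linarith)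
  rw [← sub_eq_zero]
  refine eq_zero_of_forall_mem_ordGE fun c => ?_
  obtain ⟨N, hN⟩ := exists_nat_ge (c / ε)
  exact ordGE_mono ((div_le_iff₀ hε).1 hN) (key N P)

variable {P : Model} {k : ℝ} {φ : Ser n M}

variable [IsManifold (𝓡 n) ∞ M] {g : Matrix (Fin n) (Fin n) (Ser n M)}

theorem conj_potW (hk : 0 < k) (hφ : φ ∈ ordGE n M k) : conj (potW P φ) = potW P φ := by
  have h : conj φ * φ ∈ ordGE n M (2 * k) := ordGE_mul' (conj_mem_ordGE hφ) hφ (by linarith)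
  have h2 : conj (conj φ * φ) = conj φ * φ := by rw [conj_mul, conj_conj, mul_comm]
  have h3 := conj_substReal (by linarith : 0 < 2 * k) h P.taylorV
  rw [h2] at h3
  exact h3

theorem conj_potW' (hk : 0 < k) (hφ : φ ∈ ordGE n M k) : conj (potW' P φ) = potW' P φ := by
  have h : conj φ * φ ∈ ordGE n M (2 * k) := ordGE_mul' (conj_mem_ordGE hφ) hφ (by linarith)
  have h2 : conj (conj φ * φ) = conj φ * φ := by rw [conj_mul, conj_conj, mul_comm]
  have h3 := conj_substReal (by linarith : 0 < 2 * k) h P.taylorV'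
  rw [h2] at h3
  exact h3

theorem conj_confInv (hk : 0 < k) (hφ : φ ∈ ordGE n M k) : conj (confInv P φ) = confInv P φ := by
  have h : P.ξ • (conj φ * φ) ∈ ordGE n M (2 * k) := conj_mul_self_mem hφ _
  have h2 : conj (P.ξ • (conj φ * φ)) = P.ξ • (conj φ * φ) := by
    rw [conj_smul, conj_mul, conj_conj, mul_comm]
  have h3 := conj_substReal (by linarith : 0 < 2 * k) h (PowerSeries.mk fun _ => 1)
  rw [h2] at h3
  rw [confInv_eq P hk hφ, h3]

theorem conj_entries_mul (T U : Matrix (Fin n) (Fin n) (Ser n M)) (a b : Fin n) :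
    conj ((T * U) a b) = (T.map conj * U.map conj) a b := by
  simp only [Matrix.mul_apply, conj_sum, conj_mul, Matrix.map_apply]

/-- The conjugate of an inverse is an inverse of the conjugate, and inverses are unique. -/
theorem conj_inv (hr : ∀ a b, conj (g a b) = g a b) (hi : g * g⁻¹ = 1) (a b : Fin n) :
    conj (g⁻¹ a b) = g⁻¹ a b := by
  have h1 : g.map conj = g := Matrix.ext hr
  have h2 : g * g⁻¹.map conj = 1 := by
    refine Matrix.ext fun a b => ?_
    have h3 := conj_entries_mul g g⁻¹ a b
    rw [hi, conj_one_entry, h1] at h3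
    exact h3.symm
  have h3 := Matrix.inv_eq_right_inv h2
  conv_rhs => rw [h3]
  rfl

theorem conj_kMix (hr : ∀ a b, conj (g a b) = g a b) (hi : g * g⁻¹ = 1) (H : ℝ) (a b : Fin n) :
    conj (kMix H g a b) = kMix H g a b := by
  simp only [kMix, raise, Matrix.mul_apply, conj_sum, conj_mul, conj_inv hr hi, kLow,
    Matrix.of_apply, conj_smul, conj_dt, hr]

theorem conj_trK (hr : ∀ a b, conj (g a b) = g a b) (hi : g * g⁻¹ = 1) (H : ℝ) :
    conj (trK H g) = trK H g := by
  simp only [trK, Matrix.trace, Matrix.diag_apply, conj_sum, conj_kMix hr hi]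

variable (x : GlobalChart n M)

theorem conj_gam (hr : ∀ a b, conj (g a b) = g a b) (hi : g * g⁻¹ = 1) (a b c : Fin n) :
    conj (Gam x g a b c) = Gam x g a b c := by
  simp only [Gam, conj_smul, conj_sum, conj_mul, conj_sub, conj_add, conj_inv hr hi, conj_pd, hr]

theorem conj_gradUp (hr : ∀ a b, conj (g a b) = g a b) (hi : g * g⁻¹ = 1) (f : Ser n M)
    (a : Fin n) : conj (gradUp x g f a) = gradUp x g (conj f) a := by
  simp only [gradUp, conj_sum, conj_mul, conj_inv hr hi, conj_pd]

theorem conj_hess (hr : ∀ a b, conj (g a b) = g a b) (hi : g * g⁻¹ = 1) (f : Ser n M)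
    (a b : Fin n) : conj (hess x g f a b) = hess x g (conj f) a b := by
  simp only [hess, Matrix.of_apply, conj_sub, conj_sum, conj_mul, conj_gam x hr hi, conj_pd]

theorem conj_hessMix (hr : ∀ a b, conj (g a b) = g a b) (hi : g * g⁻¹ = 1) (f : Ser n M)
    (a b : Fin n) : conj (raise g (hess x g f) a b) = raise g (hess x g (conj f)) a b := by
  simp only [raise, Matrix.mul_apply, conj_sum, conj_mul, conj_inv hr hi, conj_hess x hr hi]

theorem conj_lap (hr : ∀ a b, conj (g a b) = g a b) (hi : g * g⁻¹ = 1) (f : Ser n M) :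
    conj (lap x g f) = lap x g (conj f) := by
  simp only [lap, Matrix.trace, Matrix.diag_apply, conj_sum, conj_hessMix x hr hi]

theorem conj_ricci (hr : ∀ a b, conj (g a b) = g a b) (hi : g * g⁻¹ = 1) (a b : Fin n) :
    conj (ricci x g a b) = ricci x g a b := by
  simp only [ricci, Matrix.of_apply, conj_sub, conj_add, conj_sum, conj_mul, conj_gam x hr hi,
    conj_pd]

theorem conj_ricciMix (hr : ∀ a b, conj (g a b) = g a b) (hi : g * g⁻¹ = 1) (a b : Fin n) :
    conj (ricciMix x g a b) = ricciMix x g a b := by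
  simp only [ricciMix, raise, Matrix.mul_apply, conj_sum, conj_mul, conj_inv hr hi,
    conj_ricci x hr hi]

theorem conj_scal (hr : ∀ a b, conj (g a b) = g a b) (hi : g * g⁻¹ = 1) :
    conj (scal x g) = scal x g := by
  simp only [scal, Matrix.trace, Matrix.diag_apply, conj_sum, conj_ricciMix x hr hi]

theorem conj_kSq (hr : ∀ a b, conj (g a b) = g a b) (hi : g * g⁻¹ = 1) (H : ℝ) :
    conj (kSq H g) = kSq H g := by
  simp only [kSq, conj_sum, conj_mul, conj_inv hr hi, kLow,
    Matrix.of_apply, conj_smul, conj_dt, hr]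

theorem conj_ambientScal (hr : ∀ a b, conj (g a b) = g a b) (hi : g * g⁻¹ = 1) (H : ℝ) :
    conj (ambientScal x H g) = ambientScal x H g := by
  simp only [ambientScal, sq, conj_add, conj_sub, conj_smul, conj_mul, conj_dt, conj_scal x hr hi,
    conj_trK hr hi, conj_kSq hr hi]

theorem conj_effS (hk : 0 < k) (hφ : φ ∈ ordGE n M k) (a b : Fin n) :
    conj (effS x P g φ a b) = effS x P g φ a b := by
  rw [effS, Matrix.of_apply, conj_smul, conj_mul, conj_addCC, conj_confInv hk hφ]

theorem conj_effRho (hk : 0 < k) (hφ : φ ∈ ordGE n M k) :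
    conj (effRho x P g φ) = effRho x P g φ := by
  rw [effRho, conj_smul, conj_mul, conj_addCC, conj_confInv hk hφ]

theorem conj_traceless {T : Matrix (Fin n) (Fin n) (Ser n M)}
    (hT : ∀ a b, conj (T a b) = T a b) (a b : Fin n) :
    conj (traceless T a b) = traceless T a b := by
  simp only [traceless, Matrix.sub_apply, Matrix.smul_apply, smul_eq_mul, conj_sub, conj_mul,
    conj_smul, Matrix.trace, Matrix.diag_apply, conj_sum, hT, conj_one_entry]

theorem conj_evolTl (hk : 0 < k) (hφ : φ ∈ ordGE n M k) (hr : ∀ a b, conj (g a b) = g a b)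
    (hi : g * g⁻¹ = 1) (a b : Fin n) : conj (evolTl x P g φ a b) = evolTl x P g φ a b := by
  have h1 : ∀ a b, conj (sigma (P.H n) g a b) = sigma (P.H n) g a b :=
    conj_traceless (conj_kMix hr hi _)
  simp only [evolTl, conj_sub, conj_add, conj_mul, conj_dt, h1,
    conj_traceless (conj_ricciMix x hr hi), conj_trK hr hi,
    conj_traceless (conj_effS x hk hφ (P := P) (g := g))]

theorem conj_evolTr (hk : 0 < k) (hφ : φ ∈ ordGE n M k) (hr : ∀ a b, conj (g a b) = g a b)
    (hi : g * g⁻¹ = 1) : conj (evolTr x P g φ) = evolTr x P g φ := by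
  have h1 : conj (effS x P g φ).trace = (effS x P g φ).trace := by
    simp only [Matrix.trace, Matrix.diag_apply, conj_sum, conj_effS x hk hφ]
  simp only [evolTr, conj_sub, conj_add, conj_mul, conj_smul, sq, conj_dt, h1,
    conj_scal x hr hi, conj_trK hr hi, conj_effRho x hk hφ]

/-- The field equation of the conjugate field. -/
theorem conj_fieldEq (hk : 0 < k) (hφ : φ ∈ ordGE n M k) (hr : ∀ a b, conj (g a b) = g a b)
    (hi : g * g⁻¹ = 1) : conj (fieldEq x P g φ)
      = lap x g (conj φ) + trK (P.H n) g * dt (P.H n) (conj φ) - dt (P.H n) (dt (P.H n) (conj φ))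
        - P.ξ • (ambientScal x (P.H n) g * conj φ) - (2 : ℝ) • (conj φ * potW' P φ) := by
  simp only [fieldEq, conj_sub, conj_add, conj_mul, conj_smul, conj_lap x hr hi,
    conj_trK hr hi, conj_ambientScal x hr hi, conj_potW' hk hφ, conj_dt]

end Reality

/-! ### Propagation of the constraints -/

section Constraints

open MetricConnection

variable {n : ℕ} {M : Type*} [TopologicalSpace M] [ChartedSpace (Coord n) M]
  [IsManifold (𝓡 n) ∞ M]
variable (x : GlobalChart n M) (P : Model) {g : Matrix (Fin n) (Fin n) (Ser n M)}
variable {k : ℝ} {φ : Ser n M}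

/-- The stress tensor of the metric `-dt² + g`. -/
def spaceStress (g : Matrix (Fin n) (Fin n) (Ser n M)) (W ψ φ : Ser n M) :
    Matrix (Option (Fin n)) (Option (Fin n)) (Ser n M) :=
  stress (splitD (dtD (P.H n)) (pdD x)) (splitG (-1) g⁻¹)
    (splitΓ (dtD (P.H n)) (pdD x) g g⁻¹) P.ξ W ψ φ

/-- The violation of the Einstein equations by the metric `-dt² + g`. -/
def einsteinViolation (g : Matrix (Fin n) (Fin n) (Ser n M)) (φ : Ser n M) :
    Matrix (Option (Fin n)) (Option (Fin n)) (Ser n M) :=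
  violation (splitD (dtD (P.H n)) (pdD x)) (splitG (-1) g⁻¹)
    (splitΓ (dtD (P.H n)) (pdD x) g g⁻¹) P.ξ (potW P φ) (conj φ) φ

/-- The Ricci tensor of the metric `-dt² + g`. -/
def spaceRicci (g : Matrix (Fin n) (Fin n) (Ser n M)) :
    Matrix (Option (Fin n)) (Option (Fin n)) (Ser n M) :=
  splitG (-1) g⁻¹ * ric (splitD (dtD (P.H n)) (pdD x)) (splitΓ (dtD (P.H n)) (pdD x) g g⁻¹)

theorem dtD_pdD_comm (H : ℝ) (a : Fin n) (f : Ser n M) :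
    dtD H (pdD x a f) = pdD x a (dtD H f) := dt_pd_comm x H a f

theorem pdD_comm (a b : Fin n) (f : Ser n M) :
    pdD x a (pdD x b f) = pdD x b (pdD x a f) := pd_comm x a b f

theorem split_connection (hs : ∀ a b, g a b = g b a) (hi : g * g⁻¹ = 1) :
    MetricConnection (splitD (dtD (P.H n)) (pdD x)) (splitG (-1) g) (splitG (-1) g⁻¹)
      (splitΓ (dtD (P.H n)) (pdD x) g g⁻¹) :=
  metricConnection_split (dtD_pdD_comm x (P.H n)) (pdD_comm x) hs hi

theorem einsteinViolation_apply (hs : ∀ a b, g a b = g b a) (hi : g * g⁻¹ = 1)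
    (a b : Option (Fin n)) :
    einsteinViolation x P g φ a b = (1 - P.ξ • (conj φ * φ)) * (spaceRicci x P g a b
          - ((1 / 2 : ℝ) • (spaceRicci x P g).trace)
            * (1 : Matrix (Option (Fin n)) (Option (Fin n)) (Ser n M)) a b)
        - (1 / 2 : ℝ) • (spaceStress x P g (potW P φ) (conj φ) φ a b
          + spaceStress x P g (potW P φ) φ (conj φ) a b) :=
  violation_apply (split_connection x P hs hi) P.ξ (potW P φ) (conj φ) φ a b

theorem spaceRicci_trace (hs : ∀ a b, g a b = g b a) (hi : g * g⁻¹ = 1)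
    (hq : kSq (P.H n) g = ∑ i, ∑ j, kMix (P.H n) g i j * kMix (P.H n) g j i) :
    (spaceRicci x P g).trace = ambientScal x (P.H n) g := by
  have h : (spaceRicci x P g).trace = scal x g - 2 * dt (P.H n) (trK (P.H n) g)
      + (∑ i, ∑ j, kMix (P.H n) g i j * kMix (P.H n) g j i) + trK (P.H n) g ^ 2 :=
    ricMix_split_trace hs hi
  rw [h, ambientScal, hq, two_mul, two_smul]

theorem spaceRicci_ss (hs : ∀ a b, g a b = g b a) (hi : g * g⁻¹ = 1) (a b : Fin n) :
    spaceRicci x P g (some a) (some b) = ricciMix x g a b - dt (P.H n) (kMix (P.H n) g a b)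
      + trK (P.H n) g * kMix (P.H n) g a b :=
  ricMix_split_ss hs hi a b

theorem spaceRicci_nn (hs : ∀ a b, g a b = g b a) (hi : g * g⁻¹ = 1)
    (hq : kSq (P.H n) g = ∑ i, ∑ j, kMix (P.H n) g i j * kMix (P.H n) g j i) :
    spaceRicci x P g none none = -(dt (P.H n) (trK (P.H n) g) - kSq (P.H n) g) := by
  have h := ric_split_nn (d := dtD (P.H n)) (D := pdD x) hs (inv_symm_of_symm hs hi)
  rw [spaceRicci, mul_split_n, h, neg_one_mul, hq]
  rfl

theorem spaceRicci_sn (hs : ∀ a b, g a b = g b a) (hi : g * g⁻¹ = 1) (a : Fin n) :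
    spaceRicci x P g (some a) none = ∑ i, g⁻¹ a i * (pd x i (trK (P.H n) g)
      - ∑ j, covMix x g (kMix (P.H n) g) j j i) := by
  have h : ∀ i, ∑ j, covMix x g (kMix (P.H n) g) j j i
      = divMix (pdD x) (chris (pdD x) g g⁻¹) (secondMix (dtD (P.H n)) g g⁻¹) i := fun i => by
    simp only [covMix, Finset.sum_add_distrib, Finset.sum_sub_distrib]
    rfl
  rw [spaceRicci, mul_split_s]
  refine Finset.sum_congr rfl fun i _ => ?_
  rw [ric_split_sn hs (inv_symm_of_symm hs hi), h]
  rfl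

theorem add_conj_eq_addCC {u v : Ser n M} (h : conj u = v) : u + v = addCC u := by rw [addCC, h]

theorem mul_conf_cancel (hk : 0 < k) (hφ : φ ∈ ordGE n M k) (u : Ser n M) :
    (1 - P.ξ • (conj φ * φ)) * ((1 / 2 : ℝ) • (confInv P φ * u)) = (1 / 2 : ℝ) • u := by
  rw [mul_smul_comm, ← mul_assoc, mul_confInv P hk hφ, one_mul]

/-- For a real metric, complex conjugation of the stress amounts to exchanging the two fields. So
the c.c. in the energy momentum tensor is the symmetrization used in the abstract divergence
computation. -/
theorem conf_mul_effS (hr : ∀ a b, conj (g a b) = g a b) (hi : g * g⁻¹ = 1) (hk : 0 < k)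
    (hφ : φ ∈ ordGE n M k) (a b : Fin n) :
    (1 / 2 : ℝ) • (spaceStress x P g (potW P φ) (conj φ) φ (some a) (some b)
          + spaceStress x P g (potW P φ) φ (conj φ) (some a) (some b))
      = (1 - P.ξ • (conj φ * φ)) * effS x P g φ a b := by
  have e1 : ∀ W ψ φ : Ser n M, spaceStress x P g W ψ φ (some a) (some b)
      = (1 - 2 * P.ξ) • (gradUp x g ψ a * pd x b φ)
    - (2 * P.ξ) • (ψ * (raise g (hess x g φ) a b + kMix (P.H n) g a b * dt (P.H n) φ))
    + ((2 * P.ξ - 1 / 2) • (gradInner (pdD x) g⁻¹ ψ φ - dt (P.H n) ψ * dt (P.H n) φ)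
        + (2 * P.ξ) • (ψ * (lap x g φ + trK (P.H n) g * dt (P.H n) φ
            - dt (P.H n) (dt (P.H n) φ)))
        - W) * (1 : Matrix (Fin n) (Fin n) (Ser n M)) a b := fun W ψ φ =>
    stress_split_ss P.ξ W ψ φ a b
  have e2 : gradInner (pdD x) g⁻¹ (conj φ) φ = gradSq x g φ := rfl
  have e3 : conj (gradSq x g φ) = gradInner (pdD x) g⁻¹ φ (conj φ) := by
    simp only [gradSq, conj_sum, conj_mul, conj_pd, conj_conj, conj_gradUp x hr hi]
    rfl
  rw [effS, Matrix.of_apply, mul_conf_cancel P hk hφ, e1, e1, e2]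
  congr 1
  refine add_conj_eq_addCC ?_
  simp only [conj_add, conj_sub, conj_mul, conj_smul, conj_conj, conj_gradUp x hr hi, conj_pd,
    conj_hessMix x hr hi, conj_kMix hr hi, conj_dt, conj_lap x hr hi, conj_trK hr hi, e3,
    conj_potW hk hφ, conj_one_entry]

theorem conf_mul_effRho (hr : ∀ a b, conj (g a b) = g a b) (hi : g * g⁻¹ = 1) (hk : 0 < k)
    (hφ : φ ∈ ordGE n M k) :
    (1 / 2 : ℝ) • (spaceStress x P g (potW P φ) (conj φ) φ none none
          + spaceStress x P g (potW P φ) φ (conj φ) none none)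
      = -((1 - P.ξ • (conj φ * φ)) * effRho x P g φ) := by
  have e1 : ∀ W ψ φ : Ser n M, spaceStress x P g W ψ φ none none
      = -((1 / 2 : ℝ) • (dt (P.H n) ψ * dt (P.H n) φ)
    - (2 * P.ξ - 1 / 2) • gradInner (pdD x) g⁻¹ ψ φ
    - (2 * P.ξ) • (ψ * (lap x g φ + trK (P.H n) g * dt (P.H n) φ)) + W) := fun W ψ φ =>
    stress_split_nn P.ξ W ψ φ
  have e2 : gradInner (pdD x) g⁻¹ (conj φ) φ = gradSq x g φ := rfl
  have e3 : conj (gradSq x g φ) = gradInner (pdD x) g⁻¹ φ (conj φ) := by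
    simp only [gradSq, conj_sum, conj_mul, conj_pd, conj_conj, conj_gradUp x hr hi]
    rfl
  rw [effRho, mul_conf_cancel P hk hφ, e1, e1, e2, ← neg_add, smul_neg]
  congr 2
  refine add_conj_eq_addCC ?_
  simp only [conj_add, conj_sub, conj_mul, conj_smul, conj_conj, conj_dt, conj_lap x hr hi,
    conj_trK hr hi, e3, conj_potW hk hφ]

theorem conf_mul_effJUp (hr : ∀ a b, conj (g a b) = g a b) (hs : ∀ a b, g a b = g b a)
    (hi : g * g⁻¹ = 1) (hk : 0 < k) (hφ : φ ∈ ordGE n M k) (a : Fin n) :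
    (1 / 2 : ℝ) • (spaceStress x P g (potW P φ) (conj φ) φ (some a) none
          + spaceStress x P g (potW P φ) φ (conj φ) (some a) none)
      = -((1 - P.ξ • (conj φ * φ)) * effJUp x P g φ a) := by
  have e1 : ∀ W ψ φ : Ser n M, spaceStress x P g W ψ φ (some a) none
      = -(-((1 - 2 * P.ξ) • (gradUp x g ψ a * dt (P.H n) φ))
    + (2 * P.ξ) • (ψ * (dt (P.H n) (gradUp x g φ a)
        - ∑ i, kMix (P.H n) g a i * gradUp x g φ i))) := fun W ψ φ =>
    stress_split_sn (dtD_pdD_comm x (P.H n)) hs hi P.ξ W ψ φ a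
  rw [effJUp, mul_conf_cancel P hk hφ, e1, e1, ← neg_add, smul_neg]
  congr 2
  refine add_conj_eq_addCC ?_
  simp only [conj_add, conj_sub, conj_mul, conj_smul, conj_conj, conj_dt, conj_gradUp x hr hi,
    conj_neg, conj_sum, conj_kMix hr hi]

/-- In the time-time component of the mixed Einstein tensor the derivative of `tr k` cancels, which
leaves half of the energy constraint. -/
theorem violation_nn (hr : ∀ a b, conj (g a b) = g a b) (hs : ∀ a b, g a b = g b a)
    (hi : g * g⁻¹ = 1) (hk : 0 < k) (hφ : φ ∈ ordGE n M k)
    (hq : kSq (P.H n) g = ∑ i, ∑ j, kMix (P.H n) g i j * kMix (P.H n) g j i) :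
    einsteinViolation x P g φ none none
      = -((1 / 2 : ℝ) • ((1 - P.ξ • (conj φ * φ)) * constrHam x P g φ)) := by
  rw [einsteinViolation_apply x P hs hi, conf_mul_effRho x P hr hi hk hφ,
    spaceRicci_trace x P hs hi hq, spaceRicci_nn x P hs hi hq, Matrix.one_apply_eq, constrHam,
    ambientScal]
  generalize (1 - P.ξ • (conj φ * φ)) = u
  generalize trK (P.H n) g = k1
  generalize dt (P.H n) k1 = k2
  generalize scal x g = k3
  generalize kSq (P.H n) g = k4
  generalize effRho x P g φ = k5
  algebra

theorem violation_sn (hr : ∀ a b, conj (g a b) = g a b) (hs : ∀ a b, g a b = g b a)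
    (hi : g * g⁻¹ = 1) (hk : 0 < k) (hφ : φ ∈ ordGE n M k) (a : Fin n) :
    einsteinViolation x P g φ (some a) none
      = -∑ i, g⁻¹ a i * ((1 - P.ξ • (conj φ * φ)) * constrMom x P g φ i) := by
  have hj : effJUp x P g φ a = ∑ i, g⁻¹ a i * effJ x P g φ i := by
    have h2 : ∀ j, ∑ i, g⁻¹ a i * g i j = (1 : Matrix (Fin n) (Fin n) (Ser n M)) a j := fun j => by
      rw [← Matrix.mul_apply, mul_eq_one_comm.1 hi]
    simp only [effJ, Finset.mul_sum]
    rw [Finset.sum_comm]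
    simp only [← mul_assoc, ← Finset.sum_mul, h2, Matrix.one_apply, ite_mul, one_mul, zero_mul,
      Finset.sum_ite_eq, Finset.mem_univ, if_true]
  have h1 : (1 : Matrix (Option (Fin n)) (Option (Fin n)) (Ser n M)) (some a) none = 0 :=
    Matrix.one_apply_ne (by simp)
  rw [einsteinViolation_apply x P hs hi, conf_mul_effJUp x P hr hs hi hk hφ,
    spaceRicci_sn x P hs hi, h1, mul_zero, sub_zero, hj, sub_neg_eq_add, ← mul_add,
    ← Finset.sum_add_distrib, Finset.mul_sum, ← Finset.sum_neg_distrib]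
  refine Finset.sum_congr rfl fun i _ => ?_
  rw [constrMom]
  ring

/-- Obtained from the component with upper spatial index by the symmetry of the lowered tensor; the
metric removes the inverse metric. -/
theorem violation_ns (hr : ∀ a b, conj (g a b) = g a b) (hs : ∀ a b, g a b = g b a)
    (hi : g * g⁻¹ = 1) (hk : 0 < k) (hφ : φ ∈ ordGE n M k) (b : Fin n) :
    einsteinViolation x P g φ none (some b)
      = (1 - P.ξ • (conj φ * φ)) * constrMom x P g φ b := by
  have h := (split_connection x P hs hi).violation_lower_symm P.ξ (potW P φ) (conj φ) φ none (some b)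
  rw [mul_split_n, mul_split_s, neg_one_mul] at h
  have h1 : -einsteinViolation x P g φ none (some b)
      = ∑ i, g b i * einsteinViolation x P g φ (some i) none := h
  have h2 : ∀ j, ∑ i, g b i * g⁻¹ i j = (1 : Matrix (Fin n) (Fin n) (Ser n M)) b j := fun j => by
    rw [← Matrix.mul_apply, hi]
  rw [← neg_inj, h1]
  simp only [violation_sn x P hr hs hi hk hφ, mul_neg, Finset.sum_neg_distrib, Finset.mul_sum]
  rw [Finset.sum_comm]
  simp only [← mul_assoc, ← Finset.sum_mul, h2]
  simp only [Matrix.one_apply, ite_mul, one_mul, zero_mul,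
    Finset.sum_ite_eq, Finset.mem_univ, if_true]

theorem traceless_apply (T : Matrix (Fin n) (Fin n) (Ser n M)) (a b : Fin n) :
    traceless T a b = T a b - (n : ℝ)⁻¹ • (T.trace * (1 : Matrix (Fin n) (Fin n) (Ser n M)) a b) := by
  rw [traceless, Matrix.sub_apply, Matrix.smul_apply, smul_eq_mul, smul_mul_assoc]

/-- The spatial components of the violation, without the contribution of the energy constraint. -/
def evolViolation (g : Matrix (Fin n) (Fin n) (Ser n M)) (φ : Ser n M) :
    Matrix (Fin n) (Fin n) (Ser n M) :=
  Matrix.of fun a b => (1 - P.ξ • (conj φ * φ)) * (-evolTl x P g φ a b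
    + (((n : ℝ) - 1) / n) • (evolTr x P g φ * (1 : Matrix (Fin n) (Fin n) (Ser n M)) a b))

/-- The evolution equations express the trace reversed Einstein equations, so the spatial Einstein
tensor differs from them by a multiple of the energy constraint. This makes the divergence identity
a system for the constraints alone, with the evolution equations as sources. -/
theorem violation_ss (hn : 2 ≤ n) (hr : ∀ a b, conj (g a b) = g a b) (hs : ∀ a b, g a b = g b a)
    (hi : g * g⁻¹ = 1) (hk : 0 < k) (hφ : φ ∈ ordGE n M k)
    (hq : kSq (P.H n) g = ∑ i, ∑ j, kMix (P.H n) g i j * kMix (P.H n) g j i) (a b : Fin n) :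
    einsteinViolation x P g φ (some a) (some b) = evolViolation x P g φ a b
      + ((1 / 2 : ℝ) • ((1 - P.ξ • (conj φ * φ)) * constrHam x P g φ))
        * (1 : Matrix (Fin n) (Fin n) (Ser n M)) a b := by
  have hn1 : (2 : ℝ) ≤ n := by exact_mod_cast hn
  have hn0 : (n : ℝ) ≠ 0 := by linarith
  have hn2 : (n : ℝ) - 1 ≠ 0 := by linarith
  have h1 : (1 : Matrix (Option (Fin n)) (Option (Fin n)) (Ser n M)) (some a) (some b)
      = (1 : Matrix (Fin n) (Fin n) (Ser n M)) a b := by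
    simp only [Matrix.one_apply, Option.some.injEq]
  have h2 : dt (P.H n) (sigma (P.H n) g a b) = dt (P.H n) (kMix (P.H n) g a b)
      - (n : ℝ)⁻¹ • (dt (P.H n) (trK (P.H n) g) * (1 : Matrix (Fin n) (Fin n) (Ser n M)) a b) := by
    rw [sigma, traceless_apply, dt_sub, dt_smul, dt_mul, dt_one_entry, mul_zero, zero_add,
      mul_comm]
    rfl
  rw [einsteinViolation_apply x P hs hi, conf_mul_effS x P hr hi hk hφ,
    spaceRicci_trace x P hs hi hq, spaceRicci_ss x P hs hi, h1, evolViolation, Matrix.of_apply,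
    evolTl, evolTr, constrHam, ambientScal, h2, sigma, traceless_apply, traceless_apply,
    traceless_apply]
  have e1 : (ricciMix x g).trace = scal x g := rfl
  have e2 : (kMix (P.H n) g).trace = trK (P.H n) g := rfl
  rw [e1, e2]
  generalize (1 - P.ξ • (conj φ * φ)) = u
  generalize (1 : Matrix (Fin n) (Fin n) (Ser n M)) a b = δ
  generalize trK (P.H n) g = k1
  generalize dt (P.H n) k1 = k2
  generalize scal x g = k3
  generalize kSq (P.H n) g = k4
  generalize effRho x P g φ = k5
  generalize (effS x P g φ).trace = k6
  generalize effS x P g φ a b = k7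
  generalize ricciMix x g a b = k8
  generalize kMix (P.H n) g a b = k9
  generalize dt (P.H n) k9 = k10
  have f1 : ((n : ℝ) - 1) / n = 1 - (n : ℝ)⁻¹ := by field_simp
  -- With the weight `(n - 1)/n` the trace equation supplies `-tr S / n`, completing the traceless
  -- stress, and `ρ` with coefficient one, which cancels against half of the energy constraint.
  have f2 : (1 - (n : ℝ)⁻¹) * (1 / ((n : ℝ) - 1)) = (n : ℝ)⁻¹ := by field_simp
  have f3 : (1 - (n : ℝ)⁻¹) * (n / ((n : ℝ) - 1)) = 1 := by field_simp
  rw [f1]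
  have f4 : (1 - (n : ℝ)⁻¹) • ((k2 - (k3 + k1 ^ 2 + (1 / ((n : ℝ) - 1)) • k6
      - ((n : ℝ) / ((n : ℝ) - 1)) • k5)) * δ)
      = (1 - (n : ℝ)⁻¹) • ((k2 - (k3 + k1 ^ 2)) * δ) - (n : ℝ)⁻¹ • (k6 * δ) + k5 * δ := by
    have : k2 - (k3 + k1 ^ 2 + (1 / ((n : ℝ) - 1)) • k6 - ((n : ℝ) / ((n : ℝ) - 1)) • k5)
        = k2 - (k3 + k1 ^ 2) - (1 / ((n : ℝ) - 1)) • k6 + ((n : ℝ) / ((n : ℝ) - 1)) • k5 := by abel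
    rw [this, add_mul, sub_mul _ (_ • k6), smul_mul_assoc, smul_mul_assoc, smul_add,
      smul_sub _ _ (_ • _), smul_smul, smul_smul, f2, f3, one_smul]
  rw [f4]
  generalize (n : ℝ)⁻¹ = c
  algebra

theorem waveEq_eq (hs : ∀ a b, g a b = g b a) (hi : g * g⁻¹ = 1)
    (hq : kSq (P.H n) g = ∑ i, ∑ j, kMix (P.H n) g i j * kMix (P.H n) g j i) (W' f : Ser n M) :
    waveEq (splitD (dtD (P.H n)) (pdD x)) (splitG (-1) g⁻¹)
      (splitΓ (dtD (P.H n)) (pdD x) g g⁻¹) P.ξ W' f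
      = lap x g f + trK (P.H n) g * dt (P.H n) f - dt (P.H n) (dt (P.H n) f)
        - P.ξ • (ambientScal x (P.H n) g * f) - (2 : ℝ) • (f * W') := by
  have h1 := spaceRicci_trace x P hs hi hq
  have h2 : box (splitD (dtD (P.H n)) (pdD x)) (splitG (-1) g⁻¹)
      (splitΓ (dtD (P.H n)) (pdD x) g g⁻¹) f
      = lap x g f + trK (P.H n) g * dt (P.H n) f - dt (P.H n) (dt (P.H n) f) := box_split f
  rw [waveEq, (split_connection x P hs hi).ricMix_eq, h2, ← h1]
  rfl

theorem coeff_taylorV'_eq (j : ℕ) : PowerSeries.coeff j P.taylorV'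
    = ((j : ℝ) + 1) * PowerSeries.coeff (j + 1) P.taylorV := by
  simp only [Model.taylorV, Model.taylorV', PowerSeries.coeff_mk, Nat.factorial_succ]
  have h1 : (j.factorial : ℝ) ≠ 0 := by positivity
  have h2 : (j : ℝ) + 1 ≠ 0 := by positivity
  push_cast
  field_simp

end Constraints

/-! ### Linear equations with constant coefficients -/

section Linear

variable {n : ℕ} {M : Type*} [TopologicalSpace M] [ChartedSpace (Coord n) M]

/-- The operator `∂_t + κ` on the coefficient of `X^m`. -/
def shiftCoef (H m : ℝ) (κ : ℂ) (q : Coef n M) : Coef n M := dtCoef H m q + fn (cstC κ) * q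

theorem coeff_fn_mul (f : SmoothC n M) (q : Coef n M) (s : ℝ) :
    (fn f * q).coeff s = Polynomial.C f * q.coeff s := by
  rw [fn, AddMonoidAlgebra.coeff_single_zero_mul]

theorem coeff_shiftCoef (H m s : ℝ) (κ : ℂ) (q : Coef n M) :
    (shiftCoef H m κ q).coeff s
      = Polynomial.C (cstC (κ - ((m : ℂ) + Complex.I * (s : ℂ)) * (H : ℂ))) * q.coeff s
        + Polynomial.derivative (q.coeff s) := by
  rw [shiftCoef, AddMonoidAlgebra.coeff_add, Finsupp.add_apply, coeff_fn_mul, coeff_dtCoef,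
    sub_eq_add_neg, ← neg_mul, map_add, Polynomial.C_add]
  ring

theorem fn_cstC_mul (r : ℝ) (q : Coef n M) : fn (cstC (r : ℂ)) * q = r • q := by
  apply AddMonoidAlgebra.coeff_injective
  ext1 s
  ext1 l
  rw [coeff_fn_mul, AddMonoidAlgebra.coeff_smul, Finsupp.smul_apply, Polynomial.coeff_smul,
    Polynomial.coeff_C_mul, smul_eq_cstC_mul]

/-- The derivative lowers the degree in `Z`, so the leading coefficient is only multiplied by `α`.
-/
theorem eq_zero_of_mul_add_derivative {α : ℂ} (h : α ≠ 0) {q : Polynomial (SmoothC n M)}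
    (hq : Polynomial.C (cstC α) * q + Polynomial.derivative q = 0) : q = 0 := by
  by_contra h0
  have h1 := congrArg (fun p => Polynomial.coeff p q.natDegree) hq
  simp only [Polynomial.coeff_add, Polynomial.coeff_C_mul, Polynomial.coeff_derivative,
    Polynomial.coeff_zero, Polynomial.coeff_natDegree,
    Polynomial.coeff_eq_zero_of_natDegree_lt (Nat.lt_succ_self q.natDegree), zero_mul,
    add_zero] at h1
  have h2 := congrArg (fun f => cstC α⁻¹ * f) h1
  simp only [← mul_assoc, ← map_mul, inv_mul_cancel₀ h, map_one, one_mul, mul_zero] at h2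
  exact h0 (Polynomial.leadingCoeff_eq_zero.1 h2)

/-- Division by `α` solves the equation up to a derivative of lower degree, which is treated by
induction. -/
theorem exists_mul_add_derivative {α : ℂ} (h : α ≠ 0) (r : Polynomial (SmoothC n M)) :
    ∃ q, Polynomial.C (cstC α) * q + Polynomial.derivative q = r := by
  have key : ∀ N : ℕ, ∀ r : Polynomial (SmoothC n M), r.natDegree < N →
      ∃ q, Polynomial.C (cstC α) * q + Polynomial.derivative q = r := by
    intro N
    induction N with
    | zero => exact fun r hr => absurd hr (Nat.not_lt_zero _)
    | succ N ih =>
      intro r hr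
      have e : Polynomial.C (cstC α) * (Polynomial.C (cstC α⁻¹) * r) = r := by
        rw [← mul_assoc, ← Polynomial.C_mul, ← map_mul, mul_inv_cancel₀ h, map_one,
          Polynomial.C_1, one_mul]
      rcases Nat.eq_zero_or_pos r.natDegree with h0 | h0
      · refine ⟨Polynomial.C (cstC α⁻¹) * r, ?_⟩
        rw [e, Polynomial.eq_C_of_natDegree_eq_zero h0, ← Polynomial.C_mul,
          Polynomial.derivative_C, add_zero]
      · have hd : (-Polynomial.derivative (Polynomial.C (cstC α⁻¹) * r)).natDegree < N := by
          rw [Polynomial.natDegree_neg]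
          rw [Polynomial.derivative_C_mul]
          refine lt_of_le_of_lt (Polynomial.natDegree_C_mul_le _ _) ?_
          exact lt_of_lt_of_le (Polynomial.natDegree_derivative_lt h0.ne') (Nat.lt_succ_iff.1 hr)
        obtain ⟨q, hq⟩ := ih _ hd
        refine ⟨Polynomial.C (cstC α⁻¹) * r + q, ?_⟩
        rw [mul_add, e, Polynomial.derivative_add,
          show ∀ a b c d : Polynomial (SmoothC n M), a + b + (c + d) = a + c + (b + d) from
            fun a b c d => by ring, hq]
        ring
  exact key _ r (Nat.lt_succ_self _)

theorem shiftCoef_injective {H m : ℝ} {κ : ℂ}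
    (h : ∀ s : ℝ, κ - ((m : ℂ) + Complex.I * (s : ℂ)) * (H : ℂ) ≠ 0) {q : Coef n M}
    (hq : shiftCoef H m κ q = 0) : q = 0 := by
  apply AddMonoidAlgebra.coeff_injective
  ext1 s
  refine eq_zero_of_mul_add_derivative (h s) ?_
  rw [← coeff_shiftCoef, hq]
  rfl

theorem shiftCoef_surjective {H m : ℝ} {κ : ℂ}
    (h : ∀ s : ℝ, κ - ((m : ℂ) + Complex.I * (s : ℂ)) * (H : ℂ) ≠ 0) (r : Coef n M) :
    ∃ q, shiftCoef H m κ q = r := by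
  choose F hF using fun s => exists_mul_add_derivative (n := n) (M := M) (h s)
  refine ⟨AddMonoidAlgebra.ofCoeff (Finsupp.onFinset r.coeff.support (fun s => F s (r.coeff s))
    fun s hs => ?_), ?_⟩
  · rw [Finsupp.mem_support_iff]
    intro h0
    refine hs (eq_zero_of_mul_add_derivative (h s) ?_)
    rw [hF, h0]
  · apply AddMonoidAlgebra.coeff_injective
    ext1 s
    rw [coeff_shiftCoef]
    exact hF s _

/-- The frequency `s` changes the imaginary part only, so invertibility for all frequencies at once
is a condition on the real exponent. -/
theorem re_shift_ne_zero {H m : ℝ} {κ : ℂ} (h : κ.re ≠ m * H) (s : ℝ) :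
    κ - ((m : ℂ) + Complex.I * (s : ℂ)) * (H : ℂ) ≠ 0 := by
  intro h0
  have h1 := congrArg Complex.re h0
  simp at h1
  exact h (by linarith)

theorem mem_ordGE_of_dt_add {H c p : ℝ} (h : ∀ m < p, c ≠ m * H) {f : Ser n M}
    (hf : dt H f + c • f ∈ ordGE n M p) : f ∈ ordGE n M p := by
  intro m hm
  have h1 := hf m hm
  rw [HahnSeries.coeff_add, coeff_smul, coeff_dt, ← fn_cstC_mul] at h1
  exact shiftCoef_injective (re_shift_ne_zero (by simpa using h m hm)) h1

end Linear

/-! ### Propagation of the constraints -/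

section Propagation

open MetricConnection

variable {n : ℕ} {M : Type*} [TopologicalSpace M] [ChartedSpace (Coord n) M]
  [IsManifold (𝓡 n) ∞ M]
variable (x : GlobalChart n M) (P : Model) {g : Matrix (Fin n) (Fin n) (Ser n M)}
variable {k : ℝ} {φ : Ser n M}

theorem splitD_mem_ordGE (H : ℝ) (b : Option (Fin n)) {p : ℝ} {f : Ser n M}
    (hf : f ∈ ordGE n M p) : splitD (dtD H) (pdD x) b f ∈ ordGE n M p := by
  cases b with
  | none => exact dt_mem_ordGE H hf
  | some a => exact pd_mem_ordGE x a hf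

theorem splitD_potW (hk : 0 < k) (hφ : φ ∈ ordGE n M k) (b : Option (Fin n)) :
    splitD (dtD (P.H n)) (pdD x) b (potW P φ)
      = potW' P φ * splitD (dtD (P.H n)) (pdD x) b (conj φ * φ) :=
  derivation_substReal _ (fun _ _ hf => splitD_mem_ordGE x _ b hf) (by linarith : 0 < 2 * k)
    (ordGE_mul' (conj_mem_ordGE hφ) hφ (by linarith)) _ _
    fun j => by rw [coeff_taylorV'_eq, mul_comm]

theorem div_einsteinViolation (hr : ∀ a b, conj (g a b) = g a b) (hs : ∀ a b, g a b = g b a)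
    (hi : g * g⁻¹ = 1) (hk : 0 < k) (hφ : φ ∈ ordGE n M k)
    (hq : kSq (P.H n) g = ∑ i, ∑ j, kMix (P.H n) g i j * kMix (P.H n) g j i)
    (b : Option (Fin n)) :
    divMix (splitD (dtD (P.H n)) (pdD x)) (splitΓ (dtD (P.H n)) (pdD x) g g⁻¹)
        (einsteinViolation x P g φ) b
      = -((1 / 2 : ℝ) • (fieldEq x P g φ * splitD (dtD (P.H n)) (pdD x) b (conj φ)
        + conj (fieldEq x P g φ) * splitD (dtD (P.H n)) (pdD x) b φ)) := by
  have h := (split_connection x P hs hi).divMix_violation P.ξ (ψ := conj φ) (φ := φ)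
    (splitD_potW x P hk hφ) b
  rw [waveEq_eq x P hs hi hq, waveEq_eq x P hs hi hq, ← conj_fieldEq x hk hφ hr hi] at h
  exact h

/-- The time component of the divergence identity. The time-time component and the trace of the
spatial ones each contribute `½ (tr k) u`, which doubles the damping to `2nH`; the momentum
constraint enters only through its divergence, with raised index. -/
theorem dt_energy (hn : 2 ≤ n) (hr : ∀ a b, conj (g a b) = g a b) (hs : ∀ a b, g a b = g b a)
    (hi : g * g⁻¹ = 1) (hk : 0 < k) (hφ : φ ∈ ordGE n M k)
    (hq : kSq (P.H n) g = ∑ i, ∑ j, kMix (P.H n) g i j * kMix (P.H n) g j i) {u : Ser n M}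
    (hu : u = (1 - P.ξ • (conj φ * φ)) * constrHam x P g φ) :
    dt (P.H n) u + (2 * (n * P.H n)) • u
      = (2 : ℝ) • ((trK (P.H n) g + (n * P.H n) • 1) * u
        + ((∑ a, pd x a (einsteinViolation x P g φ (some a) none))
          + ∑ a, ∑ c, Gam x g a a c * einsteinViolation x P g φ (some c) none)
        + (∑ a, ∑ c, kMix (P.H n) g c a * evolViolation x P g φ a c)
        + (1 / 2 : ℝ) • (fieldEq x P g φ * dt (P.H n) (conj φ)
            + conj (fieldEq x P g φ) * dt (P.H n) φ)) := by
  have h := div_einsteinViolation x P hr hs hi hk hφ hq none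
  rw [divMix_split_n hs (inv_symm_of_symm hs hi)] at h
  simp only [violation_ss x P hn hr hs hi hk hφ hq, mul_add, Finset.sum_add_distrib] at h
  have h1 : ∑ a, ∑ c, secondMix (dtD (P.H n)) g g⁻¹ c a
      * (((1 / 2 : ℝ) • ((1 - P.ξ • (conj φ * φ)) * constrHam x P g φ))
        * (1 : Matrix (Fin n) (Fin n) (Ser n M)) a c) = (1 / 2 : ℝ) • (trK (P.H n) g * u) := by
    simp only [Matrix.one_apply, mul_ite, mul_one, mul_zero, Finset.sum_ite_eq, Finset.mem_univ,
      if_true, ← hu, mul_smul_comm, ← Finset.smul_sum, ← Finset.sum_mul]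
    rfl
  rw [h1, violation_nn x P hr hs hi hk hφ hq, ← hu, map_neg, Derivation.map_smul] at h
  have e1 : dtD (P.H n) u = dt (P.H n) u := rfl
  have e2 : (secondMix (dtD (P.H n)) g g⁻¹).trace = trK (P.H n) g := rfl
  rw [e1, e2] at h
  have e3 : (∑ a, pd x a (einsteinViolation x P g φ (some a) none))
          + ∑ a, ∑ c, Gam x g a a c * einsteinViolation x P g φ (some c) none
      = (∑ a, (pdD x a) (einsteinViolation x P g φ (some a) none))
          + ∑ a, ∑ c, chris (pdD x) g g⁻¹ a a c * einsteinViolation x P g φ (some c) none := rfl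
  have e4 : ∑ a, ∑ c, kMix (P.H n) g c a * evolViolation x P g φ a c
      = ∑ a, ∑ c, secondMix (dtD (P.H n)) g g⁻¹ c a * evolViolation x P g φ a c := rfl
  have e5 : (1 / 2 : ℝ) • (fieldEq x P g φ * dt (P.H n) (conj φ)
        + conj (fieldEq x P g φ) * dt (P.H n) φ)
      = (1 / 2 : ℝ) • (fieldEq x P g φ * splitD (dtD (P.H n)) (pdD x) none (conj φ)
        + conj (fieldEq x P g φ) * splitD (dtD (P.H n)) (pdD x) none φ) := rfl
  rw [e3, e4, e5]
  rw [← sub_eq_zero] at h ⊢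
  generalize (1 / 2 : ℝ) • (fieldEq x P g φ * splitD (dtD (P.H n)) (pdD x) none (conj φ)
        + conj (fieldEq x P g φ) * splitD (dtD (P.H n)) (pdD x) none φ) = z1 at h ⊢
  generalize ∑ a, ∑ c, secondMix (dtD (P.H n)) g g⁻¹ c a * evolViolation x P g φ a c = z2 at h ⊢
  generalize ∑ a, ∑ c, chris (pdD x) g g⁻¹ a a c * einsteinViolation x P g φ (some c) none = z3
    at h ⊢
  generalize ∑ a, (pdD x a) (einsteinViolation x P g φ (some a) none) = z4 at h ⊢
  generalize trK (P.H n) g = z5 at h ⊢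
  generalize dt (P.H n) u = z6 at h ⊢
  generalize n * P.H n = c
  rw [show (0 : Ser n M) = (-2 : ℝ) • 0 by rw [smul_zero], ← h]
  clear h e3 e4 e5 h1
  algebra

theorem sum_mul_neg_sum {S ι : Type*} [CommRing S] [Fintype ι] {gi : Matrix ι ι S}
    (hgi : ∀ a b, gi a b = gi b a) (T : Matrix ι ι S) (h : ι → S) (b : ι) :
    ∑ a, T a b * -∑ i, gi a i * h i = -∑ c, (gi * T) c b * h c := by
  simp only [mul_neg, Finset.sum_neg_distrib, Finset.mul_sum, Matrix.mul_apply, Finset.sum_mul]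
  rw [Finset.sum_comm]
  refine congrArg Neg.neg (Finset.sum_congr rfl fun i _ => Finset.sum_congr rfl fun j _ => ?_)
  rw [hgi i j]
  ring

/-- The spatial components of the divergence identity. Their two contractions of the second
fundamental form with the momentum constraint cancel by symmetry, so that only the trace remains.
The gradient of `u` appears without a gain of order. -/
theorem dt_momentum (hn : 2 ≤ n) (hr : ∀ a b, conj (g a b) = g a b) (hs : ∀ a b, g a b = g b a)
    (hi : g * g⁻¹ = 1) (hk : 0 < k) (hφ : φ ∈ ordGE n M k)
    (hq : kSq (P.H n) g = ∑ i, ∑ j, kMix (P.H n) g i j * kMix (P.H n) g j i) {u : Ser n M}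
    (hu : u = (1 - P.ξ • (conj φ * φ)) * constrHam x P g φ) {h : Fin n → Ser n M}
    (hh : h = fun b => (1 - P.ξ • (conj φ * φ)) * constrMom x P g φ b) (b : Fin n) :
    dt (P.H n) (h b) + (n * P.H n) • h b
      = (trK (P.H n) g + (n * P.H n) • 1) * h b - (1 / 2 : ℝ) • pd x b u
        - divMix (pdD x) (Gam x g) (evolViolation x P g φ) b
        - (1 / 2 : ℝ) • (fieldEq x P g φ * pd x b (conj φ)
            + conj (fieldEq x P g φ) * pd x b φ) := by
  have h0 := div_einsteinViolation x P hr hs hi hk hφ hq (some b)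
  rw [divMix_split_s hs (inv_symm_of_symm hs hi)] at h0
  have hns : ∀ b, einsteinViolation x P g φ none (some b) = h b := fun b => by
    rw [violation_ns x P hr hs hi hk hφ, hh]
  have hsn : ∀ a, einsteinViolation x P g φ (some a) none = -∑ i, g⁻¹ a i * h i := fun a => by
    rw [violation_sn x P hr hs hi hk hφ, hh]
  have hss : (Matrix.of fun a b => einsteinViolation x P g φ (some a) (some b))
      = evolViolation x P g φ
        + Matrix.of fun a b => ((1 / 2 : ℝ) • u) * (1 : Matrix (Fin n) (Fin n) (Ser n M)) a b := by
    refine Matrix.ext fun a b => ?_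
    rw [Matrix.of_apply, violation_ss x P hn hr hs hi hk hφ hq, ← hu]
    rfl
  have h1 : ∑ a, secondForm (dtD (P.H n)) g a b * -∑ i, g⁻¹ a i * h i
      = -∑ c, secondMix (dtD (P.H n)) g g⁻¹ c b * h c :=
    sum_mul_neg_sum (inv_symm_of_symm hs hi) _ h b
  simp only [hns, hsn] at h0
  rw [h1, hss, divMix_add, divMix_scalar, Derivation.map_smul] at h0
  have e1 : dtD (P.H n) (h b) = dt (P.H n) (h b) := rfl
  have e2 : (secondMix (dtD (P.H n)) g g⁻¹).trace = trK (P.H n) g := rfl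
  have e3 : divMix (pdD x) (chris (pdD x) g g⁻¹) (evolViolation x P g φ) b
      = divMix (pdD x) (Gam x g) (evolViolation x P g φ) b := rfl
  have e4 : pdD x b u = pd x b u := rfl
  have e5 : (1 / 2 : ℝ) • (fieldEq x P g φ * splitD (dtD (P.H n)) (pdD x) (some b) (conj φ)
        + conj (fieldEq x P g φ) * splitD (dtD (P.H n)) (pdD x) (some b) φ)
      = (1 / 2 : ℝ) • (fieldEq x P g φ * pd x b (conj φ)
        + conj (fieldEq x P g φ) * pd x b φ) := rfl
  rw [e1, e2, e3, e4, e5] at h0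
  rw [← sub_eq_zero] at h0 ⊢
  rw [← h0, add_mul, smul_mul_assoc, one_mul]
  abel

/-- The constraints hold up to relative order `n` if the evolution equations do. -/
theorem constraints_mem {A B : Matrix (Fin n) (Fin n) (SmoothR n M)} {ε : ℝ} (hn : 2 ≤ n)
    (hP : P.Valid n) (hN : NearRel (congRel n M 0) A B ε g g) (hr : ∀ a b, conj (g a b) = g a b)
    (hk : 0 < k) (hφ : φ ∈ ordGE n M k) (hE : ∀ a b, evolTl x P g φ a b ∈ ordGE n M n)
    (hE' : evolTr x P g φ ∈ ordGE n M n) (hF : fieldEq x P g φ ∈ ordGE n M n) :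
    constrHam x P g φ ∈ ordGE n M n ∧ ∀ a, constrMom x P g φ a ∈ ordGE n M n := by
  have hn1 : (2 : ℝ) ≤ n := by exact_mod_cast hn
  have hρ := hN.rel
  have hs := hN.symm
  have hi := hN.near.mul_inv
  have hq := hN.near.kSq_eq (P.H n)
  have hH := Model.H_pos hn hP
  have hφ' : congRel n M 0 k φ φ := ⟨hφ, hφ, by rw [sub_self]; exact Submodule.zero_mem _⟩
  have hcf : (1 - P.ξ • (conj φ * φ)) ∈ ordGE n M 0 :=
    Submodule.sub_mem _ one_mem_ordGE (ordGE_mono (by linarith) (conj_mul_self_mem hφ P.ξ))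
  have hcfi : confInv P φ ∈ ordGE n M 0 := (hρ.order (hρ.confInv (P := P) hk hφ')).1
  -- The conformal factor has an inverse of order zero, so rescaling the constraints by it loses
  -- nothing.
  have back : ∀ {p f}, (1 - P.ξ • (conj φ * φ)) * f ∈ ordGE n M p → f ∈ ordGE n M p := by
    intro p f hf
    have h1 : f = confInv P φ * ((1 - P.ξ • (conj φ * φ)) * f) := by
      rw [← mul_assoc, mul_comm (confInv P φ), mul_confInv P hk hφ, one_mul]
    rw [h1]
    exact ordGE_mul' hcfi hf (zero_add p).ge
  obtain ⟨u, hu⟩ : ∃ u, u = (1 - P.ξ • (conj φ * φ)) * constrHam x P g φ := ⟨_, rfl⟩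
  obtain ⟨h, hh⟩ : ∃ h : Fin n → Ser n M,
    h = fun b => (1 - P.ξ • (conj φ * φ)) * constrMom x P g φ b := ⟨_, rfl⟩
  have hX : ∀ a b, evolViolation x P g φ a b ∈ ordGE n M n := fun a b =>
    ordGE_mul' hcf (Submodule.add_mem _ (Submodule.neg_mem _ (hE a b)) (Submodule.smul_mem _ _
      (ordGE_mul' hE' (hρ.order (hρ.one_entry a b)).1 (add_zero _).ge))) (zero_add _).ge
  have hG : ∀ a b c, Gam x g a b c ∈ ordGE n M 0 := fun a b c => (hρ.order (hN.gam x a b c)).1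
  have hK : ∀ a b, kMix (P.H n) g a b ∈ ordGE n M 0 := fun a b => (hρ.order (hN.kMix _ a b)).1
  have ht : trK (P.H n) g + (n * P.H n) • 1 ∈ ordGE n M ε := (hρ.order (hN.trK_add _)).1
  have hgi : ∀ a b, g⁻¹ a b ∈ ordGE n M 2 := fun a b => (hρ.order (hN.inverse a b)).1
  have hR : ∀ f f' : Ser n M, f ∈ ordGE n M k → f' ∈ ordGE n M k → (1 / 2 : ℝ) • (fieldEq x P g φ * f
      + conj (fieldEq x P g φ) * f') ∈ ordGE n M n := fun f f' hf hf' =>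
    Submodule.smul_mem _ _ (Submodule.add_mem _ (ordGE_mul' hF hf (by linarith))
      (ordGE_mul' (conj_mem_ordGE hF) hf' (by linarith)))
  have hC0 : constrHam x P g φ ∈ ordGE n M 0 := by
    have h1 : kSq (P.H n) g ∈ ordGE n M 0 := by
      rw [hq]
      exact Submodule.sum_mem _ fun i _ => Submodule.sum_mem _ fun j _ =>
        ordGE_mul' (hK i j) (hK j i) (zero_add 0).ge
    have h2 : trK (P.H n) g ∈ ordGE n M 0 := (hρ.order (hN.trK _)).1
    have h3 : effRho x P g φ ∈ ordGE n M 0 := by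
      have h4 := (hρ.order (hN.effRho x hP hk hφ')).1
      have h5 := Submodule.add_mem _ (ordGE_mono (by linarith : (0 : ℝ) ≤ 2 * k) h4)
        (Submodule.smul_mem _ P.Λ one_mem_ordGE)
      rwa [sub_add_cancel] at h5
    refine Submodule.sub_mem _ (Submodule.add_mem _ (Submodule.sub_mem _
      (ordGE_mono (by norm_num) (hρ.order (hN.scal x)).1) h1) ?_) (Submodule.smul_mem _ _ h3)
    rw [sq]
    exact ordGE_mul' h2 h2 (zero_add 0).ge
  have hM0 : ∀ a, constrMom x P g φ a ∈ ordGE n M 0 := fun a => by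
    refine Submodule.sub_mem _ (Submodule.sub_mem _ (Submodule.sum_mem _ fun i _ => ?_)
      (pd_mem_ordGE x a (hρ.order (hN.trK _)).1))
      (ordGE_mono (by linarith) (hρ.order (hN.effJ x hk hφ' a)).1)
    exact Submodule.sub_mem _ (Submodule.add_mem _ (pd_mem_ordGE x i (hK i a))
      (Submodule.sum_mem _ fun j _ => ordGE_mul' (hG _ _ _) (hK _ _) (zero_add 0).ge))
      (Submodule.sum_mem _ fun j _ => ordGE_mul' (hG _ _ _) (hK _ _) (zero_add 0).ge)
  -- Both constraints gain `ε` per step, up to `n`. In each step the energy constraint comes first,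
  -- because its improved gradient is needed for the momentum constraint.
  have step : ∀ j : ℕ, u ∈ ordGE n M (min (j * ε) n) ∧ ∀ b, h b ∈ ordGE n M (min (j * ε) n) := by
    intro j
    induction j with
    | zero =>
      have e : min (((0 : ℕ) : ℝ) * ε) n = 0 := by
        rw [Nat.cast_zero, zero_mul, min_eq_left (by linarith)]
      rw [e, hu, hh]
      exact ⟨ordGE_mul' hcf hC0 (zero_add 0).ge, fun b => ordGE_mul' hcf (hM0 b) (zero_add 0).ge⟩
    | succ j ih =>
      obtain ⟨ihu, ihh⟩ := ih
      set m := min ((j : ℝ) * ε) n with hm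
      have hm' : min (((j + 1 : ℕ) : ℝ) * ε) n ≤ m + ε := by
        rw [hm]
        rcases le_total ((j : ℝ) * ε) n with h1 | h1
        · rw [min_eq_left h1]
          exact (min_le_left _ _).trans (by push_cast; linarith)
        · rw [min_eq_right h1]
          exact (min_le_right _ _).trans (by linarith [hN.pos])
      have hmn : min (((j + 1 : ℕ) : ℝ) * ε) n ≤ n := min_le_right _ _
      set m' := min (((j + 1 : ℕ) : ℝ) * ε) n
      have hle := hN.le_one
      -- Raising the index gives the momentum terms weight two, more than the required gain.
      have hV : ∀ a, einsteinViolation x P g φ (some a) none ∈ ordGE n M m' := fun a => by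
        rw [violation_sn x P hr hs hi hk hφ]
        refine Submodule.neg_mem _ (Submodule.sum_mem _ fun i _ => ?_)
        have h1 := ihh i
        rw [hh] at h1
        exact ordGE_mul' (hgi a i) h1 (by linarith)
      have hu' : u ∈ ordGE n M m' := by
        refine mem_ordGE_of_dt_add (H := P.H n) (c := 2 * (n * P.H n)) (fun q hq => ?_) ?_
        -- A resonance would need `q = 2n`, whereas `q < n`.
        · rw [← mul_assoc]
          exact fun h0 => by linarith [mul_right_cancel₀ hH.ne' h0]
        · rw [dt_energy x P hn hr hs hi hk hφ hq hu]
          refine Submodule.smul_mem _ _ (Submodule.add_mem _ (Submodule.add_mem _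
            (Submodule.add_mem _ (ordGE_mul' ht ihu (by linarith)) (Submodule.add_mem _
            (Submodule.sum_mem _ fun a _ => pd_mem_ordGE x a (hV a)) (Submodule.sum_mem _
            fun a _ => Submodule.sum_mem _ fun c _ => ordGE_mul' (hG _ _ _) (hV c) (zero_add _).ge)))
            (Submodule.sum_mem _ fun a _ => Submodule.sum_mem _ fun c _ =>
              ordGE_mul' (hK _ _) (hX _ _) (by linarith))) (ordGE_mono hmn (hR _ _
            (dt_mem_ordGE _ (conj_mem_ordGE hφ)) (dt_mem_ordGE _ hφ))))
      refine ⟨hu', fun b => ?_⟩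
      refine mem_ordGE_of_dt_add (H := P.H n) (c := n * P.H n) (fun q hq => ?_) ?_
      -- Here the resonance lies exactly at `n`, the order at which the statement stops.
      · exact fun h0 => by linarith [mul_right_cancel₀ hH.ne' h0]
      · rw [dt_momentum x P hn hr hs hi hk hφ hq hu hh]
        refine Submodule.sub_mem _ (Submodule.sub_mem _ (Submodule.sub_mem _
          (ordGE_mul' ht (ihh b) (by linarith)) (Submodule.smul_mem _ _ (pd_mem_ordGE x b hu')))
          (ordGE_mono hmn ?_)) (ordGE_mono hmn (hR _ _
            (pd_mem_ordGE x b (conj_mem_ordGE hφ)) (pd_mem_ordGE x b hφ)))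
        exact Submodule.sub_mem _ (Submodule.add_mem _
          (Submodule.sum_mem _ fun a _ => pd_mem_ordGE x a (hX _ _))
          (Submodule.sum_mem _ fun a _ => Submodule.sum_mem _ fun c _ =>
            ordGE_mul' (hG _ _ _) (hX _ _) (zero_add _).ge))
          (Submodule.sum_mem _ fun a _ => Submodule.sum_mem _ fun c _ =>
            ordGE_mul' (hG _ _ _) (hX _ _) (zero_add _).ge)
  obtain ⟨j, hj⟩ := exists_nat_ge ((n : ℝ) / ε)
  obtain ⟨h1, h2⟩ := step j
  rw [min_eq_right ((div_le_iff₀ hN.pos).1 hj)] at h1 h2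
  rw [hu] at h1
  rw [hh] at h2
  exact ⟨back h1, fun a => back (h2 a)⟩

end Propagation

/-! ### The characteristic exponents -/

namespace Model

variable {n : ℕ} {P : Model}

theorem k₁_add_k₂ : P.k₁ n + P.k₂ n = n := by
  rw [k₁, k₂]
  split_ifs <;> ring

theorem exponents_of_lt (hn : 2 ≤ n) (hP : P.Valid n) (h : P.μ ^ 2 < P.K n) :
    P.k₁ n < P.k₂ n ∧ P.freq n = 0 := by
  rw [k₁, k₂, freq, if_neg h.le.not_gt, if_neg h.le.not_gt, if_neg h.le.not_gt]
  have h1 : 0 < √(P.K n - P.μ ^ 2) / P.H n := div_pos (Real.sqrt_pos.2 (by linarith)) (H_pos hn hP)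
  exact ⟨by linarith, rfl⟩

theorem exponents_of_le (h : P.K n ≤ P.μ ^ 2) : P.k₁ n = n / 2 ∧ P.k₂ n = n / 2 := by
  rw [k₁, k₂]
  split_ifs with h1
  · exact ⟨rfl, rfl⟩
  · have h2 : P.K n - P.μ ^ 2 = 0 := by linarith [not_lt.1 h1]
    rw [h2, Real.sqrt_zero, zero_div, sub_zero, add_zero]
    exact ⟨rfl, rfl⟩

theorem lt_K_of_k₁_lt (h : P.k₁ n < P.k₂ n) : P.μ ^ 2 < P.K n := by
  by_contra h1
  rw [(exponents_of_le (not_lt.1 h1)).1, (exponents_of_le (not_lt.1 h1)).2] at h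
  exact lt_irrefl _ h

variable (P n) in
/-- The effective squared mass. -/
def effMass : ℝ := P.ξ * (n * (n + 1) * P.H n ^ 2) + P.μ ^ 2

/-- Together with `k₁_add_k₂` this says that sum and product of the characteristic roots are the
coefficients of the linearized field equation, up to powers of `H`. -/
theorem effMass_eq (hn : 2 ≤ n) (hP : P.Valid n) :
    (P.k₁ n * P.k₂ n + P.freq n ^ 2) * P.H n ^ 2 = P.effMass n := by
  have hH := (H_pos hn hP).ne'
  have e : P.K n = ((n : ℝ) ^ 2 / 4 - P.ξ * (n : ℝ) * ((n : ℝ) + 1)) * P.H n ^ 2 := rfl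
  rw [k₁, k₂, freq, effMass]
  split_ifs with h
  · rw [div_pow, Real.sq_sqrt (by linarith), e]
    field_simp
    ring
  · have h1 : (√(P.K n - P.μ ^ 2) / P.H n) ^ 2 = (P.K n - P.μ ^ 2) / P.H n ^ 2 := by
      rw [div_pow, Real.sq_sqrt (by linarith [not_lt.1 h])]
    have h2 : ((n : ℝ) / 2 - √(P.K n - P.μ ^ 2) / P.H n) * (n / 2 + √(P.K n - P.μ ^ 2) / P.H n)
        = n ^ 2 / 4 - (√(P.K n - P.μ ^ 2) / P.H n) ^ 2 := by ring
    rw [h2, h1, e]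
    field_simp
    ring

/-- In the non-oscillatory case the mass condition makes the product `k₁ k₂` positive, and the sum
of the exponents is `n`. -/
theorem k₁_pos (hn : 2 ≤ n) (hP : P.Valid n) : 0 < P.k₁ n := by
  have hn1 : (2 : ℝ) ≤ n := by exact_mod_cast hn
  rcases lt_or_ge (P.μ ^ 2) (P.K n) with h | h
  · have h1 := effMass_eq hn hP
    have h2 := exponents_of_lt hn hP h
    have h3 : 0 < P.effMass n := by
      rw [effMass]
      linarith [hP.mass]
    rw [h2.2] at h1
    have h4 := k₁_add_k₂ (n := n) (P := P)
    have hH := H_pos hn hP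
    by_contra h5
    have h6 : P.k₁ n * P.k₂ n ≤ 0 :=
      mul_nonpos_of_nonpos_of_nonneg (not_lt.1 h5) (by linarith [not_lt.1 h5])
    have h7 : (P.k₁ n * P.k₂ n + 0 ^ 2) * P.H n ^ 2 ≤ 0 :=
      mul_nonpos_of_nonpos_of_nonneg (by linarith) (by positivity)
    linarith
  · rw [(exponents_of_le h).1]
    linarith

end Model

/-! ### The linearized field equation -/

section Wave

variable {n : ℕ} {M : Type*} [TopologicalSpace M] [ChartedSpace (Coord n) M]

/-- The principal part of the field equation on the coefficient of `X^p`. -/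
def waveCoef (P : Model) (p : ℝ) (q : Coef n M) : Coef n M :=
  dtCoef (P.H n) p (dtCoef (P.H n) p q) + (n * P.H n) • dtCoef (P.H n) p q + P.effMass n • q

/-- The principal part of the field equation. -/
def waveOp (P : Model) (f : Ser n M) : Ser n M :=
  dt (P.H n) (dt (P.H n) f) + (n * P.H n) • dt (P.H n) f + P.effMass n • f

theorem coeff_waveOp (P : Model) (f : Ser n M) (p : ℝ) :
    (waveOp P f).coeff p = waveCoef P p (f.coeff p) := rfl

theorem dtCoef_add (H p : ℝ) (q r : Coef n M) :
    dtCoef H p (q + r) = dtCoef H p q + dtCoef H p r := map_add (dtCoefHom H p) q r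

theorem dtCoef_zero (H p : ℝ) : dtCoef H p (0 : Coef n M) = 0 := map_zero (dtCoefHom H p)

theorem waveCoef_add (P : Model) (p : ℝ) (q r : Coef n M) :
    waveCoef P p (q + r) = waveCoef P p q + waveCoef P p r := by
  simp only [waveCoef, dtCoef_add, smul_add]
  abel

theorem waveCoef_zero (P : Model) (p : ℝ) : waveCoef P p (0 : Coef n M) = 0 := by
  simp only [waveCoef, dtCoef_zero, smul_zero, add_zero]

variable [IsManifold (𝓡 n) ∞ M]

theorem waveOp_sub (P : Model) (f f' : Ser n M) : waveOp P (f - f') = waveOp P f - waveOp P f' := by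
  simp only [waveOp, dt_sub, smul_sub]
  abel

/-- Factorization by the characteristic roots. Their product is real because either the frequency
vanishes or the exponents coincide. -/
theorem waveCoef_eq {P : Model} (hn : 2 ≤ n) (hP : P.Valid n) (p : ℝ) (q : Coef n M) :
    waveCoef P p q
      = shiftCoef (P.H n) p (((P.k₁ n : ℂ) + Complex.I * P.freq n) * P.H n)
        (shiftCoef (P.H n) p (((P.k₂ n : ℂ) - Complex.I * P.freq n) * P.H n) q) := by
  have e1 : (((P.k₁ n : ℂ) + Complex.I * P.freq n) * P.H n)
      + (((P.k₂ n : ℂ) - Complex.I * P.freq n) * P.H n) = ((n * P.H n : ℝ) : ℂ) := by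
    rw [← Model.k₁_add_k₂ (n := n) (P := P)]
    push_cast
    ring
  have e2 : (((P.k₁ n : ℂ) + Complex.I * P.freq n) * P.H n)
      * (((P.k₂ n : ℂ) - Complex.I * P.freq n) * P.H n) = ((P.effMass n : ℝ) : ℂ) := by
    have h : ((P.k₂ n : ℂ) - P.k₁ n) * P.freq n = 0 := by
      rcases lt_or_ge (P.μ ^ 2) (P.K n) with h | h
      · rw [(Model.exponents_of_lt hn hP h).2]
        simp
      · rw [(Model.exponents_of_le h).1, (Model.exponents_of_le h).2]
        simp
    rw [← Model.effMass_eq hn hP]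
    push_cast
    linear_combination (Complex.I * P.H n ^ 2) * h - (P.freq n * P.H n : ℂ) ^ 2 * Complex.I_sq
  generalize (((P.k₁ n : ℂ) + Complex.I * P.freq n) * P.H n) = κ at e1 e2 ⊢
  generalize (((P.k₂ n : ℂ) - Complex.I * P.freq n) * P.H n) = κ' at e1 e2 ⊢
  have e1' := congrArg (fun z => Polynomial.C (cstC (n := n) (M := M) z)) e1
  have e2' := congrArg (fun z => Polynomial.C (cstC (n := n) (M := M) z)) e2
  simp only [map_add, map_mul] at e1' e2'
  apply AddMonoidAlgebra.coeff_injective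
  ext1 s
  rw [coeff_shiftCoef, coeff_shiftCoef, waveCoef, ← fn_cstC_mul, ← fn_cstC_mul]
  simp only [AddMonoidAlgebra.coeff_add, Finsupp.add_apply, coeff_fn_mul, coeff_dtCoef, neg_mul,
    map_sub, map_neg, Polynomial.derivative_add, Polynomial.derivative_C_mul]
  rw [← e1', ← e2']
  simp only [Polynomial.derivative_sub, Polynomial.derivative_C, Polynomial.derivative_mul,
    Polynomial.derivative_neg, sub_zero, zero_mul]
  ring

theorem waveCoef_injective {P : Model} (hn : 2 ≤ n) (hP : P.Valid n) {p : ℝ} (h1 : p ≠ P.k₁ n)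
    (h2 : p ≠ P.k₂ n) {q : Coef n M} (hq : waveCoef P p q = 0) : q = 0 := by
  have hH := (Model.H_pos hn hP).ne'
  rw [waveCoef_eq hn hP] at hq
  refine shiftCoef_injective (re_shift_ne_zero ?_) (shiftCoef_injective (re_shift_ne_zero ?_) hq)
  · simpa [hH] using h2.symm
  · simpa [hH] using h1.symm

theorem waveCoef_surjective {P : Model} (hn : 2 ≤ n) (hP : P.Valid n) {p : ℝ} (h1 : p ≠ P.k₁ n)
    (h2 : p ≠ P.k₂ n) (r : Coef n M) : ∃ q, waveCoef P p q = r := by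
  have hH := (Model.H_pos hn hP).ne'
  obtain ⟨q₁, hq₁⟩ := shiftCoef_surjective (H := P.H n) (m := p)
    (κ := ((P.k₁ n : ℂ) + Complex.I * P.freq n) * P.H n)
    (re_shift_ne_zero (by simpa [hH] using h1.symm)) r
  obtain ⟨q, hq⟩ := shiftCoef_surjective (H := P.H n) (m := p)
    (κ := ((P.k₂ n : ℂ) - Complex.I * P.freq n) * P.H n)
    (re_shift_ne_zero (by simpa [hH] using h2.symm)) q₁
  exact ⟨q, by rw [waveCoef_eq hn hP, hq, hq₁]⟩

theorem waveCoef_fn (P : Model) (p : ℝ) (f : SmoothC n M) :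
    waveCoef P p (fn f) = ((p ^ 2 - n * p) * P.H n ^ 2 + P.effMass n) • fn f := by
  rw [waveCoef, dtCoef_fn, dtCoef_smul, dtCoef_fn]
  module

theorem dtCoef_fn_varZ (H p : ℝ) (f : SmoothC n M) :
    dtCoef H p (fn f * varZ) = (-p * H) • (fn f * varZ) + fn f := by
  have h : dtCoef H (p + 0) (fn f * varZ) = _ := dtCoef_mul H p 0 (fn f) varZ
  have h1 : dtCoef H 0 (varZ : Coef n M) = 1 := by
    rw [varZ, dtCoef_single, AddMonoidAlgebra.one_def]
    simp
  rw [add_zero, dtCoef_fn, h1, mul_one, smul_mul_assoc] at h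
  exact h

theorem waveCoef_fn_varZ (P : Model) (p : ℝ) (f : SmoothC n M) :
    waveCoef P p (fn f * varZ) = ((p ^ 2 - n * p) * P.H n ^ 2 + P.effMass n) • (fn f * varZ)
      + ((n - 2 * p) * P.H n) • fn f := by
  rw [waveCoef, dtCoef_fn_varZ, dtCoef_add, dtCoef_smul, dtCoef_fn, dtCoef_fn_varZ]
  module

theorem shiftCoef_fn_powY (H p s : ℝ) (κ : ℂ) (f : SmoothC n M) :
    shiftCoef H p κ (fn f * powY s)
      = fn (cstC (κ - ((p : ℂ) + Complex.I * (s : ℂ)) * (H : ℂ)) * f) * powY s := by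
  have e : ∀ f : SmoothC n M, fn f * powY s = AddMonoidAlgebra.single s (Polynomial.C f) :=
    fun f => by rw [fn, powY, AddMonoidAlgebra.single_mul_single, zero_add, mul_one]
  rw [e, e, shiftCoef, dtCoef_single, fn, AddMonoidAlgebra.single_mul_single, zero_add,
    ← AddMonoidAlgebra.single_add, Polynomial.derivative_C, add_zero, ← Polynomial.C_mul,
    ← Polynomial.C_mul, ← Polynomial.C_add, ← add_mul, ← map_add]
  congr 5
  ring

/-- The leading coefficient of the field. -/
def leadCoef (P : Model) (φ₀ φ₁ : SmoothC n M) : Coef n M :=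
  open Classical in
  if P.μ ^ 2 < P.K n then fn φ₀
  else if P.μ ^ 2 = P.K n then fn φ₀ + fn φ₁ * varZ
  else fn φ₀ * powY (-P.freq n) + fn φ₁ * powY (P.freq n)

theorem indicial_eq {P : Model} (hn : 2 ≤ n) (hP : P.Valid n) (h : P.μ ^ 2 ≤ P.K n) (p : ℝ) :
    (p ^ 2 - n * p) * P.H n ^ 2 + P.effMass n = (p - P.k₁ n) * (p - P.k₂ n) * P.H n ^ 2 := by
  have h1 : P.freq n = 0 := by rw [Model.freq, if_neg h.not_gt]
  rw [← Model.effMass_eq hn hP, h1, ← Model.k₁_add_k₂ (n := n) (P := P)]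
  ring

/-- At a simple real root functions are annihilated; at a double root the factor `n - 2k₁` vanishes
as well, which admits `Z`. For complex roots each first order factor annihilates one of the two
oscillating terms. -/
theorem waveCoef_leadCoef {P : Model} (hn : 2 ≤ n) (hP : P.Valid n) (φ₀ φ₁ : SmoothC n M) :
    waveCoef P (P.k₁ n) (leadCoef P φ₀ φ₁) = 0 := by
  rw [leadCoef]
  split_ifs with h1 h2
  · rw [waveCoef_fn, indicial_eq hn hP h1.le, sub_self, zero_mul, zero_mul, zero_smul]
  · have h3 : (n : ℝ) - 2 * P.k₁ n = 0 := by
      rw [(Model.exponents_of_le h2.ge).1]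
      ring
    rw [waveCoef_add, waveCoef_fn, waveCoef_fn_varZ, indicial_eq hn hP h2.le, h3]
    simp
  · have h3 : P.K n ≤ P.μ ^ 2 := not_lt.1 h1
    have h4 := Model.exponents_of_le h3
    rw [waveCoef_eq hn hP, h4.1, h4.2]
    have hadd : ∀ κ : ℂ, ∀ q r : Coef n M, shiftCoef (P.H n) (n / 2) κ (q + r)
        = shiftCoef (P.H n) (n / 2) κ q + shiftCoef (P.H n) (n / 2) κ r := fun κ q r => by
      rw [shiftCoef, shiftCoef, shiftCoef, dtCoef_add, mul_add]
      abel
    rw [hadd, hadd]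
    simp only [shiftCoef_fn_powY]
    have e1 : (((((n : ℝ) / 2 : ℝ) : ℂ) - Complex.I * P.freq n) * P.H n)
        - (((n : ℝ) / 2 : ℝ) + Complex.I * ((-P.freq n : ℝ) : ℂ)) * P.H n = 0 := by
      push_cast
      ring
    have e2 : (((((n : ℝ) / 2 : ℝ) : ℂ) + Complex.I * P.freq n) * P.H n)
        - (((n : ℝ) / 2 : ℝ) + Complex.I * ((P.freq n : ℝ) : ℂ)) * P.H n = 0 := by
      push_cast
      ring
    rw [e1, e2, map_zero, zero_mul, zero_mul, mul_zero, fn_zero, zero_mul, zero_mul, add_zero]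

theorem fn_smul (c : ℝ) (f : SmoothC n M) : c • fn f = fn (c • f) := by
  rw [fn, fn, AddMonoidAlgebra.smul_single, Polynomial.smul_C]

/-- The solutions of the linearized field equation used in the construction. -/
theorem exists_waveCoef_eq {P : Model} (hn : 2 ≤ n) (hP : P.Valid n) (φ₁ : SmoothC n M) {p : ℝ}
    (hp : P.k₁ n < p) (r : Coef n M) (hr : p ≤ P.k₂ n → ∃ c, r = fn c) :
    ∃ q, waveCoef P p q = r ∧ (r = 0 → p ≠ P.k₂ n → q = 0) ∧ (p < P.k₂ n → ∃ c, q = fn c) ∧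
      (p = P.k₂ n → ∃ χ, q = fn φ₁ + fn χ * varZ) := by
  have hH := Model.H_pos hn hP
  rcases lt_trichotomy p (P.k₂ n) with h | h | h
  · obtain ⟨c, hc⟩ := hr h.le
    have hK := Model.lt_K_of_k₁_lt (hp.trans h)
    have h0 : (p - P.k₁ n) * (p - P.k₂ n) * P.H n ^ 2 ≠ 0 := by
      have h1 : p - P.k₁ n ≠ 0 := by linarith
      have h2 : p - P.k₂ n ≠ 0 := by linarith
      positivity
    refine ⟨fn (((p - P.k₁ n) * (p - P.k₂ n) * P.H n ^ 2)⁻¹ • c), ?_, fun h1 _ => ?_,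
      fun _ => ⟨_, rfl⟩, fun h1 => absurd h1 h.ne⟩
    · rw [waveCoef_fn, indicial_eq hn hP hK.le, fn_smul, smul_smul, mul_inv_cancel₀ h0, one_smul,
        hc]
    · rw [← fn_smul, ← hc, h1, smul_zero]
  · obtain ⟨c, hc⟩ := hr h.le
    have hK := Model.lt_K_of_k₁_lt (h ▸ hp)
    -- Resonance: functions are annihilated, so `φ₁` may be prescribed, while a multiple of `Z` is
    -- mapped to this nonzero multiple of its coefficient function and absorbs the source.
    have h0 : (n - 2 * P.k₂ n) * P.H n ≠ 0 := by
      have h1 : (n : ℝ) - 2 * P.k₂ n ≠ 0 := by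
        rw [← Model.k₁_add_k₂ (n := n) (P := P), ← h]
        linarith
      positivity
    refine ⟨fn φ₁ + fn (((n - 2 * P.k₂ n) * P.H n)⁻¹ • c) * varZ, ?_, fun _ h1 => absurd h h1,
      fun h1 => absurd h h1.ne, fun _ => ⟨_, rfl⟩⟩
    rw [waveCoef_add, waveCoef_fn, waveCoef_fn_varZ, indicial_eq hn hP hK.le, h, sub_self,
      mul_zero, zero_mul, zero_smul, zero_smul, zero_add, zero_add, fn_smul, smul_smul,
      mul_inv_cancel₀ h0, one_smul, hc]
  · obtain ⟨q, hq⟩ := waveCoef_surjective hn hP hp.ne' h.ne' r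
    exact ⟨q, hq, fun h1 _ => waveCoef_injective hn hP hp.ne' h.ne' (hq.trans h1),
      fun h1 => absurd h h1.not_gt, fun h1 => absurd h1 h.ne'⟩

end Wave

/-! ### Coefficientwise rescaling -/

section Rescaling

variable {n : ℕ} {M : Type*} [TopologicalSpace M] [ChartedSpace (Coord n) M]

/-- The multiplication of the coefficient of `X^p` by a real number depending on `p`. -/
def scaleSer (c : ℝ → ℝ) (f : Ser n M) : Ser n M where
  coeff p := c p • f.coeff p
  isPWO_support' := f.isPWO_support.mono fun p hp h0 => hp (by simp [h0])

theorem coeff_scaleSer (c : ℝ → ℝ) (f : Ser n M) (p : ℝ) :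
    (scaleSer c f).coeff p = c p • f.coeff p := rfl

theorem scaleSer_add (c : ℝ → ℝ) (f f' : Ser n M) :
    scaleSer c (f + f') = scaleSer c f + scaleSer c f' := by
  ext p : 2
  simp only [coeff_scaleSer, HahnSeries.coeff_add, smul_add]

theorem scaleSer_zero (c : ℝ → ℝ) : scaleSer c (0 : Ser n M) = 0 := by
  ext p : 2
  simp only [coeff_scaleSer, HahnSeries.coeff_zero, smul_zero]

theorem scaleSer_sum {ι : Type*} (s : Finset ι) (c : ℝ → ℝ) (F : ι → Ser n M) :
    scaleSer c (∑ i ∈ s, F i) = ∑ i ∈ s, scaleSer c (F i) := by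
  classical
  induction s using Finset.induction_on with
  | empty => simp [scaleSer_zero]
  | insert i s hi ih => rw [Finset.sum_insert hi, Finset.sum_insert hi, scaleSer_add, ih]

theorem serFn_mul_scaleSer (c : ℝ → ℝ) (h : SmoothC n M) (f : Ser n M) :
    serFn h * scaleSer c f = scaleSer c (serFn h * f) := by
  ext p : 2
  rw [serFn_apply, HahnSeries.coeff_single_zero_mul, coeff_scaleSer, coeff_scaleSer,
    HahnSeries.coeff_single_zero_mul, mul_smul_comm]

theorem conj_scaleSer (c : ℝ → ℝ) (f : Ser n M) :
    conj (scaleSer c f) = scaleSer c (conj f) := by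
  ext p : 2
  rw [coeff_conj, coeff_scaleSer, coeff_scaleSer, coeff_conj]
  exact conjCoef_smul _ _

theorem scaleSer_mem_ordGE {c : ℝ → ℝ} {m : ℝ} (hc : ∀ p < m, c p = 0) (f : Ser n M) :
    scaleSer c f ∈ ordGE n M m := fun p hp => by
  rw [coeff_scaleSer, hc p hp, zero_smul]

theorem scaleSer_congr {c : ℝ → ℝ} {m m' : ℝ} (hc : ∀ p, c p ≠ 0 → m ≤ p ∧ p < m')
    {f f' : Ser n M} (h : f - f' ∈ ordGE n M m') : scaleSer c f = scaleSer c f' := by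
  ext p : 2
  rw [coeff_scaleSer, coeff_scaleSer]
  by_cases h0 : c p = 0
  · rw [h0, zero_smul, zero_smul]
  · have h1 := h p (hc p h0).2
    rw [HahnSeries.coeff_sub, sub_eq_zero] at h1
    rw [h1]

variable [IsManifold (𝓡 n) ∞ M]

theorem IsPlainBelow.scaleSer {c : ℝ → ℝ} {q : ℝ} {f : Ser n M} (hf : IsPlainBelow q f) :
    IsPlainBelow q (scaleSer c f) :=
  ⟨formal_of_support_subset hf.1 fun p hp => by rw [coeff_scaleSer, hp, smul_zero], fun p hp => by
    obtain ⟨d, hd⟩ := hf.2 p hp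
    exact ⟨c p • d, by rw [coeff_scaleSer, hd, fn_smul]⟩⟩

/-- The factor by which an error is to be multiplied in order to be cancelled by the operator
`∂_t (∂_t + N H) / 2` on a window. -/
def windowFactor (H N m m' p : ℝ) : ℝ :=
  open Classical in if m ≤ p ∧ p < m' then -2 / ((N - p) * p * H ^ 2) else 0

theorem windowFactor_eq_zero {H N m m' p : ℝ} (h : p < m) : windowFactor H N m m' p = 0 := by
  rw [windowFactor, if_neg fun h1 => absurd h1.1 h.not_ge]

theorem windowFactor_ne_zero {H N m m' p : ℝ} (h : windowFactor H N m m' p ≠ 0) :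
    m ≤ p ∧ p < m' := by
  by_contra h1
  exact h (if_neg h1)

/-- On functions the operator acts at exponent `p` as multiplication by `-(N - p) p H²`, which does
not vanish for `0 < p < N`. -/
theorem window_cancel {H N m m' : ℝ} (hH : H ≠ 0) (hm : 0 < m) (hN : m' ≤ N) {f : Ser n M}
    (hf : f ∈ ordGE n M m) (hpl : ∀ p < m', ∃ c, f.coeff p = fn c) :
    f - (1 / 2 : ℝ) • (dt H (dt H (scaleSer (windowFactor H N m m') f))
      + (N * H) • dt H (scaleSer (windowFactor H N m m') f)) ∈ ordGE n M m' := by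
  intro p hp
  obtain ⟨c, hc⟩ := hpl p hp
  rw [HahnSeries.coeff_sub, coeff_smul, HahnSeries.coeff_add, coeff_smul, coeff_dt, coeff_dt,
    coeff_scaleSer, hc, dtCoef_smul, dtCoef_smul, dtCoef_fn, dtCoef_smul, dtCoef_fn]
  rcases lt_or_ge p m with h | h
  · have h0 := hf p h
    rw [hc] at h0
    simp only [h0, smul_zero, add_zero, sub_zero]
  · rw [windowFactor, if_pos ⟨h, hp⟩, smul_smul, smul_smul, smul_smul, smul_smul, ← add_smul,
      smul_smul]
    have h1 : N - p ≠ 0 := by linarith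
    have h2 : p ≠ 0 := by linarith
    conv_lhs => enter [1]; rw [← one_smul ℝ (fn c)]
    rw [← sub_smul]
    convert zero_smul ℝ (fn c)
    field_simp
    ring

end Rescaling

/-! ### Comparison of metrics -/

section Comparison

variable {n : ℕ} {M : Type*} [TopologicalSpace M] [ChartedSpace (Coord n) M]
  [IsManifold (𝓡 n) ∞ M]
variable {A B : Matrix (Fin n) (Fin n) (SmoothR n M)} {ε : ℝ}
  {g g' : Matrix (Fin n) (Fin n) (Ser n M)}

theorem IsNear.congRel (hg : IsNear A B ε g) (hg' : IsNear A B ε g') (hε : ε ≤ 1) {r : ℝ}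
    (h : ∀ a b, AlgESF.pert B g a b - AlgESF.pert B g' a b ∈ ordGE n M (ε + r)) :
    NearRel (congRel n M r) A B ε g g' where
  rel := congRel_weightRel r
  inv := hg.inv
  pos := hg.pos
  le_one := hε
  pert a b := ⟨hg.pert a b, hg'.pert a b, h a b⟩
  symm := hg.symm
  symm' := hg'.symm

theorem congRel_self {r p : ℝ} {f : Ser n M} (hf : f ∈ ordGE n M p) : congRel n M r p f f :=
  ⟨hf, hf, by rw [sub_self]; exact Submodule.zero_mem _⟩

theorem IsNear.congRel_self (hg : IsNear A B ε g) (hε : ε ≤ 1) {r : ℝ} :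
    NearRel (AlgESF.congRel n M r) A B ε g g :=
  hg.congRel hg hε fun a b => by rw [sub_self]; exact Submodule.zero_mem _

theorem plainRel_anti {r r' p : ℝ} (h : r' ≤ r) {f f' : Ser n M} (hf : plainRel n M r p f f') :
    plainRel n M r' p f f' :=
  ⟨hf.1, hf.2.1, hf.2.2.1, fun m hm => hf.2.2.2 m (by linarith)⟩

theorem plainRel_zero {r p q : ℝ} (hp : 0 ≤ p) (hq : q ≤ p + r) {f f' : Ser n M}
    (hf : plainRel n M r p f f') : plainRel n M q 0 f f' :=
  ⟨hf.1, ordGE_mono hp hf.2.1, hf.2.2.1, fun m hm => hf.2.2.2 m (by linarith)⟩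

theorem NearRel.plain_anti {r r' : ℝ} (hr : r' ≤ r) (h : NearRel (plainRel n M r) A B ε g g) :
    NearRel (plainRel n M r') A B ε g g where
  rel := plainRel_weightRel
  inv := h.inv
  pos := h.pos
  le_one := h.le_one
  pert a b := plainRel_anti hr (h.pert a b)
  symm := h.symm
  symm' := h.symm

theorem pert_add_smul (hBA : B * A = 1) (g γ : Matrix (Fin n) (Fin n) (Ser n M)) :
    pert B (g + (powX (-2) : Ser n M) • (bg A * γ)) = pert B g + γ := by
  rw [pert, pert, mul_add, smul_add, Matrix.mul_smul, smul_smul, powX_mul, ← mul_assoc, ← bg_mul,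
    hBA, bg_one, one_mul]
  norm_num [powX_zero]
  abel

theorem trace_traceless (hn : n ≠ 0) (T : Matrix (Fin n) (Fin n) (Ser n M)) :
    (traceless T).trace = 0 := by
  rw [traceless, Matrix.trace_sub, Matrix.trace_smul, Matrix.trace_one, Fintype.card_fin,
    smul_eq_mul, smul_mul_assoc, mul_comm, ← nsmul_eq_mul, ← Nat.cast_smul_eq_nsmul ℝ n,
    smul_smul, inv_mul_cancel₀ (Nat.cast_ne_zero.2 hn), one_smul, sub_self]

theorem mul_mul_mem_ordGE {p q r t : ℝ} {S T U : Matrix (Fin n) (Fin n) (Ser n M)}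
    (hS : ∀ a b, S a b ∈ ordGE n M p) (hT : ∀ a b, T a b ∈ ordGE n M q)
    (hU : ∀ a b, U a b ∈ ordGE n M r) (h : t ≤ p + q + r) (a b : Fin n) :
    (S * T * U) a b ∈ ordGE n M t := by
  rw [Matrix.mul_apply]
  refine Submodule.sum_mem _ fun i _ => ordGE_mul' (?_ : _ ∈ ordGE n M (p + q)) (hU i b) h
  rw [Matrix.mul_apply]
  exact Submodule.sum_mem _ fun j _ => ordGE_mul (hS a j) (hT j i)

variable (x : GlobalChart n M) (P : Model) {k : ℝ} {φ : Ser n M}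

theorem sum_evolTl (hn : n ≠ 0) : ∑ a, evolTl x P g φ a a = 0 := by
  have h : ∀ T : Matrix (Fin n) (Fin n) (Ser n M), ∑ a, traceless T a a = 0 :=
    fun T => trace_traceless hn T
  have h1 : ∑ a, dt (P.H n) (traceless (kMix (P.H n) g) a a) = 0 := by
    simp only [← dtD_apply]
    rw [← map_sum, h, map_zero]
  simp only [evolTl, Finset.sum_sub_distrib, Finset.sum_add_distrib, ← Finset.mul_sum, h1, h,
    sigma]
  simp

/-- The lowered violation is symmetric, and its parts from the trace equation and the energy
constraint are multiples of the metric; the conformal factor can be cancelled. -/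
theorem metric_mul_evolTl_symm (hn : 2 ≤ n) (hr : ∀ a b, conj (g a b) = g a b)
    (hs : ∀ a b, g a b = g b a) (hi : g * g⁻¹ = 1) (hk : 0 < k) (hφ : φ ∈ ordGE n M k)
    (hq : kSq (P.H n) g = ∑ i, ∑ j, kMix (P.H n) g i j * kMix (P.H n) g j i) (a b : Fin n) :
    (g * Matrix.of (evolTl x P g φ)) a b = (g * Matrix.of (evolTl x P g φ)) b a := by
  have key : ∀ a b, (splitG (-1) g * einsteinViolation x P g φ) (some a) (some b)
      = -((1 - P.ξ • (conj φ * φ)) * (g * Matrix.of (evolTl x P g φ)) a b)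
        + ((1 - P.ξ • (conj φ * φ)) * ((((n : ℝ) - 1) / n) • evolTr x P g φ)
          + (1 / 2 : ℝ) • ((1 - P.ξ • (conj φ * φ)) * constrHam x P g φ)) * g a b := by
    intro a b
    have h1 : g a b = ∑ i, g a i * (1 : Matrix (Fin n) (Fin n) (Ser n M)) i b := by
      rw [← Matrix.mul_apply, mul_one]
    rw [mul_split_s]
    conv_rhs => rw [h1]
    rw [Matrix.mul_apply, Finset.mul_sum, ← Finset.sum_neg_distrib, Finset.mul_sum,
      ← Finset.sum_add_distrib]
    refine Finset.sum_congr rfl fun i _ => ?_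
    rw [violation_ss x P hn hr hs hi hk hφ hq, evolViolation, Matrix.of_apply, Matrix.of_apply]
    generalize 1 - P.ξ • (conj φ * φ) = u
    generalize constrHam x P g φ = v
    generalize evolTr x P g φ = w
    generalize evolTl x P g φ i b = z
    generalize (1 : Matrix (Fin n) (Fin n) (Ser n M)) i b = δ
    generalize g a i = y
    generalize ((n : ℝ) - 1) / n = c
    algebra
  have h := (split_connection x P hs hi).violation_lower_symm P.ξ (potW P φ) (conj φ) φ
    (some a) (some b)
  have h1 : (splitG (-1) g * einsteinViolation x P g φ) (some a) (some b)
      = (splitG (-1) g * einsteinViolation x P g φ) (some b) (some a) := h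
  rw [key, key, hs b a, add_left_inj, neg_inj] at h1
  have h2 := congrArg (fun f => confInv P φ * f) h1
  simpa only [← mul_assoc, mul_comm (confInv P φ) (1 - _), mul_confInv P hk hφ, one_mul] using h2

end Comparison

/-! ### Construction of solutions -/

section Existence

variable {n : ℕ} {M : Type*} [TopologicalSpace M] [ChartedSpace (Coord n) M]
  [IsManifold (𝓡 n) ∞ M]

/-- Admissible step sizes for the construction. -/
structure Model.StepSize (P : Model) (n : ℕ) (ε : ℝ) : Prop where
  pos : 0 < ε
  le_one : ε ≤ 1
  -- The matter sources, quadratic in the field, then have at least weight `2 * ε`. The next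
  -- condition keeps the resonance at `k₂` out of the initial stage.
  le_k₁ : ε ≤ P.k₁ n
  le_gap : P.k₁ n < P.k₂ n → ε ≤ P.k₂ n - P.k₁ n

/-- Approximate solutions of relative order `m`, finite in the field. -/
structure ApproxSolution (x : GlobalChart n M) (P : Model)
    (A B : Matrix (Fin n) (Fin n) (SmoothR n M)) (φ₀ φ₁ : SmoothC n M) (ε m : ℝ)
    (g : Matrix (Fin n) (Fin n) (Ser n M)) (φ : Ser n M) : Prop where
  -- The deviation has weight `ε`, so this precision means absence of oscillations and logarithms
  -- below `n`.
  near : NearRel (plainRel n M (n - ε)) A B ε g g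
  real : ∀ a b, conj (g a b) = g a b
  field : plainRel n M (P.k₂ n - P.k₁ n) (P.k₁ n) φ φ
  -- Keeping the field truncated leaves the coefficients at and beyond the current order, in
  -- particular the one at `k₂`, to be chosen later.
  coeff_eq_zero : ∀ p, P.k₁ n + m ≤ p → φ.coeff p = 0
  lead : φ.coeff (P.k₁ n) = leadCoef P φ₀ φ₁
  second : P.k₁ n < P.k₂ n → P.k₂ n < P.k₁ n + m →
    ∃ χ, φ.coeff (P.k₂ n) = fn φ₁ + fn χ * varZ
  evolTl_mem : ∀ a b, evolTl x P g φ a b ∈ ordGE n M m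
  evolTr_mem : evolTr x P g φ ∈ ordGE n M m
  fieldEq_mem : fieldEq x P g φ ∈ ordGE n M (P.k₁ n + m)

variable {x : GlobalChart n M} {P : Model} {A B : Matrix (Fin n) (Fin n) (SmoothR n M)}
  {φ₀ φ₁ : SmoothC n M} {ε m m' : ℝ} {g : Matrix (Fin n) (Fin n) (Ser n M)} {φ : Ser n M}

/-- The source has weight `2k₁` and precision `k₂ - k₁`, hence is plain below `k₁ + k₂ = n`; the
nonlinear geometric terms are even plain below `n + ε`. Consequently the metric correction only has
to solve equations for functions. -/
theorem plain_evolTl (hn : 2 ≤ n) (hP : P.Valid n) (hε : P.StepSize n ε)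
    (hN : NearRel (plainRel n M (n - ε)) A B ε g g)
    (hφ : plainRel n M (P.k₂ n - P.k₁ n) (P.k₁ n) φ φ) (a b : Fin n) :
    IsPlainBelow n (evolTl x P g φ a b) := by
  have hk := Model.k₁_pos hn hP
  have h12 := Model.k₁_add_k₂ (n := n) (P := P)
  have hρ : WeightRel (plainRel n M (n : ℝ)) := plainRel_weightRel
  have hN' : NearRel (plainRel n M (P.k₂ n - P.k₁ n)) A B ε g g :=
    hN.plain_anti (by linarith [hε.le_k₁])
  have h1 := plainRel_zero (q := n) (by linarith [hε.pos]) (by linarith [hε.pos])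
    (hN.evolTl x P φ φ a b)
  have h2 := plainRel_zero (q := n) (by linarith) (by linarith)
    (hN'.tracelessEffS x hP hk hφ a b)
  have h3 := plainRel_zero (q := n) hε.pos.le (by linarith) (hN.rel.traceless hN.pert a b)
  have h4 := hρ.sub (hρ.add h1 h2) (hρ.smul (1 / 2) (hρ.add (hρ.dt (P.H n) (hρ.dt (P.H n) h3))
    (hρ.smul (n * P.H n) (hρ.dt (P.H n) h3))))
  have h5 := h4.2.2
  rw [zero_add] at h5
  convert h5 using 1
  abel

theorem plain_evolTr (hn : 2 ≤ n) (hP : P.Valid n) (hε : P.StepSize n ε)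
    (hN : NearRel (plainRel n M (n - ε)) A B ε g g)
    (hφ : plainRel n M (P.k₂ n - P.k₁ n) (P.k₁ n) φ φ) :
    IsPlainBelow n (evolTr x P g φ) := by
  have hk := Model.k₁_pos hn hP
  have h12 := Model.k₁_add_k₂ (n := n) (P := P)
  have hρ : WeightRel (plainRel n M (n : ℝ)) := plainRel_weightRel
  have hN' : NearRel (plainRel n M (P.k₂ n - P.k₁ n)) A B ε g g :=
    hN.plain_anti (by linarith [hε.le_k₁])
  have h1 := plainRel_zero (q := n) (by linarith [hε.pos]) (by linarith [hε.pos])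
    (hN.evolTr x P φ φ)
  have h2 := plainRel_zero (q := n) (by linarith) (by linarith)
    (hN'.traceSource x hn hP hk hφ)
  have h3 := plainRel_zero (q := n) hε.pos.le (by linarith) (hN.rel.trace hN.pert)
  have h4 := hρ.sub (hρ.sub h1 h2) (hρ.smul (1 / 2) (hρ.add (hρ.dt (P.H n) (hρ.dt (P.H n) h3))
    (hρ.smul (2 * n * P.H n) (hρ.dt (P.H n) h3))))
  have h5 := h4.2.2
  rw [zero_add] at h5
  convert h5 using 1
  abel

/-- The window correction of the metric, relative to the background. -/
def metricCorrection (x : GlobalChart n M) (P : Model) (m m' : ℝ)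
    (g : Matrix (Fin n) (Fin n) (Ser n M)) (φ : Ser n M) : Matrix (Fin n) (Fin n) (Ser n M) :=
  Matrix.of (fun a b => scaleSer (windowFactor (P.H n) n m m') (evolTl x P g φ a b))
    + ((n : ℝ)⁻¹ • scaleSer (windowFactor (P.H n) (2 * n) m m') (evolTr x P g φ))
      • (1 : Matrix (Fin n) (Fin n) (Ser n M))

theorem metricCorrection_apply (a b : Fin n) :
    metricCorrection x P m m' g φ a b
      = scaleSer (windowFactor (P.H n) n m m') (evolTl x P g φ a b)
        + (n : ℝ)⁻¹ • (scaleSer (windowFactor (P.H n) (2 * n) m m') (evolTr x P g φ)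
          * (1 : Matrix (Fin n) (Fin n) (Ser n M)) a b) := by
  rw [metricCorrection, Matrix.add_apply, Matrix.of_apply, Matrix.smul_apply, smul_eq_mul,
    smul_mul_assoc]

theorem trace_metricCorrection (hn : 2 ≤ n) : (metricCorrection x P m m' g φ).trace
    = scaleSer (windowFactor (P.H n) (2 * n) m m') (evolTr x P g φ) := by
  have hn0 : (n : ℝ) ≠ 0 := by positivity
  have h1 : (Matrix.of (fun a b => scaleSer (windowFactor (P.H n) n m m')
      (evolTl x P g φ a b))).trace = 0 := by
    have h2 := scaleSer_sum Finset.univ (windowFactor (P.H n) n m m')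
      fun a => evolTl x P g φ a a
    rw [sum_evolTl x P (by omega), scaleSer_zero] at h2
    exact h2.symm
  rw [metricCorrection, Matrix.trace_add, h1, zero_add, Matrix.trace_smul, Matrix.trace_one,
    Fintype.card_fin, smul_eq_mul, smul_mul_assoc, mul_comm, ← nsmul_eq_mul,
    ← Nat.cast_smul_eq_nsmul ℝ n, smul_smul, inv_mul_cancel₀ hn0, one_smul]

theorem traceless_metricCorrection (hn : 2 ≤ n) (a b : Fin n) :
    traceless (metricCorrection x P m m' g φ) a b
      = scaleSer (windowFactor (P.H n) n m m') (evolTl x P g φ a b) := by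
  rw [traceless_apply, trace_metricCorrection hn, metricCorrection_apply, add_sub_cancel_right]

theorem metricCorrection_mem (a b : Fin n) : metricCorrection x P m m' g φ a b ∈ ordGE n M m := by
  rw [metricCorrection_apply]
  refine Submodule.add_mem _ (scaleSer_mem_ordGE (fun _ => windowFactor_eq_zero) _)
    (Submodule.smul_mem _ _ (ordGE_mul' (scaleSer_mem_ordGE (fun _ => windowFactor_eq_zero) _)
      ((congRel_weightRel 0).order ((congRel_weightRel 0).one_entry a b)).1 (add_zero m).ge))

theorem conj_bg (a b : Fin n) : conj (bg A a b) = bg A a b := by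
  rw [bg_apply, conj_serFn]
  congr 1
  ext p
  exact Complex.conj_ofReal _

theorem bg_mul_metricCorrection (a b : Fin n) :
    (bg A * metricCorrection x P m m' g φ) a b
      = scaleSer (windowFactor (P.H n) n m m') ((bg A * Matrix.of (evolTl x P g φ)) a b)
        + (n : ℝ)⁻¹ • (scaleSer (windowFactor (P.H n) (2 * n) m m') (evolTr x P g φ)
          * bg A a b) := by
  have h1 : bg A a b = ∑ i, bg A a i * (1 : Matrix (Fin n) (Fin n) (Ser n M)) i b := by
    rw [← Matrix.mul_apply, mul_one]
  conv_rhs => rw [h1]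
  rw [Matrix.mul_apply, Matrix.mul_apply, scaleSer_sum, Finset.mul_sum, Finset.smul_sum,
    ← Finset.sum_add_distrib]
  refine Finset.sum_congr rfl fun i _ => ?_
  rw [metricCorrection_apply, mul_add, bg_apply, serFn_mul_scaleSer, Matrix.of_apply,
    mul_smul_comm, mul_left_comm]

theorem bg_mul_eq_sub (hAB : A * B = 1) (g T : Matrix (Fin n) (Fin n) (Ser n M)) (a b : Fin n) :
    (bg A * T) a b = powX 2 * (g * T) a b - (bg A * pert B g * T) a b := by
  have h1 := metric_eq_pert hAB g
  have h2 : (powX 2 : Ser n M) • g = bg A + bg A * pert B g := by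
    conv_lhs => rw [h1]
    rw [smul_smul, powX_mul, mul_add, mul_one]
    norm_num [powX_zero]
  have h3 : bg A = (powX 2 : Ser n M) • g - bg A * pert B g := by rw [h2, add_sub_cancel_right]
  conv_lhs => rw [h3]
  rw [sub_mul, Matrix.smul_mul, Matrix.sub_apply, Matrix.smul_apply, smul_eq_mul]

theorem bg_mem_ordGE (a b : Fin n) : bg A a b ∈ ordGE n M 0 := by
  rw [bg_apply]
  exact single_mem_ordGE 0 _

/-- The error is exactly symmetric when lowered by `g`. Lowering by the background instead costs the
product of deviation and error, of order `ε + m`, which lies beyond the window. Since the correction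
is cut off to the window, it is symmetric without remainder. -/
theorem metricCorrection_symm {k : ℝ} (hn : 2 ≤ n) (hA : IsRiemannian A) (hg : IsNear A B ε g)
    (hr : ∀ a b, conj (g a b) = g a b) (hm' : m' ≤ ε + m)
    (hE : ∀ a b, evolTl x P g φ a b ∈ ordGE n M m) (hk : 0 < k) (hφ : φ ∈ ordGE n M k)
    (a b : Fin n) : (bg A * metricCorrection x P m m' g φ) a b
      = (bg A * metricCorrection x P m m' g φ) b a := by
  have e1 : ∀ a b, (bg A * pert B g * Matrix.of (evolTl x P g φ)) a b ∈ ordGE n M m' :=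
    mul_mul_mem_ordGE (p := 0) (q := ε) (r := m) bg_mem_ordGE hg.pert hE (by linarith)
  have e2 : bg A a b = bg A b a := by rw [bg_apply, bg_apply, hA.symm]
  have e3 := metric_mul_evolTl_symm x P hn hr hg.symm hg.mul_inv hk hφ (hg.kSq_eq _) a b
  have e4 : (bg A * Matrix.of (evolTl x P g φ)) a b - (bg A * Matrix.of (evolTl x P g φ)) b a
      ∈ ordGE n M m' := by
    rw [bg_mul_eq_sub hg.inv g, bg_mul_eq_sub hg.inv g, e3, sub_sub_sub_cancel_left]
    exact Submodule.sub_mem _ (e1 b a) (e1 a b)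
  rw [bg_mul_metricCorrection, bg_mul_metricCorrection, ← e2,
    scaleSer_congr (fun _ => windowFactor_ne_zero) e4]

/-- The correction cancels the errors in the window through the linear part. Its influence on all
other terms is delayed by `ε`, and on the field equation it acts only from relative order `m` on. -/
theorem ApproxSolution.exists_metric (hn : 2 ≤ n) (hP : P.Valid n) (hA : IsRiemannian A)
    (hε : P.StepSize n ε) (hm : ε ≤ m) (hm' : m' ≤ m + ε) (hmn : m' ≤ n)
    (h : ApproxSolution x P A B φ₀ φ₁ ε m g φ) :
    ∃ g', NearRel (plainRel n M (n - ε)) A B ε g' g' ∧ (∀ a b, conj (g' a b) = g' a b) ∧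
      (∀ a b, evolTl x P g' φ a b ∈ ordGE n M m') ∧ evolTr x P g' φ ∈ ordGE n M m' ∧
      fieldEq x P g' φ ∈ ordGE n M (P.k₁ n + m) := by
  have hk := Model.k₁_pos hn hP
  have hH := Model.H_pos hn hP
  have hε0 := hε.pos
  have hεk := hε.le_k₁
  have hne := h.near.near
  have hi := hne.mul_inv
  have hBA : B * A = 1 := mul_eq_one_comm.1 h.near.inv
  have hφO : φ ∈ ordGE n M (P.k₁ n) := h.field.2.1
  have hplTl := plain_evolTl (x := x) hn hP hε h.near h.field
  have hplTr := plain_evolTr (x := x) hn hP hε h.near h.field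
  set γ := metricCorrection x P m m' g φ with hγ
  set g' := g + (powX (-2) : Ser n M) • (bg A * γ) with hg'
  have hpert : pert B g' = pert B g + γ := pert_add_smul hBA g γ
  have hγO : ∀ a b, γ a b ∈ ordGE n M m := metricCorrection_mem
  have hγr : ∀ a b, conj (γ a b) = γ a b := fun a b => by
    rw [hγ, metricCorrection_apply, conj_add, conj_smul, conj_mul, conj_scaleSer, conj_scaleSer,
      conj_one_entry, conj_evolTl x hk hφO h.real hi, conj_evolTr x hk hφO h.real hi]
  have hγp : ∀ a b, plainRel n M n 0 (γ a b) (γ a b) := fun a b => by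
    have hρ : WeightRel (plainRel n M (n : ℝ)) := plainRel_weightRel
    have hw : ∀ N : ℝ, ∀ {f : Ser n M}, IsPlainBelow n f →
        plainRel n M n 0 (scaleSer (windowFactor (P.H n) N m m') f)
          (scaleSer (windowFactor (P.H n) N m m') f) := fun N f hf =>
      ⟨rfl, ordGE_mono (by linarith) (scaleSer_mem_ordGE (fun _ => windowFactor_eq_zero) _), by
        rw [zero_add]
        exact hf.scaleSer⟩
    rw [hγ, metricCorrection_apply]
    exact hρ.add (hw _ (hplTl a b)) (hρ.smul _ (hρ.mul (hw _ hplTr) (hρ.one_entry a b)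
      (zero_add 0).ge))
  have hγs : ∀ a b, (bg A * γ) a b = (bg A * γ) b a :=
    metricCorrection_symm hn hA h.near.near h.real (by linarith) h.evolTl_mem hk hφO
  have hs' : ∀ a b, g' a b = g' b a := fun a b => by
    rw [hg', Matrix.add_apply, Matrix.add_apply, Matrix.smul_apply, Matrix.smul_apply,
      hγs a b, h.near.symm a b]
  have hne' : IsNear A B ε g' := ⟨h.near.inv, hε0, fun a b => by
    rw [hpert]
    exact Submodule.add_mem _ (hne.pert a b) (ordGE_mono hm (hγO a b)), hs'⟩
  -- The deviations have weight `ε` and differ at order `m`, so the relative precision is `m - ε`.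
  have hC : NearRel (AlgESF.congRel n M (m - ε)) A B ε g g' :=
    hne.congRel hne' hε.le_one fun a b => by
      rw [hpert, Matrix.add_apply, sub_add_cancel_left, add_sub_cancel]
      exact Submodule.neg_mem _ (hγO a b)
  have hφC : AlgESF.congRel n M (m - ε) (P.k₁ n) φ φ := congRel_self hφO
  refine ⟨g', ⟨plainRel_weightRel, h.near.inv, hε0, hε.le_one, fun a b => ?_, hs', hs'⟩,
    fun a b => ?_, fun a b => ?_, ?_, ?_⟩
  · refine ⟨rfl, hne'.pert a b, ?_⟩
    have hρ : WeightRel (plainRel n M (n : ℝ)) := plainRel_weightRel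
    have h1 := hρ.add (plainRel_zero (q := n) hε0.le (by linarith) (h.near.pert a b)) (hγp a b)
    have h2 := h1.2.2
    rw [zero_add] at h2
    rw [add_sub_cancel, hpert]
    exact h2
  · have h1 := conj_entries_mul (bg A) γ a b
    have h2 : (bg A).map conj = bg A := Matrix.ext fun a b => conj_bg a b
    have h3 : γ.map conj = γ := Matrix.ext hγr
    rw [h2, h3] at h1
    rw [hg', Matrix.add_apply, Matrix.smul_apply, smul_eq_mul, conj_add, conj_mul, conj_powX, h1,
      h.real]
  · have h1 := (hC.evolTl x P φ φ a b).2.2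
    have h2 := (hC.tracelessEffS x hP hk hφC a b).2.2
    have h3 := window_cancel hH.ne' (by linarith : 0 < m) hmn (h.evolTl_mem a b)
      fun p hp => (hplTl a b).2 p (by linarith)
    have h4 : traceless (pert B g') a b = traceless (pert B g) a b
        + scaleSer (windowFactor (P.H n) n m m') (evolTl x P g φ a b) := by
      rw [hpert, traceless_add, Matrix.add_apply, hγ, traceless_metricCorrection hn]
    rw [h4, dt_add, dt_add] at h1
    -- Weight plus precision: `2ε + (m - ε)` for the nonlinear terms and `2k₁ + (m - ε)` for the
    -- sources, both at least `m + ε`.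
    have h5 := Submodule.sub_mem _ (Submodule.sub_mem _ h3
      (ordGE_mono (by linarith : m' ≤ 2 * ε + (m - ε)) h1))
      (ordGE_mono (by linarith : m' ≤ 2 * P.k₁ n + (m - ε)) h2)
    convert h5 using 1
    module
  · have h1 := (hC.evolTr x P φ φ).2.2
    have h2 := (hC.traceSource x hn hP hk hφC).2.2
    have h3 := window_cancel hH.ne' (by linarith : 0 < m) (by linarith : m' ≤ 2 * (n : ℝ))
      h.evolTr_mem fun p hp => hplTr.2 p (by linarith)
    have h4 : (pert B g').trace = (pert B g).trace
        + scaleSer (windowFactor (P.H n) (2 * n) m m') (evolTr x P g φ) := by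
      rw [hpert, Matrix.trace_add, hγ, trace_metricCorrection hn]
    rw [h4, dt_add, dt_add] at h1
    have h5 := Submodule.add_mem _ (Submodule.sub_mem _ h3
      (ordGE_mono (by linarith : m' ≤ 2 * ε + (m - ε)) h1))
      (ordGE_mono (by linarith : m' ≤ 2 * P.k₁ n + (m - ε)) h2)
    convert h5 using 1
    module
  -- Here weight plus precision is only `k₁ + m`, which preserves the old order; the gain comes from
  -- correcting the field afterwards.
  · have h1 := (hC.fieldEq x hP (by linarith) hφC).2.2
    rw [add_sub_add_right_eq_sub] at h1
    have h5 := Submodule.sub_mem _ h.fieldEq_mem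
      (ordGE_mono (by linarith : P.k₁ n + m ≤ P.k₁ n + ε + (m - ε)) h1)
    rwa [sub_sub_cancel] at h5

end Existence

/-! ### Correction of the field -/

section FieldCorrection

variable {n : ℕ} {M : Type*} [TopologicalSpace M] [ChartedSpace (Coord n) M]
  [IsManifold (𝓡 n) ∞ M]
variable {x : GlobalChart n M} {P : Model} {A B : Matrix (Fin n) (Fin n) (SmoothR n M)}
  {φ₀ φ₁ : SmoothC n M} {ε m m' : ℝ} {g g' : Matrix (Fin n) (Fin n) (Ser n M)} {φ : Ser n M}

/-- The linear equation is solved separately at each exponent of the window. Where `F` vanishes the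
solution is zero, except possibly at `k₂`, where `φ₁` is inserted; so the support is contained in
that of `F` with one point added and remains discrete. -/
theorem exists_field_correction (hn : 2 ≤ n) (hP : P.Valid n) (φ₁ : SmoothC n M) (hm : 0 < m)
    {F : Ser n M} (hF : F ∈ formalSeries n M)
    (hF' : ∀ p, P.k₁ n + m ≤ p → p ≤ P.k₂ n → ∃ c, F.coeff p = fn c) :
    ∃ δ ∈ formalSeries n M, (∀ p, p < P.k₁ n + m → δ.coeff p = 0) ∧
      (∀ p, P.k₁ n + m' ≤ p → δ.coeff p = 0) ∧
      (∀ p, P.k₁ n + m ≤ p → p < P.k₁ n + m' → waveCoef P p (δ.coeff p) = F.coeff p) ∧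
      (∀ p < P.k₂ n, ∃ c, δ.coeff p = fn c) ∧
      (P.k₁ n + m ≤ P.k₂ n → P.k₂ n < P.k₁ n + m' →
        ∃ χ, δ.coeff (P.k₂ n) = fn φ₁ + fn χ * varZ) := by
  classical
  choose! Q hQ using fun p (hp : P.k₁ n + m ≤ p) =>
    exists_waveCoef_eq hn hP φ₁ (by linarith : P.k₁ n < p) (F.coeff p) (hF' p hp)
  have hsup : (Function.support fun p => if P.k₁ n + m ≤ p ∧ p < P.k₁ n + m' then Q p else 0)
      ⊆ F.support ∪ {P.k₂ n} := by
    intro p hp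
    rw [Function.mem_support] at hp
    by_cases h : P.k₁ n + m ≤ p ∧ p < P.k₁ n + m'
    · rw [if_pos h] at hp
      by_contra h1
      rw [Set.mem_union, not_or, HahnSeries.mem_support, not_not] at h1
      exact hp ((hQ p h.1).2.1 h1.1 h1.2)
    · rw [if_neg h] at hp
      exact absurd rfl hp
  refine ⟨⟨fun p => if P.k₁ n + m ≤ p ∧ p < P.k₁ n + m' then Q p else 0,
    (F.isPWO_support.union (Set.isPWO_singleton _)).mono hsup⟩, fun c => ?_, fun p hp => ?_,
    fun p hp => ?_, fun p hp hp' => ?_, fun p hp => ?_, fun h1 h2 => ?_⟩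
  · refine ((hF c).union (Set.finite_singleton (P.k₂ n))).subset fun p hp => ?_
    rcases hsup hp.1 with h | h
    · exact Or.inl ⟨h, hp.2⟩
    · exact Or.inr h
  · exact if_neg fun h => absurd h.1 hp.not_ge
  · exact if_neg fun h => absurd h.2 hp.not_gt
  · change waveCoef P p (if P.k₁ n + m ≤ p ∧ p < P.k₁ n + m' then Q p else 0) = _
    rw [if_pos ⟨hp, hp'⟩]
    exact (hQ p hp).1
  · change ∃ c, (if P.k₁ n + m ≤ p ∧ p < P.k₁ n + m' then Q p else 0) = _
    split_ifs with h
    · exact (hQ p h.1).2.2.1 hp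
    · exact ⟨0, fn_zero.symm⟩
  · change ∃ χ, (if P.k₁ n + m ≤ P.k₂ n ∧ P.k₂ n < P.k₁ n + m' then Q (P.k₂ n) else 0) = _
    rw [if_pos ⟨h1, h2⟩]
    exact (hQ _ h1).2.2.2 rfl

theorem formal_fieldEq (hP : P.Valid n) (hε : P.StepSize n ε)
    (hN : NearRel (plainRel n M (n - ε)) A B ε g g) (hn : 2 ≤ n)
    (hφ : φ ∈ ordGE n M (P.k₁ n)) (hφ' : φ ∈ formalSeries n M) :
    fieldEq x P g φ ∈ formalSeries n M := by
  have hn1 : (2 : ℝ) ≤ n := by exact_mod_cast hn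
  -- At precision zero the relation expresses only the order and membership in the algebra, since
  -- coefficients below the weight vanish.
  have hN' : NearRel (plainRel n M 0) A B ε g g := hN.plain_anti (by linarith [hε.le_one])
  have h1 := hN'.fieldEq (k := P.k₁ n) x hP (by linarith [hε.le_k₁, hε.pos]) (φ := φ) (φ' := φ)
    ⟨rfl, hφ, hφ', fun p hp => ⟨0, by rw [fn_zero]; exact hφ p (by linarith)⟩⟩
  have h2 : waveOp P φ ∈ formalSeries n M := formal_of_support_subset hφ' fun p hp => by
    rw [coeff_waveOp, hp, waveCoef_zero]
  have h3 := Subring.sub_mem _ h1.2.2.1 h2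
  rwa [waveOp, Model.effMass, add_sub_cancel_right] at h3

/-- In this range the truncated field has no coefficient, so the principal part contributes nothing
and the remaining terms are plain. The endpoint `k₂` is included because the source at the resonance
must be a function. -/
theorem fieldEq_coeff_plain (hn : 2 ≤ n) (hP : P.Valid n) (hε : P.StepSize n ε)
    (hN : NearRel (plainRel n M (n - ε)) A B ε g g)
    (hφ : plainRel n M (P.k₂ n - P.k₁ n) (P.k₁ n) φ φ)
    (h0 : ∀ p, P.k₁ n + m ≤ p → φ.coeff p = 0) (p : ℝ) (hp : P.k₁ n + m ≤ p)
    (hp' : p ≤ P.k₂ n) : ∃ c, (fieldEq x P g φ).coeff p = fn c := by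
  have hk := Model.k₁_pos hn hP
  have h12 := Model.k₁_add_k₂ (n := n) (P := P)
  have h1 := hN.fieldEq (k := P.k₁ n) x hP (by linarith [hε.le_k₁, hε.pos]) (φ := φ) (φ' := φ)
    ⟨rfl, hφ.2.1, hφ.2.2.1, fun q _ => by
      rcases lt_or_ge q (P.k₂ n) with h | h
      · exact hφ.2.2.2 q (by linarith)
      · exact ⟨0, by rw [fn_zero]; exact h0 q (by linarith)⟩⟩
  obtain ⟨c, hc⟩ := h1.2.2.2 p (by linarith)
  have h2 : (waveOp P φ).coeff p = 0 := by rw [coeff_waveOp, h0 p hp, waveCoef_zero]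
  have h3 : (fieldEq x P g φ).coeff p + (waveOp P φ).coeff p = fn c := hc
  exact ⟨c, by rw [← h3, h2, add_zero]⟩

/-- With the metric fixed, a change of the field at relative order `m` affects the evolution
equations only through the quadratic sources, at order `2k₁ + m`. The field equation is improved
through its principal part, with all other changes delayed by `ε`. -/
theorem ApproxSolution.exists_field (hn : 2 ≤ n) (hP : P.Valid n) (hε : P.StepSize n ε)
    (hm : ε ≤ m) (hmm : m ≤ m') (hm' : m' ≤ m + ε)
    (h : ApproxSolution x P A B φ₀ φ₁ ε m g φ)
    (hN : NearRel (plainRel n M (n - ε)) A B ε g' g') (hr : ∀ a b, conj (g' a b) = g' a b)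
    (hTl : ∀ a b, evolTl x P g' φ a b ∈ ordGE n M m') (hTr : evolTr x P g' φ ∈ ordGE n M m')
    (hF : fieldEq x P g' φ ∈ ordGE n M (P.k₁ n + m)) :
    ∃ φ', ApproxSolution x P A B φ₀ φ₁ ε m' g' φ' := by
  have hk := Model.k₁_pos hn hP
  have hε0 := hε.pos
  have hεk := hε.le_k₁
  obtain ⟨δ, hδ, hlow, hup, hwave, hpl, hsec⟩ := exists_field_correction (m' := m') hn hP φ₁
    (by linarith : 0 < m) (formal_fieldEq (x := x) hP hε hN hn h.field.2.1 h.field.2.2.1)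
    (fieldEq_coeff_plain hn hP hε hN h.field h.coeff_eq_zero)
  have hδO : δ ∈ ordGE n M (P.k₁ n + m) := hlow
  have hφO' : φ + δ ∈ ordGE n M (P.k₁ n) :=
    Submodule.add_mem _ h.field.2.1 (ordGE_mono (by linarith) hδO)
  have hC : NearRel (AlgESF.congRel n M m) A B ε g' g' := hN.near.congRel_self hε.le_one
  have hφC : AlgESF.congRel n M m (P.k₁ n) φ (φ + δ) :=
    ⟨h.field.2.1, hφO', by
      rw [sub_add_cancel_left]
      exact Submodule.neg_mem _ hδO⟩
  refine ⟨φ + δ, hN, hr, ⟨rfl, hφO', Subring.add_mem _ h.field.2.2.1 hδ, fun p hp => ?_⟩,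
    fun p hp => ?_, ?_, fun h1 h2 => ?_, fun a b => ?_, ?_, ?_⟩
  · obtain ⟨c, hc⟩ := h.field.2.2.2 p hp
    obtain ⟨d, hd⟩ := hpl p (by linarith)
    exact ⟨c + d, by rw [HahnSeries.coeff_add, hc, hd]; exact (map_add fnHom c d).symm⟩
  · rw [HahnSeries.coeff_add, h.coeff_eq_zero p (by linarith), hup p hp, add_zero]
  · rw [HahnSeries.coeff_add, h.lead, hlow _ (by linarith), add_zero]
  · rcases lt_or_ge (P.k₂ n) (P.k₁ n + m) with h3 | h3
    · obtain ⟨χ, hχ⟩ := h.second h1 h3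
      exact ⟨χ, by rw [HahnSeries.coeff_add, hχ, hlow _ h3, add_zero]⟩
    · obtain ⟨χ, hχ⟩ := hsec h3 h2
      exact ⟨χ, by rw [HahnSeries.coeff_add, hχ, h.coeff_eq_zero _ h3, zero_add]⟩
  · have h1 := (hC.evolTl x P φ (φ + δ) a b).2.2
    have h2 := (hC.tracelessEffS x hP hk hφC a b).2.2
    have h5 := Submodule.sub_mem _ (Submodule.sub_mem _ (hTl a b)
      (ordGE_mono (by linarith : m' ≤ 2 * ε + m) h1))
      (ordGE_mono (by linarith : m' ≤ 2 * P.k₁ n + m) h2)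
    convert h5 using 1
    abel
  · have h1 := (hC.evolTr x P φ (φ + δ)).2.2
    have h2 := (hC.traceSource x hn hP hk hφC).2.2
    have h5 := Submodule.add_mem _ (Submodule.sub_mem _ hTr
      (ordGE_mono (by linarith : m' ≤ 2 * ε + m) h1))
      (ordGE_mono (by linarith : m' ≤ 2 * P.k₁ n + m) h2)
    convert h5 using 1
    abel
  · have h1 : (fieldEq x P g' φ + waveOp P φ) - (fieldEq x P g' (φ + δ) + waveOp P (φ + δ))
        ∈ ordGE n M (P.k₁ n + ε + m) := (hC.fieldEq x hP (by linarith) hφC).2.2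
    have h2 : waveOp P (φ + δ) = waveOp P φ + waveOp P δ := by
      have h3 := waveOp_sub P (φ + δ) φ
      rw [add_sub_cancel_left] at h3
      rw [h3, add_sub_cancel]
    have h3 : fieldEq x P g' φ - waveOp P δ ∈ ordGE n M (P.k₁ n + m') := by
      intro p hp
      rw [HahnSeries.coeff_sub, coeff_waveOp]
      rcases lt_or_ge p (P.k₁ n + m) with h4 | h4
      · rw [hF p h4, hlow p h4, waveCoef_zero, sub_zero]
      · rw [hwave p h4 hp, sub_self]
    have h5 := Submodule.sub_mem _ h3 (ordGE_mono (by linarith : P.k₁ n + m' ≤ P.k₁ n + ε + m) h1)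
    rw [h2] at h5
    convert h5 using 1
    abel

theorem ApproxSolution.exists_next (hn : 2 ≤ n) (hP : P.Valid n) (hA : IsRiemannian A)
    (hε : P.StepSize n ε) (hm : ε ≤ m) (hmm : m ≤ m') (hm' : m' ≤ m + ε) (hmn : m' ≤ n)
    (h : ApproxSolution x P A B φ₀ φ₁ ε m g φ) :
    ∃ g' φ', ApproxSolution x P A B φ₀ φ₁ ε m' g' φ' := by
  obtain ⟨g', h1, h2, h3, h4, h5⟩ := h.exists_metric hn hP hA hε hm hm' hmn
  exact ⟨g', h.exists_field hn hP hε hm hmm hm' h1 h2 h3 h4 h5⟩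

theorem pert_background (hBA : B * A = 1) : pert B ((powX (-2) : Ser n M) • bg A) = 0 := by
  rw [pert, Matrix.mul_smul, smul_smul, powX_mul, ← bg_mul, hBA, bg_one]
  norm_num [powX_zero]

/-- For vanishing deviation and a field in the kernel of the principal part, each equation reduces
to its remainder, which already has the order required at the first stage. -/
theorem approxSolution_background (hn : 2 ≤ n) (hP : P.Valid n) (hA : IsRiemannian A)
    (hAB : A * B = 1) (hε : P.StepSize n ε) (x : GlobalChart n M) (φ₀ φ₁ : SmoothC n M) :
    ApproxSolution x P A B φ₀ φ₁ ε ε ((powX (-2) : Ser n M) • bg A)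
      (HahnSeries.single (P.k₁ n) (leadCoef P φ₀ φ₁)) := by
  have hk := Model.k₁_pos hn hP
  have hε0 := hε.pos
  have hεk := hε.le_k₁
  set g : Matrix (Fin n) (Fin n) (Ser n M) := (powX (-2) : Ser n M) • bg A with hg
  set φ : Ser n M := HahnSeries.single (P.k₁ n) (leadCoef P φ₀ φ₁) with hφ
  have hp0 : AlgESF.pert B g = 0 := pert_background (mul_eq_one_comm.1 hAB)
  have hs : ∀ a b, g a b = g b a := fun a b => by
    rw [hg, Matrix.smul_apply, Matrix.smul_apply, bg_apply, bg_apply, hA.symm]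
  have hN : NearRel (plainRel n M (n - ε)) A B ε g g :=
    ⟨plainRel_weightRel, hAB, hε0, hε.le_one, fun a b => by
      rw [hp0]
      exact plainRel_weightRel.zero ε, hs, hs⟩
  have hC : NearRel (AlgESF.congRel n M 0) A B ε g g := hN.near.congRel_self hε.le_one
  have hφO : φ ∈ ordGE n M (P.k₁ n) := single_mem_ordGE _ _
  have hφC : AlgESF.congRel n M 0 (P.k₁ n) φ φ := congRel_self hφO
  have hφ0 : ∀ p, p ≠ P.k₁ n → φ.coeff p = 0 := fun p hp => HahnSeries.coeff_single_of_ne hp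
  have hw : waveOp P φ = 0 := by
    ext p : 2
    rw [coeff_waveOp, HahnSeries.coeff_zero]
    by_cases h : p = P.k₁ n
    · rw [h, hφ, HahnSeries.coeff_single_same, waveCoef_leadCoef hn hP]
    · rw [hφ0 p h, waveCoef_zero]
  refine ⟨hN, fun a b => ?_, ⟨rfl, hφO, formal_single _ _, fun p hp => ?_⟩, fun p hp => ?_,
    HahnSeries.coeff_single_same _ _, fun h1 h2 => ?_, fun a b => ?_, ?_, ?_⟩
  · rw [hg, Matrix.smul_apply, smul_eq_mul, conj_mul, conj_powX, conj_bg]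
  · by_cases h : p = P.k₁ n
    -- The exponent is below `k₂`, so this is the case `μ² < K`, where the leading coefficient is a
    -- function.
    · refine ⟨φ₀, ?_⟩
      rw [h, hφ, HahnSeries.coeff_single_same, leadCoef,
        if_pos (Model.lt_K_of_k₁_lt (by linarith))]
    · exact ⟨0, by rw [hφ0 p h, fn_zero]⟩
  · exact hφ0 p (by linarith)
  -- Vacuous: the step size is at most the gap between the exponents.
  · linarith [hε.le_gap h1]
  · have h1 := (hC.evolTl x P φ φ a b).1
    have h2 := (hC.tracelessEffS x hP hk hφC a b).1
    have h3 : traceless (AlgESF.pert B g) a b = 0 := by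
      rw [hp0, traceless_apply, Matrix.trace_zero, zero_mul, smul_zero, Matrix.zero_apply, sub_zero]
    rw [h3, dt_zero, dt_zero, smul_zero, add_zero, smul_zero, add_zero] at h1
    have h4 := Submodule.add_mem _ (ordGE_mono (by linarith : ε ≤ 2 * ε) h1)
      (ordGE_mono (by linarith : ε ≤ 2 * P.k₁ n) h2)
    rwa [sub_add_cancel] at h4
  · have h1 := (hC.evolTr x P φ φ).1
    have h2 := (hC.traceSource x hn hP hk hφC).1
    rw [hp0, Matrix.trace_zero, dt_zero, dt_zero, smul_zero, add_zero, smul_zero, add_zero] at h1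
    have h4 := Submodule.sub_mem _ (ordGE_mono (by linarith : ε ≤ 2 * ε) h1)
      (ordGE_mono (by linarith : ε ≤ 2 * P.k₁ n) h2)
    rwa [add_sub_cancel_right] at h4
  · have h1 : fieldEq x P g φ + waveOp P φ ∈ ordGE n M (P.k₁ n + ε) :=
      (hC.fieldEq x hP (by linarith) hφC).1
    rwa [hw, add_zero] at h1

theorem exists_approxSolution (hn : 2 ≤ n) (hP : P.Valid n) (hA : IsRiemannian A)
    (hAB : A * B = 1) (hε : P.StepSize n ε) (x : GlobalChart n M) (φ₀ φ₁ : SmoothC n M) :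
    ∃ g φ, ApproxSolution x P A B φ₀ φ₁ ε n g φ := by
  have hn1 : (2 : ℝ) ≤ n := by exact_mod_cast hn
  have hε0 := hε.pos
  have hε1 := hε.le_one
  -- The minimum shortens the final step so that it ends exactly at `n`, where the linear operators
  -- of the metric are still invertible on the window.
  have key : ∀ j : ℕ, ∃ g φ, ApproxSolution x P A B φ₀ φ₁ ε (min ((j + 1) * ε) n) g φ := by
    intro j
    induction j with
    | zero =>
      rw [Nat.cast_zero, zero_add, one_mul, min_eq_left (by linarith)]
      exact ⟨_, _, approxSolution_background hn hP hA hAB hε x φ₀ φ₁⟩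
    | succ j ih =>
      obtain ⟨g, φ, h⟩ := ih
      have hj : (0 : ℝ) ≤ j * ε := by positivity
      have e : ((j + 1 : ℕ) + 1 : ℝ) * ε = (j + 1) * ε + ε := by push_cast; ring
      refine h.exists_next hn hP hA hε (le_min (by linarith) (by linarith)) ?_ ?_
        (min_le_right _ _)
      · rw [e]
        exact min_le_min_right _ (by linarith)
      · rw [e, ← min_add_add_right]
        exact min_le_min_left _ (by linarith)
  obtain ⟨j, hj⟩ := exists_nat_ge (n / ε)
  obtain ⟨g, φ, h⟩ := key j
  have h1 := (div_le_iff₀ hε0).1 hj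
  rw [min_eq_right (by linarith)] at h
  exact ⟨g, φ, h⟩

theorem Model.exists_stepSize (hn : 2 ≤ n) (hP : P.Valid n) : ∃ ε, P.StepSize n ε := by
  have hk := Model.k₁_pos hn hP
  by_cases h : P.k₁ n < P.k₂ n
  · exact ⟨min (min 1 (P.k₁ n)) (P.k₂ n - P.k₁ n),
      lt_min (lt_min one_pos hk) (by linarith), (min_le_left _ _).trans (min_le_left _ _),
      (min_le_left _ _).trans (min_le_right _ _), fun _ => min_le_right _ _⟩
  · exact ⟨min 1 (P.k₁ n), lt_min one_pos hk, min_le_left _ _, min_le_right _ _,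
      fun h1 => absurd h1 h⟩

end FieldCorrection

/-! ### Initial solutions -/

section Membership

variable {n : ℕ} {M : Type*} [TopologicalSpace M] [ChartedSpace (Coord n) M]

theorem coeff_mul_powX (f : Ser n M) (α m : ℝ) : (f * powX α).coeff m = f.coeff (m - α) := by
  have h := HahnSeries.coeff_mul_single_add (r := (1 : Coef n M)) (x := f) (a := m - α) (b := α)
  rwa [sub_add_cancel, mul_one] at h

theorem coeff_fn_of_ne (c : SmoothC n M) {s : ℝ} {l : ℕ} (h : s ≠ 0 ∨ l ≠ 0) :
    (((fn c : Coef n M).coeff s).coeff l) = 0 := by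
  rw [fn, AddMonoidAlgebra.coeff_single]
  rcases h with h | h
  · rw [Finsupp.single_eq_of_ne h, Polynomial.coeff_zero]
  · rw [Finsupp.single_apply]
    split_ifs
    · exact Polynomial.coeff_C_of_ne_zero h
    · exact Polynomial.coeff_zero l

theorem coeff_fn_zero (c : SmoothC n M) : (((fn c : Coef n M).coeff 0).coeff 0) = c := by
  rw [fn, AddMonoidAlgebra.coeff_single, Finsupp.single_eq_same, Polynomial.coeff_C_zero]

theorem mem_calSX_of_plain [IsManifold (𝓡 n) ∞ M] {u α : ℝ} {f : Ser n M}
    (h : plainRel n M u α f f) : f ∈ calSX (n := n) (M := M) u α := by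
  refine ⟨f * powX (-α), ⟨Subring.mul_mem _ h.2.2.1 (formal_single _ _), fun m hm => ?_,
    fun m hm s l hsl => ?_⟩, ?_⟩
  · rw [coeff_mul_powX]
    exact h.2.1 _ (by linarith)
  · obtain ⟨c, hc⟩ := h.2.2.2 (m - -α) (by linarith)
    rw [coef, coeff_mul_powX, hc]
    exact coeff_fn_of_ne c hsl
  · rw [mul_assoc, powX_mul, neg_add_cancel, powX_zero, mul_one]

theorem formal_of_mem_calSX {u α : ℝ} {f : Ser n M} (h : f ∈ calSX (n := n) (M := M) u α) :
    f ∈ formalSeries n M := by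
  obtain ⟨q, hq, rfl⟩ := h
  refine Subring.mul_mem _ hq.1 fun c => (Set.finite_singleton α).subset fun z hz => ?_
  by_contra h0
  exact hz.1 (HahnSeries.coeff_single_of_ne h0)

theorem mem_ordGE_of_mem_calSX {u α : ℝ} {f : Ser n M} (h : f ∈ calSX (n := n) (M := M) u α) :
    f ∈ ordGE n M α := by
  obtain ⟨q, hq, rfl⟩ := h
  intro m hm
  rw [coeff_mul_powX]
  exact hq.2.1 _ (by linarith)

/-- A discrete support leaves a gap above `q`. The formulation with all small `ε` allows finitely
many series to share one value. -/
theorem eventually_mem_ordGE {f : Ser n M} (hf : f ∈ formalSeries n M) {q : ℝ}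
    (h : ∀ p ≤ q, f.coeff p = 0) : ∀ᶠ ε in nhdsWithin (0 : ℝ) (Set.Ioi 0),
      f ∈ ordGE n M (q + ε) := by
  have h1 : q ∉ f.support ∩ Set.Iic (q + 1) := fun h2 => h2.1 (h q le_rfl)
  obtain ⟨r, hr, hball⟩ := Metric.isOpen_iff.1 (hf (q + 1)).isClosed.isOpen_compl q h1
  have h2 : ∀ᶠ ε in nhdsWithin (0 : ℝ) (Set.Ioi 0), ε < min r 1 :=
    nhdsWithin_le_nhds (eventually_lt_nhds (lt_min hr one_pos))
  filter_upwards [h2] with ε hε p hp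
  rcases le_or_gt p q with h3 | h3
  · exact h p h3
  · by_contra h4
    have h5 := lt_min_iff.1 hε
    refine hball (show p ∈ Metric.ball q r from ?_) ⟨h4, ?_⟩
    · rw [Metric.mem_ball, Real.dist_eq, abs_of_pos (by linarith)]
      linarith
    · rw [Set.mem_Iic]
      linarith

end Membership

/-! ### Existence and uniqueness of initial solutions -/

section Initial

variable {n : ℕ} {M : Type*} [TopologicalSpace M] [ChartedSpace (Coord n) M]
  [IsManifold (𝓡 n) ∞ M]
variable {x : GlobalChart n M} {P : Model} {A B : Matrix (Fin n) (Fin n) (SmoothR n M)}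
  {φ₀ φ₁ : SmoothC n M} {ε m m' : ℝ} {g g' : Matrix (Fin n) (Fin n) (Ser n M)} {φ φ' : Ser n M}

theorem IsNear.metric_sub_mem (hg : IsNear A B ε g) (a b : Fin n) :
    g a b - powX (-2) * bg A a b ∈ ordGE n M (-2 + ε) := by
  have h : g a b - powX (-2) * bg A a b = powX (-2) * (bg A * AlgESF.pert B g) a b := by
    conv_lhs => rw [metric_eq_pert hg.inv g]
    rw [Matrix.smul_apply, smul_eq_mul, mul_add, mul_one, Matrix.add_apply, mul_add,
      add_sub_cancel_left]
  rw [h, Matrix.mul_apply]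
  exact ordGE_mul (single_mem_ordGE _ _) (Submodule.sum_mem _ fun i _ =>
    ordGE_mul' (bg_mem_ordGE a i) (hg.pert i b) (zero_add ε).ge)

theorem coeff_background (a b : Fin n) :
    (powX (-2) * bg A a b : Ser n M).coeff (-2) = fn (ofRealC (A a b)) := by
  rw [mul_comm, coeff_mul_powX, sub_self]
  exact HahnSeries.coeff_single_same 0 _

theorem NearRel.metric_mem_calSX (hε : ε ≤ n) (h : NearRel (plainRel n M (n - ε)) A B ε g g)
    (a b : Fin n) : g a b ∈ calSX (n := n) (M := M) n (-2) := by
  have hρ : WeightRel (plainRel n M (n : ℝ)) := plainRel_weightRel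
  refine mem_calSX_of_plain ?_
  have h1 : ∀ a b, plainRel n M n 0 ((1 + AlgESF.pert B g) a b) ((1 + AlgESF.pert B g) a b) :=
    fun a b => hρ.add (hρ.one_entry a b)
      (plainRel_zero (q := n) h.pos.le (by linarith) (h.pert a b))
  rw [metric_eq_pert h.inv g]
  exact hρ.mul (hρ.powX (-2)) (hρ.matMul (S := bg A) (S' := bg A) (fun a b => hρ.serFn _) h1
    (zero_add 0).ge a b) (add_zero (-2 : ℝ)).ge

/-- The construction never used the constraints; they follow from the evolution and field equations
by `constraints_mem`. -/
theorem ApproxSolution.isInitialSolution (hn : 2 ≤ n) (hP : P.Valid n) (hA : IsRiemannian A)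
    (h : ApproxSolution x P A B φ₀ φ₁ ε n g φ) : IsInitialSolution x P A φ₀ φ₁ g φ := by
  have hn1 : (2 : ℝ) ≤ n := by exact_mod_cast hn
  have hk := Model.k₁_pos hn hP
  have h12 := Model.k₁_add_k₂ (n := n) (P := P)
  have hne := h.near.near
  have hg := h.near.metric_mem_calSX (by linarith [h.near.le_one])
  have hG1 : ∀ a b, (g a b).coeff (-2) = fn (ofRealC (A a b)) := fun a b => by
    have h1 := hne.metric_sub_mem a b (-2) (by linarith [h.near.pos])
    rwa [HahnSeries.coeff_sub, sub_eq_zero, coeff_background] at h1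
  have hC := constraints_mem x P hn hP (hne.congRel_self h.near.le_one) h.real hk h.field.2.1
    h.evolTl_mem h.evolTr_mem (ordGE_mono (by linarith) h.fieldEq_mem)
  have hlead := h.lead
  rw [leadCoef] at hlead
  refine ⟨⟨h.real, h.near.symm, ⟨n, by linarith, 2, hg, A, hA, fun a b => ?_⟩, h.field.2.2.1,
    fun m hm => h.field.2.1 m (by linarith)⟩, fun m hm => ⟨fun a b => h.evolTl_mem a b m hm,
    h.evolTr_mem m hm, hC.1 m hm, fun a => hC.2 a m hm⟩,
    fun m hm => h.fieldEq_mem _ (by linarith), hg, mem_calSX_of_plain h.field, hG1,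
    fun h1 => ?_, fun h1 => ?_, fun h1 => ?_, fun h1 => ?_⟩
  · rw [coef, hG1, coeff_fn_zero]
  · rwa [if_pos h1] at hlead
  · rwa [if_neg h1.not_lt, if_pos h1] at hlead
  · rwa [if_neg h1.le.not_gt, if_neg h1.ne'] at hlead
  · exact h.second (Model.exponents_of_lt hn hP h1).1 (by linarith)

theorem IsInitialSolution.lead (h : IsInitialSolution x P A φ₀ φ₁ g φ) :
    φ.coeff (P.k₁ n) = leadCoef P φ₀ φ₁ := by
  rw [leadCoef]
  split_ifs with h1 h2
  · exact h.P1_sub h1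
  · exact h.P1_crit h2
  · exact h.P1_super (lt_of_le_of_ne (not_lt.1 h1) (Ne.symm h2))

/-- By (G1) the leading coefficient is that of the background, and discreteness of the support turns
the next order into a definite gap. -/
theorem IsInitialSolution.eventually_isNear (hAB : A * B = 1)
    (h : IsInitialSolution x P A φ₀ φ₁ g φ) :
    ∀ᶠ ε in nhdsWithin (0 : ℝ) (Set.Ioi 0), IsNear A B ε g := by
  have hBA : B * A = 1 := mul_eq_one_comm.1 hAB
  have h1 : ∀ᶠ ε in nhdsWithin (0 : ℝ) (Set.Ioi 0), ∀ a b,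
      g a b - powX (-2) * bg A a b ∈ ordGE n M (-2 + ε) := by
    rw [Filter.eventually_all]
    intro a
    rw [Filter.eventually_all]
    intro b
    refine eventually_mem_ordGE (Subring.sub_mem _ (formal_of_mem_calSX (h.metric_mem a b))
      (Subring.mul_mem _ (formal_single _ _) (formal_serFn _))) fun p hp => ?_
    rw [HahnSeries.coeff_sub, sub_eq_zero]
    rcases hp.lt_or_eq with h2 | rfl
    · rw [mem_ordGE_of_mem_calSX (h.metric_mem a b) p h2]
      exact (ordGE_mul' (single_mem_ordGE (-2 : ℝ) (1 : Coef n M)) (bg_mem_ordGE a b)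
        (add_zero (-2 : ℝ)).ge p h2).symm
    · exact (h.G1 a b).trans (coeff_background a b).symm
  filter_upwards [h1, self_mem_nhdsWithin] with ε hε hε0
  refine ⟨hAB, hε0, fun a b => ?_, h.admissible.symm⟩
  have h2 : AlgESF.pert B g
      = (powX 2 : Ser n M) • (bg B * (g - (powX (-2) : Ser n M) • bg A)) := by
    have h3 := pert_background (n := n) (M := M) hBA
    rw [AlgESF.pert, sub_eq_zero] at h3
    rw [mul_sub, smul_sub, h3, AlgESF.pert]
  rw [h2, Matrix.smul_apply, smul_eq_mul, Matrix.mul_apply]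
  exact ordGE_mul' (single_mem_ordGE _ _) (Submodule.sum_mem _ fun i _ =>
    ordGE_mul' (bg_mem_ordGE a i) (hε i b) (zero_add _).ge) (by linarith)

/-- The factor `∂_t + NH` is injective below `N`. The factor `∂_t` fails to be injective only at
exponent zero, which the a priori order `m > 0` excludes. -/
theorem mem_ordGE_of_second_order {H N : ℝ} (hH : H ≠ 0) (hm : 0 < m) (hN : m' ≤ N)
    {f : Ser n M} (hf : f ∈ ordGE n M m)
    (h : dt H (dt H f) + (N * H) • dt H f ∈ ordGE n M m') : f ∈ ordGE n M m' := by
  have h1 : dt H f ∈ ordGE n M m' := mem_ordGE_of_dt_add (fun p hp h0 => by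
    linarith [mul_right_cancel₀ hH h0]) h
  intro p hp
  rcases lt_or_ge p m with h2 | h2
  · exact hf p h2
  · refine shiftCoef_injective (H := H) (m := p) (κ := 0) (re_shift_ne_zero ?_) ?_
    · exact (mul_ne_zero (by linarith) hH).symm
    · rw [shiftCoef, map_zero, fn_zero, zero_mul, add_zero]
      exact h1 p hp

/-- Subtracting the expansions of the evolution equations leaves the linear operator on the
difference of the deviations, up to order `m + ε`. Traceless part and trace are treated separately,
with `N = n` and `N = 2n`; the constraints play no role. -/
theorem IsInitialSolution.metric_unique_step (hn : 2 ≤ n) (hP : P.Valid n) (hε1 : ε ≤ 1)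
    (hεk : ε ≤ P.k₁ n) (hg : IsNear A B ε g) (hg' : IsNear A B ε g')
    (h : IsInitialSolution x P A φ₀ φ₁ g φ) (h' : IsInitialSolution x P A φ₀ φ₁ g' φ')
    (hm : ε ≤ m) (hm' : m' ≤ m + ε) (hmn : m' ≤ n)
    (hη : ∀ a b, AlgESF.pert B g a b - AlgESF.pert B g' a b ∈ ordGE n M m)
    (hφ : φ - φ' ∈ ordGE n M (P.k₁ n + m)) (a b : Fin n) :
    AlgESF.pert B g a b - AlgESF.pert B g' a b ∈ ordGE n M m' := by
  have hk := Model.k₁_pos hn hP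
  have hH := Model.H_pos hn hP
  have hε0 := hg.pos
  have hC : NearRel (AlgESF.congRel n M (m - ε)) A B ε g g' :=
    hg.congRel hg' hε1 fun a b => by
      rw [add_sub_cancel]
      exact hη a b
  have hφC : AlgESF.congRel n M (m - ε) (P.k₁ n) φ φ' :=
    ⟨mem_ordGE_of_mem_calSX h.field_mem, mem_ordGE_of_mem_calSX h'.field_mem,
      ordGE_mono (by linarith) hφ⟩
  have hdC : WeightRel (AlgESF.congRel n M m) := congRel_weightRel m
  have hpC : ∀ a b, AlgESF.congRel n M m 0 (AlgESF.pert B g a b) (AlgESF.pert B g' a b) :=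
    fun a b => ⟨ordGE_mono hε0.le (hg.pert a b), ordGE_mono hε0.le (hg'.pert a b), by
      rw [zero_add]
      exact hη a b⟩
  have hTl : traceless (AlgESF.pert B g) a b - traceless (AlgESF.pert B g') a b
      ∈ ordGE n M m' := by
    have h0 := (hdC.traceless hpC a b).2.2
    rw [zero_add] at h0
    refine mem_ordGE_of_second_order hH.ne' (by linarith : 0 < m) hmn h0 ?_
    have h1 := (hC.evolTl x P φ φ' a b).2.2
    have h2 := (hC.tracelessEffS x hP hk hφC a b).2.2
    have e1 : evolTl x P g φ a b ∈ ordGE n M n := fun p hp => (h.einstein p hp).evolTl_eq a b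
    have e2 : evolTl x P g' φ' a b ∈ ordGE n M n := fun p hp => (h'.einstein p hp).evolTl_eq a b
    have h5 := Submodule.smul_mem _ (2 : ℝ) (Submodule.add_mem _ (Submodule.sub_mem _
      (ordGE_mono (by linarith : m' ≤ 2 * ε + (m - ε)) h1)
      (ordGE_mono hmn (Submodule.sub_mem _ e1 e2)))
      (ordGE_mono (by linarith : m' ≤ 2 * P.k₁ n + (m - ε)) h2))
    rw [dt_sub, dt_sub]
    convert h5 using 1
    module
  have hTr : (AlgESF.pert B g).trace - (AlgESF.pert B g').trace ∈ ordGE n M m' := by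
    have h0 := (hdC.trace hpC).2.2
    rw [zero_add] at h0
    refine mem_ordGE_of_second_order (N := 2 * n) hH.ne' (by linarith : 0 < m) (by linarith)
      h0 ?_
    have h1 := (hC.evolTr x P φ φ').2.2
    have h2 := (hC.traceSource x hn hP hk hφC).2.2
    have e1 : evolTr x P g φ ∈ ordGE n M n := fun p hp => (h.einstein p hp).evolTr_eq
    have e2 : evolTr x P g' φ' ∈ ordGE n M n := fun p hp => (h'.einstein p hp).evolTr_eq
    have h5 := Submodule.smul_mem _ (2 : ℝ) (Submodule.sub_mem _ (Submodule.sub_mem _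
      (ordGE_mono (by linarith : m' ≤ 2 * ε + (m - ε)) h1)
      (ordGE_mono hmn (Submodule.sub_mem _ e1 e2)))
      (ordGE_mono (by linarith : m' ≤ 2 * P.k₁ n + (m - ε)) h2))
    rw [dt_sub, dt_sub]
    convert h5 using 1
    module
  have hδ := ((congRel_weightRel (n := n) (M := M) 0).one_entry a b).1
  have h3 := Submodule.add_mem _ hTl (Submodule.smul_mem _ (n : ℝ)⁻¹
    (ordGE_mul' hTr hδ (add_zero m').ge))
  rw [traceless_apply, traceless_apply, sub_mul, smul_sub] at h3
  convert h3 using 1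
  abel

/-- The wave operator determines the next coefficients away from `k₂`. At `k₂` condition (P2) fixes
the part in its kernel, and on the remaining multiple of `Z` it is injective. -/
theorem IsInitialSolution.field_unique_step (hn : 2 ≤ n) (hP : P.Valid n) (hε1 : ε ≤ 1)
    (hεk : ε ≤ P.k₁ n) (hg : IsNear A B ε g) (hg' : IsNear A B ε g')
    (h : IsInitialSolution x P A φ₀ φ₁ g φ) (h' : IsInitialSolution x P A φ₀ φ₁ g' φ')
    (hm : ε ≤ m) (hm' : m' ≤ m + ε) (hmn : m' ≤ n)
    (hη : ∀ a b, AlgESF.pert B g a b - AlgESF.pert B g' a b ∈ ordGE n M m')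
    (hφ : φ - φ' ∈ ordGE n M (P.k₁ n + m)) : φ - φ' ∈ ordGE n M (P.k₁ n + m') := by
  have hH := Model.H_pos hn hP
  have hε0 := hg.pos
  -- The metrics already agree up to the new order `m'`, so weight plus precision in the field
  -- equation is `k₁ + m'`.
  have hC : NearRel (AlgESF.congRel n M (m' - ε)) A B ε g g' :=
    hg.congRel hg' hε1 fun a b => by
      rw [add_sub_cancel]
      exact hη a b
  have hφC : AlgESF.congRel n M (m' - ε) (P.k₁ n) φ φ' :=
    ⟨mem_ordGE_of_mem_calSX h.field_mem, mem_ordGE_of_mem_calSX h'.field_mem,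
      ordGE_mono (by linarith) hφ⟩
  have h1 : (fieldEq x P g φ + waveOp P φ) - (fieldEq x P g' φ' + waveOp P φ')
      ∈ ordGE n M (P.k₁ n + ε + (m' - ε)) := (hC.fieldEq x hP (by linarith) hφC).2.2
  have hF : ∀ {g : Matrix (Fin n) (Fin n) (Ser n M)} {φ : Ser n M},
      IsInitialSolution x P A φ₀ φ₁ g φ → fieldEq x P g φ ∈ ordGE n M (P.k₁ n + n) :=
    fun h p hp => by
      have h2 := h.field (p - P.k₁ n) (by linarith)
      rwa [FieldAt, sub_add_cancel] at h2
  have hw : waveOp P (φ - φ') ∈ ordGE n M (P.k₁ n + m') := by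
    have h2 := Submodule.sub_mem _
      (ordGE_mono (by linarith : P.k₁ n + m' ≤ P.k₁ n + ε + (m' - ε)) h1)
      (ordGE_mono (by linarith : P.k₁ n + m' ≤ P.k₁ n + n)
        (Submodule.sub_mem _ (hF h) (hF h')))
    rw [waveOp_sub]
    convert h2 using 1
    abel
  intro p hp
  rcases lt_or_ge p (P.k₁ n + m) with h2 | h2
  · exact hφ p h2
  have h3 := hw p hp
  rw [coeff_waveOp] at h3
  -- As `p` is at least `k₁ + m`, equality forces `k₁ < k₂`, so that (P2) is available.
  by_cases h4 : p = P.k₂ n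
  · have hK := Model.lt_K_of_k₁_lt (by linarith : P.k₁ n < P.k₂ n)
    obtain ⟨χ, hχ⟩ := h.P2 hK
    obtain ⟨χ', hχ'⟩ := h'.P2 hK
    have h5 : (φ - φ').coeff (P.k₂ n) = fn (χ - χ') * varZ := by
      have h6 : (fn (χ - χ') : Coef n M) = fn χ - fn χ' := map_sub fnHom χ χ'
      rw [HahnSeries.coeff_sub, hχ, hχ', add_sub_add_left_eq_sub, h6, sub_mul]
    have h0 : (n - 2 * P.k₂ n) * P.H n ≠ 0 := by
      have h6 : (n : ℝ) - 2 * P.k₂ n ≠ 0 := by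
        rw [← Model.k₁_add_k₂ (n := n) (P := P)]
        linarith
      exact mul_ne_zero h6 hH.ne'
    rw [h4, h5, waveCoef_fn_varZ, indicial_eq hn hP hK.le, sub_self, mul_zero, zero_mul, zero_smul,
      zero_add] at h3
    have h6 := congrArg (fun q => ((n - 2 * P.k₂ n) * P.H n)⁻¹ • q) h3
    simp only [smul_smul, inv_mul_cancel₀ h0, one_smul, smul_zero] at h6
    rw [h4, h5, h6, zero_mul]
  · exact waveCoef_injective hn hP (by linarith) h4 h3

theorem IsInitialSolution.unique (hn : 2 ≤ n) (hP : P.Valid n) (hA : IsRiemannian A)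
    (h : IsInitialSolution x P A φ₀ φ₁ g φ) (h' : IsInitialSolution x P A φ₀ φ₁ g' φ') :
    (∀ a b, g a b - g' a b ∈ ordGE n M (-2 + n)) ∧ φ - φ' ∈ ordGE n M (P.k₁ n + n) := by
  obtain ⟨B, hAB⟩ := hA.exists_inverse
  have hn1 : (2 : ℝ) ≤ n := by exact_mod_cast hn
  have hgap : ∀ᶠ ε in nhdsWithin (0 : ℝ) (Set.Ioi 0), φ - φ' ∈ ordGE n M (P.k₁ n + ε) := by
    refine eventually_mem_ordGE (Subring.sub_mem _ (formal_of_mem_calSX h.field_mem)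
      (formal_of_mem_calSX h'.field_mem)) fun p hp => ?_
    rw [HahnSeries.coeff_sub]
    rcases hp.lt_or_eq with h2 | rfl
    · rw [mem_ordGE_of_mem_calSX h.field_mem p h2, mem_ordGE_of_mem_calSX h'.field_mem p h2,
        sub_self]
    · rw [h.lead, h'.lead, sub_self]
  have hsmall : ∀ᶠ ε in nhdsWithin (0 : ℝ) (Set.Ioi 0), ε < min 1 (P.k₁ n) :=
    nhdsWithin_le_nhds (eventually_lt_nhds (lt_min one_pos (Model.k₁_pos hn hP)))
  -- One step size serves both metrics and the difference of the fields, whose leading coefficients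
  -- agree by (P1).
  obtain ⟨ε, hφ, hεs, hg, hg'⟩ := (hgap.and (hsmall.and ((h.eventually_isNear hAB).and
    (h'.eventually_isNear hAB)))).exists
  have hε0 := hg.pos
  have hε1 : ε ≤ 1 := (lt_min_iff.1 hεs).1.le
  have hεk : ε ≤ P.k₁ n := (lt_min_iff.1 hεs).2.le
  have key : ∀ j : ℕ,
      (∀ a b, AlgESF.pert B g a b - AlgESF.pert B g' a b ∈ ordGE n M (min ((j + 1) * ε) n)) ∧
        φ - φ' ∈ ordGE n M (P.k₁ n + min ((j + 1) * ε) n) := by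
    intro j
    induction j with
    | zero =>
      rw [Nat.cast_zero, zero_add, one_mul, min_eq_left (by linarith)]
      exact ⟨fun a b => Submodule.sub_mem _ (hg.pert a b) (hg'.pert a b), hφ⟩
    | succ j ih =>
      have hj : (0 : ℝ) ≤ j * ε := by positivity
      have hm : ε ≤ min ((j + 1) * ε) (n : ℝ) := le_min (by linarith) (by linarith)
      have hm' : min (((j + 1 : ℕ) + 1) * ε) (n : ℝ) ≤ min ((j + 1) * ε) (n : ℝ) + ε := by
        rw [← min_add_add_right]
        refine min_le_min (by push_cast; linarith) (by linarith)
      have h1 := h.metric_unique_step hn hP hε1 hεk hg hg' h' hm hm' (min_le_right _ _) ih.1 ih.2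
      exact ⟨h1, h.field_unique_step hn hP hε1 hεk hg hg' h' hm hm' (min_le_right _ _) h1 ih.2⟩
  obtain ⟨j, hj⟩ := exists_nat_ge (n / ε)
  have h1 := (div_le_iff₀ hε0).1 hj
  have h2 := key j
  rw [min_eq_right (by linarith)] at h2
  refine ⟨fun a b => ?_, h2.2⟩
  have h3 : g a b - g' a b
      = powX (-2) * ∑ i, bg A a i * (AlgESF.pert B g i b - AlgESF.pert B g' i b) := by
    conv_lhs => rw [metric_eq_pert hAB g, metric_eq_pert hAB g']
    rw [Matrix.smul_apply, Matrix.smul_apply, smul_eq_mul, smul_eq_mul, ← mul_sub, mul_add,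
      mul_add, Matrix.add_apply, Matrix.add_apply, add_sub_add_left_eq_sub, Matrix.mul_apply,
      Matrix.mul_apply, ← Finset.sum_sub_distrib]
    simp only [mul_sub]
  rw [h3]
  exact ordGE_mul (single_mem_ordGE _ _) (Submodule.sum_mem _ fun i _ =>
    ordGE_mul' (bg_mem_ordGE a i) (h2.1 i b) (zero_add _).ge)

theorem exists_isInitialSolution (hn : 2 ≤ n) (x : GlobalChart n M) (hP : P.Valid n)
    (hA : IsRiemannian A) (φ₀ φ₁ : SmoothC n M) :
    ∃ (g : Matrix (Fin n) (Fin n) (Ser n M)) (φ : Ser n M),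
      IsInitialSolution x P A φ₀ φ₁ g φ := by
  obtain ⟨B, hAB⟩ := hA.exists_inverse
  obtain ⟨ε, hε⟩ := Model.exists_stepSize hn hP
  obtain ⟨g, φ, h⟩ := exists_approxSolution hn hP hA hAB hε x φ₀ φ₁
  exact ⟨g, φ, h.isInitialSolution hn hP hA⟩

end Initial

end AlgESF

end

theorem lemma1 {n : ℕ} (hn : 2 ≤ n) {M : Type*} [TopologicalSpace M]
    [ChartedSpace (AlgESF.Coord n) M] [IsManifold (𝓡 n) ∞ M] (x : AlgESF.GlobalChart n M)
    (P : AlgESF.Model) (hP : P.Valid n)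
    (A : Matrix (Fin n) (Fin n) (AlgESF.SmoothR n M)) (hA : AlgESF.IsRiemannian A)
    (φ₀ φ₁ : AlgESF.SmoothC n M) :
    (∃ (g : Matrix (Fin n) (Fin n) (AlgESF.Ser n M)) (φ : AlgESF.Ser n M),
      AlgESF.IsInitialSolution x P A φ₀ φ₁ g φ) ∧
    ∀ (g g' : Matrix (Fin n) (Fin n) (AlgESF.Ser n M)) (φ φ' : AlgESF.Ser n M),
      AlgESF.IsInitialSolution x P A φ₀ φ₁ g φ →
      AlgESF.IsInitialSolution x P A φ₀ φ₁ g' φ' →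
      ∀ m < (n : ℝ), (∀ a b, (g a b).coeff (m - 2) = (g' a b).coeff (m - 2)) ∧
        φ.coeff (m + P.k₁ n) = φ'.coeff (m + P.k₁ n) := by
  refine ⟨AlgESF.exists_isInitialSolution hn x hP hA φ₀ φ₁, fun g g' φ φ' h h' m hm => ?_⟩
  obtain ⟨h1, h2⟩ := h.unique hn hP hA h'
  refine ⟨fun a b => ?_, ?_⟩
  · have h3 := h1 a b (m - 2) (by linarith)
    rwa [HahnSeries.coeff_sub, sub_eq_zero] at h3
  · have h3 := h2 (m + P.k₁ n) (by linarith)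
    rwa [HahnSeries.coeff_sub, sub_eq_zero] at h3
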